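/- **Notation.** Let $n\ge 1$, $B(x,r)\subset\mathbb R^n$ the open ball, $B=B(0,1)$, $Q(z,r)=B(x,r)\times\,]t-r^2,t[$ for $z=(x,t)\in\mathbb R^n\times\mathbb R$, $Q(r)=Q(0,r)$, $Q=Q(1)$. For a matrix-valued $f$ on an open set $\Omega\subset\mathbb R^n$ put $$\|f\|_{BMO(\Omega)}=\sup\Big\{\frac1{|B(x,r)|}\int_{B(x,r)}|f-[f]_{x,r}|\,dy:\ \overline{B(x,r)}\subset\Omega\Big\},$$ with $[f]_{x,r}$ the average of $f$ over $B(x,r)$, and $\|d\|_{L_\infty(BMO)}=\operatorname{ess\,sup}_{-1<t<0}\|d(\cdot,t)\|_{BMO(B)}$. **Coefficients.** Let $A=a+d$ on $Q$ with $a,d$ measurable $n\times n$-matrix functions such that a.e. in $Q$: $a$ is symmetric, $\nu\mathbb I\le a\le\nu^{-1}\mathbb I$ (where $\nu>0$), $d$ is skew symmetric, and $\|d\|_{L_\infty(BMO)}<\infty$. **Suitable weak solutions.** A function $u$ is a suitable weak solution of $\partial_tu-\operatorname{div}(A\nabla u)=0$ in $Q(R)$ if $u\in L_\infty(-R^2,0;L_2(B(0,R)))$,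 $u$ and its weak spatial gradient $\nabla u$ are in $L_2(Q(R))$, $$\int_{Q(R)}u\,\partial_t\varphi\,dz=\int_{Q(R)}(A\nabla u)\cdot\nabla\varphi\,dz\qquad\forall\varphi\in C_0^\infty(Q(R)),$$ and for a.e. $t_0\in\,]-R^2,0[$ the inequality $$\frac12\int_{B(0,R)}\varphi(x,t_0)|u(x,t_0)|^2dx+\int_{-R^2}^{t_0}\!\int_{B(0,R)}\varphi\,\nabla u\cdot a\nabla u\,dz\le\frac12\int_{-R^2}^{t_0}\!\int_{B(0,R)}|u|^2\partial_t\varphi\,dz-\int_{-R^2}^{t_0}\!\int_{B(0,R)}(A\nabla u)\cdot\nabla\varphi\,u\,dz$$ holds for all non-negative $\varphi\in C_0^\infty(B(0,R)\times\,]-R^2,R^2[)$ (the integrals containing $A$ being absolutely convergent). **Theorem (higher integrability).** For every $n\ge1$, $\nu>0$ and $\Gamma\ge0$ there are constants $p>2$ and $C>0$, depending only on $n,\nu,\Gamma$, such that, for all $a,d$ as above with $\|d\|_{L_\infty(BMO)}\le\Gamma$ and every suitable weak solution $u$ of $\partial_tu-\operatorname{div}(A\nabla u)=0$ in $Q$,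 one has $u\in L_p(Q(R))$ and $\nabla u\in L_p(Q(R))$ for all $R\in\,]0,1[$, and $$\Big(\frac1{|Q(R)|}\int_{Q(z_0,R)}|\nabla u|^p\,dz\Big)^{1/p}\le C\Big(\frac1{|Q(6R)|}\int_{Q(z_0,6R)}|\nabla u|^2\,dz\Big)^{1/2}$$ for all $z_0=(x_0,t_0)$ and $R>0$ with $Q(z_0,6R)\subset Q$, $6R<\operatorname{dist}(x_0,\partial B)$ and $t_0-(6R)^2>-1$. -/

import Mathlib

open MeasureTheory Set Metric
open scoped ContDiff ENNReal NNReal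

namespace ParabolicBMO

/-- The space `ℝⁿ` with its Euclidean norm. Space-time points are pairs `z = (x, t)` in
`Space n × ℝ`, which carries the product Lebesgue measure. -/
abbrev Space (n : ℕ) : Type := EuclideanSpace ℝ (Fin n)

/-- The parabolic ball `Q(z, r) = B(x, r) × ]t - r², t[` for `z = (x, t)`. -/
def parabolicBall {n : ℕ} (z : Space n × ℝ) (r : ℝ) : Set (Space n × ℝ) :=
  ball z.1 r ×ˢ Ioo (z.2 - r ^ 2) z.2

/-- `φ ∈ C₀^∞(U)`: a smooth function on space-time with compact support contained in `U`. -/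
structure IsTestFunction {n : ℕ} (U : Set (Space n × ℝ)) (φ : Space n × ℝ → ℝ) : Prop where
  smooth : ContDiff ℝ ∞ φ
  hasCompactSupport : HasCompactSupport φ
  tsupport_subset : tsupport φ ⊆ U

/-- The spatial gradient `∇φ(x, t)` of a (classically differentiable) function. -/
noncomputable def spatialGrad {n : ℕ} (φ : Space n × ℝ → ℝ) (z : Space n × ℝ) : Space n :=
  gradient (fun x => φ (x, z.2)) z.1

/-- The time derivative `∂ₜφ(x, t)` of a (classically differentiable) function. -/
noncomputable def timeDeriv {n : ℕ} (φ : Space n × ℝ → ℝ) (z : Space n × ℝ) : ℝ :=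
  deriv (fun s => φ (z.1, s)) z.2

/-- `(M v) · w = ∑ᵢⱼ Mᵢⱼ vⱼ wᵢ`. -/
def pairing {n : ℕ} (M : Matrix (Fin n) (Fin n) ℝ) (v w : Space n) : ℝ :=
  ∑ i, ∑ j, M i j * v j * w i

/-- The Euclidean norm `|M|` of a matrix. -/
noncomputable def matNorm {n : ℕ} (M : Matrix (Fin n) (Fin n) ℝ) : ℝ :=
  Real.sqrt (∑ i, ∑ j, M i j ^ 2)

/-- The average `[f]_{x,r}` of a matrix function over the ball `B(x, r)`. -/
noncomputable def ballAverage {n : ℕ} (f : Space n → Matrix (Fin n) (Fin n) ℝ)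
    (x : Space n) (r : ℝ) : Matrix (Fin n) (Fin n) ℝ :=
  Matrix.of fun i j => ⨍ y in ball x r, f y i j

/-- The norm of `f` in `BMO(Ω; 𝕄ⁿˣⁿ)`: the supremum of the mean oscillations
`|B(x,r)|⁻¹ ∫_{B(x,r)} |f - [f]_{x,r}|` over the balls `B(x,r)` whose closure lies in `Ω`.
(If a measurable `f` is not integrable on one of these balls, the value is `∞`.) -/
noncomputable def bmoNorm {n : ℕ} (Ω : Set (Space n))
    (f : Space n → Matrix (Fin n) (Fin n) ℝ) : ℝ≥0∞ :=
  ⨆ (x : Space n) (r : ℝ) (_ : 0 < r) (_ : closedBall x r ⊆ Ω),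
    (volume (ball x r))⁻¹ * ∫⁻ y in ball x r, ENNReal.ofReal (matNorm (f y - ballAverage f x r))

/-- The norm of `d` in `L_∞(I; BMO(Ω; 𝕄ⁿˣⁿ))`. -/
noncomputable def linftyBMONorm {n : ℕ} (I : Set ℝ) (Ω : Set (Space n))
    (d : Space n × ℝ → Matrix (Fin n) (Fin n) ℝ) : ℝ≥0∞ :=
  essSup (fun t => bmoNorm Ω (fun x => d (x, t))) (volume.restrict I)

/-- `a` is (measurable and) symmetric with `ν 𝕀 ≤ a ≤ ν⁻¹ 𝕀` almost everywhere on `U`. -/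
structure IsEllipticOn {n : ℕ} (ν : ℝ) (U : Set (Space n × ℝ))
    (a : Space n × ℝ → Matrix (Fin n) (Fin n) ℝ) : Prop where
  measurable : ∀ i j, AEStronglyMeasurable (fun z => a z i j) (volume.restrict U)
  symm : ∀ᵐ z ∂volume.restrict U, (a z).transpose = a z
  lower : ∀ᵐ z ∂volume.restrict U, ∀ ξ : Space n, ν * ‖ξ‖ ^ 2 ≤ pairing (a z) ξ ξ
  upper : ∀ᵐ z ∂volume.restrict U, ∀ ξ : Space n, pairing (a z) ξ ξ ≤ ν⁻¹ * ‖ξ‖ ^ 2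

/-- `d` is measurable and skew symmetric almost everywhere on `U`. -/
structure IsSkewOn {n : ℕ} (U : Set (Space n × ℝ))
    (d : Space n × ℝ → Matrix (Fin n) (Fin n) ℝ) : Prop where
  measurable : ∀ i j, AEStronglyMeasurable (fun z => d z i j) (volume.restrict U)
  skew : ∀ᵐ z ∂volume.restrict U, d z = -(d z).transpose

/-- `u ∈ L_{2,∞}(Q(R)) = L_∞(-R², 0; L₂(B(R)))`. -/
structure MemL2Linfty {n : ℕ} (R : ℝ) (u : Space n × ℝ → ℝ) : Prop where
  measurable : AEStronglyMeasurable u (volume.restrict (parabolicBall 0 R))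
  bounded : essSup (fun t => eLpNorm (fun x => u (x, t)) 2 (volume.restrict (ball 0 R)))
    (volume.restrict (Ioo (-R ^ 2) 0)) < ⊤

/-- `u ∈ W^{1,0}_2(U)` with weak spatial gradient `∇u = Du`: both `u` and `Du` are in `L₂(U)`
and `∫ u ∂ᵢφ = - ∫ (Du)ᵢ φ` for all test functions `φ` in `U`. -/
structure HasWeakSpatialGradientL2 {n : ℕ} (U : Set (Space n × ℝ))
    (u : Space n × ℝ → ℝ) (Du : Space n × ℝ → Space n) : Prop where
  memLp : MemLp u 2 (volume.restrict U)
  memLp_grad : MemLp Du 2 (volume.restrict U)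
  weak : ∀ φ : Space n × ℝ → ℝ, IsTestFunction U φ → ∀ i : Fin n,
    ∫ z in U, u z * (spatialGrad φ z) i = -∫ z in U, (Du z) i * φ z

/-- `u` is a suitable weak solution of `∂ₜu - div (A ∇u) = 0` in the parabolic ball `Q(R)`, where
`A = a + d` and `Du` is the weak spatial gradient `∇u` of `u` (unique up to null sets).
The two integrals that contain `A` are required to converge absolutely; the other integrals
do so automatically. -/
structure IsSuitableWeakSolution {n : ℕ} (a d : Space n × ℝ → Matrix (Fin n) (Fin n) ℝ) (R : ℝ)
    (u : Space n × ℝ → ℝ) (Du : Space n × ℝ → Space n) : Prop where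
  memL2Linfty : MemL2Linfty R u
  memW : HasWeakSpatialGradientL2 (parabolicBall 0 R) u Du
  /-- The equation in the sense of distributions. -/
  weakForm : ∀ φ : Space n × ℝ → ℝ, IsTestFunction (parabolicBall 0 R) φ →
    IntegrableOn (fun z => pairing (a z + d z) (Du z) (spatialGrad φ z)) (parabolicBall 0 R) ∧
    ∫ z in parabolicBall 0 R, u z * timeDeriv φ z
      = ∫ z in parabolicBall 0 R, pairing (a z + d z) (Du z) (spatialGrad φ z)
  /-- The local energy inequality. -/
  localEnergy : ∀ᵐ t₀ ∂volume.restrict (Ioo (-R ^ 2) 0), ∀ φ : Space n × ℝ → ℝ,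
    IsTestFunction (ball 0 R ×ˢ Ioo (-R ^ 2) (R ^ 2)) φ → (∀ z, 0 ≤ φ z) →
    IntegrableOn (fun z => pairing (a z + d z) (Du z) (spatialGrad φ z) * u z)
      (ball 0 R ×ˢ Ioo (-R ^ 2) t₀) ∧
    1 / 2 * (∫ x in ball 0 R, φ (x, t₀) * |u (x, t₀)| ^ 2)
        + ∫ z in ball 0 R ×ˢ Ioo (-R ^ 2) t₀, φ z * pairing (a z) (Du z) (Du z)
      ≤ 1 / 2 * (∫ z in ball 0 R ×ˢ Ioo (-R ^ 2) t₀, |u z| ^ 2 * timeDeriv φ z)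
        - ∫ z in ball 0 R ×ˢ Ioo (-R ^ 2) t₀,
            pairing (a z + d z) (Du z) (spatialGrad φ z) * u z

end ParabolicBMO

open ParabolicBMO

/-!
# Higher integrability for parabolic equations with a skew-symmetric part in BMO

The gradient of a suitable weak solution satisfies a reverse Hölder inequality on backward
cylinders, with constants that depend on `n`, `ν` and `Γ` only, and Gehring's lemma turns this into
integrability to a power larger than two.

The skew-symmetric part `d` is not bounded, but only its oscillation enters. On a fixed time slice
let `M` be the mean of `d(·, t)` over a ball. As a constant skew-symmetric matrix, `M` drops out of
the local energy inequality, because `(u - c) ∇u` is a gradient and second derivatives are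
symmetric (`IsSobolevOn.integral_pairing_mul_sub_eq_zero`). So `d` may be replaced by `d - M`, all
of whose powers are integrable on the ball with a bound in terms of `Γ`
(`exists_john_nirenberg`). The matrix `M` depends on time without any bound or regularity, which is
harmless since it is removed slice by slice. No measurability of `t ↦ M(t)` is needed either, as
only the resulting bounds are integrated in time.

The local energy inequality holds for `u - c` as well (`IsSuitableWeakSolution.energy_sub_const`),
so the energy of `u - c` on a cylinder is bounded by `r⁻² ∫∫ K² |u - c|²` on a larger one, where `K`
bounds `a + d - M`. Hölder's inequality with the exponents of `IsExponents` and the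
Sobolev–Poincaré inequality on slices (`sobolev_poincare_of_contDiff`) give, for a slice with mean
`b`, the bound `∫ K² |u - b|² ≤ C (∫ |u - b|²)^{1-α} ∫ |∇u|^{2α}` with some `α < 1`, up to powers
of `r`. The slice means drift little in time, since by the equation their increments are integrals
of the flux. This is the one-scale estimate `exists_one_scale`. Applied once at the doubled scale it
bounds `∫ |u - b|²` uniformly in time by the mean of `|∇u|²`, and applied a second time with this
bound it yields (`exists_reverse_holder`)

  `⨍_{Q(z, r)} |∇u|² ≤ A (⨍_{Q(z, 4r)} |∇u|²)^{1-α} ⨍_{Q(z, 4r)} |∇u|^{2α}`.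

Here the right-hand side is homogeneous of degree one in `|∇u|²`, and the second factor carries a
lower power; this form serves Gehring's lemma directly. The lemma (`gehring`) is proved on metric
spaces in which the measure of a ball of radius `r` is `c r^D`, by a good-`λ` inequality, for
functions supported in the set of centres at which the reverse Hölder inequality is known. For the
parabolic distance `max (|x - y|, |t - s|^{1/2})`, where `D = n + 2`, the balls extend into the
future of their centres. The gradient is therefore extended by zero past the top `t₀` of the given
cylinder: a ball centred at a time before `t₀` meets the support inside a backward cylinder of twice
the radius whose top is moved down to `t₀` if necessary (`reverseHolder_parabolicVolume`). The
result is the estimate `exists_lintegral_grad_rpow_le`, and a covering of `Q(R)` by small cylinders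
gives `∇u ∈ L_p(Q(R))` (`lintegral_parabolicBall_ne_top_of_local`).

For `u` itself, interpolation on each slice between `L_2`, where the bound is uniform in time, and
the Sobolev–Poincaré exponent gives `u ∈ L_p(Q(R))`
(`IsSuitableWeakSolution.lintegral_rpow_ne_top`) for `p ≤ 2 + 1 / n`; the exponent of the theorem is
the smaller one of the two.
-/

namespace ParabolicBMO
open Filter Topology

/-! ### Ball-regular measures and stopping-time coverings -/

/-- The balls of radius `r` have measure `c r ^ D`. -/
structure IsBallRegular {X : Type*} [MetricSpace X] [MeasurableSpace X] (μ : Measure X)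
    (c : ℝ) (D : ℕ) : Prop where
  pos : 0 < c
  measure_closedBall : ∀ (x : X) (r : ℝ), 0 < r → μ (closedBall x r) = ENNReal.ofReal (c * r ^ D)

section Regular

variable {X : Type*} [MetricSpace X] [MeasurableSpace X] {μ : Measure X} {c : ℝ} {D : ℕ}

theorem IsBallRegular.measure_lt_top (h : IsBallRegular μ c D) (x : X) (r : ℝ) :
    μ (closedBall x r) < ⊤ := by
  refine lt_of_le_of_lt (measure_mono (closedBall_subset_closedBall (le_max_left r 1))) ?_
  rw [h.measure_closedBall x _ (by positivity)]
  exact ENNReal.ofReal_lt_top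

theorem IsBallRegular.measure_pos (h : IsBallRegular μ c D) (x : X) {r : ℝ} (hr : 0 < r) :
    0 < μ (closedBall x r) := by
  rw [h.measure_closedBall x r hr, ENNReal.ofReal_pos]
  have := h.pos
  positivity

theorem IsBallRegular.measure_mul (h : IsBallRegular μ c D) (x y : X) {k r : ℝ} (hk : 0 < k)
    (hr : 0 < r) :
    μ (closedBall x (k * r)) = ENNReal.ofReal (k ^ D) * μ (closedBall y r) := by
  rw [h.measure_closedBall x _ (by positivity), h.measure_closedBall y r hr,
    ← ENNReal.ofReal_mul (by positivity)]
  congr 1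
  ring

theorem IsBallRegular.isUnifLocDoublingMeasure (h : IsBallRegular μ c D) :
    IsUnifLocDoublingMeasure μ := by
  refine ⟨⟨Real.toNNReal (2 ^ D), ?_⟩⟩
  filter_upwards [self_mem_nhdsWithin] with ε hε x
  rw [h.measure_mul x x two_pos hε]
  rfl

theorem IsBallRegular.isLocallyFiniteMeasure (h : IsBallRegular μ c D) :
    IsLocallyFiniteMeasure μ :=
  ⟨fun x => ⟨closedBall x 1, closedBall_mem_nhds x one_pos, h.measure_lt_top x 1⟩⟩

variable [BorelSpace X] [SecondCountableTopology X]

theorem IsBallRegular.ae_tendsto_lintegral_div (h : IsBallRegular μ c D) {f : X → ℝ≥0∞}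
    (hf : AEMeasurable f μ) (hfin : ∫⁻ y, f y ∂μ ≠ ⊤) :
    ∀ᵐ x ∂μ, Tendsto (fun r => (∫⁻ y in closedBall x r, f y ∂μ) / μ (closedBall x r))
      (𝓝[>] 0) (𝓝 (f x)) := by
  have := h.isUnifLocDoublingMeasure
  have := h.isLocallyFiniteMeasure
  filter_upwards [(IsUnifLocDoublingMeasure.vitaliFamily μ 1).ae_tendsto_lintegral_div hf hfin]
    with x hx
  refine hx.comp (IsUnifLocDoublingMeasure.tendsto_closedBall_filterAt μ (fun _ => x) id
    tendsto_id ?_)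
  filter_upwards [self_mem_nhdsWithin] with r hr
  simpa using (le_of_lt hr : (0:ℝ) ≤ r)

/-- A stopping-time covering. Around each point of `E` the ball with the largest radius
`δ (5κ)⁻ʲ` on which the average of `f` exceeds `lam` is chosen, and Vitali's lemma is applied to
the concentric balls that are `κ` times larger. -/
theorem IsBallRegular.exists_stopping_cover (h : IsBallRegular μ c D) {f : X → ℝ≥0∞}
    (hf : AEMeasurable f μ) (hfin : ∫⁻ y, f y ∂μ ≠ ⊤) {κ δ : ℝ} (hκ : 1 ≤ κ) (hδ : 0 < δ)
    {lam : ℝ≥0∞} {E : Set X} (hE : ∀ x ∈ E, lam < f x)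
    (hE' : ∀ x ∈ E, ∫⁻ y in closedBall x δ, f y ∂μ ≤ lam * μ (closedBall x δ)) :
    ∃ (T : Set X) (ρ : X → ℝ), T ⊆ E ∧ T.Countable ∧
      (∀ x ∈ T, 0 < ρ x ∧ 5 * κ * ρ x ≤ δ ∧
        lam * μ (closedBall x (ρ x)) < ∫⁻ y in closedBall x (ρ x), f y ∂μ ∧
        ∫⁻ y in closedBall x (5 * κ * ρ x), f y ∂μ ≤ lam * μ (closedBall x (5 * κ * ρ x))) ∧
      T.PairwiseDisjoint (fun x => closedBall x (κ * ρ x)) ∧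
      ∃ N, μ N = 0 ∧ E ⊆ N ∪ ⋃ x ∈ T, closedBall x (5 * κ * ρ x) := by
  classical
  have hκ0 : (0:ℝ) < 5 * κ := by linarith
  set N : Set X := {x | ¬ Tendsto (fun r => (∫⁻ y in closedBall x r, f y ∂μ) /
    μ (closedBall x r)) (𝓝[>] 0) (𝓝 (f x))} with hN
  have hN0 : μ N = 0 := h.ae_tendsto_lintegral_div hf hfin
  -- the radii `δ (5κ)⁻ʲ` among which the stopping radius is chosen
  let s : ℕ → ℝ := fun j => δ * ((5 * κ)⁻¹) ^ j
  have s_pos : ∀ j, 0 < s j := fun j => by positivity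
  have s_lim : Tendsto s atTop (𝓝[>] 0) := by
    refine tendsto_nhdsWithin_iff.2 ⟨?_, Eventually.of_forall s_pos⟩
    have : Tendsto (fun j : ℕ => δ * ((5 * κ)⁻¹) ^ j) atTop (𝓝 (δ * 0)) :=
      (tendsto_pow_atTop_nhds_zero_of_lt_one (by positivity)
        (inv_lt_one_of_one_lt₀ (by linarith))).const_mul δ
    rwa [mul_zero] at this
  have s_succ : ∀ j, 5 * κ * s (j + 1) = s j := by
    intro j
    simp only [s, pow_succ]
    field_simp
  have s_le : ∀ j, s j ≤ δ := by
    intro j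
    exact mul_le_of_le_one_right hδ.le
      (pow_le_one₀ (by positivity) (inv_le_one_of_one_le₀ (by linarith)))
  have key : ∀ x ∈ E \ N, ∃ ρ : ℝ, 0 < ρ ∧ 5 * κ * ρ ≤ δ ∧
      lam * μ (closedBall x ρ) < ∫⁻ y in closedBall x ρ, f y ∂μ ∧
      ∫⁻ y in closedBall x (5 * κ * ρ), f y ∂μ ≤ lam * μ (closedBall x (5 * κ * ρ)) := by
    rintro x ⟨hxE, hxN⟩
    have hx : Tendsto (fun r => (∫⁻ y in closedBall x r, f y ∂μ) / μ (closedBall x r))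
        (𝓝[>] 0) (𝓝 (f x)) := by simpa [hN] using hxN
    have hex : ∃ j, lam * μ (closedBall x (s j)) < ∫⁻ y in closedBall x (s j), f y ∂μ := by
      obtain ⟨j, hj⟩ := ((hx.comp s_lim).eventually (lt_mem_nhds (hE x hxE))).exists
      exact ⟨j, ENNReal.mul_lt_of_lt_div hj⟩
    -- the first such index is not `0` because of `hE'`, and at the preceding radius, which is `5κ` times
    -- larger, the average is at most `lam`
    have hfind := Nat.find_spec hex
    have hmin := fun {m} => Nat.find_min hex (m := m)
    cases hj : Nat.find hex with
    | zero =>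
      rw [hj] at hfind
      have h0 : s 0 = δ := by simp [s]
      rw [h0] at hfind
      exact absurd (hE' x hxE) (not_le.2 hfind)
    | succ j =>
      rw [hj] at hfind
      refine ⟨s (j + 1), s_pos _, ?_, hfind, ?_⟩
      · rw [s_succ]; exact s_le j
      · rw [s_succ]; exact not_lt.1 (hmin (by omega))
  choose! ρ hρ using key
  -- outside the null set `N`, Vitali's covering lemma selects a disjoint subfamily
  obtain ⟨T, hTE, hTd, hTc⟩ := Vitali.exists_disjoint_subfamily_covering_enlargement_closedBall
    (E \ N) id (fun x => κ * ρ x) δ (fun x hx => by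
      have := hρ x hx
      nlinarith [mul_pos (by linarith : (0:ℝ) < κ) this.1]) 5 (by norm_num)
  refine ⟨T, ρ, hTE.trans sdiff_subset, ?_, fun x hx => hρ x (hTE hx), hTd, N, hN0, ?_⟩
  · refine hTd.countable_of_nonempty_interior fun x hx => ?_
    refine ⟨x, ball_subset_interior_closedBall (mem_ball_self ?_)⟩
    exact mul_pos (by linarith) (hρ x (hTE hx)).1
  · intro x hx
    by_cases hxN : x ∈ N
    · exact Or.inl hxN
    obtain ⟨b, hb, hsub⟩ := hTc x ⟨hx, hxN⟩
    refine Or.inr (mem_biUnion hb ?_)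
    have hxx : x ∈ closedBall x (κ * ρ x) :=
      mem_closedBall_self (mul_nonneg (by linarith) (hρ x ⟨hx, hxN⟩).1.le)
    have := hsub hxx
    simpa [mul_assoc] using this

end Regular
end ParabolicBMO

namespace ParabolicBMO
open Filter Topology

/-! ### The good-λ inequality for reverse Hölder functions -/

section Gehring

variable {X : Type*} [MetricSpace X] [MeasurableSpace X] {μ : Measure X} {c : ℝ} {D : ℕ}

/-- A reverse Hölder inequality for `g` on balls centred in `S` and well inside the ball
`B(z₀, ρ₀)`, the larger ball having `κ` times the radius of the smaller one. -/
def ReverseHolder (μ : Measure X) (κ : ℝ) (A : ℝ≥0) (α : ℝ) (S : Set X) (z₀ : X) (ρ₀ : ℝ)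
    (g : X → ℝ≥0∞) : Prop :=
  ∀ z ∈ S, ∀ r : ℝ, 0 < r → dist z z₀ + κ * r < ρ₀ →
    ⨍⁻ y in closedBall z r, g y ∂μ ≤
      A * (⨍⁻ y in closedBall z (κ * r), g y ∂μ) ^ (1 - α) *
        ⨍⁻ y in closedBall z (κ * r), g y ^ α ∂μ

/-- On a ball where the stopping rule applies, the reverse Hölder inequality shows that the
level `lam` is controlled by the part of `g` above the level `η * lam`. -/
theorem stopping_ball_estimate (h : IsBallRegular μ c D) {κ : ℝ} (hκ : 1 ≤ κ) {A : ℝ≥0} {α : ℝ}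
    (hα : 0 < α) (hα1 : α < 1) {g : X → ℝ≥0∞} (hg : Measurable g) {lam η : ℝ≥0∞}
    (hlam : lam ≠ 0) (hlam' : lam ≠ ⊤)
    (hη : A * (5 : ℝ≥0∞) ^ (D * (1 - α)) * η ^ α ≤ 2⁻¹)
    {x : X} {ρ : ℝ} (hρ : 0 < ρ)
    (hlow : lam * μ (closedBall x ρ) < ∫⁻ y in closedBall x ρ, g y ∂μ)
    (hup : ∫⁻ y in closedBall x (5 * κ * ρ), g y ∂μ ≤ lam * μ (closedBall x (5 * κ * ρ)))
    (hRH : ⨍⁻ y in closedBall x ρ, g y ∂μ ≤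
      A * (⨍⁻ y in closedBall x (κ * ρ), g y ∂μ) ^ (1 - α) *
        ⨍⁻ y in closedBall x (κ * ρ), g y ^ α ∂μ) :
    lam ^ α * μ (closedBall x (κ * ρ)) ≤ 2 * (A * (5 : ℝ≥0∞) ^ (D * (1 - α))) *
      ∫⁻ y in closedBall x (κ * ρ) ∩ {y | η * lam < g y}, g y ^ α ∂μ := by
  set A' : ℝ≥0∞ := A * (5 : ℝ≥0∞) ^ (D * (1 - α)) with hA'
  have hκρ : 0 < κ * ρ := by positivity
  set m := μ (closedBall x (κ * ρ)) with hm
  have hm0 : m ≠ 0 := (h.measure_pos x hκρ).ne'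
  have hmt : m ≠ ⊤ := (h.measure_lt_top x _).ne
  have h5 : μ (closedBall x (5 * κ * ρ)) = 5 ^ D * m := by
    rw [mul_assoc, h.measure_mul x x (by norm_num) hκρ, ENNReal.ofReal_pow (by norm_num)]
    norm_num [hm]
  have havg : ⨍⁻ y in closedBall x (κ * ρ), g y ∂μ ≤ 5 ^ D * lam := by
    rw [setLAverage_eq]
    refine ENNReal.div_le_of_le_mul ?_
    calc ∫⁻ y in closedBall x (κ * ρ), g y ∂μ
        ≤ ∫⁻ y in closedBall x (5 * κ * ρ), g y ∂μ :=
          lintegral_mono_set (closedBall_subset_closedBall (by nlinarith))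
      _ ≤ lam * μ (closedBall x (5 * κ * ρ)) := hup
      _ = 5 ^ D * lam * m := by rw [h5]; ring
  have hl1 : lam < ⨍⁻ y in closedBall x ρ, g y ∂μ := by
    rw [setLAverage_eq]
    refine (ENNReal.lt_div_iff_mul_lt (Or.inl (h.measure_pos x hρ).ne')
      (Or.inl (h.measure_lt_top x _).ne)).2 hlow
  -- one factor `lam ^ (1 - α)`, positive and finite, is cancelled
  have hsplit : lam = lam ^ (1 - α) * lam ^ α := by
    rw [← ENNReal.rpow_add _ _ hlam hlam']; simp
  have hp0 : lam ^ (1 - α) ≠ 0 := (ENNReal.rpow_pos (pos_iff_ne_zero.2 hlam) hlam').ne'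
  have hpt : lam ^ (1 - α) ≠ ⊤ := ENNReal.rpow_ne_top_of_nonneg (by linarith) hlam'
  have h1 : lam ^ α ≤ A' * ⨍⁻ y in closedBall x (κ * ρ), g y ^ α ∂μ := by
    have : lam ^ (1 - α) * lam ^ α ≤
        lam ^ (1 - α) * (A' * ⨍⁻ y in closedBall x (κ * ρ), g y ^ α ∂μ) := by
      rw [← hsplit]
      refine (hl1.trans_le hRH).le.trans ?_
      calc _ ≤ A * (5 ^ D * lam) ^ (1 - α) * ⨍⁻ y in closedBall x (κ * ρ), g y ^ α ∂μ := by
            gcongr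
        _ = _ := by
            rw [ENNReal.mul_rpow_of_nonneg _ _ (by linarith), hA', ← ENNReal.rpow_natCast,
              ← ENNReal.rpow_mul]
            ring
    exact (ENNReal.mul_le_mul_iff_right hp0 hpt).1 this
  have h2 : lam ^ α * m ≤ A' * ∫⁻ y in closedBall x (κ * ρ), g y ^ α ∂μ := by
    rw [setLAverage_eq] at h1
    calc lam ^ α * m ≤ A' * ((∫⁻ y in closedBall x (κ * ρ), g y ^ α ∂μ) / m) * m := by gcongr
      _ = _ := by rw [mul_assoc, ENNReal.div_mul_cancel hm0 hmt]
  have hmeas : MeasurableSet {y | η * lam < g y} := measurableSet_lt measurable_const hg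
  -- split at the level `η * lam`; the part below it is absorbed into the left-hand side
  have h3 : ∫⁻ y in closedBall x (κ * ρ), g y ^ α ∂μ ≤
      η ^ α * lam ^ α * m + ∫⁻ y in closedBall x (κ * ρ) ∩ {y | η * lam < g y}, g y ^ α ∂μ := by
    rw [← lintegral_inter_add_sdiff _ (closedBall x (κ * ρ)) hmeas, add_comm]
    gcongr
    calc ∫⁻ y in closedBall x (κ * ρ) \ {y | η * lam < g y}, g y ^ α ∂μ
        ≤ ∫⁻ y in closedBall x (κ * ρ) \ {y | η * lam < g y}, η ^ α * lam ^ α ∂μ := by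
          refine setLIntegral_mono measurable_const fun y hy => ?_
          rw [← ENNReal.mul_rpow_of_nonneg _ _ hα.le]
          exact ENNReal.rpow_le_rpow (not_lt.1 hy.2) hα.le
      _ ≤ η ^ α * lam ^ α * m := by
          rw [setLIntegral_const]
          gcongr
          exact measure_mono sdiff_subset
  set J := ∫⁻ y in closedBall x (κ * ρ) ∩ {y | η * lam < g y}, g y ^ α ∂μ with hJ
  have h4 : lam ^ α * m ≤ 2⁻¹ * (lam ^ α * m) + A' * J := by
    calc lam ^ α * m ≤ A' * (η ^ α * lam ^ α * m + J) := h2.trans (by gcongr)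
      _ = A' * η ^ α * (lam ^ α * m) + A' * J := by ring
      _ ≤ _ := by gcongr
  have hfin : 2⁻¹ * (lam ^ α * m) ≠ ⊤ :=
    ENNReal.mul_ne_top (by norm_num)
      (ENNReal.mul_ne_top (ENNReal.rpow_ne_top_of_nonneg hα.le hlam') hmt)
  have e : lam ^ α * m = 2⁻¹ * (lam ^ α * m) + 2⁻¹ * (lam ^ α * m) := by
    rw [← add_mul, ENNReal.inv_two_add_inv_two, one_mul]
  have h6 : 2⁻¹ * (lam ^ α * m) ≤ A' * J :=
    (ENNReal.add_le_add_iff_left hfin).1 (e.symm.trans_le h4)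
  calc lam ^ α * m = 2 * (2⁻¹ * (lam ^ α * m)) := by
        rw [← mul_assoc, ENNReal.mul_inv_cancel (by norm_num) (by norm_num), one_mul]
    _ ≤ 2 * (A' * J) := by gcongr
    _ = _ := (mul_assoc _ _ _).symm

variable [BorelSpace X] [SecondCountableTopology X]

/-- The good-`λ` inequality of Gehring's lemma. -/
theorem ReverseHolder.good_lambda (h : IsBallRegular μ c D) {κ : ℝ} (hκ : 1 ≤ κ) {A : ℝ≥0}
    {α : ℝ} (hα : 0 < α) (hα1 : α < 1) {g : X → ℝ≥0∞} (hg : Measurable g) {η : ℝ≥0∞}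
    (hη : A * (5 : ℝ≥0∞) ^ (D * (1 - α)) * η ^ α ≤ 2⁻¹) {S : Set X} {z₀ : X} {ρ₀ : ℝ}
    (hRH : ReverseHolder μ κ A α S z₀ ρ₀ g) (hS : ∀ x, g x ≠ 0 → x ∈ S)
    (hfin : ∫⁻ y in ball z₀ ρ₀, g y ∂μ ≠ ⊤) {ρ σ : ℝ} (hρσ : ρ < σ) (hσ : σ ≤ ρ₀)
    {lam : ℝ≥0∞} (hlam : lam ≠ 0) (hlam' : lam ≠ ⊤)
    (hI : ∫⁻ y in ball z₀ ρ₀, g y ∂μ ≤ lam * ENNReal.ofReal (c * ((σ - ρ) / 2) ^ D)) :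
    ∫⁻ y in ball z₀ ρ ∩ {y | lam < g y}, g y ∂μ ≤
      5 ^ D * (2 * (A * (5 : ℝ≥0∞) ^ (D * (1 - α)))) * lam ^ (1 - α) *
        ∫⁻ y in ball z₀ σ ∩ {y | η * lam < g y}, g y ^ α ∂μ := by
  set A' : ℝ≥0∞ := A * (5 : ℝ≥0∞) ^ (D * (1 - α)) with hA'
  -- the stopping balls stay within `δ` of `ball z₀ ρ`, hence in `ball z₀ σ`, where `f = g`
  set f : X → ℝ≥0∞ := (ball z₀ ρ₀).indicator g with hf
  set δ := (σ - ρ) / 2 with hδ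
  have hδ0 : 0 < δ := by simp only [hδ]; linarith
  have hfm : Measurable f := hg.indicator measurableSet_ball
  have hff : ∫⁻ y, f y ∂μ = ∫⁻ y in ball z₀ ρ₀, g y ∂μ := lintegral_indicator measurableSet_ball g
  set E := ball z₀ ρ ∩ {y | lam < g y} with hE
  have hsub : ∀ x ∈ E, ∀ r, r ≤ δ → closedBall x r ⊆ ball z₀ σ := by
    intro x hx r hr
    refine closedBall_subset_ball' ?_
    have : dist x z₀ < ρ := hx.1
    linarith
  have heq : ∀ x ∈ E, ∀ r, r ≤ δ →
      ∫⁻ y in closedBall x r, f y ∂μ = ∫⁻ y in closedBall x r, g y ∂μ := by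
    intro x hx r hr
    refine setLIntegral_congr_fun measurableSet_closedBall fun y hy => ?_
    exact indicator_of_mem (ball_subset_ball hσ (hsub x hx r hr hy)) g
  obtain ⟨T, r, hTE, hTc, hT, hTd, N, hN, hcov⟩ := h.exists_stopping_cover hfm.aemeasurable
    (hff ▸ hfin) hκ hδ0 (lam := lam) (E := E) (fun x hx => by
      have : x ∈ ball z₀ ρ₀ := ball_subset_ball (hρσ.le.trans hσ) hx.1
      rw [hf, indicator_of_mem this]; exact hx.2) (fun x hx => by
      rw [h.measure_closedBall x δ hδ0]
      exact (setLIntegral_le_lintegral _ _).trans (hff.trans_le hI))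
  have hball : ∀ x ∈ T, lam * μ (closedBall x (5 * κ * r x)) ≤
      5 ^ D * (2 * A') * lam ^ (1 - α) *
        ∫⁻ y in closedBall x (κ * r x) ∩ {y | η * lam < g y}, g y ^ α ∂μ := by
    intro x hx
    obtain ⟨hr0, hrδ, hlow, hup⟩ := hT x hx
    have hx' := hTE hx
    have hr1 : κ * r x ≤ δ := by nlinarith [mul_pos (by linarith : (0:ℝ) < κ) hr0]
    have hr2 : r x ≤ δ := by nlinarith
    rw [heq x hx' _ hr2] at hlow
    rw [heq x hx' _ hrδ] at hup
    have hRH' := hRH x (hS x (ne_of_gt (lt_of_le_of_lt zero_le hx'.2))) (r x) hr0 (by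
      have : dist x z₀ < ρ := hx'.1
      linarith)
    have := stopping_ball_estimate h hκ hα hα1 hg hlam hlam' hη hr0 hlow hup hRH'
    have e5 : μ (closedBall x (5 * κ * r x)) = 5 ^ D * μ (closedBall x (κ * r x)) := by
      rw [mul_assoc, h.measure_mul x x (by norm_num) (by positivity),
        ENNReal.ofReal_pow (by norm_num)]
      norm_num
    have hsplit : lam = lam ^ (1 - α) * lam ^ α := by
      rw [← ENNReal.rpow_add _ _ hlam hlam']; simp
    calc lam * μ (closedBall x (5 * κ * r x))
        = 5 ^ D * lam ^ (1 - α) * (lam ^ α * μ (closedBall x (κ * r x))) := by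
          rw [e5]; nth_rewrite 1 [hsplit]; ring
      _ ≤ 5 ^ D * lam ^ (1 - α) * (2 * A' *
        ∫⁻ y in closedBall x (κ * r x) ∩ {y | η * lam < g y}, g y ^ α ∂μ) := by gcongr
      _ = _ := by ring
  have := hTc.to_subtype
  calc ∫⁻ y in E, g y ∂μ ≤ ∫⁻ y in N ∪ ⋃ x ∈ T, closedBall x (5 * κ * r x), f y ∂μ := by
        rw [← setLIntegral_congr_fun (f := f) (g := g) (s := E)
          (measurableSet_ball.inter (measurableSet_lt measurable_const hg)) (fun y hy =>
            indicator_of_mem (ball_subset_ball (hρσ.le.trans hσ) hy.1) g)]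
        exact lintegral_mono_set hcov
    _ ≤ ∫⁻ y in N, f y ∂μ + ∫⁻ y in ⋃ x ∈ T, closedBall x (5 * κ * r x), f y ∂μ :=
        lintegral_union_le _ _ _
    _ = ∫⁻ y in ⋃ x : T, closedBall (x : X) (5 * κ * r x), f y ∂μ := by
        rw [setLIntegral_measure_zero _ _ hN, zero_add, biUnion_eq_iUnion]
    _ ≤ ∑' x : T, ∫⁻ y in closedBall (x : X) (5 * κ * r x), f y ∂μ := lintegral_iUnion_le _ _
    _ ≤ ∑' x : T, 5 ^ D * (2 * A') * lam ^ (1 - α) *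
        ∫⁻ y in closedBall (x : X) (κ * r x) ∩ {y | η * lam < g y}, g y ^ α ∂μ :=
        ENNReal.tsum_le_tsum fun x => ((hT x x.2).2.2.2).trans (hball x x.2)
    _ = 5 ^ D * (2 * A') * lam ^ (1 - α) * ∑' x : T,
        ∫⁻ y in closedBall (x : X) (κ * r x) ∩ {y | η * lam < g y}, g y ^ α ∂μ :=
        ENNReal.tsum_mul_left
    _ = 5 ^ D * (2 * A') * lam ^ (1 - α) *
        ∫⁻ y in ⋃ x ∈ T, closedBall x (κ * r x) ∩ {y | η * lam < g y}, g y ^ α ∂μ := by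
        rw [lintegral_biUnion hTc (fun x _ => measurableSet_closedBall.inter
          (measurableSet_lt measurable_const hg))
          (hTd.mono_on fun x _ => inter_subset_left)]
    _ ≤ _ := by
        gcongr
        refine iUnion₂_subset fun x hx => inter_subset_inter_left _ (hsub x (hTE hx) _ ?_)
        obtain ⟨hr0, hrδ, -⟩ := hT x hx
        nlinarith [mul_pos (by linarith : (0:ℝ) < κ) hr0]

end Gehring
end ParabolicBMO

namespace ParabolicBMO
open Filter Topology

/-! ### Gehring's lemma -/

section Gehring

variable {X : Type*} [MetricSpace X] [MeasurableSpace X] [BorelSpace X]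
  [SecondCountableTopology X] {μ : Measure X} {c : ℝ} {D : ℕ}

theorem lintegral_Ioc_rpow_sub_one {τ : ℝ} (hτ : 0 < τ) {b : ℝ} (hb : 0 ≤ b) :
    ENNReal.ofReal τ * ∫⁻ t in Ioc 0 b, ENNReal.ofReal (t ^ (τ - 1)) = ENNReal.ofReal (b ^ τ) := by
  have hint : IntegrableOn (fun t : ℝ => t ^ (τ - 1)) (Ioc 0 b) := by
    rw [← intervalIntegrable_iff_integrableOn_Ioc_of_le hb]
    exact intervalIntegral.intervalIntegrable_rpow' (by linarith)
  rw [← ofReal_integral_eq_lintegral_ofReal hint, ← ENNReal.ofReal_mul hτ.le,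
    ← intervalIntegral.integral_of_le hb, integral_rpow (Or.inl (by linarith))]
  · congr 1
    rw [sub_add_cancel, Real.zero_rpow hτ.ne']
    field_simp
    simp
  · filter_upwards [ae_restrict_mem measurableSet_Ioc] with t ht
    exact Real.rpow_nonneg ht.1.le _

/-- The good-`λ` inequality integrated against `lam ^ (τ - 1)`, for `G` truncated at height `M`. -/
theorem ReverseHolder.truncated_step (h : IsBallRegular μ c D) {κ : ℝ} (hκ : 1 ≤ κ) {A : ℝ≥0}
    {α : ℝ} (hα : 0 < α) (hα1 : α < 1) {G : X → ℝ} (hG : Measurable G) (hG0 : ∀ x, 0 ≤ G x)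
    {η : ℝ} (hη0 : 0 < η) (hη1 : η ≤ 1)
    (hη : A * (5 : ℝ≥0∞) ^ (D * (1 - α)) * ENNReal.ofReal η ^ α ≤ 2⁻¹) {S : Set X} {z₀ : X}
    {ρ₀ : ℝ} (hRH : ReverseHolder μ κ A α S z₀ ρ₀ (fun x => ENNReal.ofReal (G x)))
    (hS : ∀ x, G x ≠ 0 → x ∈ S)
    (hfin : ∫⁻ y in ball z₀ ρ₀, ENNReal.ofReal (G y) ∂μ ≠ ⊤) {ρ σ : ℝ} (hρσ : ρ < σ)
    (hσ : σ ≤ ρ₀) {τ : ℝ} (hτ : 0 < τ) (hτ1 : τ ≤ 1) {M lam₀ : ℝ} (hM : 0 < M) (hlam₀ : 0 ≤ lam₀)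
    (hI : ∫⁻ y in ball z₀ ρ₀, ENNReal.ofReal (G y) ∂μ ≤
      ENNReal.ofReal lam₀ * ENNReal.ofReal (c * ((σ - ρ) / 2) ^ D)) :
    ∫⁻ y in ball z₀ ρ, ENNReal.ofReal (G y * (min (G y) M) ^ τ) ∂μ ≤
      ENNReal.ofReal (lam₀ ^ τ) * ∫⁻ y in ball z₀ ρ₀, ENNReal.ofReal (G y) ∂μ +
      ENNReal.ofReal (τ / (1 - α) * (η⁻¹) ^ 2) *
        (5 ^ D * (2 * (A * (5 : ℝ≥0∞) ^ (D * (1 - α))))) *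
        ∫⁻ y in ball z₀ σ, ENNReal.ofReal (G y * (min (G y) M) ^ τ) ∂μ := by
  set C₁ : ℝ≥0∞ := 5 ^ D * (2 * (A * (5 : ℝ≥0∞) ^ (D * (1 - α)))) with hC₁
  set g : X → ℝ≥0∞ := fun x => ENNReal.ofReal (G x) with hg
  have hgm : Measurable g := hG.ennreal_ofReal
  set I := ∫⁻ y in ball z₀ ρ₀, g y ∂μ with hIdef
  have hH : Measurable fun y => min (G y) M := hG.min measurable_const
  have hH0 : ∀ y, 0 ≤ min (G y) M := fun y => le_min (hG0 y) hM.le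
  have hH' : Measurable fun y => min (G y / η) M := (hG.div_const η).min measurable_const
  have hH0' : ∀ y, 0 ≤ min (G y / η) M := fun y => le_min (div_nonneg (hG0 y) hη0.le) hM.le
  -- the good-`λ` inequality compares the distribution functions of these two measures
  set ν₁ : Measure X := (μ.restrict (ball z₀ ρ)).withDensity g with hν₁
  set ν₂ : Measure X := (μ.restrict (ball z₀ σ)).withDensity (fun y => g y ^ α) with hν₂
  have hL : ∫⁻ y in ball z₀ ρ, ENNReal.ofReal (G y * (min (G y) M) ^ τ) ∂μ =
      ∫⁻ y, ENNReal.ofReal ((min (G y) M) ^ τ) ∂ν₁ := by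
    rw [hν₁, lintegral_withDensity_eq_lintegral_mul _ hgm (by fun_prop)]
    refine lintegral_congr fun y => ?_
    simp only [Pi.mul_apply, hg]
    rw [← ENNReal.ofReal_mul (hG0 y)]
  have hp : 0 < 1 - α + τ := by linarith
  have hR : ∫⁻ y, ENNReal.ofReal ((min (G y / η) M) ^ (1 - α + τ)) ∂ν₂ ≤
      ENNReal.ofReal ((η⁻¹) ^ 2) *
        ∫⁻ y in ball z₀ σ, ENNReal.ofReal (G y * (min (G y) M) ^ τ) ∂μ := by
    rw [hν₂, lintegral_withDensity_eq_lintegral_mul _ (hgm.pow_const α) (by fun_prop),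
      ← lintegral_const_mul _ (by fun_prop)]
    refine lintegral_mono fun y => ?_
    simp only [Pi.mul_apply, hg]
    rw [ENNReal.ofReal_rpow_of_nonneg (hG0 y) hα.le,
      ← ENNReal.ofReal_mul (Real.rpow_nonneg (hG0 y) _), ← ENNReal.ofReal_mul (by positivity)]
    refine ENNReal.ofReal_le_ofReal ?_
    have hηi : 1 ≤ η⁻¹ := (one_le_inv₀ hη0).2 hη1
    have a1 : min (G y / η) M ≤ η⁻¹ * min (G y) M := by
      rw [mul_min_of_nonneg _ _ (by positivity)]
      refine min_le_min (by rw [div_eq_inv_mul]) (by nlinarith)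
    have a2 : min (G y / η) M ^ (1 - α + τ) ≤
        η⁻¹ ^ 2 * (G y ^ (1 - α) * min (G y) M ^ τ) := by
      calc min (G y / η) M ^ (1 - α + τ) ≤ (η⁻¹ * min (G y) M) ^ (1 - α + τ) :=
            Real.rpow_le_rpow (hH0' y) a1 hp.le
        _ = (η⁻¹) ^ (1 - α + τ) * (min (G y) M ^ (1 - α) * min (G y) M ^ τ) := by
            rw [Real.mul_rpow (by positivity) (hH0 y),
              Real.rpow_add_of_nonneg (hH0 y) (by linarith) hτ.le]
        _ ≤ (η⁻¹) ^ (2:ℝ) * (G y ^ (1 - α) * min (G y) M ^ τ) := by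
            have := Real.rpow_nonneg (hH0 y) τ
            have := Real.rpow_nonneg (hH0 y) (1 - α)
            gcongr
            · linarith
            · exact hH0 y
            · exact min_le_left _ _
        _ = _ := by rw [Real.rpow_two]
    calc G y ^ α * min (G y / η) M ^ (1 - α + τ)
        ≤ G y ^ α * (η⁻¹ ^ 2 * (G y ^ (1 - α) * min (G y) M ^ τ)) :=
          mul_le_mul_of_nonneg_left a2 (Real.rpow_nonneg (hG0 y) _)
      _ = η⁻¹ ^ 2 * ((G y ^ α * G y ^ (1 - α)) * min (G y) M ^ τ) := by ring
      _ = η⁻¹ ^ 2 * (G y * min (G y) M ^ τ) := by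
          rw [← Real.rpow_add_of_nonneg (hG0 y) hα.le (by linarith)]
          simp
  -- layer-cake formula; the levels below `lam₀`, where the good-`λ` inequality is not available,
  -- contribute the first term on the right
  rw [hL, lintegral_rpow_eq_lintegral_meas_lt_mul ν₁ (Eventually.of_forall hH0)
    hH.aemeasurable hτ, ← Ioc_union_Ioi_eq_Ioi hlam₀]
  refine (mul_le_mul_right (lintegral_union_le _ _ _) _).trans ?_
  rw [mul_add]
  refine add_le_add ?_ ?_
  · calc ENNReal.ofReal τ * ∫⁻ t in Ioc 0 lam₀,
          ν₁ {a | t < min (G a) M} * ENNReal.ofReal (t ^ (τ - 1))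
        ≤ ENNReal.ofReal τ * ∫⁻ t in Ioc 0 lam₀, I * ENNReal.ofReal (t ^ (τ - 1)) := by
          gcongr with t
          refine (measure_mono (subset_univ _)).trans ?_
          rw [hν₁, withDensity_apply _ MeasurableSet.univ, Measure.restrict_univ]
          exact lintegral_mono_set (ball_subset_ball (hρσ.le.trans hσ))
      _ = (ENNReal.ofReal τ * ∫⁻ t in Ioc 0 lam₀, ENNReal.ofReal (t ^ (τ - 1))) * I := by
          rw [lintegral_const_mul _ (by fun_prop)]; ring
      _ = _ := by rw [lintegral_Ioc_rpow_sub_one hτ hlam₀]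
  · calc ENNReal.ofReal τ * ∫⁻ t in Ioi lam₀,
          ν₁ {a | t < min (G a) M} * ENNReal.ofReal (t ^ (τ - 1))
        ≤ ENNReal.ofReal τ * ∫⁻ t in Ioi lam₀, C₁ * (ν₂ {a | t < min (G a / η) M} *
            ENNReal.ofReal (t ^ (1 - α + τ - 1))) := by
          refine mul_le_mul_right (setLIntegral_mono' measurableSet_Ioi fun t ht => ?_) _
          have ht0 : 0 < t := hlam₀.trans_lt ht
          -- above the truncation height the left-hand side vanishes
          rcases le_or_gt M t with hMt | hMt
          · have : {a | t < min (G a) M} = ∅ := by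
              ext a; simp [hMt]
            rw [this]
            simp
          have hgl := ReverseHolder.good_lambda h hκ hα hα1 hgm hη hRH
            (fun x hx => hS x fun h0 => hx (by simp [hg, h0])) hfin hρσ hσ
            (lam := ENNReal.ofReal t) (ENNReal.ofReal_pos.2 ht0).ne' ENNReal.ofReal_ne_top
            (hI.trans (by gcongr; exact (ht : lam₀ < t).le))
          have e1 : ν₁ {a | t < min (G a) M} ≤
              ∫⁻ y in ball z₀ ρ ∩ {y | ENNReal.ofReal t < g y}, g y ∂μ := by
            rw [hν₁, withDensity_apply _ (measurableSet_lt measurable_const hH),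
              Measure.restrict_restrict (measurableSet_lt measurable_const hH), inter_comm]
            refine lintegral_mono_set (inter_subset_inter_right _ fun a ha => ?_)
            have : t < G a := lt_of_lt_of_le ha (min_le_left _ _)
            exact (ENNReal.ofReal_lt_ofReal_iff (ht0.trans this)).2 this
          have e2 : ∫⁻ y in ball z₀ σ ∩ {y | ENNReal.ofReal η * ENNReal.ofReal t < g y},
              g y ^ α ∂μ ≤ ν₂ {a | t < min (G a / η) M} := by
            rw [hν₂, withDensity_apply _ (measurableSet_lt measurable_const hH'),
              Measure.restrict_restrict (measurableSet_lt measurable_const hH'),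
              inter_comm {a | t < min (G a / η) M}]
            refine lintegral_mono_set (inter_subset_inter_right _ fun a ha => ?_)
            have ha' : ENNReal.ofReal η * ENNReal.ofReal t < ENNReal.ofReal (G a) := ha
            rw [← ENNReal.ofReal_mul hη0.le, ENNReal.ofReal_lt_ofReal_iff_of_nonneg
              (by positivity)] at ha'
            refine lt_min ?_ hMt
            rw [lt_div_iff₀ hη0]; linarith
          calc ν₁ {a | t < min (G a) M} * ENNReal.ofReal (t ^ (τ - 1))
              ≤ (C₁ * ENNReal.ofReal t ^ (1 - α) * ν₂ {a | t < min (G a / η) M}) *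
                ENNReal.ofReal (t ^ (τ - 1)) := by
                gcongr
                exact e1.trans (hgl.trans (by gcongr))
            _ = C₁ * (ν₂ {a | t < min (G a / η) M} *
                (ENNReal.ofReal t ^ (1 - α) * ENNReal.ofReal (t ^ (τ - 1)))) := by ring
            _ = _ := by
                rw [ENNReal.ofReal_rpow_of_pos ht0, ← ENNReal.ofReal_mul (by positivity),
                  ← Real.rpow_add ht0]
                congr 4
                ring
      _ ≤ ENNReal.ofReal τ * ∫⁻ t in Ioi 0, C₁ * (ν₂ {a | t < min (G a / η) M} *
            ENNReal.ofReal (t ^ (1 - α + τ - 1))) := by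
          gcongr
      _ = ENNReal.ofReal (τ / (1 - α + τ)) * C₁ *
            (ENNReal.ofReal (1 - α + τ) * ∫⁻ t in Ioi 0, ν₂ {a | t < min (G a / η) M} *
            ENNReal.ofReal (t ^ (1 - α + τ - 1))) := by
          rw [lintegral_const_mul' _ _ (by
            simp only [hC₁]
            refine ENNReal.mul_ne_top (by simp) (ENNReal.mul_ne_top (by simp)
              (ENNReal.mul_ne_top (by simp) (ENNReal.rpow_ne_top_of_nonneg ?_ (by simp))))
            have : 0 ≤ 1 - α := by linarith
            positivity)]
          have : ENNReal.ofReal τ =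
              ENNReal.ofReal (τ / (1 - α + τ)) * ENNReal.ofReal (1 - α + τ) := by
            rw [← ENNReal.ofReal_mul (by positivity)]
            congr 1; field_simp
          rw [this]; ring
      _ = ENNReal.ofReal (τ / (1 - α + τ)) * C₁ *
            ∫⁻ y, ENNReal.ofReal ((min (G y / η) M) ^ (1 - α + τ)) ∂ν₂ := by
          rw [lintegral_rpow_eq_lintegral_meas_lt_mul ν₂ (Eventually.of_forall hH0')
            hH'.aemeasurable hp]
      _ ≤ ENNReal.ofReal (τ / (1 - α)) * C₁ * (ENNReal.ofReal ((η⁻¹) ^ 2) *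
            ∫⁻ y in ball z₀ σ, ENNReal.ofReal (G y * (min (G y) M) ^ τ) ∂μ) := by
          gcongr
          linarith
      _ = _ := by
          rw [ENNReal.ofReal_mul (div_nonneg hτ.le (by linarith))]
          ring

/-- **Gehring's lemma.** The inequality for the truncated functions is iterated over an
increasing sequence of radii, and the truncation is then removed. -/
theorem gehring (h : IsBallRegular μ c D) {κ : ℝ} (hκ : 1 ≤ κ) (A : ℝ≥0)
    {α : ℝ} (hα : 0 < α) (hα1 : α < 1) :
    ∃ τ₀ : ℝ, 0 < τ₀ ∧ ∀ τ : ℝ, 0 < τ → τ ≤ τ₀ → ∀ (G : X → ℝ) (S : Set X) (z₀ : X) (R : ℝ),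
      Measurable G → (∀ x, 0 ≤ G x) → 0 < R →
      ReverseHolder μ κ A α S z₀ (6 * R) (fun x => ENNReal.ofReal (G x)) →
      (∀ x, G x ≠ 0 → x ∈ S) →
      ∫⁻ y in ball z₀ (6 * R), ENNReal.ofReal (G y) ∂μ ≠ ⊤ →
      ∫⁻ y in ball z₀ R, ENNReal.ofReal (G y ^ (1 + τ)) ∂μ ≤
        4 * ENNReal.ofReal (((∫⁻ y in ball z₀ (6 * R), ENNReal.ofReal (G y) ∂μ).toReal /
          (c * R ^ D)) ^ τ) * ∫⁻ y in ball z₀ (6 * R), ENNReal.ofReal (G y) ∂μ := by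
  have hc := h.pos
  set A' : ℝ≥0∞ := A * (5 : ℝ≥0∞) ^ (D * (1 - α)) with hA'
  have hA't : A' ≠ ⊤ := by
    refine ENNReal.mul_ne_top (by simp) (ENNReal.rpow_ne_top_of_nonneg ?_ (by simp))
    have : 0 ≤ 1 - α := by linarith
    positivity
  -- a level ratio `η` for which the part of the function below `η * lam` is absorbed
  obtain ⟨η, hη0, hη1, hη⟩ : ∃ η : ℝ, 0 < η ∧ η ≤ 1 ∧ A' * ENNReal.ofReal η ^ α ≤ 2⁻¹ := by
    set a := A'.toReal with ha
    refine ⟨((2 * (a + 1))⁻¹) ^ (α⁻¹), by positivity, ?_, ?_⟩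
    · refine Real.rpow_le_one (by positivity) ?_ (by positivity)
      refine inv_le_one_of_one_le₀ ?_
      have : 0 ≤ a := ENNReal.toReal_nonneg
      linarith
    · have ha0 : 0 ≤ a := ENNReal.toReal_nonneg
      rw [ENNReal.ofReal_rpow_of_nonneg (by positivity) hα.le, Real.rpow_inv_rpow (by positivity)
        hα.ne', ← ENNReal.ofReal_toReal hA't, ← ENNReal.ofReal_mul ENNReal.toReal_nonneg]
      have : (2⁻¹ : ℝ≥0∞) = ENNReal.ofReal 2⁻¹ := by
        rw [ENNReal.ofReal_inv_of_pos two_pos]; simp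
      rw [this]
      refine ENNReal.ofReal_le_ofReal ?_
      rw [← ha, mul_inv, ← mul_assoc, mul_comm a, mul_assoc, ← div_eq_mul_inv]
      have : a / (a + 1) ≤ 1 := (div_le_one (by positivity)).2 (by linarith)
      linarith
  set C₁ : ℝ≥0∞ := 5 ^ D * (2 * A') with hC₁
  have hC₁t : C₁ ≠ ⊤ := ENNReal.mul_ne_top (by simp) (ENNReal.mul_ne_top (by simp) hA't)
  set K : ℝ := C₁.toReal * (η⁻¹) ^ 2 / (1 - α) with hK
  have hK0 : 0 ≤ K := div_nonneg (by positivity) (by linarith)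
  -- `τ ≤ 1/(2(K+1))` makes the coefficient of one step at most `1/2`; `τ ≤ 1/(2(D+1))` makes the
  -- growth `2^(Dτ)` of the level from one radius to the next at most `√2 ≤ 3/2`, so that the
  -- sum over all steps is dominated by the geometric series of `3/4`
  refine ⟨min 1 (min ((2 * (K + 1))⁻¹) ((2 * (D + 1) : ℝ)⁻¹)), by positivity, ?_⟩
  intro τ hτ hττ G S z₀ R hG hG0 hR hRH hS hfin
  have hτ1 : τ ≤ 1 := hττ.trans (min_le_left _ _)
  have hτ2 : τ ≤ (2 * (K + 1))⁻¹ := hττ.trans ((min_le_right _ _).trans (min_le_left _ _))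
  have hτ3 : τ ≤ (2 * (D + 1) : ℝ)⁻¹ := hττ.trans ((min_le_right _ _).trans (min_le_right _ _))
  set I := ∫⁻ y in ball z₀ (6 * R), ENNReal.ofReal (G y) ∂μ with hI
  have hcoef : ENNReal.ofReal (τ / (1 - α) * (η⁻¹) ^ 2) * C₁ ≤ ENNReal.ofReal 2⁻¹ := by
    rw [← ENNReal.ofReal_toReal hC₁t, ← ENNReal.ofReal_mul (by
      have : 0 ≤ 1 - α := by linarith
      positivity)]
    refine ENNReal.ofReal_le_ofReal ?_
    have : τ / (1 - α) * η⁻¹ ^ 2 * C₁.toReal = τ * K := by rw [hK]; ring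
    rw [this]
    calc τ * K ≤ (2 * (K + 1))⁻¹ * (K + 1) := by gcongr; linarith
      _ = 2⁻¹ := by field_simp
  set L : ℝ := I.toReal / (c * R ^ D) with hLdef
  have hL0 : 0 ≤ L := by positivity
  -- the radii of the iteration
  let ρ : ℕ → ℝ := fun i => R * (6 - 5 * (1 / 2) ^ i)
  have hρ6 : ∀ i, ρ i ≤ 6 * R := fun i => by
    have : (0:ℝ) ≤ (1 / 2) ^ i := by positivity
    simp only [ρ]; nlinarith
  have hρd : ∀ i, ρ (i + 1) - ρ i = 5 / 2 * R * (1 / 2) ^ i := fun i => by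
    simp only [ρ, pow_succ]; ring
  have hmain : ∀ M : ℝ, 0 < M →
      ∫⁻ y in ball z₀ R, ENNReal.ofReal (G y * (min (G y) M) ^ τ) ∂μ ≤
        4 * ENNReal.ofReal (L ^ τ) * I := by
    intro M hM
    set F : ℕ → ℝ≥0∞ := fun i => ∫⁻ y in ball z₀ (ρ i), ENNReal.ofReal (G y * (min (G y) M) ^ τ) ∂μ
      with hF
    set P : ℝ≥0∞ := ENNReal.ofReal (L ^ τ) * I with hP
    have hstep : ∀ i, F i ≤ ENNReal.ofReal ((3 / 2) ^ i) * P + ENNReal.ofReal 2⁻¹ * F (i + 1) := by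
      intro i
      -- the level at which the stopping rule applies between the radii `ρ i` and `ρ (i + 1)`
      set lam₀ : ℝ := L * 2 ^ (D * i) with hlam₀
      have hpow : lam₀ ^ τ ≤ (3 / 2) ^ i * L ^ τ := by
        rw [hlam₀, Real.mul_rpow hL0 (by positivity), mul_comm]
        refine mul_le_mul_of_nonneg_right ?_ (by positivity)
        rw [pow_mul, ← Real.rpow_natCast ((2:ℝ) ^ D) i, ← Real.rpow_mul (by positivity),
          mul_comm (i : ℝ) τ, Real.rpow_mul (by positivity), Real.rpow_natCast]
        refine pow_le_pow_left₀ (by positivity) ?_ i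
        rw [← Real.rpow_natCast, ← Real.rpow_mul (by norm_num)]
        have hDτ : (D : ℝ) * τ ≤ 1 / 2 := by
          calc (D : ℝ) * τ ≤ (D + 1) * (2 * (D + 1) : ℝ)⁻¹ := by gcongr; linarith
            _ = 1 / 2 := by field_simp
        calc (2:ℝ) ^ ((D : ℝ) * τ) ≤ 2 ^ (1 / 2 : ℝ) :=
              Real.rpow_le_rpow_of_exponent_le (by norm_num) hDτ
          _ = √2 := (Real.sqrt_eq_rpow 2).symm
          _ ≤ 3 / 2 := by rw [Real.sqrt_le_left (by norm_num)]; norm_num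
      have := ReverseHolder.truncated_step h hκ hα hα1 hG hG0 hη0 hη1 hη hRH hS hfin
        (ρ := ρ i) (σ := ρ (i + 1)) (by
          have := hρd i
          have : 0 < 5 / 2 * R * (1 / 2 : ℝ) ^ i := by positivity
          linarith) (hρ6 _) hτ hτ1 hM (lam₀ := lam₀) (by positivity) (by
          rw [← ENNReal.ofReal_mul (by positivity), hρd, ← hI, ← ENNReal.ofReal_toReal hfin]
          refine ENNReal.ofReal_le_ofReal ?_
          have e : lam₀ * (c * (5 / 2 * R * (1 / 2) ^ i / 2) ^ D) =
              I.toReal * (5 / 4) ^ D := by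
            have : (5 / 2 * R * (1 / 2) ^ i / 2) ^ D = (5 / 4) ^ D * R ^ D * (2 ^ (D * i))⁻¹ := by
              rw [mul_comm D i, pow_mul, ← inv_pow, ← mul_pow, ← mul_pow]
              congr 1
              rw [← inv_pow]; ring
            rw [this, hlam₀, hLdef]
            field_simp
          rw [e]
          exact le_mul_of_one_le_right ENNReal.toReal_nonneg (one_le_pow₀ (by norm_num)))
      refine this.trans (add_le_add ?_ ?_)
      · rw [hP, ← mul_assoc, ← ENNReal.ofReal_mul (by positivity)]
        gcongr
      · gcongr
    have hiter : ∀ N : ℕ, F 0 ≤ ENNReal.ofReal (4 * (1 - (3 / 4) ^ N)) * P +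
        ENNReal.ofReal ((1 / 2) ^ N) * F N := by
      intro N
      induction N with
      | zero => simp
      | succ N ih =>
        refine ih.trans ?_
        calc ENNReal.ofReal (4 * (1 - (3 / 4) ^ N)) * P + ENNReal.ofReal ((1 / 2) ^ N) * F N
            ≤ ENNReal.ofReal (4 * (1 - (3 / 4) ^ N)) * P + ENNReal.ofReal ((1 / 2) ^ N) *
              (ENNReal.ofReal ((3 / 2) ^ N) * P + ENNReal.ofReal 2⁻¹ * F (N + 1)) := by
              gcongr; exact hstep N
          _ = (ENNReal.ofReal (4 * (1 - (3 / 4) ^ N)) + ENNReal.ofReal ((1 / 2) ^ N) *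
              ENNReal.ofReal ((3 / 2) ^ N)) * P +
              ENNReal.ofReal ((1 / 2) ^ N) * ENNReal.ofReal 2⁻¹ * F (N + 1) := by ring
          _ = _ := by
              have h34 : (3 / 4 : ℝ) ^ N ≤ 1 := pow_le_one₀ (by norm_num) (by norm_num)
              rw [← ENNReal.ofReal_mul (by positivity), ← ENNReal.ofReal_mul (by positivity),
                ← mul_pow, ← ENNReal.ofReal_add (by linarith) (by positivity)]
              congr 3
              · rw [pow_succ]; norm_num; ring
              · rw [pow_succ]; norm_num
    -- the truncation makes the remainder `2⁻ᴺ F N` of the iteration tend to zero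
    have hFN : ∀ N, F N ≤ ENNReal.ofReal (M ^ τ) * I := by
      intro N
      simp only [hF, hI]
      rw [← lintegral_const_mul _ (by fun_prop)]
      refine (lintegral_mono fun y => ?_).trans (lintegral_mono_set (ball_subset_ball (hρ6 N)))
      rw [← ENNReal.ofReal_mul (by positivity), mul_comm]
      refine ENNReal.ofReal_le_ofReal (mul_le_mul_of_nonneg_right ?_ (hG0 y))
      exact Real.rpow_le_rpow (le_min (hG0 y) hM.le) (min_le_right _ _) hτ.le
    have hlim : Tendsto (fun N : ℕ => 4 * P + ENNReal.ofReal ((1 / 2) ^ N) *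
        (ENNReal.ofReal (M ^ τ) * I)) atTop (𝓝 (4 * P + 0)) := by
      refine tendsto_const_nhds.add ?_
      have h0 : Tendsto (fun N : ℕ => ENNReal.ofReal ((1 / 2) ^ N)) atTop (𝓝 0) := by
        rw [← ENNReal.ofReal_zero]
        exact ENNReal.tendsto_ofReal (tendsto_pow_atTop_nhds_zero_of_lt_one (by norm_num)
          (by norm_num))
      have := ENNReal.Tendsto.mul_const (b := ENNReal.ofReal (M ^ τ) * I) h0
        (Or.inr (ENNReal.mul_ne_top ENNReal.ofReal_ne_top hfin))
      rwa [zero_mul] at this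
    have h0 : F 0 ≤ 4 * P := by
      rw [← add_zero (4 * P)]
      refine ge_of_tendsto' hlim fun N => (hiter N).trans ?_
      gcongr
      · have : ENNReal.ofReal (4 * (1 - (3 / 4) ^ N)) ≤ ENNReal.ofReal 4 := by
          refine ENNReal.ofReal_le_ofReal ?_
          have : (0:ℝ) ≤ (3 / 4) ^ N := by positivity
          linarith
        simpa using this
      · exact hFN N
    have hρ0 : ρ 0 = R := by simp only [ρ]; norm_num
    simp only [hF, hρ0] at h0
    rw [mul_assoc]
    exact h0
  -- removal of the truncation
  have hmono : ∀ y, Tendsto (fun N : ℕ => ENNReal.ofReal (G y * (min (G y) ((N : ℝ) + 1)) ^ τ))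
      atTop (𝓝 (ENNReal.ofReal (G y ^ (1 + τ)))) := by
    intro y
    refine tendsto_const_nhds.congr' ?_
    obtain ⟨N₀, hN₀⟩ := exists_nat_ge (G y)
    filter_upwards [eventually_ge_atTop N₀] with N hN
    have : G y ≤ (N : ℝ) + 1 := by
      have : (N₀ : ℝ) ≤ N := by exact_mod_cast hN
      linarith
    rw [min_eq_left this, Real.rpow_add_of_nonneg (hG0 y) zero_le_one hτ.le, Real.rpow_one]
  calc ∫⁻ y in ball z₀ R, ENNReal.ofReal (G y ^ (1 + τ)) ∂μ
      = ∫⁻ y in ball z₀ R, liminf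
          (fun N : ℕ => ENNReal.ofReal (G y * (min (G y) ((N : ℝ) + 1)) ^ τ)) atTop ∂μ :=
        lintegral_congr fun y => (hmono y).liminf_eq.symm
    _ ≤ liminf (fun N : ℕ => ∫⁻ y in ball z₀ R,
          ENNReal.ofReal (G y * (min (G y) ((N : ℝ) + 1)) ^ τ) ∂μ) atTop :=
        lintegral_liminf_le fun N => by fun_prop
    _ ≤ 4 * ENNReal.ofReal (L ^ τ) * I :=
        liminf_le_of_frequently_le' (Frequently.of_forall fun N => hmain _ (by positivity))

end Gehring
end ParabolicBMO

namespace ParabolicBMO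
open Filter Topology

/-! ### The John–Nirenberg inequality -/

section JohnNirenberg

theorem enorm_setAverage_sub_mul_le {X : Type*} [MeasurableSpace X] {μ : Measure X} {s : Set X}
    {f : X → ℝ} (hs : μ s ≠ 0) (hs' : μ s ≠ ⊤) (hf : IntegrableOn f s μ) (a : ℝ) :
    ‖(⨍ y in s, f y ∂μ) - a‖ₑ * μ s ≤ ∫⁻ y in s, ‖f y - a‖ₑ ∂μ := by
  have h1 : (⨍ y in s, f y ∂μ) - a = ⨍ y in s, (f y - a) ∂μ := by
    rw [setAverage_eq, setAverage_eq, integral_sub hf (integrableOn_const hs'), smul_sub]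
    have : μ.real s ≠ 0 := by
      rw [measureReal_def]; exact ENNReal.toReal_ne_zero.2 ⟨hs, hs'⟩
    simp [this]
  rw [h1, setAverage_eq, enorm_smul]
  have h2 : ‖(μ.real s)⁻¹‖ₑ = (μ s)⁻¹ := by
    rw [enorm_inv (by rw [measureReal_def]; exact ENNReal.toReal_ne_zero.2 ⟨hs, hs'⟩),
      measureReal_def, Real.enorm_eq_ofReal ENNReal.toReal_nonneg, ENNReal.ofReal_toReal hs']
  rw [h2, mul_comm, ← mul_assoc, ENNReal.mul_inv_cancel hs hs', one_mul]
  exact enorm_integral_le_lintegral_enorm _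

variable {X : Type*} [MetricSpace X] [MeasurableSpace X] [BorelSpace X]
  [SecondCountableTopology X] {μ : Measure X} {c : ℝ} {D : ℕ}

/-- `f` has mean oscillation at most `Γ` on all balls contained in `U`. -/
def HasOscillationLE (μ : Measure X) (U : Set X) (Γ : ℝ≥0) (f : X → ℝ) : Prop :=
  ∀ (x : X) (r : ℝ), 0 < r → closedBall x r ⊆ U →
    ∫⁻ y in closedBall x r, ‖f y - ⨍ w in closedBall x r, f w ∂μ‖ₑ ∂μ ≤ Γ * μ (closedBall x r)

/-- The John–Nirenberg decay of the distribution function: each increase of the level by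
`2 * 10 ^ D * (1 + 2 ^ D) * Γ` halves the measure of the level set. -/
theorem HasOscillationLE.measure_lt_le (h : IsBallRegular μ c D) {U : Set X} {Γ : ℝ≥0}
    (hΓ : 0 < Γ) {f : X → ℝ} (hf : IntegrableOn f U μ) (hosc : HasOscillationLE μ U Γ f) (k : ℕ) :
    ∀ (x : X) (r : ℝ), 0 < r → closedBall x (2 * r) ⊆ U →
    μ {y ∈ closedBall x r | k * (2 * 10 ^ D * (1 + 2 ^ D) * Γ : ℝ≥0∞) <
      ‖f y - ⨍ w in closedBall x r, f w ∂μ‖ₑ} ≤ (2⁻¹) ^ k * μ (closedBall x r) := by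
  induction k with
  | zero =>
    intro x r hr hU
    simpa using measure_mono (fun y hy => hy.1)
  | succ k ih =>
  intro x r hr hU
  set K : ℝ≥0∞ := 2 * 10 ^ D * (1 + 2 ^ D) with hK
  set fB := ⨍ w in closedBall x r, f w ∂μ with hfB
  set B := closedBall x r with hB
  set B2 := closedBall x (2 * r) with hB2
  have hBB2 : B ⊆ B2 := closedBall_subset_closedBall (by linarith)
  have hB0 : μ B ≠ 0 := (h.measure_pos x hr).ne'
  have hBt : μ B ≠ ⊤ := (h.measure_lt_top x r).ne
  have hB2μ : μ B2 = 2 ^ D * μ B := by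
    rw [hB2, h.measure_mul x x two_pos hr, ENNReal.ofReal_pow (by norm_num)]; simp [hB]
  have hB2t : μ B2 ≠ ⊤ := (h.measure_lt_top x _).ne
  have hfB2 : IntegrableOn f B2 μ := hf.mono_set hU
  -- the stopping rule at level `K * Γ` is applied to the deviation from the mean `fB`, extended by zero
  -- outside the doubled ball; radii up to `r / 2` keep the stopping balls inside it
  set φ : X → ℝ≥0∞ := B2.indicator (fun y => ‖f y - fB‖ₑ) with hφ
  have hφm : AEMeasurable φ μ := by
    rw [hφ, aemeasurable_indicator_iff measurableSet_closedBall]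
    exact (hfB2.aestronglyMeasurable.sub aestronglyMeasurable_const).enorm
  have hφint : ∫⁻ y, φ y ∂μ ≤ Γ * (1 + 2 ^ D) * 2 ^ D * μ B := by
    rw [hφ, lintegral_indicator measurableSet_closedBall]
    set f2 := ⨍ w in B2, f w ∂μ with hf2
    have h1 := hosc x (2 * r) (by linarith) hU
    have h2 : ‖fB - f2‖ₑ * μ B ≤ Γ * μ B2 :=
      (enorm_setAverage_sub_mul_le hB0 hBt (hfB2.mono_set hBB2) f2).trans
        ((lintegral_mono_set hBB2).trans h1)
    calc ∫⁻ y in B2, ‖f y - fB‖ₑ ∂μ ≤ ∫⁻ y in B2, (‖f y - f2‖ₑ + ‖fB - f2‖ₑ) ∂μ := by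
          refine lintegral_mono fun y => ?_
          have e : f y - fB = (f y - f2) - (fB - f2) := by ring
          rw [e]
          exact enorm_sub_le
      _ = ∫⁻ y in B2, ‖f y - f2‖ₑ ∂μ + ‖fB - f2‖ₑ * μ B2 := by
          rw [lintegral_add_right _ measurable_const, setLIntegral_const]
      _ ≤ Γ * μ B2 + 2 ^ D * (Γ * μ B2) := by
          refine add_le_add h1 ?_
          calc ‖fB - f2‖ₑ * μ B2 = 2 ^ D * (‖fB - f2‖ₑ * μ B) := by rw [hB2μ]; ring
            _ ≤ _ := by gcongr
      _ = _ := by rw [hB2μ]; ring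
  have hφt : ∫⁻ y, φ y ∂μ ≠ ⊤ := by
    refine ne_top_of_le_ne_top ?_ hφint
    refine ENNReal.mul_ne_top (ENNReal.mul_ne_top (ENNReal.mul_ne_top (by simp) ?_) (by simp)) hBt
    simp
  set E := {y ∈ B | ((k + 1 : ℕ) : ℝ≥0∞) * (K * Γ) < ‖f y - fB‖ₑ} with hE
  have hEB : E ⊆ B := fun y hy => hy.1
  have hKΓ0 : K * Γ ≠ 0 := by
    simp [hK, hΓ.ne']
  have hKΓt : K * Γ ≠ ⊤ := by
    refine ENNReal.mul_ne_top (ENNReal.mul_ne_top (ENNReal.mul_ne_top (by simp) ?_) ?_) (by simp)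
      <;> simp
  obtain ⟨T, ρ, hTE, hTc, hT, hTd, N, hN, hcov⟩ := h.exists_stopping_cover hφm hφt (κ := 1)
    le_rfl (half_pos hr) (lam := K * Γ) (E := E) (fun y hy => by
      rw [hφ, indicator_of_mem (hBB2 hy.1)]
      refine lt_of_le_of_lt ?_ hy.2
      rw [Nat.cast_add, Nat.cast_one, add_mul, one_mul]
      exact le_add_self) (fun y hy => by
      refine (setLIntegral_le_lintegral _ _).trans (hφint.trans ?_)
      have : μ B = 2 ^ D * μ (closedBall y (r / 2)) := by
        have e : B = closedBall x (2 * (r / 2)) := by rw [hB]; congr 1; ring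
        rw [e, h.measure_mul x y two_pos (half_pos hr), ENNReal.ofReal_pow (by norm_num)]; simp
      rw [this, ← mul_assoc]
      refine mul_le_mul_left ?_ _
      have h4 : (2:ℝ≥0∞) ^ D * 2 ^ D ≤ 2 * 10 ^ D := by
        rw [← mul_pow]
        calc (2 * 2 : ℝ≥0∞) ^ D ≤ 10 ^ D := by gcongr; norm_num
          _ ≤ 2 * 10 ^ D := le_mul_of_one_le_left' (by norm_num)
      calc (Γ : ℝ≥0∞) * (1 + 2 ^ D) * 2 ^ D * 2 ^ D
          = (2 ^ D * 2 ^ D) * (1 + 2 ^ D) * Γ := by ring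
        _ ≤ K * Γ := by rw [hK]; gcongr)
  simp only [mul_one, one_mul] at hT hTd hcov
  have hTB2 : ∀ y ∈ T, closedBall y (5 * ρ y) ⊆ B2 := by
    intro y hy
    have h1 := (hT y hy).2.1
    have h2 : dist y x ≤ r := hEB (hTE hy)
    exact closedBall_subset_closedBall' (by linarith)
  have hball : ∀ y ∈ T, μ (E ∩ closedBall y (5 * ρ y)) ≤
      (2⁻¹) ^ k * 5 ^ D * μ (closedBall y (ρ y)) := by
    intro y hy
    obtain ⟨hρ0, hρr, hlow, hup⟩ := hT y hy
    have hyx : dist y x ≤ r := hEB (hTE hy)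
    set f5 := ⨍ w in closedBall y (5 * ρ y), f w ∂μ with hf5
    -- the upper stopping bound controls the change of the mean, so a deviation of `(k + 1) K Γ` from `fB`
    -- is a deviation of at least `k K Γ` from the mean `f5`, and the induction hypothesis applies
    have hd : ‖f5 - fB‖ₑ ≤ K * Γ := by
      have h1 := enorm_setAverage_sub_mul_le (h.measure_pos y (by positivity : 0 < 5 * ρ y)).ne'
        (h.measure_lt_top y _).ne (hfB2.mono_set (hTB2 y hy)) fB
      have h2 : ∫⁻ w in closedBall y (5 * ρ y), ‖f w - fB‖ₑ ∂μ =
          ∫⁻ w in closedBall y (5 * ρ y), φ w ∂μ :=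
        setLIntegral_congr_fun measurableSet_closedBall fun w hw =>
          (indicator_of_mem (hTB2 y hy hw) (fun y => ‖f y - fB‖ₑ)).symm
      rw [h2] at h1
      exact (ENNReal.mul_le_mul_iff_left (h.measure_pos y (by positivity : 0 < 5 * ρ y)).ne'
        (h.measure_lt_top y _).ne).1 (h1.trans hup)
    have := ih y (5 * ρ y) (by positivity)
      ((closedBall_subset_closedBall' (by linarith)).trans hU)
    calc μ (E ∩ closedBall y (5 * ρ y))
        ≤ μ {w ∈ closedBall y (5 * ρ y) | (k : ℝ≥0∞) * (K * Γ) < ‖f w - f5‖ₑ} := by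
          refine measure_mono fun w hw => ⟨hw.2, ?_⟩
          have h1 : ((k + 1 : ℕ) : ℝ≥0∞) * (K * Γ) < ‖f w - f5‖ₑ + K * Γ := by
            refine hw.1.2.trans_le ?_
            have e : f w - fB = (f w - f5) + (f5 - fB) := by ring
            rw [e]
            exact (enorm_add_le _ _).trans (by gcongr)
          rw [Nat.cast_add, Nat.cast_one, add_mul, one_mul] at h1
          exact lt_of_add_lt_add_right h1
      _ ≤ _ := this
      _ = _ := by
          rw [h.measure_mul y y (by norm_num) hρ0, ENNReal.ofReal_pow (by norm_num)]
          norm_num [mul_assoc]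
  -- the lower stopping bound controls the total measure of the disjoint stopping balls
  have hsum : K * Γ * ∑' y : T, μ (closedBall (y : X) (ρ y)) ≤
      Γ * (1 + 2 ^ D) * 2 ^ D * μ B := by
    rw [← ENNReal.tsum_mul_left]
    calc ∑' y : T, K * Γ * μ (closedBall (y : X) (ρ y))
        ≤ ∑' y : T, ∫⁻ w in closedBall (y : X) (ρ y), φ w ∂μ :=
          ENNReal.tsum_le_tsum fun y => (hT y y.2).2.2.1.le
      _ = ∫⁻ w in ⋃ y ∈ T, closedBall y (ρ y), φ w ∂μ :=
          (lintegral_biUnion hTc (fun _ _ => measurableSet_closedBall) hTd _).symm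
      _ ≤ ∫⁻ w, φ w ∂μ := setLIntegral_le_lintegral _ _
      _ ≤ _ := hφint
  have hEle : μ E ≤ (2⁻¹) ^ k * 5 ^ D * ∑' y : T, μ (closedBall (y : X) (ρ y)) := by
    have := hTc.to_subtype
    calc μ E ≤ μ (N ∪ ⋃ y ∈ T, E ∩ closedBall y (5 * ρ y)) := by
          refine measure_mono fun w hw => ?_
          rcases hcov hw with hw' | hw'
          · exact Or.inl hw'
          · obtain ⟨y, hy, hwy⟩ := mem_iUnion₂.1 hw'
            exact Or.inr (mem_biUnion hy ⟨hw, hwy⟩)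
      _ ≤ μ N + μ (⋃ y ∈ T, E ∩ closedBall y (5 * ρ y)) := measure_union_le _ _
      _ ≤ 0 + ∑' y : T, μ (E ∩ closedBall (y : X) (5 * ρ y)) := by
          rw [hN]; gcongr; exact measure_biUnion_le μ hTc _
      _ ≤ ∑' y : T, (2⁻¹) ^ k * 5 ^ D * μ (closedBall (y : X) (ρ y)) := by
          rw [zero_add]
          exact ENNReal.tsum_le_tsum fun y => hball y y.2
      _ = _ := ENNReal.tsum_mul_left
  have hfinal : K * Γ * μ E ≤ K * Γ * ((2⁻¹) ^ (k + 1) * μ B) := by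
    calc K * Γ * μ E ≤ (2⁻¹) ^ k * 5 ^ D *
          (K * Γ * ∑' y : T, μ (closedBall (y : X) (ρ y))) := by
          calc _ ≤ K * Γ * _ := mul_le_mul_right hEle _
            _ = _ := by ring
      _ ≤ (2⁻¹) ^ k * 5 ^ D * (Γ * (1 + 2 ^ D) * 2 ^ D * μ B) := by gcongr
      _ = (2⁻¹) ^ k * 10 ^ D * (1 + 2 ^ D) * Γ * μ B := by
          have : (10 : ℝ≥0∞) ^ D = 5 ^ D * 2 ^ D := by rw [← mul_pow]; norm_num
          rw [this]; ring
      _ = (2⁻¹ * 2) * ((2⁻¹) ^ k * 10 ^ D * (1 + 2 ^ D) * Γ * μ B) := by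
          rw [ENNReal.inv_mul_cancel (by norm_num) (by norm_num), one_mul]
      _ = _ := by rw [hK, pow_succ]; ring
  exact (ENNReal.mul_le_mul_iff_right hKΓ0 hKΓt).1 hfinal

/-- **John–Nirenberg inequality** in `L^s` form. -/
theorem exists_john_nirenberg (h : IsBallRegular μ c D) {s : ℕ} (hs : s ≠ 0) :
    ∃ C : ℝ≥0, ∀ (U : Set X) (Γ : ℝ≥0) (f : X → ℝ), 0 < Γ → IntegrableOn f U μ →
      HasOscillationLE μ U Γ f → ∀ (x : X) (r : ℝ), 0 < r → closedBall x (2 * r) ⊆ U →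
      ∫⁻ y in closedBall x r, ‖f y - ⨍ w in closedBall x r, f w ∂μ‖ₑ ^ s ∂μ ≤
        C * Γ ^ s * μ (closedBall x r) := by
  set K : ℝ≥0 := 2 * 10 ^ D * (1 + 2 ^ D) with hK
  have hsm : Summable fun k : ℕ => (((k : ℝ≥0) + 1) * K) ^ s * (2⁻¹ : ℝ≥0) ^ k := by
    have h1 : Summable fun k : ℕ => ((k : ℝ)) ^ s * (2⁻¹ : ℝ) ^ k :=
      summable_pow_mul_geometric_of_norm_lt_one s (by norm_num)
    have h2 := ((summable_nat_add_iff 1).2 h1).mul_left ((K : ℝ) ^ s * 2)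
    rw [← NNReal.summable_coe]
    refine h2.congr fun k => ?_
    push_cast
    rw [pow_succ, mul_pow]
    field_simp
  refine ⟨∑' k : ℕ, (((k : ℝ≥0) + 1) * K) ^ s * (2⁻¹ : ℝ≥0) ^ k, ?_⟩
  intro U Γ f hΓ hf hosc x r hr hU
  set B := closedBall x r with hB
  set w : X → ℝ≥0∞ := fun y => ‖f y - ⨍ w in B, f w ∂μ‖ₑ with hw
  have hBU : B ⊆ U := (closedBall_subset_closedBall (by linarith)).trans hU
  have hwm : AEMeasurable w (μ.restrict B) :=
    ((hf.mono_set hBU).aestronglyMeasurable.sub aestronglyMeasurable_const).enorm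
  have hKΓ0 : ((K : ℝ≥0∞) * Γ) ≠ 0 := by simp [hK, hΓ.ne']
  have hKΓt : ((K : ℝ≥0∞) * Γ) ≠ ⊤ := by
    rw [← ENNReal.coe_mul]; exact ENNReal.coe_ne_top
  have hKc : (K : ℝ≥0∞) = 2 * 10 ^ D * (1 + 2 ^ D) := by rw [hK]; push_cast; rfl
  -- `w ^ s` is bounded by a step function on the level sets of `w`, whose measures decay geometrically
  have hpt : ∀ y, w y ^ s ≤ ∑' k : ℕ, {y | k * ((K : ℝ≥0∞) * Γ) < w y}.indicator
      (fun _ => ((k + 1) * ((K : ℝ≥0∞) * Γ)) ^ s) y := by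
    intro y
    rcases eq_or_ne (w y) 0 with h0 | h0
    · rw [h0, zero_pow hs]; exact zero_le
    have hex : ∃ k : ℕ, w y ≤ (k + 1) * ((K : ℝ≥0∞) * Γ) := by
      have hdiv : w y / ((K : ℝ≥0∞) * Γ) ≠ ⊤ := ENNReal.div_ne_top (by simp [hw]) hKΓ0
      obtain ⟨k, hk⟩ := ENNReal.exists_nat_gt hdiv
      refine ⟨k, ?_⟩
      have := (ENNReal.div_le_iff_le_mul (Or.inl hKΓ0) (Or.inl hKΓt)).1 hk.le
      exact this.trans (by gcongr; exact le_self_add)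
    have hspec := Nat.find_spec hex
    set k := Nat.find hex with hk
    have hlt : k * ((K : ℝ≥0∞) * Γ) < w y := by
      rcases Nat.eq_zero_or_pos k with h1 | h1
      · rw [h1]; simpa using pos_iff_ne_zero.2 h0
      · have := Nat.find_min hex (m := k - 1) (by omega)
        rw [not_le] at this
        have e : ((k - 1 : ℕ) : ℝ≥0∞) + 1 = k := by
          have : k - 1 + 1 = k := by omega
          exact_mod_cast this
        rwa [e] at this
    refine le_trans ?_ (ENNReal.le_tsum k)
    rw [indicator_of_mem (show y ∈ {y | (k : ℝ≥0∞) * ((K : ℝ≥0∞) * Γ) < w y} from hlt)]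
    gcongr
  have hnull : ∀ k : ℕ, NullMeasurableSet {y | k * ((K : ℝ≥0∞) * Γ) < w y} (μ.restrict B) :=
    fun k => nullMeasurableSet_lt aemeasurable_const hwm
  calc ∫⁻ y in B, w y ^ s ∂μ
      ≤ ∫⁻ y in B, ∑' k : ℕ, {y | k * ((K : ℝ≥0∞) * Γ) < w y}.indicator
          (fun _ => ((k + 1) * ((K : ℝ≥0∞) * Γ)) ^ s) y ∂μ := lintegral_mono hpt
    _ = ∑' k : ℕ, ((k + 1) * ((K : ℝ≥0∞) * Γ)) ^ s *
          (μ.restrict B) {y | k * ((K : ℝ≥0∞) * Γ) < w y} := by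
        rw [lintegral_tsum fun k => (aemeasurable_const.indicator₀ (hnull k))]
        exact tsum_congr fun k => lintegral_indicator_const₀ (hnull k) _
    _ ≤ ∑' k : ℕ, ((k + 1) * ((K : ℝ≥0∞) * Γ)) ^ s * ((2⁻¹) ^ k * μ B) := by
        refine ENNReal.tsum_le_tsum fun k => mul_le_mul_right ?_ _
        rw [Measure.restrict_apply₀ (hnull k)]
        refine le_trans (measure_mono ?_) (hosc.measure_lt_le h hΓ hf k x r hr hU)
        rintro y ⟨hy1, hy2⟩
        refine ⟨hy2, ?_⟩
        rw [← hKc]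
        exact hy1
    _ = (∑' k : ℕ, (((((k : ℝ≥0) + 1) * K) ^ s * (2⁻¹ : ℝ≥0) ^ k : ℝ≥0) : ℝ≥0∞)) *
          (Γ ^ s * μ B) := by
        rw [← ENNReal.tsum_mul_right]
        refine tsum_congr fun k => ?_
        push_cast
        rw [← mul_assoc ((k : ℝ≥0∞) + 1), mul_pow _ (Γ : ℝ≥0∞)]
        ring
    _ = _ := by
        rw [← ENNReal.coe_tsum hsm, mul_assoc]

end JohnNirenberg
end ParabolicBMO

namespace ParabolicBMO
open Filter Topology

/-! ### The Sobolev–Poincaré inequality for smooth functions -/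

section SobolevPoincare

/-- The uniform probability measure on a set `B` of positive finite volume. -/
noncomputable def unif {X : Type*} [MeasureSpace X] (B : Set X) : Measure X :=
  (volume B)⁻¹ • volume.restrict B

theorem lintegral_unif {X : Type*} [MeasureSpace X] (B : Set X) (f : X → ℝ≥0∞) :
    ∫⁻ x, f x ∂unif B = (volume B)⁻¹ * ∫⁻ x in B, f x := by
  rw [unif, lintegral_smul_measure, smul_eq_mul]

theorem isProbabilityMeasure_unif {X : Type*} [MeasureSpace X] {B : Set X} (h0 : volume B ≠ 0)
    (ht : volume B ≠ ⊤) : IsProbabilityMeasure (unif B) :=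
  ⟨by rw [unif]; simp [ENNReal.inv_mul_cancel h0 ht]⟩

theorem unif_absolutelyContinuous {X : Type*} [MeasureSpace X] (B : Set X) :
    unif B ≪ volume.restrict B :=
  Measure.smul_absolutelyContinuous

theorem lintegral_rpow_le_of_isProbabilityMeasure {X : Type*} [MeasurableSpace X] {P : Measure X}
    [IsProbabilityMeasure P] {f : X → ℝ≥0∞} (hf : AEMeasurable f P) {p : ℝ} (hp : 1 ≤ p) :
    (∫⁻ x, f x ∂P) ^ p ≤ ∫⁻ x, f x ^ p ∂P := by
  have hp0 : 0 < p := by linarith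
  have h := ENNReal.lintegral_mul_norm_pow_le (μ := P) (hf.pow_const p)
    (aemeasurable_const (b := (1 : ℝ≥0∞))) (p := p⁻¹) (q := 1 - p⁻¹) (by positivity)
    (by have := inv_le_one_of_one_le₀ hp; linarith) (by ring)
  simp only [ENNReal.one_rpow, mul_one, ENNReal.rpow_rpow_inv hp0.ne', lintegral_const,
    measure_univ] at h
  calc (∫⁻ x, f x ∂P) ^ p ≤ ((∫⁻ x, f x ^ p ∂P) ^ p⁻¹) ^ p := by gcongr
    _ = _ := ENNReal.rpow_inv_rpow hp0.ne' _

variable {n : ℕ}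

theorem lintegral_comp_smul_add (F : Space n → ℝ≥0∞) (hF : Measurable F) {s : ℝ}
    (hs : 0 < s) (b : Space n) :
    ∫⁻ y, F (s • y + b) = ENNReal.ofReal (s⁻¹ ^ n) * ∫⁻ y, F y := by
  have h1 := Measure.map_addHaar_smul (volume : Measure (Space n)) hs.ne'
  have h2 : ∫⁻ y, F (s • y + b) = ∫⁻ z, F (z + b) ∂(Measure.map (fun x => s • x) volume) := by
    rw [lintegral_map (by fun_prop) (by fun_prop)]
  rw [h2, h1, lintegral_smul_measure, lintegral_add_right_eq_self]
  simp [abs_of_pos hs]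

/-- Averaging `F` over the homothetic copy `a + s (B - a)` of a convex set costs `s⁻ⁿ`. -/
theorem lintegral_unif_homothety_le {B : Set (Space n)} (hB : Convex ℝ B) (hBm : MeasurableSet B)
    {F : Space n → ℝ≥0∞} (hF : Measurable F) {s : ℝ} (hs : 0 < s) (hs1 : s ≤ 1) {a : Space n}
    (ha : a ∈ B) :
    ∫⁻ y, F ((1 - s) • a + s • y) ∂unif B ≤ ENNReal.ofReal (s⁻¹ ^ n) * ∫⁻ y, F y ∂unif B := by
  rw [lintegral_unif, lintegral_unif]
  have : ∫⁻ y in B, F ((1 - s) • a + s • y) ≤ ENNReal.ofReal (s⁻¹ ^ n) * ∫⁻ y in B, F y := by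
    calc ∫⁻ y in B, F ((1 - s) • a + s • y)
        ≤ ∫⁻ y in B, B.indicator F (s • y + (1 - s) • a) := by
          refine setLIntegral_mono ((hF.indicator hBm).comp (by fun_prop)) fun y hy => ?_
          rw [add_comm (s • y), indicator_of_mem
            (hB ha hy (by linarith) hs.le (by ring))]
      _ ≤ ∫⁻ y, B.indicator F (s • y + (1 - s) • a) := setLIntegral_le_lintegral _ _
      _ = _ := by
          rw [lintegral_comp_smul_add _ (hF.indicator hBm) hs, lintegral_indicator hBm]
  calc _ ≤ (volume B)⁻¹ * (ENNReal.ofReal (s⁻¹ ^ n) * ∫⁻ y in B, F y) := by gcongr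
    _ = _ := by ring

theorem measurable_convexCombination_prod {F : Space n → ℝ≥0∞} (hF : Measurable F) (s : ℝ) :
    Measurable fun p : Space n × Space n => F ((1 - s) • p.1 + s • p.2) :=
  hF.comp (by fun_prop)

instance sFinite_unif {X : Type*} [MeasureSpace X] [SFinite (volume : Measure X)] (B : Set X) :
    SFinite (unif B) := by
  unfold unif; infer_instance

/-- The averages of `F` over `a + s (B - a)` have, as functions of `a`, an `L^r` norm that grows
at most like `s ^ (-n (r - 1) / r)` as `s → 0`. -/
theorem lintegral_homothety_average_rpow_le {B : Set (Space n)} (hB : Convex ℝ B)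
    (hBm : MeasurableSet B) (h0 : volume B ≠ 0) (ht : volume B ≠ ⊤)
    {F : Space n → ℝ≥0∞} (hF : Measurable F) {s : ℝ} (hs : 0 < s) (hs1 : s < 1)
    {r : ℝ} (hr : 1 ≤ r) :
    ∫⁻ x, (∫⁻ y, F ((1 - s) • x + s • y) ∂unif B) ^ r ∂unif B ≤
      ENNReal.ofReal ((s⁻¹ ^ n) ^ (r - 1)) * 2 ^ n * (∫⁻ y, F y ∂unif B) ^ r := by
  have := isProbabilityMeasure_unif h0 ht
  set Z := ∫⁻ y, F y ∂unif B with hZ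
  set k : Space n → ℝ≥0∞ := fun x => ∫⁻ y, F ((1 - s) • x + s • y) ∂unif B with hk
  have hkm : Measurable k := (measurable_convexCombination_prod hF s).lintegral_prod_right'
  have hae : ∀ᵐ x ∂unif B, x ∈ B :=
    (unif_absolutelyContinuous B).ae_le (ae_restrict_mem hBm)
  have h1 : ∀ x ∈ B, k x ≤ ENNReal.ofReal (s⁻¹ ^ n) * Z := fun x hx =>
    lintegral_unif_homothety_le hB hBm hF hs hs1.le hx
  -- the mean of `k` stays bounded as `s → 0`: for small `s` the roles of `x` and `y` are exchanged, so
  -- that the ratio of the homothety is `1 - s ≥ 1/2`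
  have h2 : ∫⁻ x, k x ∂unif B ≤ 2 ^ n * Z := by
    have h2' : ∀ t : ℝ, 1 / 2 ≤ t → ENNReal.ofReal (t⁻¹ ^ n) ≤ 2 ^ n := by
      intro t ht
      have e : (2 : ℝ≥0∞) ^ n = ENNReal.ofReal (2 ^ n) := by
        rw [ENNReal.ofReal_pow (by norm_num)]; simp
      rw [e]
      refine ENNReal.ofReal_le_ofReal (pow_le_pow_left₀ (by positivity) ?_ n)
      rw [inv_le_comm₀ (by linarith) (by norm_num)]
      linarith
    rcases le_total (1 / 2) s with hs2 | hs2
    · calc ∫⁻ x, k x ∂unif B ≤ ∫⁻ x, 2 ^ n * Z ∂unif B := by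
            refine lintegral_mono_ae (hae.mono fun x hx => (h1 x hx).trans ?_)
            gcongr
            exact h2' s hs2
        _ = _ := by simp
    · have hswap : ∫⁻ x, k x ∂unif B =
          ∫⁻ y, ∫⁻ x, F ((1 - (1 - s)) • y + (1 - s) • x) ∂unif B ∂unif B := by
        simp only [hk]
        rw [lintegral_lintegral_swap (measurable_convexCombination_prod hF s).aemeasurable]
        refine lintegral_congr fun y => lintegral_congr fun x => ?_
        rw [sub_sub_cancel, add_comm]
      rw [hswap]
      calc _ ≤ ∫⁻ y, 2 ^ n * Z ∂unif B := by
            refine lintegral_mono_ae (hae.mono fun y hy => ?_)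
            refine (lintegral_unif_homothety_le hB hBm hF (by linarith) (by linarith) hy).trans ?_
            gcongr
            exact h2' _ (by linarith)
        _ = _ := by simp
  -- interpolation between the sup bound `h1` and the mean bound `h2`
  have hsplit : ∀ a : ℝ≥0∞, a ^ r = a ^ (r - 1) * a := by
    intro a
    nth_rewrite 3 [← ENNReal.rpow_one a]
    rw [← ENNReal.rpow_add_of_nonneg _ _ (by linarith) zero_le_one]
    congr 1; ring
  calc ∫⁻ x, k x ^ r ∂unif B
      ≤ ∫⁻ x, (ENNReal.ofReal (s⁻¹ ^ n) * Z) ^ (r - 1) * k x ∂unif B := by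
        refine lintegral_mono_ae (hae.mono fun x hx => ?_)
        rw [hsplit]
        gcongr
        exact h1 x hx
    _ = (ENNReal.ofReal (s⁻¹ ^ n) * Z) ^ (r - 1) * ∫⁻ x, k x ∂unif B :=
        lintegral_const_mul _ hkm
    _ ≤ (ENNReal.ofReal (s⁻¹ ^ n) * Z) ^ (r - 1) * (2 ^ n * Z) := by gcongr
    _ = _ := by
        rw [ENNReal.mul_rpow_of_nonneg _ _ (by linarith),
          ENNReal.ofReal_rpow_of_nonneg (by positivity) (by linarith), hsplit Z]
        ring

/-- The total mass of the weight `s ^ (-1/2)` that is used to integrate over the segments. -/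
theorem lintegral_Ioc_rpow_neg_half :
    ∫⁻ t in Ioc (0:ℝ) 1, ENNReal.ofReal (t ^ (-(1/2) : ℝ)) = 2 := by
  have h := lintegral_Ioc_rpow_sub_one (τ := 1 / 2) (by norm_num) (zero_le_one)
  have e : (1 / 2 - 1 : ℝ) = -(1/2) := by norm_num
  rw [e, Real.one_rpow, ENNReal.ofReal_one] at h
  have h2 : ENNReal.ofReal (1 / 2) = 2⁻¹ := by
    rw [one_div, ENNReal.ofReal_inv_of_pos two_pos]; simp
  rw [h2, mul_comm] at h
  have := ENNReal.eq_inv_of_mul_eq_one_left h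
  simpa using this

/-- Hölder's inequality with the integrable weight `s ^ (-1/2)`, whose exponent leaves room both for
its own integrability and for a growth like `s ^ (-m/2)` of the integrand's `m`-th power. -/
theorem rpow_lintegral_Ioc_le {h : ℝ → ℝ≥0∞} (hh : Measurable h) {m : ℝ} (hm : 1 ≤ m) :
    (∫⁻ s in Ioc (0:ℝ) 1, h s) ^ m ≤
      2 ^ (m - 1) * ∫⁻ s in Ioc (0:ℝ) 1, ENNReal.ofReal (s ^ ((m - 1) / 2)) * h s ^ m := by
  have hm0 : 0 < m := by linarith
  have hm' : 0 ≤ 1 - m⁻¹ := by have := inv_le_one_of_one_le₀ hm; linarith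
  have key := ENNReal.lintegral_mul_norm_pow_le (μ := volume.restrict (Ioc (0:ℝ) 1))
    (f := fun s => ENNReal.ofReal (s ^ ((m - 1) / 2)) * h s ^ m)
    (g := fun s => ENNReal.ofReal (s ^ (-(1/2) : ℝ)))
    (by fun_prop) (by fun_prop) (p := m⁻¹) (q := 1 - m⁻¹) (by positivity) hm' (by ring)
  rw [lintegral_Ioc_rpow_neg_half] at key
  have e : ∫⁻ s in Ioc (0:ℝ) 1, h s = ∫⁻ s in Ioc (0:ℝ) 1,
      (ENNReal.ofReal (s ^ ((m - 1) / 2)) * h s ^ m) ^ m⁻¹ *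
        ENNReal.ofReal (s ^ (-(1/2) : ℝ)) ^ (1 - m⁻¹) := by
    refine setLIntegral_congr_fun measurableSet_Ioc fun s hs => ?_
    have hs0 : 0 < s := hs.1
    rw [ENNReal.mul_rpow_of_nonneg _ _ (by positivity), ENNReal.rpow_rpow_inv hm0.ne',
      ENNReal.ofReal_rpow_of_pos (by positivity), ENNReal.ofReal_rpow_of_pos (by positivity),
      mul_right_comm, ← ENNReal.ofReal_mul (by positivity), ← Real.rpow_mul hs0.le,
      ← Real.rpow_mul hs0.le, ← Real.rpow_add hs0]
    have : (m - 1) / 2 * m⁻¹ + -(1 / 2) * (1 - m⁻¹) = 0 := by field_simp; ring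
    rw [this]; simp
  rw [e]
  calc _ ≤ (_ ^ m⁻¹ * _ ^ (1 - m⁻¹)) ^ m := ENNReal.rpow_le_rpow key hm0.le
    _ = _ := by
        rw [ENNReal.mul_rpow_of_nonneg _ _ hm0.le, ENNReal.rpow_inv_rpow hm0.ne',
          ← ENNReal.rpow_mul, mul_comm]
        congr 2
        field_simp

/-- The integral over `s` of a family with `‖H(·, s)‖_m^m ≤ s ^ (-m/2) W` has an `m`-th moment of at
most `2 ^ m W`. -/
theorem lintegral_rpow_lintegral_Ioc_le {X : Type*} [MeasurableSpace X] {P : Measure X}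
    [SFinite P] {H : X → ℝ → ℝ≥0∞} (hH : Measurable fun p : X × ℝ => H p.1 p.2) {m : ℝ}
    (hm : 1 ≤ m) {W : ℝ≥0∞}
    (hW : ∀ s ∈ Ioo (0:ℝ) 1, ∫⁻ x, H x s ^ m ∂P ≤ ENNReal.ofReal (s ^ (-(m / 2))) * W) :
    ∫⁻ x, (∫⁻ s in Ioc (0:ℝ) 1, H x s) ^ m ∂P ≤ 2 ^ m * W := by
  have hHx : ∀ x, Measurable (H x) := fun x => hH.comp (measurable_const.prodMk measurable_id)
  have hHs : ∀ s : ℝ, Measurable fun x => H x s ^ m := fun s =>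
    (hH.comp (measurable_id.prodMk measurable_const)).pow_const m
  have hmm : Measurable fun p : X × ℝ =>
      ENNReal.ofReal (p.2 ^ ((m - 1) / 2)) * H p.1 p.2 ^ m := by fun_prop
  calc ∫⁻ x, (∫⁻ s in Ioc (0:ℝ) 1, H x s) ^ m ∂P
      ≤ ∫⁻ x, 2 ^ (m - 1) *
          (∫⁻ s in Ioc (0:ℝ) 1, ENNReal.ofReal (s ^ ((m - 1) / 2)) * H x s ^ m) ∂P :=
        lintegral_mono fun x => rpow_lintegral_Ioc_le (hHx x) hm
    _ = 2 ^ (m - 1) * ∫⁻ x, (∫⁻ s in Ioc (0:ℝ) 1,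
          ENNReal.ofReal (s ^ ((m - 1) / 2)) * H x s ^ m) ∂P :=
        lintegral_const_mul _ hmm.lintegral_prod_right'
    _ = 2 ^ (m - 1) * ∫⁻ s in Ioc (0:ℝ) 1,
          ∫⁻ x, ENNReal.ofReal (s ^ ((m - 1) / 2)) * H x s ^ m ∂P := by
        rw [lintegral_lintegral_swap hmm.aemeasurable]
    _ = 2 ^ (m - 1) * ∫⁻ s in Ioc (0:ℝ) 1, ENNReal.ofReal (s ^ ((m - 1) / 2)) *
          ∫⁻ x, H x s ^ m ∂P := by
        congr 1
        exact lintegral_congr fun s => lintegral_const_mul _ (hHs s)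
    _ ≤ 2 ^ (m - 1) * ∫⁻ s in Ioc (0:ℝ) 1, ENNReal.ofReal (s ^ (-(1/2) : ℝ)) * W := by
        refine mul_le_mul_right ?_ _
        rw [Measure.restrict_congr_set (Ioo_ae_eq_Ioc (a := (0:ℝ)) (b := 1)).symm]
        refine setLIntegral_mono' measurableSet_Ioo fun s hs => ?_
        refine (mul_le_mul_right (hW s hs) _).trans (le_of_eq ?_)
        have hs0 : 0 < s := hs.1
        rw [← mul_assoc, ← ENNReal.ofReal_mul (by positivity), ← Real.rpow_add hs0]
        congr 3
        ring
    _ = _ := by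
        rw [lintegral_mul_const _ (by fun_prop), lintegral_Ioc_rpow_neg_half, ← mul_assoc]
        congr 1
        nth_rewrite 2 [← ENNReal.rpow_one 2]
        rw [← ENNReal.rpow_add _ _ (by norm_num) (by norm_num)]
        congr 1; ring

theorem enorm_sub_le_lintegral_fderiv {f : Space n → ℝ} (hf : ContDiff ℝ 1 f) (x y : Space n) :
    ‖f x - f y‖ₑ ≤ ‖x - y‖ₑ *
      ∫⁻ s in Ioc (0:ℝ) 1, ‖fderiv ℝ f ((1 - s) • x + s • y)‖ₑ := by
  have hd : ∀ s ∈ uIcc (0:ℝ) 1, HasDerivAt (fun s : ℝ => f ((1 - s) • x + s • y))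
      (fderiv ℝ f ((1 - s) • x + s • y) (y - x)) s := by
    intro s _
    have h1 : HasDerivAt (fun s : ℝ => (1 - s) • x + s • y) (y - x) s := by
      have h2 : HasDerivAt (fun s : ℝ => (1 - s) • x) ((-1 : ℝ) • x) s :=
        ((hasDerivAt_id s).const_sub 1).smul_const x
      have h3 : HasDerivAt (fun s : ℝ => s • y) ((1 : ℝ) • y) s :=
        (hasDerivAt_id s).smul_const y
      refine (h2.fun_add h3).congr_deriv ?_
      rw [neg_one_smul, one_smul]
      abel
    exact ((hf.differentiable one_ne_zero).differentiableAt.hasFDerivAt).comp_hasDerivAt s h1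
  have hcont : Continuous fun s : ℝ => fderiv ℝ f ((1 - s) • x + s • y) (y - x) :=
    ((hf.continuous_fderiv one_ne_zero).comp (by fun_prop)).clm_apply continuous_const
  have := intervalIntegral.integral_eq_sub_of_hasDerivAt hd (hcont.intervalIntegrable _ _)
  simp only [sub_zero, one_smul, zero_smul, add_zero, sub_self, zero_add] at this
  rw [← enorm_neg, neg_sub, ← this, intervalIntegral.integral_of_le zero_le_one]
  refine (enorm_integral_le_lintegral_enorm _).trans ?_
  rw [← lintegral_const_mul' _ _ (by simp)]
  refine lintegral_mono fun s => ?_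
  rw [mul_comm, ← enorm_neg (x - y), neg_sub]
  exact ContinuousLinearMap.le_opENorm _ _

/-- **Sobolev–Poincaré inequality** on a convex set, with the mean oscillation on the left.
Writing `f x - f y` as an integral of the gradient along the segment from `x` to `y`, one has to
bound the averages of `|∇f|` over the sets `x + s (B - x)`; the relation between the exponents
makes the resulting power of `s` integrable. -/
theorem sobolev_poincare_of_contDiff {B : Set (Space n)} (hB : Convex ℝ B)
    (hBm : MeasurableSet B) (h0 : volume B ≠ 0) (ht : volume B ≠ ⊤) {d : ℝ≥0∞}
    (hd : ∀ x ∈ B, ∀ y ∈ B, ‖x - y‖ₑ ≤ d) {q m : ℝ} (hq : 1 ≤ q) (hqm : q ≤ m)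
    (hnm : n * (m / q - 1) = m / 2) {f : Space n → ℝ} (hf : ContDiff ℝ 1 f) :
    ∫⁻ x, (∫⁻ y, ‖f x - f y‖ₑ ∂unif B) ^ m ∂unif B ≤
      d ^ m * 2 ^ (m + n) * (∫⁻ x, ‖fderiv ℝ f x‖ₑ ^ q ∂unif B) ^ (m / q) := by
  have := isProbabilityMeasure_unif h0 ht
  have hq0 : 0 < q := by linarith
  have hm : 1 ≤ m := hq.trans hqm
  have hm0 : 0 < m := by linarith
  set g : Space n → ℝ≥0∞ := fun z => ‖fderiv ℝ f z‖ₑ with hg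
  have hgm : Measurable g := (hf.continuous_fderiv one_ne_zero).measurable.enorm
  set Z := ∫⁻ x, g x ^ q ∂unif B with hZ
  set H : Space n → ℝ → ℝ≥0∞ := fun x s => ∫⁻ y, g ((1 - s) • x + s • y) ∂unif B with hH
  have hH3 : Measurable fun p : (Space n × ℝ) × Space n =>
      g ((1 - p.1.2) • p.1.1 + p.1.2 • p.2) := hgm.comp (by fun_prop)
  have hHm : Measurable fun p : Space n × ℝ => H p.1 p.2 := hH3.lintegral_prod_right'
  have hae : ∀ᵐ x ∂unif B, x ∈ B :=
    (unif_absolutelyContinuous B).ae_le (ae_restrict_mem hBm)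
  have step1 : ∀ x ∈ B, ∫⁻ y, ‖f x - f y‖ₑ ∂unif B ≤ d * ∫⁻ s in Ioc (0:ℝ) 1, H x s := by
    intro x hx
    have hm2 : Measurable fun p : Space n × ℝ => g ((1 - p.2) • x + p.2 • p.1) :=
      hgm.comp (by fun_prop)
    calc ∫⁻ y, ‖f x - f y‖ₑ ∂unif B
        ≤ ∫⁻ y, d * (∫⁻ s in Ioc (0:ℝ) 1, g ((1 - s) • x + s • y)) ∂unif B := by
          refine lintegral_mono_ae (hae.mono fun y hy => ?_)
          exact (enorm_sub_le_lintegral_fderiv hf x y).trans (by gcongr; exact hd x hx y hy)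
      _ = d * ∫⁻ y, (∫⁻ s in Ioc (0:ℝ) 1, g ((1 - s) • x + s • y)) ∂unif B :=
          lintegral_const_mul _ hm2.lintegral_prod_right'
      _ = _ := by rw [lintegral_lintegral_swap hm2.aemeasurable]
  have step2 : ∀ s ∈ Ioo (0:ℝ) 1, ∫⁻ x, H x s ^ m ∂unif B ≤
      ENNReal.ofReal (s ^ (-(m / 2))) * 2 ^ n * Z ^ (m / q) := by
    intro s hs
    have hr : 1 ≤ m / q := (one_le_div hq0).2 hqm
    have h1 := lintegral_homothety_average_rpow_le hB hBm h0 ht (hgm.pow_const q) hs.1 hs.2 hr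
    calc ∫⁻ x, H x s ^ m ∂unif B
        ≤ ∫⁻ x, (∫⁻ y, g ((1 - s) • x + s • y) ^ q ∂unif B) ^ (m / q) ∂unif B := by
          refine lintegral_mono fun x => ?_
          have e : H x s ^ m = (H x s ^ q) ^ (m / q) := by
            rw [← ENNReal.rpow_mul]; congr 1; field_simp
          simp only [e]
          refine ENNReal.rpow_le_rpow ?_ (by positivity)
          exact lintegral_rpow_le_of_isProbabilityMeasure
            (hgm.comp (by fun_prop)).aemeasurable hq
      _ ≤ _ := h1
      _ = _ := by
          congr 3
          rw [← Real.rpow_natCast, ← Real.rpow_mul (by have := hs.1; positivity), hnm,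
            Real.inv_rpow hs.1.le, Real.rpow_neg hs.1.le]
  calc ∫⁻ x, (∫⁻ y, ‖f x - f y‖ₑ ∂unif B) ^ m ∂unif B
      ≤ ∫⁻ x, d ^ m * (∫⁻ s in Ioc (0:ℝ) 1, H x s) ^ m ∂unif B := by
        refine lintegral_mono_ae (hae.mono fun x hx => ?_)
        rw [← ENNReal.mul_rpow_of_nonneg _ _ hm0.le]
        exact ENNReal.rpow_le_rpow (step1 x hx) hm0.le
    _ = d ^ m * ∫⁻ x, (∫⁻ s in Ioc (0:ℝ) 1, H x s) ^ m ∂unif B :=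
        lintegral_const_mul _ (hHm.lintegral_prod_right'.pow_const m)
    _ ≤ d ^ m * (2 ^ m * (2 ^ n * Z ^ (m / q))) := by
        refine mul_le_mul_right (lintegral_rpow_lintegral_Ioc_le hHm hm fun s hs => ?_) _
        rw [← mul_assoc]
        exact step2 s hs
    _ = _ := by
        rw [ENNReal.rpow_add _ _ (by norm_num) (by norm_num), ENNReal.rpow_natCast]
        ring

end SobolevPoincare
end ParabolicBMO

namespace ParabolicBMO
open Filter Topology

/-! ### Mollification -/

section Mollification

variable {n : ℕ} {F : Type*} [NormedAddCommGroup F] [NormedSpace ℝ F]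

/-- The convolution `η * f`. -/
noncomputable def mollify (η : Space n → ℝ) (f : Space n → F) (x : Space n) : F :=
  ∫ y, η (x - y) • f y

theorem tendsto_eLpNorm_translate_sub {F : Type*} [NormedAddCommGroup F] {f : Space n → F}
    (hf : MemLp f 2 volume) :
    Tendsto (fun t : Space n => eLpNorm (fun x => f (x - t) - f x) 2 volume) (𝓝 0) (𝓝 0) := by
  have hmp : ∀ t : Space n, MeasurePreserving (fun x : Space n => x - t) volume volume :=
    fun t => measurePreserving_sub_right volume t
  let g : Space n → C(Space n, Space n) := fun t => ⟨fun x => x - t, by fun_prop⟩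
  have hg : Continuous g := by
    refine ContinuousMap.continuous_of_continuous_uncurry _ ?_
    change Continuous fun p : Space n × Space n => p.2 - p.1
    fun_prop
  have h := Filter.Tendsto.compMeasurePreservingLp (μ := (volume : Measure (Space n)))
    (ν := (volume : Measure (Space n))) (p := 2) (l := 𝓝 (0 : Space n))
    (f := fun _ => hf.toLp f) (f₀ := hf.toLp f) tendsto_const_nhds
    (g := g) (g₀ := g 0) (hg.tendsto 0) (fun t => hmp t) (hmp 0) (by simp)
  rw [tendsto_iff_edist_tendsto_0] at h
  refine h.congr fun t => ?_
  rw [Lp.toLp_compMeasurePreserving, Lp.toLp_compMeasurePreserving, Lp.edist_toLp_toLp]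
  congr 1
  ext x
  simp [g]

theorem mollify_sub_eq [CompleteSpace F] {η : Space n → ℝ} (hη : Continuous η)
    (hηc : HasCompactSupport η) (hη1 : ∫ y, η y = 1) {f : Space n → F}
    (hf : LocallyIntegrable f volume) (x : Space n) :
    mollify η f x - f x = ∫ t, η t • (f (x - t) - f x) := by
  have h1 : mollify η f x = ∫ t, η t • f (x - t) := by
    rw [mollify, ← integral_sub_left_eq_self (fun y => η (x - y) • f y) volume x]
    simp
  have hi : Integrable (fun t => η t • f (x - t)) volume := by
    have h2 : LocallyIntegrable (fun t => f (x - t)) volume := by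
      have := (Measure.measurePreserving_sub_left (volume : Measure (Space n)) x)
      intro t
      obtain ⟨U, hU, hUi⟩ := hf (x - t)
      refine ⟨(fun s => x - s) ⁻¹' U, (by fun_prop :
        Continuous fun s : Space n => x - s).continuousAt.preimage_mem_nhds hU, ?_⟩
      exact (this.integrableOn_comp_preimage
        (Homeomorph.subLeft x).measurableEmbedding).2 hUi
    exact h2.integrable_smul_left_of_hasCompactSupport hη hηc
  have hi2 : Integrable (fun t => η t • f x) volume :=
    (hη.integrable_of_hasCompactSupport hηc).smul_const _
  simp only [smul_sub]
  rw [integral_sub hi hi2, integral_smul_const, hη1, one_smul, h1]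

/-- Mollification changes `f` in `L²` by no more than the translations by vectors in the support of
the kernel do, by Jensen's inequality. -/
theorem eLpNorm_mollify_sub_le [CompleteSpace F] {η : Space n → ℝ} (hη : Continuous η)
    (hηc : HasCompactSupport η) (hη0 : ∀ y, 0 ≤ η y) (hη1 : ∫ y, η y = 1) {f : Space n → F}
    (hf : MemLp f 2 volume) {δ : ℝ} (hδ : Function.support η ⊆ ball 0 δ) {ε : ℝ≥0∞}
    (hε : ∀ t ∈ ball (0 : Space n) δ, eLpNorm (fun x => f (x - t) - f x) 2 volume ≤ ε) :
    eLpNorm (fun x => mollify η f x - f x) 2 volume ≤ ε := by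
  have hloc : LocallyIntegrable f volume := hf.locallyIntegrable (by norm_num)
  have hηm : Measurable fun t => ENNReal.ofReal (η t) := hη.measurable.ennreal_ofReal
  set P : Measure (Space n) := volume.withDensity fun t => ENNReal.ofReal (η t) with hP
  have hηint : ∫⁻ t, ENNReal.ofReal (η t) = 1 := by
    rw [← ofReal_integral_eq_lintegral_ofReal (hη.integrable_of_hasCompactSupport hηc)
      (Eventually.of_forall hη0), hη1, ENNReal.ofReal_one]
  have : IsProbabilityMeasure P := ⟨by
    rw [hP, withDensity_apply _ MeasurableSet.univ, Measure.restrict_univ, hηint]⟩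
  have hsub : ∀ t : Space n, eLpNorm (fun x => f (x - t) - f x) 2 volume ^ (2:ℝ) =
      ∫⁻ x, ‖f (x - t) - f x‖ₑ ^ (2:ℝ) := by
    intro t
    rw [eLpNorm_eq_lintegral_rpow_enorm_toReal (by norm_num) (by norm_num), ENNReal.toReal_ofNat,
      ← ENNReal.rpow_mul]
    norm_num
  have hprod : AEStronglyMeasurable (fun p : Space n × Space n => f (p.1 - p.2) - f p.1)
      (volume.prod volume) := by
    refine AEStronglyMeasurable.sub ?_ hf.aestronglyMeasurable.comp_fst
    exact hf.aestronglyMeasurable.comp_quasiMeasurePreserving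
      (quasiMeasurePreserving_sub_of_right_invariant volume volume)
  have hPac : P ≪ volume := withDensity_absolutelyContinuous _ _
  have hprod' : AEMeasurable (fun p : Space n × Space n => ‖f (p.1 - p.2) - f p.1‖ₑ ^ (2:ℝ))
      (volume.prod P) :=
    (hprod.mono_ac (Measure.AbsolutelyContinuous.rfl.prod hPac)).enorm.pow_const _
  have key : ∫⁻ x, ‖mollify η f x - f x‖ₑ ^ (2:ℝ) ≤ ε ^ (2:ℝ) := by
    calc ∫⁻ x, ‖mollify η f x - f x‖ₑ ^ (2:ℝ)
        ≤ ∫⁻ x, ∫⁻ t, ‖f (x - t) - f x‖ₑ ^ (2:ℝ) ∂P := by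
          have hm : ∀ᵐ x : Space n, AEStronglyMeasurable (fun t => f (x - t) - f x) volume :=
            hprod.prodMk_left
          refine lintegral_mono_ae (hm.mono fun x hx => ?_)
          rw [mollify_sub_eq hη hηc hη1 hloc]
          refine le_trans ?_ (lintegral_rpow_le_of_isProbabilityMeasure
            (hx.mono_ac hPac).enorm (by norm_num))
          refine ENNReal.rpow_le_rpow ?_ (by norm_num)
          refine (enorm_integral_le_lintegral_enorm _).trans (le_of_eq ?_)
          rw [hP, lintegral_withDensity_eq_lintegral_mul₀ hηm.aemeasurable hx.enorm]
          refine lintegral_congr fun t => ?_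
          rw [enorm_smul, Pi.mul_apply, Real.enorm_eq_ofReal (hη0 t)]
      _ = ∫⁻ t, (∫⁻ x, ‖f (x - t) - f x‖ₑ ^ (2:ℝ)) ∂P := lintegral_lintegral_swap hprod'
      _ ≤ ∫⁻ t, ε ^ (2:ℝ) ∂P := by
          refine lintegral_mono_ae ?_
          rw [hP, ae_withDensity_iff hηm]
          refine Eventually.of_forall fun t ht => ?_
          rw [← hsub]
          refine ENNReal.rpow_le_rpow (hε t (hδ ?_)) (by norm_num)
          intro h0
          simp [h0] at ht
      _ = _ := by simp
  rw [eLpNorm_eq_lintegral_rpow_enorm_toReal (by norm_num) (by norm_num), ENNReal.toReal_ofNat]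
  calc _ ≤ (ε ^ (2:ℝ)) ^ (1 / (2:ℝ)) := ENNReal.rpow_le_rpow key (by norm_num)
    _ = ε := by rw [← ENNReal.rpow_mul]; norm_num

/-- A sequence of standard mollifiers, the `k`-th one supported in the ball of radius
`1 / (k + 1)`. -/
noncomputable def mollifier (n k : ℕ) : Space n → ℝ :=
  ContDiffBump.normed (⟨1 / (2 * ((k : ℝ) + 1)), 1 / ((k : ℝ) + 1), by positivity, by
    rw [div_lt_div_iff₀ (by positivity) (by positivity)]; nlinarith [k.cast_nonneg (α := ℝ)]⟩ :
    ContDiffBump (0 : Space n)) volume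

theorem mollifier_contDiff (k : ℕ) : ContDiff ℝ ∞ (mollifier n k) := ContDiffBump.contDiff_normed _

theorem mollifier_hasCompactSupport (k : ℕ) : HasCompactSupport (mollifier n k) :=
  ContDiffBump.hasCompactSupport_normed _

theorem mollifier_nonneg (k : ℕ) (x : Space n) : 0 ≤ mollifier n k x :=
  ContDiffBump.nonneg_normed _ _

theorem integral_mollifier (k : ℕ) : ∫ x, mollifier n k x = 1 := ContDiffBump.integral_normed _

theorem support_mollifier (k : ℕ) :
    Function.support (mollifier n k) = ball 0 (1 / ((k : ℝ) + 1)) :=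
  ContDiffBump.support_normed_eq _

theorem tendsto_eLpNorm_mollify_sub [CompleteSpace F] {f : Space n → F}
    (hf : MemLp f 2 volume) :
    Tendsto (fun k => eLpNorm (fun x => mollify (mollifier n k) f x - f x) 2 volume)
      atTop (𝓝 0) := by
  refine ENNReal.tendsto_nhds_zero.2 fun ε hε => ?_
  have h := ENNReal.tendsto_nhds_zero.1 (tendsto_eLpNorm_translate_sub hf) ε hε
  obtain ⟨δ, hδ, hball⟩ := Metric.eventually_nhds_iff_ball.1 h
  obtain ⟨N, hN⟩ := exists_nat_one_div_lt hδ
  filter_upwards [eventually_ge_atTop N] with k hk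
  refine eLpNorm_mollify_sub_le (mollifier_contDiff k).continuous (mollifier_hasCompactSupport k)
    (mollifier_nonneg k) (integral_mollifier k) hf (δ := δ) ?_ hball
  rw [support_mollifier]
  refine ball_subset_ball (le_trans ?_ hN.le)
  gcongr

theorem mollify_contDiff {η : Space n → ℝ} (hη : ContDiff ℝ ∞ η) (hηc : HasCompactSupport η)
    {f : Space n → ℝ} (hf : LocallyIntegrable f volume) : ContDiff ℝ ∞ (mollify η f) := by
  have := hηc.contDiff_convolution_right (ContinuousLinearMap.mul ℝ ℝ) hf (n := ⊤) hη
  convert this using 1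
  ext x
  simp [mollify, convolution, mul_comm]

theorem fderiv_mollify {η : Space n → ℝ} (hη : ContDiff ℝ ∞ η) (hηc : HasCompactSupport η)
    {f : Space n → ℝ} (hf : LocallyIntegrable f volume) (x e : Space n) :
    fderiv ℝ (mollify η f) x e = ∫ y, fderiv ℝ η (x - y) e * f y := by
  have h1 := hηc.hasFDerivAt_convolution_right (ContinuousLinearMap.mul ℝ ℝ) hf
    (hη.of_le (by norm_cast)) x
  have e1 : mollify η f = convolution f η (ContinuousLinearMap.mul ℝ ℝ) volume := by
    ext x; simp [mollify, convolution, mul_comm]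
  rw [e1, h1.fderiv, convolution_precompR_apply _ hf (hηc.fderiv ℝ)
    (hη.continuous_fderiv (by norm_cast))]
  simp [convolution, mul_comm]

theorem gradient_apply {f : Space n → ℝ} (x : Space n) (i : Fin n) :
    gradient f x i = fderiv ℝ f x (EuclideanSpace.single i 1) := by
  have h := EuclideanSpace.inner_single_right i (1:ℝ) (gradient f x)
  rw [gradient, InnerProductSpace.toDual_symm_apply] at h
  rw [gradient]
  simpa using h.symm

theorem enorm_gradient (f : Space n → ℝ) (x : Space n) : ‖gradient f x‖ₑ = ‖fderiv ℝ f x‖ₑ := by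
  rw [← ofReal_norm, ← ofReal_norm, gradient, LinearIsometryEquiv.norm_map]

end Mollification
end ParabolicBMO

namespace ParabolicBMO
open Filter Topology

/-! ### Time slices of functions with a weak spatial gradient -/

section Slices

variable {n : ℕ}

theorem parabolicBall_zero (R : ℝ) :
    parabolicBall (0 : Space n × ℝ) R = ball 0 R ×ˢ Ioo (-R ^ 2) 0 := by
  simp [parabolicBall]

theorem restrict_prod_eq (B : Set (Space n)) (J : Set ℝ) :
    (volume : Measure (Space n × ℝ)).restrict (B ×ˢ J) =
      (volume.restrict B).prod (volume.restrict J) := by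
  rw [Measure.prod_restrict, Measure.volume_eq_prod]

theorem setIntegral_prod_slices {B : Set (Space n)} {J : Set ℝ} {h : Space n × ℝ → ℝ}
    (hh : IntegrableOn h (B ×ˢ J)) : ∫ z in B ×ˢ J, h z = ∫ t in J, ∫ x in B, h (x, t) := by
  rw [IntegrableOn, restrict_prod_eq] at hh
  rw [restrict_prod_eq, integral_prod_symm _ hh]

theorem ae_integrableOn_slice {B : Set (Space n)} {J : Set ℝ} {h : Space n × ℝ → ℝ}
    (hh : IntegrableOn h (B ×ˢ J)) :
    ∀ᵐ t ∂volume.restrict J, IntegrableOn (fun x => h (x, t)) B := by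
  rw [IntegrableOn, restrict_prod_eq] at hh
  exact hh.prod_left_ae

theorem integrableOn_integral_slice {B : Set (Space n)} {J : Set ℝ} {h : Space n × ℝ → ℝ}
    (hh : IntegrableOn h (B ×ˢ J)) : IntegrableOn (fun t => ∫ x in B, h (x, t)) J := by
  rw [IntegrableOn, restrict_prod_eq] at hh
  exact hh.integral_prod_right

theorem ae_memLp_slice {F : Type*} [NormedAddCommGroup F] {B : Set (Space n)} {J : Set ℝ}
    {h : Space n × ℝ → F} (hh : MemLp h 2 (volume.restrict (B ×ˢ J))) :
    ∀ᵐ t ∂volume.restrict J, MemLp (fun x => h (x, t)) 2 (volume.restrict B) := by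
  rw [restrict_prod_eq] at hh
  have h1 : AEStronglyMeasurable h ((volume.restrict B).prod (volume.restrict J)) :=
    hh.aestronglyMeasurable
  have h2 : Integrable (fun z => ‖h z‖ ^ 2) ((volume.restrict B).prod (volume.restrict J)) :=
    (memLp_two_iff_integrable_sq_norm h1).1 hh
  filter_upwards [h1.prodMk_right, h2.prod_left_ae] with t ht1 ht2
  exact (memLp_two_iff_integrable_sq_norm ht1).2 ht2

/-- A function on `B × J` whose integral against all test functions of time vanishes has
vanishing spatial integrals at almost every time. -/
theorem ae_integral_slice_eq_zero {B : Set (Space n)} {J : Set ℝ} (hJ : IsOpen J)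
    {h : Space n × ℝ → ℝ} (hh : IntegrableOn h (B ×ˢ J))
    (hθ : ∀ θ : ℝ → ℝ, ContDiff ℝ ∞ θ → HasCompactSupport θ → tsupport θ ⊆ J →
      ∫ z in B ×ˢ J, θ z.2 * h z = 0) :
    ∀ᵐ t ∂volume.restrict J, ∫ x in B, h (x, t) = 0 := by
  rw [ae_restrict_iff' hJ.measurableSet]
  refine hJ.ae_eq_zero_of_integral_contDiff_smul_eq_zero
    (integrableOn_integral_slice hh).locallyIntegrableOn ?_
  intro θ hθ1 hθ2 hθ3
  have hb : ∃ C, ∀ x, ‖θ x‖ ≤ C := hθ2.exists_bound_of_continuous hθ1.continuous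
  obtain ⟨C, hC⟩ := hb
  have hint : IntegrableOn (fun z : Space n × ℝ => θ z.2 * h z) (B ×ˢ J) :=
    hh.bdd_mul (c := C) (hθ1.continuous.comp continuous_snd).aestronglyMeasurable
      (Eventually.of_forall fun z => hC z.2)
  have h0 := hθ θ hθ1 hθ2 hθ3
  rw [setIntegral_prod_slices hint] at h0
  rw [← h0, ← setIntegral_eq_integral_of_forall_compl_eq_zero (s := J)]
  · refine integral_congr_ae (Eventually.of_forall fun t => ?_)
    simp only [smul_eq_mul]
    rw [← integral_const_mul]
  · intro t ht
    rw [image_eq_zero_of_notMem_tsupport (fun h => ht (hθ3 h)), zero_smul]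

theorem isTestFunction_mul {U : Set (Space n)} {J : Set ℝ} {ψ : Space n → ℝ} {θ : ℝ → ℝ}
    (hψ : ContDiff ℝ ∞ ψ) (hψc : HasCompactSupport ψ) (hψU : tsupport ψ ⊆ U)
    (hθ : ContDiff ℝ ∞ θ) (hθc : HasCompactSupport θ) (hθJ : tsupport θ ⊆ J) :
    IsTestFunction (U ×ˢ J) (fun z : Space n × ℝ => ψ z.1 * θ z.2) := by
  have hsub : tsupport (fun z : Space n × ℝ => ψ z.1 * θ z.2) ⊆ tsupport ψ ×ˢ tsupport θ := by
    refine closure_minimal (fun z hz => ?_) ((isClosed_tsupport _).prod (isClosed_tsupport _))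
    exact ⟨subset_tsupport _ (left_ne_zero_of_mul hz), subset_tsupport _ (right_ne_zero_of_mul hz)⟩
  refine ⟨(hψ.comp contDiff_fst).mul (hθ.comp contDiff_snd), ?_,
    hsub.trans (prod_mono hψU hθJ)⟩
  exact (hψc.isCompact.prod hθc.isCompact).of_isClosed_subset (isClosed_tsupport _) hsub

theorem spatialGrad_mul (ψ : Space n → ℝ) (θ : ℝ → ℝ) (hψ : Differentiable ℝ ψ)
    (z : Space n × ℝ) :
    spatialGrad (fun z : Space n × ℝ => ψ z.1 * θ z.2) z = θ z.2 • gradient ψ z.1 := by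
  simp only [spatialGrad, gradient]
  rw [fderiv_mul_const hψ.differentiableAt, map_smulₛₗ]
  simp

theorem timeDeriv_mul (ψ : Space n → ℝ) (θ : ℝ → ℝ)
    (z : Space n × ℝ) :
    timeDeriv (fun z : Space n × ℝ => ψ z.1 * θ z.2) z = ψ z.1 * deriv θ z.2 := by
  simp only [timeDeriv]
  rw [deriv_const_mul_field]

/-- The weak gradient of `u` on space-time is the weak gradient of almost every slice, as far as one
fixed test function in space is concerned. -/
theorem ae_slice_weak_gradient {U : Set (Space n)} {J : Set ℝ} (hJ : IsOpen J)
    (hUt : volume U ≠ ⊤) (hJt : volume J ≠ ⊤)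
    {u : Space n × ℝ → ℝ} {Du : Space n × ℝ → Space n}
    (hW : HasWeakSpatialGradientL2 (U ×ˢ J) u Du) {ψ : Space n → ℝ} (hψ : ContDiff ℝ ∞ ψ)
    (hψc : HasCompactSupport ψ) (hψU : tsupport ψ ⊆ U) (i : Fin n) :
    ∀ᵐ t ∂volume.restrict J, ∫ x in U, u (x, t) * fderiv ℝ ψ x (EuclideanSpace.single i 1) =
      -∫ x in U, Du (x, t) i * ψ x := by
  have hfin : IsFiniteMeasure ((volume : Measure (Space n × ℝ)).restrict (U ×ˢ J)) :=
    ⟨by rw [Measure.restrict_apply_univ, Measure.volume_eq_prod, Measure.prod_prod]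
        exact ENNReal.mul_lt_top hUt.lt_top hJt.lt_top⟩
  have hu : Integrable u (volume.restrict (U ×ˢ J)) := hW.memLp.integrable (by norm_num)
  have hDu : Integrable Du (volume.restrict (U ×ˢ J)) := hW.memLp_grad.integrable (by norm_num)
  have hDui : Integrable (fun z => Du z i) (volume.restrict (U ×ˢ J)) :=
    (EuclideanSpace.proj (𝕜 := ℝ) i).integrable_comp hDu
  set e : Space n := EuclideanSpace.single i 1 with he
  have hψ1 : Continuous fun x => fderiv ℝ ψ x e :=
    (hψ.continuous_fderiv (by norm_cast)).clm_apply continuous_const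
  obtain ⟨C1, hC1⟩ := (hψc.fderiv_apply (𝕜 := ℝ) (v := e)).exists_bound_of_continuous hψ1
  obtain ⟨C2, hC2⟩ := hψc.exists_bound_of_continuous hψ.continuous
  have h1 : Integrable (fun z : Space n × ℝ => u z * fderiv ℝ ψ z.1 e)
      (volume.restrict (U ×ˢ J)) :=
    hu.mul_bdd (c := C1) (hψ1.comp continuous_fst).aestronglyMeasurable
      (Eventually.of_forall fun z => hC1 z.1)
  have h2 : Integrable (fun z : Space n × ℝ => Du z i * ψ z.1) (volume.restrict (U ×ˢ J)) :=
    hDui.mul_bdd (c := C2) (hψ.continuous.comp continuous_fst).aestronglyMeasurable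
      (Eventually.of_forall fun z => hC2 z.1)
  have key := ae_integral_slice_eq_zero hJ (h := fun z => u z * fderiv ℝ ψ z.1 e + Du z i * ψ z.1)
    (B := U) (h1.add h2) (by
      intro θ hθ1 hθ2 hθ3
      obtain ⟨C3, hC3⟩ := hθ2.exists_bound_of_continuous hθ1.continuous
      have hw := hW.weak _ (isTestFunction_mul hψ hψc hψU hθ1 hθ2 hθ3) i
      have hθm : AEStronglyMeasurable (fun z : Space n × ℝ => θ z.2) (volume.restrict (U ×ˢ J)) :=
        (hθ1.continuous.comp continuous_snd).aestronglyMeasurable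
      have h1' := h1.bdd_mul (c := C3) hθm (Eventually.of_forall fun z => hC3 z.2)
      have h2' := h2.bdd_mul (c := C3) hθm (Eventually.of_forall fun z => hC3 z.2)
      simp only [mul_add]
      rw [integral_add h1' h2']
      rw [← sub_eq_zero, sub_neg_eq_add] at hw
      rw [← hw]
      congr 1
      · refine integral_congr_ae (Eventually.of_forall fun z => ?_)
        simp only [spatialGrad_mul ψ θ (hψ.differentiable (by norm_cast)), PiLp.smul_apply,
          smul_eq_mul, gradient_apply]
        ring
      · refine integral_congr_ae (Eventually.of_forall fun z => ?_)
        ring)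
  filter_upwards [key, ae_integrableOn_slice h1, ae_integrableOn_slice h2] with t ht ht1 ht2
  rw [integral_add ht1 ht2] at ht
  linarith

/-- `f` belongs to `W^{1,2}` with gradient `g` in the sense of strong `L²(B)` approximation by
smooth functions. -/
structure IsSobolevOn (B : Set (Space n)) (f : Space n → ℝ) (g : Space n → Space n) : Prop where
  memLp : MemLp f 2 (volume.restrict B)
  memLp_grad : MemLp g 2 (volume.restrict B)
  exists_approx : ∃ F : ℕ → Space n → ℝ, (∀ k, ContDiff ℝ ∞ (F k)) ∧
    Tendsto (fun k => eLpNorm (fun x => F k x - f x) 2 (volume.restrict B)) atTop (𝓝 0) ∧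
    Tendsto (fun k => eLpNorm (fun x => gradient (F k) x - g x) 2 (volume.restrict B)) atTop (𝓝 0)

/-- Mollification commutes with the weak gradient at distance more than `1 / (k + 1)` from the sphere.
The weak gradient is tested against translates of the mollifier by a dense set of vectors only. -/
theorem gradient_mollify_eq {f : Space n → ℝ} {g : Space n → Space n}
    (hf : MemLp f 2 (volume.restrict (ball 0 1))) (hg : MemLp g 2 (volume.restrict (ball 0 1)))
    {D : Set (Space n)} (hD : Dense D) (k : ℕ)
    (hfg : ∀ x ∈ D, ‖x‖ + 1 / ((k : ℝ) + 1) < 1 → ∀ i : Fin n,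
      ∫ y in ball 0 1, f y * fderiv ℝ (fun y => mollifier n k (x - y)) y
        (EuclideanSpace.single i 1) = -∫ y in ball 0 1, g y i * mollifier n k (x - y))
    {x : Space n} (hx : ‖x‖ + 1 / ((k : ℝ) + 1) < 1) :
    gradient (mollify (mollifier n k) ((ball 0 1).indicator f)) x =
      mollify (mollifier n k) ((ball 0 1).indicator g) x := by
  set η := mollifier n k with hη
  have hηs : ContDiff ℝ ∞ η := mollifier_contDiff k
  have hηc : HasCompactSupport η := mollifier_hasCompactSupport k
  have hf' : LocallyIntegrable ((ball (0 : Space n) 1).indicator f) volume :=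
    ((memLp_indicator_iff_restrict measurableSet_ball).2 hf).locallyIntegrable (by norm_num)
  have hg' : LocallyIntegrable ((ball (0 : Space n) 1).indicator g) volume :=
    ((memLp_indicator_iff_restrict measurableSet_ball).2 hg).locallyIntegrable (by norm_num)
  have hgi : ∀ i, LocallyIntegrable (fun y => (ball (0 : Space n) 1).indicator g y i) volume := by
    intro i y
    obtain ⟨V, hV, hVi⟩ := hg' y
    exact ⟨V, hV, (EuclideanSpace.proj (𝕜 := ℝ) i).integrable_comp hVi⟩
  have hcomp : ∀ x i, mollify η ((ball 0 1).indicator g) x i =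
      mollify η (fun y => (ball (0 : Space n) 1).indicator g y i) x := by
    intro x i
    have hint : Integrable (fun y => η (x - y) • (ball (0 : Space n) 1).indicator g y) volume := by
      refine hg'.integrable_smul_left_of_hasCompactSupport (by
        have := hηs.continuous; fun_prop) ?_
      exact hηc.comp_homeomorph (Homeomorph.subLeft x)
    have := (EuclideanSpace.proj (𝕜 := ℝ) i).integral_comp_comm hint
    exact this.symm
  -- both sides are continuous, so it suffices to compare them on a dense set
  have hopen : IsOpen {x : Space n | ‖x‖ + 1 / ((k : ℝ) + 1) < 1} :=
    isOpen_lt (by fun_prop) continuous_const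
  ext i
  rw [gradient_apply, hcomp]
  set e : Space n := EuclideanSpace.single i 1 with he
  have hc1 : Continuous fun x => fderiv ℝ (mollify η ((ball 0 1).indicator f)) x e :=
    ((mollify_contDiff hηs hηc hf').continuous_fderiv (by norm_cast)).clm_apply continuous_const
  have hc2 : Continuous (mollify η (fun y => (ball (0 : Space n) 1).indicator g y i)) :=
    (mollify_contDiff hηs hηc (hgi i)).continuous
  have hmain : ∀ x ∈ D, ‖x‖ + 1 / ((k : ℝ) + 1) < 1 →
      fderiv ℝ (mollify η ((ball 0 1).indicator f)) x e =
        mollify η (fun y => (ball (0 : Space n) 1).indicator g y i) x := by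
    intro x hxD hx
    have h := hfg x hxD hx i
    rw [fderiv_mollify hηs hηc hf', mollify]
    have hd : ∀ y, fderiv ℝ (fun y => η (x - y)) y e = -fderiv ℝ η (x - y) e := by
      intro y
      have h1 : HasFDerivAt (fun y : Space n => x - y) (-ContinuousLinearMap.id ℝ (Space n)) y :=
        (hasFDerivAt_id y).const_sub x
      have h2 := ((hηs.differentiable (by norm_cast)).differentiableAt
        (x := x - y)).hasFDerivAt.comp y h1
      have h3 := h2.fderiv
      simp only [Function.comp_def] at h3
      rw [h3]
      simp
    have e1 : ∫ y, fderiv ℝ η (x - y) e * (ball 0 1).indicator f y =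
        -∫ y in ball 0 1, f y * fderiv ℝ (fun y => η (x - y)) y e := by
      rw [← integral_neg, ← integral_indicator measurableSet_ball]
      refine integral_congr_ae (Eventually.of_forall fun y => ?_)
      by_cases hy : y ∈ ball (0 : Space n) 1
      · simp only [indicator_of_mem hy, hd]; ring
      · simp only [indicator_of_notMem hy, mul_zero]
    have e2 : ∫ y, η (x - y) • (ball (0 : Space n) 1).indicator g y i =
        ∫ y in ball 0 1, g y i * η (x - y) := by
      rw [← integral_indicator measurableSet_ball]
      refine integral_congr_ae (Eventually.of_forall fun y => ?_)
      by_cases hy : y ∈ ball (0 : Space n) 1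
      · simp only [indicator_of_mem hy, smul_eq_mul]; ring
      · simp [indicator_of_notMem hy]
    rw [e1, e2, h, neg_neg]
  have hcl := hD.open_subset_closure_inter hopen hx
  have hclosed : IsClosed {x | fderiv ℝ (mollify η ((ball 0 1).indicator f)) x e =
      mollify η (fun y => (ball (0 : Space n) 1).indicator g y i) x} := isClosed_eq hc1 hc2
  exact closure_minimal (fun y hy => hmain y hy.2 hy.1) hclosed hcl

/-- For almost every time, the slice `u(·, t)` is a `W^{1,2}` function in the interior. Only
countably many test functions (translated mollifiers) are needed. -/
theorem ae_isSobolevOn_slice {J : Set ℝ} (hJ : IsOpen J) (hJt : volume J ≠ ⊤)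
    {u : Space n × ℝ → ℝ} {Du : Space n × ℝ → Space n}
    (hW : HasWeakSpatialGradientL2 (ball 0 1 ×ˢ J) u Du) :
    ∀ᵐ t ∂volume.restrict J, ∀ r < 1,
      IsSobolevOn (ball 0 r) (fun x => u (x, t)) (fun x => Du (x, t)) := by
  have hUt : volume (ball (0 : Space n) 1) ≠ ⊤ := measure_ball_lt_top.ne
  set D : Set (Space n) := range (TopologicalSpace.denseSeq (Space n)) with hDdef
  have hD : Dense D := TopologicalSpace.denseRange_denseSeq _
  have hDc : D.Countable := countable_range _
  have hall : ∀ᵐ t ∂volume.restrict J, ∀ k : ℕ, ∀ x ∈ D, ‖x‖ + 1 / ((k : ℝ) + 1) < 1 →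
      ∀ i : Fin n, ∫ y in ball 0 1, u (y, t) * fderiv ℝ (fun y => mollifier n k (x - y)) y
        (EuclideanSpace.single i 1) =
          -∫ y in ball 0 1, Du (y, t) i * mollifier n k (x - y) := by
    rw [ae_all_iff]; intro k
    rw [ae_ball_iff hDc]; intro x hx
    by_cases hxk : ‖x‖ + 1 / ((k : ℝ) + 1) < 1
    swap
    · exact Eventually.of_forall fun t h => absurd h hxk
    have hae : ∀ᵐ t ∂volume.restrict J, ∀ i : Fin n,
        ∫ y in ball 0 1, u (y, t) * fderiv ℝ (fun y => mollifier n k (x - y)) y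
        (EuclideanSpace.single i 1) =
          -∫ y in ball 0 1, Du (y, t) i * mollifier n k (x - y) := by
      rw [ae_all_iff]; intro i
      refine ae_slice_weak_gradient (ψ := fun y => mollifier n k (x - y)) hJ hUt hJt hW
        ((mollifier_contDiff k).comp (contDiff_const.sub contDiff_id))
        ((mollifier_hasCompactSupport k).comp_homeomorph (Homeomorph.subLeft x)) ?_ i
      have hcl : tsupport (fun y => mollifier n k (x - y)) ⊆ closedBall x (1 / ((k : ℝ) + 1)) := by
        refine closure_minimal (fun y hy => ?_) isClosed_closedBall
        have : x - y ∈ Function.support (mollifier n k) := hy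
        rw [support_mollifier, mem_ball_zero_iff] at this
        rw [mem_closedBall, dist_comm, dist_eq_norm]
        exact this.le
      refine hcl.trans fun y hy => ?_
      rw [mem_closedBall, dist_eq_norm] at hy
      rw [mem_ball_zero_iff]
      calc ‖y‖ = ‖(y - x) + x‖ := by congr 1; abel
        _ ≤ ‖y - x‖ + ‖x‖ := norm_add_le _ _
        _ < 1 := by linarith
    exact hae.mono fun t ht _ => ht
  filter_upwards [hall, ae_memLp_slice hW.memLp, ae_memLp_slice hW.memLp_grad] with t ht hu hDu
  intro r hr
  have hsub : ball (0 : Space n) r ⊆ ball 0 1 := ball_subset_ball hr.le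
  set f : Space n → ℝ := fun x => u (x, t) with hf
  set g : Space n → Space n := fun x => Du (x, t) with hg
  have hf1 : MemLp ((ball (0 : Space n) 1).indicator f) 2 volume :=
    (memLp_indicator_iff_restrict measurableSet_ball).2 hu
  have hg1 : MemLp ((ball (0 : Space n) 1).indicator g) 2 volume :=
    (memLp_indicator_iff_restrict measurableSet_ball).2 hDu
  refine ⟨hu.mono_measure (Measure.restrict_mono hsub le_rfl),
    hDu.mono_measure (Measure.restrict_mono hsub le_rfl),
    fun k => mollify (mollifier n k) ((ball 0 1).indicator f), fun k =>
      mollify_contDiff (mollifier_contDiff k) (mollifier_hasCompactSupport k)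
        (hf1.locallyIntegrable (by norm_num)), ?_, ?_⟩
  · refine tendsto_of_tendsto_of_tendsto_of_le_of_le tendsto_const_nhds
      (tendsto_eLpNorm_mollify_sub hf1) (fun _ => zero_le) fun k => ?_
    refine le_trans (le_of_eq (eLpNorm_congr_ae ?_)) (eLpNorm_mono_measure _ Measure.restrict_le_self)
    filter_upwards [ae_restrict_mem measurableSet_ball] with x hx
    rw [indicator_of_mem (hsub hx)]
  · refine tendsto_of_tendsto_of_tendsto_of_le_of_le' tendsto_const_nhds
      (tendsto_eLpNorm_mollify_sub hg1) (Eventually.of_forall fun _ => zero_le) ?_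
    obtain ⟨N, hN⟩ := exists_nat_one_div_lt (sub_pos.2 hr)
    filter_upwards [eventually_ge_atTop N] with k hk
    refine le_trans (le_of_eq (eLpNorm_congr_ae ?_)) (eLpNorm_mono_measure _ Measure.restrict_le_self)
    filter_upwards [ae_restrict_mem measurableSet_ball] with x hx
    rw [gradient_mollify_eq hu hDu hD k (ht k), indicator_of_mem (hsub hx)]
    rw [mem_ball_zero_iff] at hx
    have : 1 / ((k : ℝ) + 1) ≤ 1 / ((N : ℝ) + 1) := by gcongr
    linarith

end Slices
end ParabolicBMO

namespace ParabolicBMO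
open Filter Topology

/-! ### Cancellation of constant skew-symmetric matrices -/

section SobolevSlices

variable {n : ℕ}

theorem pairing_eq_sum_gradient (M : Matrix (Fin n) (Fin n) ℝ) (h ψ : Space n → ℝ) (x : Space n) :
    pairing M (gradient h x) (gradient ψ x) = ∑ i, ∑ j, M i j *
      (fderiv ℝ h x (EuclideanSpace.single j 1) * fderiv ℝ ψ x (EuclideanSpace.single i 1)) := by
  simp only [pairing, gradient_apply, mul_assoc]

/-- A constant skew-symmetric matrix is invisible in the divergence form: the second derivatives of
`ψ` are symmetric. -/
theorem integral_pairing_gradient_gradient_eq_zero {M : Matrix (Fin n) (Fin n) ℝ}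
    (hM : ∀ i j, M i j = -M j i) {h ψ : Space n → ℝ} (hh : ContDiff ℝ ∞ h) (hψ : ContDiff ℝ ∞ ψ)
    (hψc : HasCompactSupport ψ) : ∫ x, pairing M (gradient h x) (gradient ψ x) = 0 := by
  set e : Fin n → Space n := fun i => EuclideanSpace.single i 1 with he
  have hψ1 : ∀ i, ContDiff ℝ ∞ fun x => fderiv ℝ ψ x (e i) := fun i =>
    (hψ.fderiv_right (m := ∞) (by norm_cast)).clm_apply contDiff_const
  have hψ1c : ∀ i, HasCompactSupport fun x => fderiv ℝ ψ x (e i) := fun i =>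
    hψc.fderiv_apply (𝕜 := ℝ) (e i)
  have hh1 : ∀ j, Continuous fun x => fderiv ℝ h x (e j) := fun j =>
    (hh.continuous_fderiv (by norm_cast)).clm_apply continuous_const
  have hint : ∀ i j, Integrable fun x => fderiv ℝ h x (e j) * fderiv ℝ ψ x (e i) := fun i j =>
    ((hh1 j).mul (hψ1 i).continuous).integrable_of_hasCompactSupport (hψ1c i).mul_left
  set S : Fin n → Fin n → ℝ := fun i j => ∫ x, h x * fderiv ℝ (fun y => fderiv ℝ ψ y (e i)) x (e j)
    with hS
  -- one integration by parts moves the derivative from `h` onto `ψ`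
  have hIBP : ∀ i j, ∫ x, fderiv ℝ h x (e j) * fderiv ℝ ψ x (e i) = -S i j := by
    intro i j
    rw [hS]
    simp only
    rw [integral_mul_fderiv_eq_neg_fderiv_mul_of_integrable (hint i j), neg_neg]
    · exact (hh.continuous.mul (((hψ1 i).continuous_fderiv (by norm_cast)).clm_apply
        continuous_const)).integrable_of_hasCompactSupport
        ((hψ1c i).fderiv_apply (𝕜 := ℝ) (e j)).mul_left
    · exact (hh.continuous.mul (hψ1 i).continuous).integrable_of_hasCompactSupport
        (hψ1c i).mul_left
    · exact fun x _ => (hh.differentiable (by norm_cast)).differentiableAt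
    · exact fun x _ => ((hψ1 i).differentiable (by norm_cast)).differentiableAt
  have hSs : ∀ i j, S i j = S j i := by
    intro i j
    refine integral_congr_ae (Eventually.of_forall fun x => ?_)
    have hd : DifferentiableAt ℝ (fderiv ℝ ψ) x :=
      ((hψ.fderiv_right (m := ∞) (by norm_cast)).differentiable (by norm_cast)).differentiableAt
    have h2 : IsSymmSndFDerivAt ℝ ψ x :=
      hψ.contDiffAt.isSymmSndFDerivAt (by simp; norm_cast)
    have h3 : ∀ v w, fderiv ℝ (fun y => fderiv ℝ ψ y v) x w = fderiv ℝ (fderiv ℝ ψ) x w v := by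
      intro v w
      rw [fderiv_clm_apply hd (differentiableAt_const v)]
      simp
    simp only [h3]
    rw [h2.eq]
  simp only [pairing_eq_sum_gradient]
  have e0 : ∫ x, ∑ i, ∑ j, M i j * (fderiv ℝ h x (e j) * fderiv ℝ ψ x (e i)) =
      ∑ i, ∫ x, ∑ j, M i j * (fderiv ℝ h x (e j) * fderiv ℝ ψ x (e i)) :=
    integral_finsetSum _ fun i _ => integrable_finsetSum _ fun j _ => (hint i j).const_mul (M i j)
  have e1 : ∑ i, ∫ x, ∑ j, M i j * (fderiv ℝ h x (e j) * fderiv ℝ ψ x (e i)) =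
      ∑ i, ∑ j, -(M i j * S i j) := by
    refine Finset.sum_congr rfl fun i _ => ?_
    refine (integral_finsetSum _ fun j _ => (hint i j).const_mul (M i j)).trans ?_
    refine Finset.sum_congr rfl fun j _ => ?_
    rw [integral_const_mul, hIBP]; ring
  have e2 : ∑ i, ∑ j, -(M i j * S i j) = -∑ i, ∑ j, -(M i j * S i j) := by
    rw [← Finset.sum_neg_distrib]
    conv_lhs => rw [Finset.sum_comm]
    refine Finset.sum_congr rfl fun i _ => ?_
    rw [← Finset.sum_neg_distrib]
    refine Finset.sum_congr rfl fun j _ => ?_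
    rw [hM j i, hSs j i]; ring
  refine e0.trans (e1.trans ?_)
  linarith

/-- The `L²` pairing is continuous: this is continuity of the inner product of `L²`. -/
theorem tendsto_integral_mul_of_tendsto_eLpNorm {X : Type*} [MeasurableSpace X] {μ : Measure X}
    {F G : ℕ → X → ℝ} {f g : X → ℝ} (hF : ∀ k, MemLp (F k) 2 μ) (hG : ∀ k, MemLp (G k) 2 μ)
    (hf : MemLp f 2 μ) (hg : MemLp g 2 μ)
    (hFf : Tendsto (fun k => eLpNorm (F k - f) 2 μ) atTop (𝓝 0))
    (hGg : Tendsto (fun k => eLpNorm (G k - g) 2 μ) atTop (𝓝 0)) :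
    Tendsto (fun k => ∫ x, F k x * G k x ∂μ) atTop (𝓝 (∫ x, f x * g x ∂μ)) := by
  have h1 := (Lp.tendsto_Lp_iff_tendsto_eLpNorm'' F hF f hf).2 hFf
  have h2 := (Lp.tendsto_Lp_iff_tendsto_eLpNorm'' G hG g hg).2 hGg
  have h3 := h1.inner (𝕜 := ℝ) h2
  have key : ∀ {a b : X → ℝ} (ha : MemLp a 2 μ) (hb : MemLp b 2 μ),
      inner ℝ (ha.toLp a) (hb.toLp b) = ∫ x, a x * b x ∂μ := by
    intro a b ha hb
    rw [L2.inner_def]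
    refine integral_congr_ae ?_
    filter_upwards [ha.coeFn_toLp, hb.coeFn_toLp] with x h1 h2
    rw [h1, h2]; simp [mul_comm]
  simpa only [key] using h3

theorem norm_pairing_le (M : Matrix (Fin n) (Fin n) ℝ) (v w : Space n) :
    |pairing M v w| ≤ (∑ i, ∑ j, |M i j|) * ‖v‖ * ‖w‖ := by
  rw [pairing, Finset.sum_mul, Finset.sum_mul]
  refine (Finset.abs_sum_le_sum_abs _ _).trans (Finset.sum_le_sum fun i _ => ?_)
  rw [Finset.sum_mul, Finset.sum_mul]
  refine (Finset.abs_sum_le_sum_abs _ _).trans (Finset.sum_le_sum fun j _ => ?_)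
  rw [abs_mul, abs_mul]
  have h1 : |v j| ≤ ‖v‖ := PiLp.norm_apply_le v j
  have h2 : |w i| ≤ ‖w‖ := PiLp.norm_apply_le w i
  gcongr

theorem pairing_sub_left (M : Matrix (Fin n) (Fin n) ℝ) (v v' w : Space n) :
    pairing M (v - v') w = pairing M v w - pairing M v' w := by
  simp only [pairing, ← Finset.sum_sub_distrib]
  refine Finset.sum_congr rfl fun i _ => Finset.sum_congr rfl fun j _ => ?_
  simp; ring

theorem pairing_smul_left (M : Matrix (Fin n) (Fin n) ℝ) (c : ℝ) (v w : Space n) :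
    pairing M (c • v) w = c * pairing M v w := by
  simp only [pairing, Finset.mul_sum]
  refine Finset.sum_congr rfl fun i _ => Finset.sum_congr rfl fun j _ => ?_
  simp; ring

theorem aestronglyMeasurable_pairing {X : Type*} [MeasurableSpace X] {μ : Measure X}
    {M : X → Matrix (Fin n) (Fin n) ℝ} {v w : X → Space n}
    (hM : ∀ i j, AEStronglyMeasurable (fun x => M x i j) μ) (hv : AEStronglyMeasurable v μ)
    (hw : AEStronglyMeasurable w μ) :
    AEStronglyMeasurable (fun x => pairing (M x) (v x) (w x)) μ := by
  have hc : ∀ {v : X → Space n}, AEStronglyMeasurable v μ → ∀ i,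
      AEStronglyMeasurable (fun x => v x i) μ := fun hv i =>
    (EuclideanSpace.proj (𝕜 := ℝ) i).continuous.comp_aestronglyMeasurable hv
  unfold pairing
  refine Finset.aestronglyMeasurable_fun_sum _ fun i _ =>
    Finset.aestronglyMeasurable_fun_sum _ fun j _ => ?_
  exact ((hM i j).mul (hc hv j)).mul (hc hw i)

theorem memLp_of_continuous_of_isBounded {F : Type*} [NormedAddCommGroup F]
    {f : Space n → F} (hf : Continuous f) {B : Set (Space n)}
    (hBb : Bornology.IsBounded B) (p : ℝ≥0∞) : MemLp f p (volume.restrict B) := by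
  have hK : IsCompact (closure B) := hBb.isCompact_closure
  obtain ⟨C, hC⟩ := hK.exists_bound_of_continuousOn hf.continuousOn
  have hfin : IsFiniteMeasure (volume.restrict B) :=
    ⟨by rw [Measure.restrict_apply_univ]; exact hBb.measure_lt_top⟩
  have h1 : MemLp f p (volume.restrict (closure B)) := by
    have : IsFiniteMeasure (volume.restrict (closure B)) :=
      ⟨by rw [Measure.restrict_apply_univ]; exact hK.measure_lt_top⟩
    refine MemLp.of_bound hf.aestronglyMeasurable C ?_
    filter_upwards [ae_restrict_mem isClosed_closure.measurableSet] with x hx using hC x hx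
  exact h1.mono_measure (Measure.restrict_mono subset_closure le_rfl)

theorem continuous_gradient {f : Space n → ℝ} (hf : ContDiff ℝ ∞ f) : Continuous (gradient f) :=
  (InnerProductSpace.toDual ℝ (Space n)).symm.continuous.comp
    (hf.continuous_fderiv (by norm_cast))

namespace IsSobolevOn

variable {B : Set (Space n)} {f : Space n → ℝ} {g : Space n → Space n}

theorem mono (h : IsSobolevOn B f g) {B' : Set (Space n)} (hB : B' ⊆ B) : IsSobolevOn B' f g := by
  have hm : (volume : Measure (Space n)).restrict B' ≤ volume.restrict B :=
    Measure.restrict_mono hB le_rfl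
  obtain ⟨F, hF, h1, h2⟩ := h.exists_approx
  refine ⟨h.memLp.mono_measure hm, h.memLp_grad.mono_measure hm, F, hF, ?_, ?_⟩
  · exact tendsto_of_tendsto_of_tendsto_of_le_of_le tendsto_const_nhds h1 (fun _ => zero_le)
      fun k => eLpNorm_mono_measure _ hm
  · exact tendsto_of_tendsto_of_tendsto_of_le_of_le tendsto_const_nhds h2 (fun _ => zero_le)
      fun k => eLpNorm_mono_measure _ hm

/-- The skew-symmetric cancellation: `div (M ∇f) = 0` for a constant skew-symmetric `M`, tested
with `ψ (f - c)`, since `(f - c) ∇f` is a gradient. -/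
theorem integral_pairing_mul_sub_eq_zero (h : IsSobolevOn B f g) (hB : Bornology.IsBounded B)
    {M : Matrix (Fin n) (Fin n) ℝ} (hM : ∀ i j, M i j = -M j i) {ψ : Space n → ℝ}
    (hψ : ContDiff ℝ ∞ ψ) (hψc : HasCompactSupport ψ) (hψB : tsupport ψ ⊆ B) (c : ℝ) :
    ∫ x in B, pairing M (g x) (gradient ψ x) * (f x - c) = 0 := by
  obtain ⟨F, hF, h1, h2⟩ := h.exists_approx
  have hfin : IsFiniteMeasure (volume.restrict B) :=
    ⟨by rw [Measure.restrict_apply_univ]; exact hB.measure_lt_top⟩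
  have hψg : Continuous (gradient ψ) := continuous_gradient hψ
  obtain ⟨C, hC⟩ : ∃ C, ∀ x, ‖gradient ψ x‖ ≤ C := by
    obtain ⟨C, hC⟩ := (hψc.fderiv (𝕜 := ℝ)).exists_bound_of_continuous
      (hψ.continuous_fderiv (by norm_cast))
    refine ⟨C, fun x => ?_⟩
    have := hC x
    simpa [gradient] using this
  set L : ℝ := (∑ i, ∑ j, |M i j|) * C with hL
  have hbd : ∀ (v : Space n) x, ‖pairing M v (gradient ψ x)‖ ≤ L * ‖v‖ := by
    intro v x
    rw [Real.norm_eq_abs]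
    refine (norm_pairing_le M v _).trans ?_
    have h0 : 0 ≤ ∑ i, ∑ j, |M i j| := by positivity
    calc _ ≤ (∑ i, ∑ j, |M i j|) * ‖v‖ * C := by gcongr; exact hC x
      _ = L * ‖v‖ := by rw [hL]; ring
  have hmeas : ∀ {v : Space n → Space n}, AEStronglyMeasurable v (volume.restrict B) →
      AEStronglyMeasurable (fun x => pairing M (v x) (gradient ψ x)) (volume.restrict B) :=
    fun hv => aestronglyMeasurable_pairing (fun i j => aestronglyMeasurable_const) hv
      hψg.aestronglyMeasurable
  have hmem : ∀ {v : Space n → Space n}, MemLp v 2 (volume.restrict B) →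
      MemLp (fun x => pairing M (v x) (gradient ψ x)) 2 (volume.restrict B) := fun hv =>
    hv.of_le_mul (hmeas hv.aestronglyMeasurable) (Eventually.of_forall fun x => hbd _ x)
  have hFm : ∀ k, MemLp (F k) 2 (volume.restrict B) := fun k =>
    memLp_of_continuous_of_isBounded (hF k).continuous hB 2
  have hGm : ∀ k, MemLp (gradient (F k)) 2 (volume.restrict B) := fun k =>
    memLp_of_continuous_of_isBounded (continuous_gradient (hF k)) hB 2
  have hlim := tendsto_integral_mul_of_tendsto_eLpNorm (μ := volume.restrict B)
    (F := fun k x => pairing M (gradient (F k) x) (gradient ψ x))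
    (G := fun k x => F k x - c) (fun k => hmem (hGm k))
    (fun k => (hFm k).sub (memLp_const c)) (hmem h.memLp_grad) (h.memLp.sub (memLp_const c)) (by
      have h3 : Tendsto (fun k => ENNReal.ofReal L *
          eLpNorm (fun x => gradient (F k) x - g x) 2 (volume.restrict B)) atTop (𝓝 0) := by
        have := ENNReal.Tendsto.const_mul (a := ENNReal.ofReal L) h2 (Or.inr ENNReal.ofReal_ne_top)
        rwa [mul_zero] at this
      refine tendsto_of_tendsto_of_tendsto_of_le_of_le tendsto_const_nhds h3 (fun _ => zero_le)
        fun k => ?_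
      refine eLpNorm_le_mul_eLpNorm_of_ae_le_mul (Eventually.of_forall fun x => ?_) 2
      simp only [Pi.sub_apply]
      rw [← pairing_sub_left]
      exact hbd _ x) (by
      have e : ∀ k, (fun x => F k x - c) - (f - fun _ => c) = fun x => F k x - f x := by
        intro k; funext x; simp
      simpa only [e] using h1)
  -- for smooth approximations, `(F k - c) ∇(F k)` is the gradient of `(F k - c)² / 2`
  have hzero : ∀ k, ∫ x in B, pairing M (gradient (F k) x) (gradient ψ x) * (F k x - c) = 0 := by
    intro k
    set H : Space n → ℝ := fun x => (F k x - c) ^ 2 / 2 with hH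
    have hFc : ContDiff ℝ ∞ fun x => F k x - c := (hF k).sub contDiff_const
    have hHs : ContDiff ℝ ∞ H := (hFc.pow 2).div_const 2
    have hgrad : ∀ x, gradient H x = (F k x - c) • gradient (F k) x := by
      intro x
      have hd : DifferentiableAt ℝ (F k) x := ((hF k).differentiable (by norm_cast)).differentiableAt
      have h5 : HasFDerivAt (fun x => F k x - c) (fderiv ℝ (F k) x) x :=
        hd.hasFDerivAt.sub_const c
      have h6 := ((h5.pow 2).mul_const (2⁻¹ : ℝ)).fderiv
      have h7 : H = fun y => (F k y - c) ^ 2 * 2⁻¹ := by funext y; rw [hH]; ring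
      have h8 : fderiv ℝ H x = (F k x - c) • fderiv ℝ (F k) x := by
        rw [h7]
        refine h6.trans ?_
        ext v
        simp
        ring
      simp only [gradient]
      rw [h8, map_smulₛₗ]
      simp
    rw [setIntegral_eq_integral_of_forall_compl_eq_zero,
      ← integral_pairing_gradient_gradient_eq_zero hM hHs hψ hψc]
    · refine integral_congr_ae (Eventually.of_forall fun x => ?_)
      simp only [hgrad, pairing_smul_left]; ring
    · intro x hx
      have : fderiv ℝ ψ x = 0 := by
        have h9 : x ∉ tsupport (fderiv ℝ ψ) := fun h => hx (hψB (tsupport_fderiv_subset ℝ h))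
        exact image_eq_zero_of_notMem_tsupport h9
      have h0 : gradient ψ x = 0 := by simp [gradient, this]
      rw [h0]; simp [pairing]
  simp only [hzero] at hlim
  exact (tendsto_nhds_unique hlim tendsto_const_nhds)

theorem integrable_pairing_mul (h : IsSobolevOn B f g)
    (M : Matrix (Fin n) (Fin n) ℝ) {ψ : Space n → ℝ}
    (hψ : ContDiff ℝ ∞ ψ) (hψc : HasCompactSupport ψ) {b : Space n → ℝ}
    (hb : MemLp b 2 (volume.restrict B)) :
    IntegrableOn (fun x => pairing M (g x) (gradient ψ x) * b x) B := by
  have hψg : Continuous (gradient ψ) := continuous_gradient hψ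
  obtain ⟨C, hC⟩ := (hψc.fderiv (𝕜 := ℝ)).exists_bound_of_continuous
      (hψ.continuous_fderiv (by norm_cast))
  have hm : MemLp (fun x => pairing M (g x) (gradient ψ x)) 2 (volume.restrict B) := by
    refine h.memLp_grad.of_le_mul (c := (∑ i, ∑ j, |M i j|) * C)
      (aestronglyMeasurable_pairing (fun i j => aestronglyMeasurable_const)
        h.memLp_grad.aestronglyMeasurable hψg.aestronglyMeasurable)
      (Eventually.of_forall fun x => ?_)
    have hCx : ‖gradient ψ x‖ ≤ C := by simpa [gradient] using hC x
    rw [Real.norm_eq_abs]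
    refine (norm_pairing_le M _ _).trans ?_
    calc _ ≤ (∑ i, ∑ j, |M i j|) * ‖g x‖ * C := by gcongr
      _ = _ := by ring
  exact hm.integrable_mul hb

theorem integral_pairing_eq_zero (h : IsSobolevOn B f g) (hB : Bornology.IsBounded B)
    {M : Matrix (Fin n) (Fin n) ℝ} (hM : ∀ i j, M i j = -M j i) {ψ : Space n → ℝ}
    (hψ : ContDiff ℝ ∞ ψ) (hψc : HasCompactSupport ψ) (hψB : tsupport ψ ⊆ B) :
    ∫ x in B, pairing M (g x) (gradient ψ x) = 0 := by
  have h0 := h.integral_pairing_mul_sub_eq_zero hB hM hψ hψc hψB 0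
  have h1 := h.integral_pairing_mul_sub_eq_zero hB hM hψ hψc hψB 1
  have hfin : IsFiniteMeasure (volume.restrict B) :=
    ⟨by rw [Measure.restrict_apply_univ]; exact hB.measure_lt_top⟩
  have i0 := h.integrable_pairing_mul M hψ hψc (h.memLp.sub (memLp_const 0))
  have i1 := h.integrable_pairing_mul M hψ hψc (h.memLp.sub (memLp_const 1))
  have h2 := integral_sub i0 i1
  simp only [Pi.sub_apply] at h2
  rw [h0, h1, sub_zero] at h2
  rw [← h2]
  refine integral_congr_ae (Eventually.of_forall fun x => ?_)
  simp only
  ring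

end IsSobolevOn

end SobolevSlices

end ParabolicBMO

namespace ParabolicBMO
open Filter Topology

/-! ### Weighted means and Sobolev–Poincaré estimates on a slice -/

section SliceEstimates

variable {n : ℕ}

/-- The exponents of the argument: `m` is a Sobolev-type exponent of `q = 2α < 2`, and `s` is the
integrability of the coefficients that closes the Hölder inequality
`∫ K² v² ≤ (∫ K^s)^{2/s} (∫ v²)^{1-α} (∫ |v|^m)^{q/m}`. -/
structure IsExponents (n : ℕ) (α q m : ℝ) (s : ℕ) : Prop where
  pos : 0 < α
  lt_one : α < 1
  one_le : 1 < q
  eq_two_mul : q = 2 * α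
  two_le : 2 ≤ m
  le_s : m ≤ s
  conj : q⁻¹ + m⁻¹ = 1
  sobolev : n * (m / q - 1) = m / 2
  holder : 2 / (s : ℝ) + (1 - α) + q / m = 1

/-- An explicit admissible choice of exponents. Here `m` lies strictly below the Sobolev exponent of
`q`, which leaves room for the finite power `s` of the coefficients. -/
theorem exists_isExponents (hn : 1 ≤ n) :
    IsExponents n (2 * n / (2 * n + 1)) (4 * n / (2 * n + 1)) (4 * n / (2 * n - 1)) (4 * n + 2) := by
  have h : (1:ℝ) ≤ n := by exact_mod_cast hn
  have h1 : (0:ℝ) < 2 * n - 1 := by linarith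
  constructor
  · positivity
  · rw [div_lt_one (by positivity)]; linarith
  · rw [lt_div_iff₀ (by positivity)]; linarith
  · ring
  · rw [le_div_iff₀ h1]; linarith
  · rw [div_le_iff₀ h1]; push_cast; nlinarith
  · field_simp; ring
  · have h2 : (2 * n - 1 : ℝ) ≠ 0 := h1.ne'
    rw [div_div_div_cancel_left' _ _ (by positivity)]
    obtain ⟨x, hx⟩ : ∃ x : ℝ, 2 * (n : ℝ) - 1 = x := ⟨_, rfl⟩
    rw [hx] at h2 ⊢
    have hn' : (n : ℝ) = (x + 1) / 2 := by linarith
    rw [hn']; field_simp; ring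
  · push_cast; field_simp; ring

namespace IsSobolevOn

variable {B : Set (Space n)} {f : Space n → ℝ} {g : Space n → Space n}

theorem memLp_unif {F : Type*} [NormedAddCommGroup F] {v : Space n → F} {p : ℝ≥0∞}
    (h : MemLp v p (volume.restrict B)) (h0 : volume B ≠ 0) : MemLp v p (unif B) :=
  h.smul_measure (ENNReal.inv_ne_top.2 h0)

theorem tendsto_eLpNorm_unif {F : Type*} [NormedAddCommGroup F] {v : ℕ → Space n → F}
    (h0 : volume B ≠ 0)
    (h : Tendsto (fun k => eLpNorm (v k) 2 (volume.restrict B)) atTop (𝓝 0)) :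
    Tendsto (fun k => eLpNorm (v k) 2 (unif B)) atTop (𝓝 0) := by
  simp only [unif]
  have e : ∀ k, eLpNorm (v k) 2 ((volume B)⁻¹ • volume.restrict B) =
      (volume B)⁻¹ ^ (1 / (2:ℝ≥0∞)).toReal • eLpNorm (v k) 2 (volume.restrict B) := fun k =>
    eLpNorm_smul_measure_of_ne_top (by norm_num) _ _
  simp only [e, smul_eq_mul]
  have := ENNReal.Tendsto.const_mul (a := (volume B)⁻¹ ^ (1 / (2:ℝ≥0∞)).toReal) h (Or.inr (by
    refine ENNReal.rpow_ne_top_of_nonneg (by simp) (ENNReal.inv_ne_top.2 h0)))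
  rwa [mul_zero] at this

/-- The Sobolev–Poincaré inequality passes to the limit of smooth functions by Fatou's lemma. -/
theorem sobolev_poincare (h : IsSobolevOn B f g) (hB : Convex ℝ B)
    (hBm : MeasurableSet B) (h0 : volume B ≠ 0) (ht : volume B ≠ ⊤) {d : ℝ≥0∞} (hdt : d ≠ ⊤)
    (hd : ∀ x ∈ B, ∀ y ∈ B, ‖x - y‖ₑ ≤ d) {q m : ℝ} (hq : 1 ≤ q) (hq2 : q ≤ 2) (hqm : q ≤ m)
    (hnm : n * (m / q - 1) = m / 2) :
    ∫⁻ x, (∫⁻ y, ‖f x - f y‖ₑ ∂unif B) ^ m ∂unif B ≤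
      d ^ m * 2 ^ (m + n) * (∫⁻ x, ‖g x‖ₑ ^ q ∂unif B) ^ (m / q) := by
  have hP := isProbabilityMeasure_unif h0 ht
  have hq0 : 0 < q := by linarith
  have hm0 : 0 < m := by linarith
  obtain ⟨F, hF, h1, h2⟩ := h.exists_approx
  have hf : MemLp f 2 (unif B) := memLp_unif h.memLp h0
  have hg : MemLp g 2 (unif B) := memLp_unif h.memLp_grad h0
  have h1' := tendsto_eLpNorm_unif h0 h1
  have h2' := tendsto_eLpNorm_unif h0 h2
  obtain ⟨ns, hns, hae⟩ := (tendstoInMeasure_of_tendsto_eLpNorm (μ := unif B) (p := 2) (f := F)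
    (g := f) (by norm_num) (fun k => (hF k).continuous.aestronglyMeasurable)
    hf.aestronglyMeasurable h1').exists_seq_tendsto_ae
  set P := unif B with hPdef
  have hFm : ∀ k, Measurable fun p : Space n × Space n => ‖F (ns k) p.1 - F (ns k) p.2‖ₑ := fun k =>
    (((hF (ns k)).continuous.comp continuous_fst).sub
      ((hF (ns k)).continuous.comp continuous_snd)).enorm.measurable
  have hpt : ∀ᵐ x ∂P, (∫⁻ y, ‖f x - f y‖ₑ ∂P) ^ m ≤
      liminf (fun k => (∫⁻ y, ‖F (ns k) x - F (ns k) y‖ₑ ∂P) ^ m) atTop := by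
    filter_upwards [hae] with x hx
    have hin : ∫⁻ y, ‖f x - f y‖ₑ ∂P ≤
        liminf (fun k => ∫⁻ y, ‖F (ns k) x - F (ns k) y‖ₑ ∂P) atTop := by
      refine le_trans (le_of_eq ?_) (lintegral_liminf_le fun k => (hFm k).comp measurable_prodMk_left)
      refine lintegral_congr_ae ?_
      filter_upwards [hae] with y hy
      exact ((hx.sub hy).enorm.liminf_eq).symm
    refine (ENNReal.rpow_le_rpow hin hm0.le).trans (le_of_eq ?_)
    exact (ENNReal.monotone_rpow_of_nonneg hm0.le).map_liminf_of_continuousAt _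
      ENNReal.continuous_rpow_const.continuousAt
  -- convergence of the gradients
  have hgq : ∀ (v : Space n → Space n), ∫⁻ x, ‖v x‖ₑ ^ q ∂P = eLpNorm v (ENNReal.ofReal q) P ^ q := by
    intro v
    rw [eLpNorm_eq_lintegral_rpow_enorm_toReal (by simpa using hq0) ENNReal.ofReal_ne_top,
      ENNReal.toReal_ofReal hq0.le, ← ENNReal.rpow_mul, one_div_mul_cancel hq0.ne',
      ENNReal.rpow_one]
  -- the smooth inequality, with the gradient of `F (ns k)` split into `g` and an error that is
  -- small in `L²`, hence in `L^q` because `P` is a probability measure and `q ≤ 2`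
  have hupper : ∀ k, ∫⁻ x, (∫⁻ y, ‖F (ns k) x - F (ns k) y‖ₑ ∂P) ^ m ∂P ≤
      d ^ m * 2 ^ (m + n) * ((eLpNorm g (ENNReal.ofReal q) P +
        eLpNorm (fun x => gradient (F (ns k)) x - g x) 2 P) ^ q) ^ (m / q) := by
    intro k
    refine (sobolev_poincare_of_contDiff hB hBm h0 ht hd hq hqm hnm
      ((hF (ns k)).of_le (by norm_cast))).trans ?_
    gcongr
    have e : ∀ x, ‖fderiv ℝ (F (ns k)) x‖ₑ = ‖gradient (F (ns k)) x‖ₑ := fun x =>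
      (enorm_gradient _ _).symm
    simp only [e]
    rw [hgq]
    gcongr
    have hgm : AEStronglyMeasurable (gradient (F (ns k))) P :=
      (continuous_gradient (hF (ns k))).aestronglyMeasurable
    have hone : (1:ℝ≥0∞) ≤ ENNReal.ofReal q := by simpa using hq
    calc eLpNorm (gradient (F (ns k))) (ENNReal.ofReal q) P
        = eLpNorm (g + fun x => gradient (F (ns k)) x - g x) (ENNReal.ofReal q) P := by
          congr 1; funext x; simp
      _ ≤ eLpNorm g (ENNReal.ofReal q) P +
          eLpNorm (fun x => gradient (F (ns k)) x - g x) (ENNReal.ofReal q) P :=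
          eLpNorm_add_le hg.aestronglyMeasurable (hgm.sub hg.aestronglyMeasurable) hone
      _ ≤ _ := by
          gcongr
          refine eLpNorm_le_eLpNorm_of_exponent_le ?_ (hgm.sub hg.aestronglyMeasurable)
          rw [show (2:ℝ≥0∞) = ENNReal.ofReal 2 by simp]
          exact ENNReal.ofReal_le_ofReal hq2
  have hlim : Tendsto (fun k => d ^ m * 2 ^ (m + n) * ((eLpNorm g (ENNReal.ofReal q) P +
        eLpNorm (fun x => gradient (F (ns k)) x - g x) 2 P) ^ q) ^ (m / q)) atTop
      (𝓝 (d ^ m * 2 ^ (m + n) * ((eLpNorm g (ENNReal.ofReal q) P + 0) ^ q) ^ (m / q))) := by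
    refine ENNReal.Tendsto.const_mul ?_ (Or.inr ?_)
    · have h3 := (tendsto_const_nhds (x := eLpNorm g (ENNReal.ofReal q) P)).add
        (h2'.comp hns.tendsto_atTop)
      exact ((ENNReal.continuous_rpow_const (y := m / q)).tendsto _).comp
        (((ENNReal.continuous_rpow_const (y := q)).tendsto _).comp h3)
    · exact ENNReal.mul_ne_top (ENNReal.rpow_ne_top_of_nonneg hm0.le hdt)
        (ENNReal.rpow_ne_top_of_nonneg (by positivity) (by norm_num))
  calc ∫⁻ x, (∫⁻ y, ‖f x - f y‖ₑ ∂P) ^ m ∂P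
      ≤ ∫⁻ x, liminf (fun k => (∫⁻ y, ‖F (ns k) x - F (ns k) y‖ₑ ∂P) ^ m) atTop ∂P :=
        lintegral_mono_ae hpt
    _ ≤ liminf (fun k => ∫⁻ x, (∫⁻ y, ‖F (ns k) x - F (ns k) y‖ₑ ∂P) ^ m ∂P) atTop :=
        lintegral_liminf_le fun k => ((hFm k).lintegral_prod_right').pow_const m
    _ ≤ liminf (fun k => d ^ m * 2 ^ (m + n) * ((eLpNorm g (ENNReal.ofReal q) P +
        eLpNorm (fun x => gradient (F (ns k)) x - g x) 2 P) ^ q) ^ (m / q)) atTop :=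
        liminf_le_liminf (Eventually.of_forall hupper)
    _ = _ := by rw [hlim.liminf_eq, add_zero, hgq]

end IsSobolevOn

/-- The mean of `f` over `B` with weight `w`. -/
noncomputable def weightedMean (B : Set (Space n)) (w f : Space n → ℝ) : ℝ :=
  (∫ y in B, w y)⁻¹ * ∫ y in B, w y * f y

/-- The constant `L` measures how much of the volume of `B` the weight occupies. -/
theorem enorm_sub_weightedMean_le {B : Set (Space n)} (h0 : volume B ≠ 0) (ht : volume B ≠ ⊤)
    {w f : Space n → ℝ} (hw : Continuous w)
    (hw0 : ∀ x, 0 ≤ w x) (hw1 : ∀ x, w x ≤ 1) {L : ℝ≥0∞}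
    (hL : volume B ≤ L * ENNReal.ofReal (∫ y in B, w y)) (hf : IntegrableOn f B) (b : ℝ) :
    ‖b - weightedMean B w f‖ₑ ≤ L * ∫⁻ y, ‖b - f y‖ₑ ∂unif B := by
  set W : ℝ := ∫ y in B, w y with hW
  have hW0 : 0 < W := by
    by_contra hcon
    rw [ENNReal.ofReal_of_nonpos (not_lt.1 hcon), mul_zero] at hL
    exact h0 (le_antisymm hL zero_le)
  have hfin : IsFiniteMeasure (volume.restrict B) :=
    ⟨by rw [Measure.restrict_apply_univ]; exact ht.lt_top⟩
  have hwi : IntegrableOn w B := by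
    refine Integrable.of_bound hw.aestronglyMeasurable 1 (Eventually.of_forall fun x => ?_)
    rw [Real.norm_eq_abs, abs_of_nonneg (hw0 x)]; exact hw1 x
  have hwf : IntegrableOn (fun y => w y * f y) B := by
    refine Integrable.bdd_mul (c := 1) hf hw.aestronglyMeasurable (Eventually.of_forall fun x => ?_)
    rw [Real.norm_eq_abs, abs_of_nonneg (hw0 x)]; exact hw1 x
  -- the weight is normalized by its own integral, so `b` may be moved inside
  have e : b - weightedMean B w f = W⁻¹ * ∫ y in B, w y * (b - f y) := by
    have : ∫ y in B, w y * (b - f y) = W * b - ∫ y in B, w y * f y := by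
      simp only [mul_sub]
      rw [integral_sub (hwi.mul_const b) hwf, integral_mul_const]
    rw [this, weightedMean, mul_sub, ← mul_assoc, inv_mul_cancel₀ hW0.ne', one_mul]
  rw [e, enorm_mul, lintegral_unif, ← mul_assoc]
  have hWe : ‖W⁻¹‖ₑ = (ENNReal.ofReal W)⁻¹ := by
    rw [Real.enorm_eq_ofReal (by positivity), ENNReal.ofReal_inv_of_pos hW0]
  rw [hWe]
  gcongr
  · have hWp : ENNReal.ofReal W ≠ 0 := by simpa using hW0
    rw [ENNReal.inv_le_iff_le_mul (fun _ => hWp) (fun h => absurd h ENNReal.ofReal_ne_top)]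
    calc (1:ℝ≥0∞) = volume B * (volume B)⁻¹ := (ENNReal.mul_inv_cancel h0 ht).symm
      _ ≤ L * ENNReal.ofReal W * (volume B)⁻¹ := by gcongr
      _ = _ := by ring
  · refine (enorm_integral_le_lintegral_enorm _).trans (lintegral_mono fun y => ?_)
    rw [enorm_mul]
    calc ‖w y‖ₑ * ‖b - f y‖ₑ ≤ 1 * ‖b - f y‖ₑ := by
          gcongr
          rw [Real.enorm_eq_ofReal (hw0 y)]
          simpa using hw1 y
      _ = _ := one_mul _

/-- The Hölder inequality behind the choice of exponents. -/
theorem lintegral_sq_mul_sq_le {X : Type*} [MeasurableSpace X] {P : Measure X} {α q m : ℝ} {s : ℕ}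
    (he : IsExponents n α q m s) {K v : X → ℝ≥0∞} (hK : AEMeasurable K P) (hv : AEMeasurable v P) :
    ∫⁻ x, K x ^ (2:ℝ) * v x ^ (2:ℝ) ∂P ≤ (∫⁻ x, K x ^ (s:ℝ) ∂P) ^ (2 / (s:ℝ)) *
      (∫⁻ x, v x ^ (2:ℝ) ∂P) ^ (1 - α) * (∫⁻ x, v x ^ m ∂P) ^ (q / m) := by
  have hm : 0 < m := by linarith [he.two_le]
  have hs : (0:ℝ) < s := by linarith [he.two_le, he.le_s]
  -- Hölder's inequality for `K ^ s`, `v ^ 2`, `v ^ m` with the weights `2 / s`, `1 - α`, `q / m`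
  have h := ENNReal.lintegral_prod_norm_pow_le (μ := P) (Finset.univ : Finset (Fin 3))
    (f := ![fun x => K x ^ (s:ℝ), fun x => v x ^ (2:ℝ), fun x => v x ^ m]) (by
      intro i _
      fin_cases i
      · exact hK.pow_const _
      · exact hv.pow_const _
      · exact hv.pow_const _) (p := ![2 / (s:ℝ), 1 - α, q / m]) (by
      simpa [Fin.sum_univ_three] using he.holder) (by
      intro i _
      have := he.lt_one; have := he.one_le
      fin_cases i
      · simp only [Fin.zero_eta, Matrix.cons_val]; positivity
      · simp; linarith
      · simp only [Fin.reduceFinMk, Matrix.cons_val]; positivity)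
  simp only [Fin.prod_univ_three, Matrix.cons_val_zero, Matrix.cons_val_one, Matrix.cons_val] at h
  refine le_trans (le_of_eq (lintegral_congr fun x => ?_)) h
  rw [← ENNReal.rpow_mul, ← ENNReal.rpow_mul, ← ENNReal.rpow_mul, mul_div_cancel₀ _ hs.ne',
    mul_div_cancel₀ _ hm.ne', mul_assoc, ← ENNReal.rpow_add_of_nonneg]
  · congr 2; rw [he.eq_two_mul]; ring
  · linarith [he.lt_one]
  · linarith [he.one_le]

/-- The constant of the Sobolev–Poincaré inequality for weighted means. -/
noncomputable def sobolevConst (n : ℕ) (m q : ℝ) (L : ℝ≥0∞) : ℝ≥0∞ :=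
  (L ^ m * 2 ^ (m + n)) ^ (q / m)

theorem sobolevConst_ne_top {n : ℕ} {m q : ℝ} {L : ℝ≥0∞} (hm : 0 < m) (hq : 0 < q) (hL : L ≠ ⊤) :
    sobolevConst n m q L ≠ ⊤ :=
  ENNReal.rpow_ne_top_of_nonneg (by positivity) (ENNReal.mul_ne_top
    (ENNReal.rpow_ne_top_of_nonneg hm.le hL) (ENNReal.rpow_ne_top_of_nonneg (by positivity)
      (by norm_num)))

variable {B : Set (Space n)} {f : Space n → ℝ} {g : Space n → Space n} {α q m : ℝ} {s : ℕ}

/-- The Sobolev–Poincaré inequality for the deviation from a weighted mean. -/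
theorem lintegral_sub_weightedMean_rpow_le (he : IsExponents n α q m s)
    (h : IsSobolevOn B f g) (hB : Convex ℝ B)
    (hBm : MeasurableSet B) (h0 : volume B ≠ 0) (ht : volume B ≠ ⊤) {d : ℝ≥0∞} (hdt : d ≠ ⊤)
    (hd : ∀ x ∈ B, ∀ y ∈ B, ‖x - y‖ₑ ≤ d) {w : Space n → ℝ} (hw : Continuous w)
    (hw0 : ∀ x, 0 ≤ w x) (hw1 : ∀ x, w x ≤ 1) {L : ℝ≥0∞}
    (hL : volume B ≤ L * ENNReal.ofReal (∫ y in B, w y)) :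
    (∫⁻ x, ‖f x - weightedMean B w f‖ₑ ^ m ∂unif B) ^ (q / m) ≤
      sobolevConst n m q L * d ^ q * ∫⁻ x, ‖g x‖ₑ ^ q ∂unif B := by
  have hq0 : 0 < q := by linarith [he.one_le]
  have hm0 : 0 < m := by linarith [he.two_le]
  have hfin : IsFiniteMeasure (volume.restrict B) :=
    ⟨by rw [Measure.restrict_apply_univ]; exact ht.lt_top⟩
  have hfi : IntegrableOn f B := h.memLp.integrable (by norm_num)
  have hsp := h.sobolev_poincare hB hBm h0 ht hdt hd he.one_le.le
    (by linarith [he.eq_two_mul, he.lt_one]) (by linarith [he.eq_two_mul, he.lt_one, he.two_le])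
    he.sobolev
  have hPm := h.memLp.aestronglyMeasurable.mono_ac (unif_absolutelyContinuous B)
  calc (∫⁻ x, ‖f x - weightedMean B w f‖ₑ ^ m ∂unif B) ^ (q / m)
      ≤ (∫⁻ x, (L * ∫⁻ y, ‖f x - f y‖ₑ ∂unif B) ^ m ∂unif B) ^ (q / m) := by
        gcongr with x
        exact enorm_sub_weightedMean_le h0 ht hw hw0 hw1 hL hfi (f x)
    _ = (L ^ m * ∫⁻ x, (∫⁻ y, ‖f x - f y‖ₑ ∂unif B) ^ m ∂unif B) ^ (q / m) := by
        simp only [ENNReal.mul_rpow_of_nonneg _ _ hm0.le]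
        rw [lintegral_const_mul'']
        have : AEMeasurable (fun p : Space n × Space n => ‖f p.1 - f p.2‖ₑ)
            ((unif B).prod (unif B)) := (hPm.comp_fst.sub hPm.comp_snd).enorm
        exact this.lintegral_prod_right'.pow_const m
    _ ≤ (L ^ m * (d ^ m * 2 ^ (m + n) * (∫⁻ x, ‖g x‖ₑ ^ q ∂unif B) ^ (m / q))) ^ (q / m) := by
        gcongr
    _ = ((L ^ m * 2 ^ (m + n)) * (d ^ m) * (∫⁻ x, ‖g x‖ₑ ^ q ∂unif B) ^ (m / q)) ^ (q / m) := by
        congr 1; ring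
    _ = _ := by
        have hqm : 0 ≤ q / m := by positivity
        rw [ENNReal.mul_rpow_of_nonneg _ _ hqm, ENNReal.mul_rpow_of_nonneg _ _ hqm, sobolevConst,
          ← ENNReal.rpow_mul, ← ENNReal.rpow_mul, mul_div_cancel₀ _ hm0.ne']
        rw [show m / q * (q / m) = 1 by field_simp, ENNReal.rpow_one]

theorem lintegral_sub_weightedMean_sq_le (he : IsExponents n α q m s)
    (h : IsSobolevOn B f g) (hB : Convex ℝ B)
    (hBm : MeasurableSet B) (h0 : volume B ≠ 0) (ht : volume B ≠ ⊤) {d : ℝ≥0∞} (hdt : d ≠ ⊤)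
    (hd : ∀ x ∈ B, ∀ y ∈ B, ‖x - y‖ₑ ≤ d) {w : Space n → ℝ} (hw : Continuous w)
    (hw0 : ∀ x, 0 ≤ w x) (hw1 : ∀ x, w x ≤ 1) {L : ℝ≥0∞}
    (hL : volume B ≤ L * ENNReal.ofReal (∫ y in B, w y)) :
    ∫⁻ x, ‖f x - weightedMean B w f‖ₑ ^ (2:ℝ) ∂unif B ≤
      sobolevConst n m q L ^ (2 / q) * d ^ (2:ℝ) * ∫⁻ x, ‖g x‖ₑ ^ (2:ℝ) ∂unif B := by
  have hq0 : 0 < q := by linarith [he.one_le]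
  have hm0 : 0 < m := by linarith [he.two_le]
  have hP := isProbabilityMeasure_unif h0 ht
  have hPm := h.memLp.aestronglyMeasurable.mono_ac (unif_absolutelyContinuous B)
  have hPg := h.memLp_grad.aestronglyMeasurable.mono_ac (unif_absolutelyContinuous B)
  have h1 := lintegral_sub_weightedMean_rpow_le he h hB hBm h0 ht hdt hd hw hw0 hw1 hL
  have hq2 : 0 ≤ 2 / q := by positivity
  have h2q : 1 ≤ 2 / q := by
    rw [le_div_iff₀ hq0]; linarith [he.eq_two_mul, he.lt_one]
  have hm2 : 1 ≤ m / 2 := by linarith [he.two_le]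
  set V := ∫⁻ x, ‖f x - weightedMean B w f‖ₑ ^ m ∂unif B with hV
  have hJ : (∫⁻ x, ‖f x - weightedMean B w f‖ₑ ^ (2:ℝ) ∂unif B) ^ (m / 2) ≤ V := by
    refine (lintegral_rpow_le_of_isProbabilityMeasure
      (((hPm.sub aestronglyMeasurable_const).enorm).pow_const _) hm2).trans (le_of_eq ?_)
    refine lintegral_congr fun x => ?_
    rw [← ENNReal.rpow_mul]; congr 1; ring
  have hJ2 : ∫⁻ x, ‖f x - weightedMean B w f‖ₑ ^ (2:ℝ) ∂unif B ≤ (V ^ (q / m)) ^ (2 / q) := by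
    rw [← ENNReal.rpow_mul, show q / m * (2 / q) = (m / 2)⁻¹ by field_simp]
    exact (ENNReal.le_rpow_inv_iff (by positivity)).2 hJ
  refine hJ2.trans ((ENNReal.rpow_le_rpow h1 hq2).trans ?_)
  rw [ENNReal.mul_rpow_of_nonneg _ _ hq2, ENNReal.mul_rpow_of_nonneg _ _ hq2, ← ENNReal.rpow_mul,
    mul_div_cancel₀ _ hq0.ne']
  gcongr
  refine (lintegral_rpow_le_of_isProbabilityMeasure (hPg.enorm.pow_const _) h2q).trans
    (le_of_eq (lintegral_congr fun x => ?_))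
  rw [← ENNReal.rpow_mul, mul_div_cancel₀ _ hq0.ne']

/-- The weighted `L²` estimate of a slice: only a fraction `1 - α` of the mean square oscillation
of `f` enters, the rest is paid by the gradient in the lower power `q < 2`. -/
theorem lintegral_sq_mul_sub_sq_le (he : IsExponents n α q m s)
    (h : IsSobolevOn B f g) (hB : Convex ℝ B)
    (hBm : MeasurableSet B) (h0 : volume B ≠ 0) (ht : volume B ≠ ⊤) {d : ℝ≥0∞} (hdt : d ≠ ⊤)
    (hd : ∀ x ∈ B, ∀ y ∈ B, ‖x - y‖ₑ ≤ d) {w : Space n → ℝ} (hw : Continuous w)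
    (hw0 : ∀ x, 0 ≤ w x) (hw1 : ∀ x, w x ≤ 1) {L : ℝ≥0∞}
    (hL : volume B ≤ L * ENNReal.ofReal (∫ y in B, w y)) {K : Space n → ℝ≥0∞}
    (hK : AEMeasurable K (unif B)) {κ : ℝ≥0∞} (hKκ : ∫⁻ x, K x ^ (s:ℝ) ∂unif B ≤ κ) (c : ℝ) :
    ∫⁻ x, K x ^ (2:ℝ) * ‖f x - c‖ₑ ^ (2:ℝ) ∂unif B ≤ 2 * κ ^ (2 / (s:ℝ)) *
      ((∫⁻ x, ‖f x - weightedMean B w f‖ₑ ^ (2:ℝ) ∂unif B) ^ (1 - α) *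
        (sobolevConst n m q L * d ^ q * ∫⁻ x, ‖g x‖ₑ ^ q ∂unif B) +
        ‖weightedMean B w f - c‖ₑ ^ (2:ℝ)) := by
  have hs : (0:ℝ) < s := by linarith [he.two_le, he.le_s]
  have hP := isProbabilityMeasure_unif h0 ht
  have hPm := h.memLp.aestronglyMeasurable.mono_ac (unif_absolutelyContinuous B)
  set b := weightedMean B w f with hb
  have hKb : (∫⁻ x, K x ^ (s:ℝ) ∂unif B) ^ (2 / (s:ℝ)) ≤ κ ^ (2 / (s:ℝ)) := by gcongr
  -- the deviation from `c` is split at the weighted mean `b`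
  have h1 : ∫⁻ x, K x ^ (2:ℝ) * ‖f x - b‖ₑ ^ (2:ℝ) ∂unif B ≤ κ ^ (2 / (s:ℝ)) *
      ((∫⁻ x, ‖f x - b‖ₑ ^ (2:ℝ) ∂unif B) ^ (1 - α) *
        (sobolevConst n m q L * d ^ q * ∫⁻ x, ‖g x‖ₑ ^ q ∂unif B)) := by
    refine (lintegral_sq_mul_sq_le he hK (hPm.sub aestronglyMeasurable_const).enorm).trans ?_
    rw [mul_assoc]
    exact mul_le_mul' hKb (mul_le_mul' le_rfl
      (lintegral_sub_weightedMean_rpow_le he h hB hBm h0 ht hdt hd hw hw0 hw1 hL))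
  have h2 : ∫⁻ x, K x ^ (2:ℝ) ∂unif B ≤ κ ^ (2 / (s:ℝ)) := by
    refine le_trans ?_ hKb
    rw [show 2 / (s:ℝ) = ((s:ℝ) / 2)⁻¹ by rw [inv_div], ENNReal.le_rpow_inv_iff (by positivity)]
    refine (lintegral_rpow_le_of_isProbabilityMeasure (hK.pow_const _)
      (by linarith [he.two_le, he.le_s])).trans (le_of_eq (lintegral_congr fun x => ?_))
    rw [← ENNReal.rpow_mul]; congr 1; ring
  calc ∫⁻ x, K x ^ (2:ℝ) * ‖f x - c‖ₑ ^ (2:ℝ) ∂unif B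
      ≤ ∫⁻ x, 2 * (K x ^ (2:ℝ) * ‖f x - b‖ₑ ^ (2:ℝ)) +
          2 * ‖b - c‖ₑ ^ (2:ℝ) * K x ^ (2:ℝ) ∂unif B := by
        refine lintegral_mono fun x => ?_
        have h3 : ‖f x - c‖ₑ ≤ ‖f x - b‖ₑ + ‖b - c‖ₑ := by
          rw [← sub_add_sub_cancel (f x) b c]; exact enorm_add_le _ _
        have h4 : ‖f x - c‖ₑ ^ (2:ℝ) ≤ 2 * (‖f x - b‖ₑ ^ (2:ℝ) + ‖b - c‖ₑ ^ (2:ℝ)) := by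
          refine (ENNReal.rpow_le_rpow h3 (by norm_num)).trans ?_
          refine (ENNReal.rpow_add_le_mul_rpow_add_rpow _ _ (by norm_num)).trans (le_of_eq ?_)
          norm_num
        calc K x ^ (2:ℝ) * ‖f x - c‖ₑ ^ (2:ℝ)
            ≤ K x ^ (2:ℝ) * (2 * (‖f x - b‖ₑ ^ (2:ℝ) + ‖b - c‖ₑ ^ (2:ℝ))) := by gcongr
          _ = _ := by ring
    _ = 2 * (∫⁻ x, K x ^ (2:ℝ) * ‖f x - b‖ₑ ^ (2:ℝ) ∂unif B) +
          2 * ‖b - c‖ₑ ^ (2:ℝ) * ∫⁻ x, K x ^ (2:ℝ) ∂unif B := by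
        have hm1 : AEMeasurable (fun x => K x ^ (2:ℝ) * ‖f x - b‖ₑ ^ (2:ℝ)) (unif B) :=
          (hK.pow_const _).mul ((hPm.sub aestronglyMeasurable_const).enorm.pow_const _)
        rw [lintegral_add_left' (hm1.const_mul _), lintegral_const_mul'' _ hm1,
          lintegral_const_mul'' _ (hK.pow_const _)]
    _ ≤ 2 * (κ ^ (2 / (s:ℝ)) * ((∫⁻ x, ‖f x - b‖ₑ ^ (2:ℝ) ∂unif B) ^ (1 - α) *
        (sobolevConst n m q L * d ^ q * ∫⁻ x, ‖g x‖ₑ ^ q ∂unif B))) +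
          2 * ‖b - c‖ₑ ^ (2:ℝ) * κ ^ (2 / (s:ℝ)) := by gcongr
    _ = _ := by ring

end SliceEstimates

end ParabolicBMO

namespace ParabolicBMO
open Filter Topology

/-! ### Weak derivatives on an interval -/

section WeakDerivative

variable {a b : ℝ} {f g : ℝ → ℝ}

/-- A smooth function with compact support in `]a, b[` and mean zero is the derivative of such a
function. -/
theorem exists_primitive_of_integral_eq_zero (hab : a < b) {η : ℝ → ℝ} (hη : ContDiff ℝ ∞ η)
    (hηc : HasCompactSupport η) (hηJ : tsupport η ⊆ Ioo a b) (h0 : ∫ t in a..b, η t = 0) :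
    ∃ θ : ℝ → ℝ, ContDiff ℝ ∞ θ ∧ HasCompactSupport θ ∧ tsupport θ ⊆ Ioo a b ∧ deriv θ = η := by
  obtain ⟨a', b', ha', hb', hsub⟩ : ∃ a' b', a < a' ∧ b' < b ∧ tsupport η ⊆ Icc a' b' := by
    rcases (tsupport η).eq_empty_or_nonempty with he | hne
    · obtain ⟨c, hc1, hc2⟩ := exists_between hab
      exact ⟨c, c, hc1, hc2, by rw [he]; exact empty_subset _⟩
    · obtain ⟨x, hx⟩ := hηc.isCompact.exists_isLeast hne
      obtain ⟨y, hy⟩ := hηc.isCompact.exists_isGreatest hne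
      exact ⟨x, y, (hηJ hx.1).1, (hηJ hy.1).2, fun z hz => ⟨hx.2 hz, hy.2 hz⟩⟩
  have hz : ∀ t, t ∉ Icc a' b' → η t = 0 := fun t ht =>
    image_eq_zero_of_notMem_tsupport fun h => ht (hsub h)
  -- the primitive vanishes to the left of the support, and to the right because the mean is zero
  set θ : ℝ → ℝ := fun t => ∫ s in a..t, η s with hθ
  have hd : ∀ t, HasDerivAt θ (η t) t := fun t =>
    intervalIntegral.integral_hasDerivAt_right (hη.continuous.intervalIntegrable _ _)
      (hη.continuous.stronglyMeasurableAtFilter _ _) hη.continuous.continuousAt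
  have hderiv : deriv θ = η := funext fun t => (hd t).deriv
  have hleft : ∀ t, t < a' → θ t = 0 := by
    intro t ht
    refine intervalIntegral.integral_zero_ae (Eventually.of_forall fun s hs => hz s fun h => ?_)
    rcases uIoc_subset_uIcc hs with ⟨_, h2⟩
    have : s < a' := lt_of_le_of_lt h2 (sup_lt_iff.2 ⟨ha', ht⟩)
    linarith [h.1]
  have hright : ∀ t, b' < t → θ t = 0 := by
    intro t ht
    have h1 : θ t = (∫ s in a..b, η s) + ∫ s in b..t, η s :=
      (intervalIntegral.integral_add_adjacent_intervals (hη.continuous.intervalIntegrable _ _)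
        (hη.continuous.intervalIntegrable _ _)).symm
    rw [h1, h0, zero_add]
    refine intervalIntegral.integral_zero_ae (Eventually.of_forall fun s hs => hz s fun h => ?_)
    rcases uIoc_subset_uIcc hs with ⟨h2, _⟩
    have : b' < s := lt_of_lt_of_le (lt_inf_iff.2 ⟨hb', ht⟩) h2
    linarith [h.2]
  have hts : tsupport θ ⊆ Icc a' b' := by
    refine closure_minimal (fun t ht => ?_) isClosed_Icc
    by_contra hcon
    rcases not_and_or.1 hcon with h | h
    · exact ht (hleft t (not_le.1 h))
    · exact ht (hright t (not_le.1 h))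
  refine ⟨θ, ?_, isCompact_Icc.of_isClosed_subset (isClosed_tsupport _) hts,
    hts.trans (Icc_subset_Ioo ha' hb'), hderiv⟩
  rw [contDiff_infty_iff_deriv, hderiv]
  exact ⟨fun t => (hd t).differentiableAt, hη⟩

/-- **du Bois-Reymond**: a function with weak derivative `-g` is a primitive of `-g`. -/
theorem ae_eq_const_sub_integral_of_weak_deriv (hab : a < b) (hf : IntegrableOn f (Ioo a b))
    (hg : IntegrableOn g (Ioo a b))
    (h : ∀ θ : ℝ → ℝ, ContDiff ℝ ∞ θ → HasCompactSupport θ → tsupport θ ⊆ Ioo a b →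
      ∫ t in Ioo a b, f t * deriv θ t = ∫ t in Ioo a b, g t * θ t) :
    ∃ K, ∀ᵐ t ∂volume.restrict (Ioo a b), f t = K - ∫ s in a..t, g s := by
  have hset : ∀ φ : ℝ → ℝ, ∫ t in a..b, φ t = ∫ t in Ioo a b, φ t := fun φ => by
    rw [intervalIntegral.integral_of_le hab.le, integral_Ioc_eq_integral_Ioo]
  have hgi : IntervalIntegrable g volume a b := by
    rw [intervalIntegrable_iff_integrableOn_Ioo_of_le hab.le]; exact hg
  set G : ℝ → ℝ := fun t => ∫ s in a..t, g s with hG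
  have hGac : AbsolutelyContinuousOnInterval G a b :=
    hgi.absolutelyContinuousOnInterval_intervalIntegral left_mem_uIcc
  have hGc : ContinuousOn G (Icc a b) := by
    have := hGac.continuousOn; rwa [uIcc_of_le hab.le] at this
  have hGi : IntegrableOn G (Ioo a b) :=
    (hGc.integrableOn_Icc).mono_set Ioo_subset_Icc_self
  have hGd : ∀ᵐ t ∂volume.restrict (Ioo a b), deriv G t = g t := by
    rw [ae_restrict_iff' measurableSet_Ioo]
    filter_upwards [hgi.ae_hasDerivAt_integral] with t ht htab
    have ht' : t ∈ uIcc a b := by rw [uIcc_of_le hab.le]; exact Ioo_subset_Icc_self htab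
    exact (ht ht' a left_mem_uIcc).deriv
  have hbdd : ∀ (η : ℝ → ℝ) {φ : ℝ → ℝ}, ContDiff ℝ ∞ η → HasCompactSupport η →
      IntegrableOn φ (Ioo a b) → IntegrableOn (fun t => φ t * η t) (Ioo a b) := by
    intro η φ hη hηc hφ
    obtain ⟨C, hC⟩ := hηc.exists_bound_of_continuous hη.continuous
    exact Integrable.mul_bdd (c := C) hφ hη.continuous.aestronglyMeasurable
      (Eventually.of_forall hC)
  -- `H` has zero weak derivative, so it is constant
  set H : ℝ → ℝ := fun t => f t + G t with hH
  have hHi : IntegrableOn H (Ioo a b) := hf.add hGi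
  have hzero : ∀ θ : ℝ → ℝ, ContDiff ℝ ∞ θ → HasCompactSupport θ → tsupport θ ⊆ Ioo a b →
      ∫ t in Ioo a b, H t * deriv θ t = 0 := by
    intro θ hθ hθc hθJ
    have hθac : AbsolutelyContinuousOnInterval θ a b :=
      ContDiffOn.absolutelyContinuousOnInterval (hθ.of_le (by norm_cast)).contDiffOn
    have hθa : θ a = 0 := image_eq_zero_of_notMem_tsupport fun h => lt_irrefl _ (hθJ h).1
    have hθb : θ b = 0 := image_eq_zero_of_notMem_tsupport fun h => lt_irrefl _ (hθJ h).2
    have h1 := hGac.integral_mul_deriv_eq_deriv_mul hθac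
    rw [hθa, hθb, hset, hset] at h1
    have hθ' : ContDiff ℝ ∞ (deriv θ) := (contDiff_infty_iff_deriv.1 hθ).2
    have h2 := h θ hθ hθc hθJ
    have h3 : ∫ t in Ioo a b, deriv G t * θ t = ∫ t in Ioo a b, g t * θ t :=
      integral_congr_ae (hGd.mono fun t ht => by simp only [ht])
    simp only [hH, add_mul]
    rw [integral_add (hbdd _ hθ' hθc.deriv hf) (hbdd _ hθ' hθc.deriv hGi), h1, h2, h3]
    ring
  -- a normalized bump, used to correct the mean of a test function
  obtain ⟨θ₀, h01, h02, h03, h04⟩ : ∃ θ₀ : ℝ → ℝ, ContDiff ℝ ∞ θ₀ ∧ HasCompactSupport θ₀ ∧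
      tsupport θ₀ ⊆ Ioo a b ∧ ∫ t in Ioo a b, θ₀ t = 1 := by
    set B : ContDiffBump ((a + b) / 2) := ⟨(b - a) / 8, (b - a) / 4, by linarith, by linarith⟩
    have hsub : tsupport (B.normed volume) ⊆ Ioo a b := by
      rw [B.tsupport_normed_eq, Real.closedBall_eq_Icc]
      refine Icc_subset_Ioo ?_ ?_
      · change a < (a + b) / 2 - (b - a) / 4; linarith
      · change (a + b) / 2 + (b - a) / 4 < b; linarith
    refine ⟨B.normed volume, B.contDiff_normed, B.hasCompactSupport_normed, hsub, ?_⟩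
    rw [setIntegral_eq_integral_of_forall_compl_eq_zero, B.integral_normed]
    intro t ht
    exact image_eq_zero_of_notMem_tsupport fun h => ht (hsub h)
  set k : ℝ := ∫ t in Ioo a b, H t * θ₀ t with hk
  have hmain : ∀ᵐ t, t ∈ Ioo a b → H t - k = 0 := by
    refine isOpen_Ioo.ae_eq_zero_of_integral_contDiff_smul_eq_zero
      (hHi.sub (integrable_const k)).locallyIntegrableOn ?_
    intro η hη hηc hηJ
    -- after subtraction of `M • θ₀` the test function has mean zero, hence a compactly supported
    -- primitive
    set M : ℝ := ∫ t in Ioo a b, η t with hM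
    have hηi : IntegrableOn η (Ioo a b) := (hη.continuous.integrable_of_hasCompactSupport hηc).integrableOn
    have h0i : IntegrableOn θ₀ (Ioo a b) :=
      (h01.continuous.integrable_of_hasCompactSupport h02).integrableOn
    have hsm : ContDiff ℝ ∞ fun t => η t - M * θ₀ t := hη.sub (contDiff_const.mul h01)
    have htsub : tsupport (fun t => η t - M * θ₀ t) ⊆ tsupport η ∪ tsupport θ₀ := by
      refine closure_minimal (fun t ht => ?_) ((isClosed_tsupport _).union (isClosed_tsupport _))
      by_contra hcon
      rw [mem_union, not_or] at hcon
      refine ht ?_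
      simp only [image_eq_zero_of_notMem_tsupport hcon.1, image_eq_zero_of_notMem_tsupport hcon.2]
      ring
    obtain ⟨θ, hθ1, hθ2, hθ3, hθ4⟩ := exists_primitive_of_integral_eq_zero hab hsm
      ((hηc.isCompact.union h02.isCompact).of_isClosed_subset (isClosed_tsupport _) htsub)
      (htsub.trans (union_subset hηJ h03)) (by
        rw [hset, integral_sub hηi (h0i.const_mul M), integral_const_mul, h04, mul_one, sub_self])
    have h5 := hzero θ hθ1 hθ2 hθ3
    rw [hθ4] at h5
    have h6 : ∫ t in Ioo a b, H t * (η t - M * θ₀ t) =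
        (∫ t in Ioo a b, H t * η t) - M * k := by
      rw [hk, ← integral_const_mul, ← integral_sub (hbdd _ hη hηc hHi)
        ((hbdd _ h01 h02 hHi).const_mul M)]
      refine integral_congr_ae (Eventually.of_forall fun t => ?_)
      simp only; ring
    rw [h6] at h5
    have h7 : ∫ t, η t • (H t - k) = ∫ t in Ioo a b, (H t * η t - k * η t) := by
      rw [← setIntegral_eq_integral_of_forall_compl_eq_zero (s := Ioo a b)]
      · refine integral_congr_ae (Eventually.of_forall fun t => ?_)
        simp only [smul_eq_mul]; ring
      · intro t ht
        rw [image_eq_zero_of_notMem_tsupport fun h => ht (hηJ h), zero_smul]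
    rw [h7, integral_sub (hbdd _ hη hηc hHi) (hηi.const_mul k), integral_const_mul, ← hM]
    linarith
  refine ⟨k, ?_⟩
  rw [ae_restrict_iff' measurableSet_Ioo]
  filter_upwards [hmain] with t ht htab
  have := ht htab
  simp only [hH, hG] at this
  linarith

end WeakDerivative

/-! ### The equation tested with products of space and time cutoffs -/

section EnergyIdentities

variable {n : ℕ} {a d : Space n × ℝ → Matrix (Fin n) (Fin n) ℝ} {u : Space n × ℝ → ℝ}
  {Du : Space n × ℝ → Space n}

theorem parabolicBall_zero_one :
    parabolicBall (0 : Space n × ℝ) 1 = ball 0 1 ×ˢ Ioo (-1) 0 := by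
  rw [parabolicBall_zero]; norm_num

/-- The flux `∫ (A ∇u)(·, t) · ∇ψ` through the cutoff `ψ` at time `t`. -/
noncomputable def flux (a d : Space n × ℝ → Matrix (Fin n) (Fin n) ℝ)
    (Du : Space n × ℝ → Space n) (ψ : Space n → ℝ) (t : ℝ) : ℝ :=
  ∫ x in ball 0 1, pairing (a (x, t) + d (x, t)) (Du (x, t)) (gradient ψ x)

/-- `∫ ψ u(·, t)`. -/
noncomputable def localMass (u : Space n × ℝ → ℝ) (ψ : Space n → ℝ) (t : ℝ) : ℝ :=
  ∫ x in ball 0 1, ψ x * u (x, t)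

theorem pairing_smul_right (M : Matrix (Fin n) (Fin n) ℝ) (c : ℝ) (v w : Space n) :
    pairing M v (c • w) = c * pairing M v w := by
  simp only [pairing, Finset.mul_sum]
  refine Finset.sum_congr rfl fun i _ => Finset.sum_congr rfl fun j _ => ?_
  simp; ring

namespace IsSuitableWeakSolution

variable (hu : IsSuitableWeakSolution a d 1 u Du) {ψ : Space n → ℝ} (hψ : ContDiff ℝ ∞ ψ)
  (hψc : HasCompactSupport ψ) (hψB : tsupport ψ ⊆ ball 0 1)
include hu hψ hψc hψB

theorem integrableOn_pairing {t₁ t₂ : ℝ} (h1 : -1 < t₁) (h2 : t₂ < 0) :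
    IntegrableOn (fun z => pairing (a z + d z) (Du z) (gradient ψ z.1))
      (ball 0 1 ×ˢ Ioo t₁ t₂) := by
  rcases le_or_gt t₂ t₁ with h12 | h12
  · rw [Ioo_eq_empty (not_lt.2 h12), prod_empty]; exact integrableOn_empty
  -- a time cutoff equal to one on `]t₁, t₂[`, so that the integrability in the weak formulation
  -- carries over
  set ε : ℝ := min (t₁ + 1) (-t₂) with hε
  have hε0 : 0 < ε := lt_min (by linarith) (by linarith)
  have hε1 : ε ≤ t₁ + 1 := min_le_left _ _
  have hε2 : ε ≤ -t₂ := min_le_right _ _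
  set b : ContDiffBump (-(1/2) : ℝ) := ⟨1/2 - ε, 1/2 - ε/2, by linarith, by linarith⟩
  have hb : tsupport b ⊆ Ioo (-1) 0 := by
    rw [b.tsupport_eq, Real.closedBall_eq_Icc]
    refine Icc_subset_Ioo ?_ ?_
    · change -1 < -(1/2) - (1/2 - ε/2); linarith
    · change -(1/2) + (1/2 - ε/2) < 0; linarith
  have h := (hu.weakForm _ (by
    rw [parabolicBall_zero_one]
    exact isTestFunction_mul hψ hψc hψB b.contDiff b.hasCompactSupport hb)).1
  rw [parabolicBall_zero_one] at h
  have hs : ball (0 : Space n) 1 ×ˢ Ioo t₁ t₂ ⊆ ball 0 1 ×ˢ Ioo (-1) 0 :=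
    prod_mono subset_rfl (Ioo_subset_Ioo h1.le h2.le)
  refine (h.mono_set hs).congr ?_
  filter_upwards [ae_restrict_mem (measurableSet_ball.prod measurableSet_Ioo)] with z hz
  rw [spatialGrad_mul ψ b (hψ.differentiable (by norm_cast)), pairing_smul_right,
    b.one_of_mem_closedBall, one_mul]
  rw [Real.closedBall_eq_Icc]
  refine ⟨?_, ?_⟩
  · change -(1/2) - (1/2 - ε) ≤ _; linarith [hz.2.1]
  · change _ ≤ -(1/2) + (1/2 - ε); linarith [hz.2.2]

theorem integrableOn_flux {t₁ t₂ : ℝ} (h1 : -1 < t₁) (h2 : t₂ < 0) :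
    IntegrableOn (flux a d Du ψ) (Ioo t₁ t₂) :=
  integrableOn_integral_slice (hu.integrableOn_pairing hψ hψc hψB h1 h2)

omit hψB in
theorem integrableOn_mul_u :
    IntegrableOn (fun z => ψ z.1 * u z) (ball 0 1 ×ˢ Ioo (-1) 0) := by
  have hfin : IsFiniteMeasure ((volume : Measure (Space n × ℝ)).restrict
      (ball 0 1 ×ˢ Ioo (-1) 0)) :=
    ⟨by rw [Measure.restrict_apply_univ, Measure.volume_eq_prod, Measure.prod_prod]
        exact ENNReal.mul_lt_top measure_ball_lt_top measure_Ioo_lt_top⟩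
  have h1 := hu.memW.memLp
  rw [parabolicBall_zero_one] at h1
  obtain ⟨C, hC⟩ := hψc.exists_bound_of_continuous hψ.continuous
  exact (h1.integrable (by norm_num)).bdd_mul (c := C)
    (hψ.continuous.comp continuous_fst).aestronglyMeasurable (Eventually.of_forall fun z => hC z.1)

omit hψB in
theorem integrableOn_localMass : IntegrableOn (localMass u ψ) (Ioo (-1) 0) :=
  integrableOn_integral_slice (hu.integrableOn_mul_u hψ hψc)

/-- The equation, tested with `ψ`: the weak time derivative of `∫ ψ u` is minus the flux. -/
theorem integral_localMass_mul_deriv {θ : ℝ → ℝ} (hθ : ContDiff ℝ ∞ θ)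
    (hθc : HasCompactSupport θ) {t₁ t₂ : ℝ} (h1 : -1 < t₁) (h2 : t₂ < 0)
    (hθJ : tsupport θ ⊆ Ioo t₁ t₂) :
    ∫ t in Ioo t₁ t₂, localMass u ψ t * deriv θ t = ∫ t in Ioo t₁ t₂, flux a d Du ψ t * θ t := by
  have hJ : Ioo t₁ t₂ ⊆ Ioo (-1) 0 := Ioo_subset_Ioo h1.le h2.le
  have hw := hu.weakForm _ (by
    rw [parabolicBall_zero_one]
    exact isTestFunction_mul hψ hψc hψB hθ hθc (hθJ.trans hJ))
  rw [parabolicBall_zero_one] at hw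
  obtain ⟨hwi, hw⟩ := hw
  obtain ⟨C, hC⟩ := hθc.deriv.exists_bound_of_continuous
    (contDiff_infty_iff_deriv.1 hθ).2.continuous
  have hi : IntegrableOn (fun z => u z * timeDeriv (fun z : Space n × ℝ => ψ z.1 * θ z.2) z)
      (ball 0 1 ×ˢ Ioo (-1) 0) := by
    simp only [timeDeriv_mul]
    have := (hu.integrableOn_mul_u hψ hψc).bdd_mul (c := C)
      (f := fun z : Space n × ℝ => deriv θ z.2)
      ((contDiff_infty_iff_deriv.1 hθ).2.continuous.comp continuous_snd).aestronglyMeasurable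
      (Eventually.of_forall fun z => hC z.2)
    refine this.congr (Eventually.of_forall fun z => ?_)
    simp only; ring
  rw [setIntegral_prod_slices hi, setIntegral_prod_slices hwi] at hw
  have hz : ∀ t, t ∉ Ioo t₁ t₂ → θ t = 0 ∧ deriv θ t = 0 := fun t ht =>
    ⟨image_eq_zero_of_notMem_tsupport fun h => ht (hθJ h),
      image_eq_zero_of_notMem_tsupport fun h => ht (hθJ (tsupport_deriv_subset h))⟩
  have e1 : ∀ φ : ℝ → ℝ, (∀ t, t ∉ Ioo t₁ t₂ → φ t = 0) →
      ∫ t in Ioo t₁ t₂, φ t = ∫ t in Ioo (-1) 0, φ t := fun φ hφ => by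
    rw [setIntegral_eq_integral_of_forall_compl_eq_zero hφ,
      setIntegral_eq_integral_of_forall_compl_eq_zero fun t ht => hφ t fun h => ht (hJ h)]
  rw [e1 _ fun t ht => by rw [(hz t ht).2, mul_zero], e1 _ fun t ht => by rw [(hz t ht).1, mul_zero]]
  refine (integral_congr_ae (Eventually.of_forall fun t => ?_)).trans
    (hw.trans (integral_congr_ae (Eventually.of_forall fun t => ?_)))
  · simp only [localMass, timeDeriv_mul]
    rw [← integral_mul_const]
    refine integral_congr_ae (Eventually.of_forall fun x => ?_)
    simp only; ring
  · simp only [flux]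
    rw [← integral_mul_const]
    refine integral_congr_ae (Eventually.of_forall fun x => ?_)
    simp only [spatialGrad_mul ψ θ (hψ.differentiable (by norm_cast)), pairing_smul_right]
    ring

/-- Almost everywhere in time, the local mass is a primitive of minus the flux. -/
theorem exists_localMass_eq {t₁ t₂ : ℝ} (h1 : -1 < t₁) (h12 : t₁ < t₂) (h2 : t₂ < 0) :
    ∃ K, ∀ᵐ t ∂volume.restrict (Ioo t₁ t₂),
      localMass u ψ t = K - ∫ s in t₁..t, flux a d Du ψ s :=
  ae_eq_const_sub_integral_of_weak_deriv h12
    ((hu.integrableOn_localMass hψ hψc).mono_set (Ioo_subset_Ioo h1.le h2.le))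
    (hu.integrableOn_flux hψ hψc hψB h1 h2)
    fun _ hθ hθc hθJ => hu.integral_localMass_mul_deriv hψ hψc hψB hθ hθc h1 h2 hθJ

/-- The equation, tested with `ψ χ` up to the time `t`. -/
theorem mul_localMass_eq_integral {χ : ℝ → ℝ} (hχ : ContDiff ℝ ∞ χ) {t₁ t₁' t₂ : ℝ}
    (h1 : -1 < t₁) (h11 : t₁ < t₁') (h12 : t₁ < t₂) (h2 : t₂ < 0) (hχ0 : ∀ t < t₁', χ t = 0) :
    IntegrableOn (fun s => deriv χ s * localMass u ψ s - χ s * flux a d Du ψ s) (Ioo t₁ t₂) ∧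
    ∀ᵐ t ∂volume.restrict (Ioo t₁ t₂), χ t * localMass u ψ t =
      ∫ s in t₁..t, (deriv χ s * localMass u ψ s - χ s * flux a d Du ψ s) := by
  have hJ : Ioo t₁ t₂ ⊆ Ioo (-1) 0 := Ioo_subset_Ioo h1.le h2.le
  have hF := (hu.integrableOn_localMass hψ hψc).mono_set hJ
  have hg := hu.integrableOn_flux hψ hψc hψB h1 h2
  have hχ' : ContDiff ℝ ∞ (deriv χ) := (contDiff_infty_iff_deriv.1 hχ).2
  have hbd : ∀ {η φ : ℝ → ℝ}, Continuous η → IntegrableOn φ (Ioo t₁ t₂) →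
      IntegrableOn (fun t => η t * φ t) (Ioo t₁ t₂) := by
    intro η φ hη hφ
    obtain ⟨C, hC⟩ := (isCompact_Icc (a := t₁) (b := t₂)).exists_bound_of_continuousOn
      hη.continuousOn
    refine Integrable.bdd_mul (c := C) hφ hη.aestronglyMeasurable ?_
    filter_upwards [ae_restrict_mem measurableSet_Ioo] with t ht using
      hC t (Ioo_subset_Icc_self ht)
  have hi1 := hbd hχ.continuous hF
  have hi2 := hbd hχ'.continuous hF
  have hi3 := hbd hχ.continuous hg
  refine ⟨hi2.sub hi3, ?_⟩
  obtain ⟨K, hK⟩ := ae_eq_const_sub_integral_of_weak_deriv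
    (f := fun t => χ t * localMass u ψ t)
    (g := fun s => χ s * flux a d Du ψ s - deriv χ s * localMass u ψ s) h12 hi1 (hi3.sub hi2) (by
      intro θ hθ hθc hθJ
      have hθ' : ContDiff ℝ ∞ (deriv θ) := (contDiff_infty_iff_deriv.1 hθ).2
      have h3 := hu.integral_localMass_mul_deriv hψ hψc hψB (hχ.mul hθ) hθc.mul_left h1 h2
        ((tsupport_mul_subset_right).trans hθJ)
      have hder : ∀ t, deriv (fun t => χ t * θ t) t = deriv χ t * θ t + χ t * deriv θ t :=
        fun t => deriv_fun_mul ((hχ.differentiable (by norm_cast)).differentiableAt)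
          ((hθ.differentiable (by norm_cast)).differentiableAt)
      have hder' : deriv (χ * θ) = fun t => deriv χ t * θ t + χ t * deriv θ t := by
        funext t; exact hder t
      have e1 : ∫ t in Ioo t₁ t₂, localMass u ψ t * deriv (χ * θ) t =
          (∫ t in Ioo t₁ t₂, θ t * (deriv χ t * localMass u ψ t)) +
            ∫ t in Ioo t₁ t₂, χ t * localMass u ψ t * deriv θ t := by
        rw [← integral_add (hbd hθ.continuous hi2)
          ((hbd hθ'.continuous hi1).congr (Eventually.of_forall fun t => mul_comm _ _)), hder']
        refine integral_congr_ae (Eventually.of_forall fun t => ?_)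
        simp only; ring
      have e2 : ∫ t in Ioo t₁ t₂, (χ t * flux a d Du ψ t - deriv χ t * localMass u ψ t) * θ t =
          (∫ t in Ioo t₁ t₂, flux a d Du ψ t * (χ * θ) t) -
            ∫ t in Ioo t₁ t₂, θ t * (deriv χ t * localMass u ψ t) := by
        rw [← integral_sub _ (hbd hθ.continuous hi2)]
        · refine integral_congr_ae (Eventually.of_forall fun t => ?_)
          simp only [Pi.mul_apply]; ring
        · refine (hbd hθ.continuous hi3).congr (Eventually.of_forall fun t => ?_)
          simp only [Pi.mul_apply]; ring
      change ∫ t in Ioo t₁ t₂, localMass u ψ t * deriv (χ * θ) t =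
        ∫ t in Ioo t₁ t₂, flux a d Du ψ t * (χ * θ) t at h3
      linarith)
  -- the constant of integration vanishes: it is read off at a time before `t₁'`, where `χ = 0`
  have hK0 : K = 0 := by
    have hne : ∃ t ∈ Ioo t₁ (min t₁' t₂),
        χ t * localMass u ψ t = K - ∫ s in t₁..t,
          (χ s * flux a d Du ψ s - deriv χ s * localMass u ψ s) := by
      have hsub : Ioo t₁ (min t₁' t₂) ⊆ Ioo t₁ t₂ := Ioo_subset_Ioo_right (min_le_right _ _)
      have hK' := ae_restrict_of_ae_restrict_of_subset hsub hK
      rw [ae_restrict_iff' measurableSet_Ioo] at hK'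
      by_contra hcon
      push Not at hcon
      have hz : volume (Ioo t₁ (min t₁' t₂)) = 0 := by
        refine measure_mono_null (fun t ht => ?_) hK'
        simp only [mem_compl_iff, mem_ofPred_eq]
        exact fun h => hcon t ht (h ht)
      rw [Real.volume_Ioo, ENNReal.ofReal_eq_zero] at hz
      have := lt_min h11 h12
      linarith
    obtain ⟨t, ht, hte⟩ := hne
    have ht' : t < t₁' := ht.2.trans_le (min_le_left _ _)
    rw [hχ0 t ht', zero_mul] at hte
    have : ∫ s in t₁..t, (χ s * flux a d Du ψ s - deriv χ s * localMass u ψ s) = 0 := by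
      refine intervalIntegral.integral_zero_ae (Eventually.of_forall fun s hs => ?_)
      rw [uIoc_of_le ht.1.le] at hs
      have hs' : s < t₁' := hs.2.trans_lt ht'
      have hd : deriv χ s = 0 := by
        have : χ =ᶠ[𝓝 s] fun _ => 0 := by
          filter_upwards [Iio_mem_nhds hs'] with r hr using hχ0 r hr
        rw [this.deriv_eq, deriv_const]
      rw [hχ0 s hs', hd]; ring
    rw [this] at hte
    linarith
  filter_upwards [hK] with t ht
  rw [ht, hK0, zero_sub, ← intervalIntegral.integral_neg]
  refine intervalIntegral.integral_congr fun s _ => ?_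
  ring

end IsSuitableWeakSolution

end EnergyIdentities

end ParabolicBMO

namespace ParabolicBMO
open Filter Topology

/-! ### The local energy inequality for `u - c` -/

section EnergyInequality

variable {n : ℕ} {a d : Space n × ℝ → Matrix (Fin n) (Fin n) ℝ} {u : Space n × ℝ → ℝ}
  {Du : Space n × ℝ → Space n}

/-- A property that holds almost everywhere up to every earlier time holds almost everywhere. -/
theorem ae_restrict_Ioo_of_forall_lt {p : ℝ → Prop} {a b : ℝ}
    (h : ∀ t < b, ∀ᵐ s ∂volume.restrict (Ioo a t), p s) :
    ∀ᵐ s ∂volume.restrict (Ioo a b), p s := by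
  have hU : Ioo a b ⊆ ⋃ k : ℕ, Ioo a (b - 1 / ((k : ℝ) + 1)) := by
    intro t ht
    obtain ⟨k, hk⟩ := exists_nat_one_div_lt (sub_pos.2 ht.2)
    exact mem_iUnion.2 ⟨k, ht.1, by linarith⟩
  refine ae_restrict_of_ae_restrict_of_subset hU ?_
  rw [ae_restrict_iUnion_iff]
  intro k
  refine h _ ?_
  have : (0:ℝ) < 1 / ((k : ℝ) + 1) := by positivity
  linarith

/-- The right-hand side of the local energy inequality for `u - c` and the cutoff `ψ χ`, at
time `s`. -/
noncomputable def energyRate (a d : Space n × ℝ → Matrix (Fin n) (Fin n) ℝ)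
    (u : Space n × ℝ → ℝ) (Du : Space n × ℝ → Space n) (ψ : Space n → ℝ) (χ : ℝ → ℝ)
    (c s : ℝ) : ℝ :=
  1 / 2 * deriv χ s * (∫ x in ball 0 1, ψ x * (u (x, s) - c) ^ 2)
    - χ s * (∫ x in ball 0 1,
        pairing (a (x, s) + d (x, s)) (Du (x, s)) (gradient ψ x) * (u (x, s) - c))
    - χ s * ∫ x in ball 0 1, ψ x * pairing (a (x, s)) (Du (x, s)) (Du (x, s))

theorem integral_linear_combination {X : Type*} [MeasurableSpace X] {μ : Measure X}
    {A B D W Z : X → ℝ} (hA : Integrable A μ) (hB : Integrable B μ) (hD : Integrable D μ)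
    (hW : Integrable W μ) (hZ : Integrable Z μ) (b c k : ℝ) :
    Integrable (fun x => b * A x - B x - D x - c * W x + k * Z x) μ ∧
    ∫ x, (b * A x - B x - D x - c * W x + k * Z x) ∂μ =
      b * (∫ x, A x ∂μ) - (∫ x, B x ∂μ) - (∫ x, D x ∂μ) - c * (∫ x, W x ∂μ) +
        k * ∫ x, Z x ∂μ := by
  have h1 : Integrable (fun x => b * A x - B x) μ := (hA.const_mul b).sub hB
  have h2 : Integrable (fun x => b * A x - B x - D x) μ := h1.sub hD
  have h3 : Integrable (fun x => b * A x - B x - D x - c * W x) μ := h2.sub (hW.const_mul c)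
  refine ⟨h3.add (hZ.const_mul k), ?_⟩
  rw [integral_add h3 (hZ.const_mul k), integral_sub h2 (hW.const_mul c), integral_sub h1 hD,
    integral_sub (hA.const_mul b) hB, integral_const_mul, integral_const_mul, integral_const_mul]

theorem IsEllipticOn.integrableOn_mul_pairing {ν : ℝ} {J : Set ℝ}
    (ha : IsEllipticOn ν (ball 0 1 ×ˢ J) a) (hν : 0 < ν)
    (hDu : MemLp Du 2 (volume.restrict (ball 0 1 ×ˢ J))) {φ : Space n × ℝ → ℝ}
    (hφ : Continuous φ) (hφc : HasCompactSupport φ) :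
    IntegrableOn (fun z => φ z * pairing (a z) (Du z) (Du z)) (ball 0 1 ×ˢ J) := by
  obtain ⟨C, hC⟩ := hφc.exists_bound_of_continuous hφ
  refine Integrable.bdd_mul (c := C) ?_ hφ.aestronglyMeasurable (Eventually.of_forall hC)
  have h2 := (memLp_two_iff_integrable_sq_norm hDu.aestronglyMeasurable).1 hDu
  refine (h2.const_mul ν⁻¹).mono' (aestronglyMeasurable_pairing ha.measurable
    hDu.aestronglyMeasurable hDu.aestronglyMeasurable) ?_
  filter_upwards [ha.lower, ha.upper] with z h3 h4
  have h5 : 0 ≤ pairing (a z) (Du z) (Du z) := le_trans (by positivity) (h3 (Du z))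
  rw [Real.norm_eq_abs, abs_of_nonneg h5]
  exact h4 _

namespace IsSuitableWeakSolution

/-- The local energy inequality holds for `u - c`, since the equation may be tested with the
cutoff itself. -/
theorem energy_sub_const (hu : IsSuitableWeakSolution a d 1 u Du) {ν : ℝ} (hν : 0 < ν)
    (ha : IsEllipticOn ν (parabolicBall 0 1) a) {ψ : Space n → ℝ} (hψ : ContDiff ℝ ∞ ψ)
    (hψc : HasCompactSupport ψ) (hψB : tsupport ψ ⊆ ball 0 1) (hψ0 : ∀ x, 0 ≤ ψ x)
    {χ : ℝ → ℝ} (hχ : ContDiff ℝ ∞ χ) (hχc : HasCompactSupport χ)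
    (hχJ : tsupport χ ⊆ Ioo (-1) 1) (hχ0 : ∀ t, 0 ≤ χ t) {t₁ t₁' : ℝ} (h1 : -1 < t₁)
    (h11 : t₁ < t₁') (hχz : ∀ t < t₁', χ t = 0) :
    ∀ᵐ t₀ ∂volume.restrict (Ioo t₁ 0), ∀ c,
      IntegrableOn (energyRate a d u Du ψ χ c) (Ioo t₁ t₀) ∧
      1 / 2 * χ t₀ * (∫ x in ball 0 1, ψ x * (u (x, t₀) - c) ^ 2) ≤
        ∫ s in Ioo t₁ t₀, energyRate a d u Du ψ χ c s := by
  have hfinB : IsFiniteMeasure ((volume : Measure (Space n)).restrict (ball 0 1)) :=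
    ⟨by rw [Measure.restrict_apply_univ]; exact measure_ball_lt_top⟩
  refine ae_restrict_Ioo_of_forall_lt fun t₂ h2 => ?_
  rcases le_or_gt t₂ t₁ with h12 | h12
  · rw [Ioo_eq_empty (not_lt.2 h12), Measure.restrict_empty]; rw [ae_zero]; trivial
  have hJ2 : Ioo t₁ t₂ ⊆ Ioo (-1) 0 := Ioo_subset_Ioo h1.le h2.le
  have hW := hu.memW
  rw [parabolicBall_zero_one] at hW
  rw [parabolicBall_zero_one] at ha
  have hloc := hu.localEnergy
  rw [show Ioo (-(1:ℝ) ^ 2) 0 = Ioo (-1) 0 by norm_num] at hloc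
  -- the equation tested with `ψ χ`, which pays for the term of first order in `c`
  obtain ⟨hWi, hWe⟩ := hu.mul_localMass_eq_integral hψ hψc hψB hχ h1 h11 h12 h2 hχz
  have hpi := hu.integrableOn_pairing hψ hψc hψB h1 h2
  have hχd : ContDiff ℝ ∞ (deriv χ) := (contDiff_infty_iff_deriv.1 hχ).2
  have hχdz : ∀ t < t₁', deriv χ t = 0 := by
    intro s hs
    have : χ =ᶠ[𝓝 s] fun _ => 0 := by
      filter_upwards [Iio_mem_nhds hs] with r hr using hχz r hr
    rw [this.deriv_eq, deriv_const]
  set φ : Space n × ℝ → ℝ := fun z => ψ z.1 * χ z.2 with hφ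
  have htest : IsTestFunction (ball 0 1 ×ˢ Ioo (-1) 1) φ :=
    isTestFunction_mul hψ hψc hψB hχ hχc hχJ
  have hDi := ha.integrableOn_mul_pairing hν hW.memLp_grad htest.smooth.continuous
    htest.hasCompactSupport
  obtain ⟨Cψ, hCψ⟩ := hψc.exists_bound_of_continuous hψ.continuous
  obtain ⟨Cχ, hCχ⟩ := hχc.deriv.exists_bound_of_continuous hχd.continuous
  have hUi : IntegrableOn (fun z => |u z| ^ 2 * timeDeriv φ z) (ball 0 1 ×ˢ Ioo (-1) 0) := by
    simp only [hφ, timeDeriv_mul]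
    have h3 := (memLp_two_iff_integrable_sq_norm hW.memLp.aestronglyMeasurable).1 hW.memLp
    refine Integrable.mul_bdd (c := Cψ * Cχ) h3 ?_ (Eventually.of_forall fun z => ?_)
    · exact ((hψ.continuous.comp continuous_fst).mul
        (hχd.continuous.comp continuous_snd)).aestronglyMeasurable
    · rw [norm_mul]; exact mul_le_mul (hCψ _) (hCχ _) (norm_nonneg _) ((norm_nonneg _).trans (hCψ 0))
  set m : ℝ := ∫ x in ball 0 1, ψ x with hm
  have hψi : IntegrableOn ψ (ball 0 1) :=
    (hψ.continuous.integrable_of_hasCompactSupport hψc).integrableOn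
  -- the quadratic expansion of a slice
  have hexp : ∀ s, MemLp (fun x => u (x, s)) 2 (volume.restrict (ball 0 1)) → ∀ c,
      ∫ x in ball 0 1, ψ x * (u (x, s) - c) ^ 2 =
        (∫ x in ball 0 1, ψ x * u (x, s) ^ 2) - 2 * c * localMass u ψ s + c ^ 2 * m := by
    intro s hs c
    have i1 : IntegrableOn (fun x => ψ x * u (x, s) ^ 2) (ball 0 1) :=
      hs.integrable_sq.bdd_mul (c := Cψ) hψ.continuous.aestronglyMeasurable
        (Eventually.of_forall hCψ)
    have i2 : IntegrableOn (fun x => ψ x * u (x, s)) (ball 0 1) :=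
      (hs.integrable (by norm_num)).bdd_mul (c := Cψ) hψ.continuous.aestronglyMeasurable
        (Eventually.of_forall hCψ)
    rw [localMass, hm, ← integral_const_mul, ← integral_const_mul,
      ← integral_sub i1 (i2.const_mul _), ← integral_add _ (hψi.const_mul _)]
    · refine integral_congr_ae (Eventually.of_forall fun x => ?_)
      simp only; ring
    · exact i1.sub (i2.const_mul _)
  have hmono2 : ∀ {p : ℝ → Prop}, (∀ᵐ t ∂volume.restrict (Ioo (-1) 0), p t) →
      ∀ᵐ t ∂volume.restrict (Ioo t₁ t₂), p t := fun h =>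
    ae_restrict_of_ae_restrict_of_subset hJ2 h
  filter_upwards [hmono2 hloc, hWe, ae_restrict_mem measurableSet_Ioo,
    hmono2 (ae_memLp_slice hW.memLp)] with t₀ hl hWt ht₀ hut₀ c
  have hle := hl φ (by norm_num; exact htest) fun z => mul_nonneg (hψ0 _) (hχ0 _)
  rw [show Ioo (-(1:ℝ) ^ 2) t₀ = Ioo (-1) t₀ by norm_num] at hle
  obtain ⟨hPi, hle⟩ := hle
  have hsub0 : Ioo (-1) t₀ ⊆ Ioo (-1) 0 := Ioo_subset_Ioo_right (ht₀.2.trans h2).le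
  have hsub2 : Ioo t₁ t₀ ⊆ Ioo (-1) t₀ := Ioo_subset_Ioo_left h1.le
  have hsub3 : Ioo t₁ t₀ ⊆ Ioo t₁ t₂ := Ioo_subset_Ioo_right ht₀.2.le
  have hDi' := hDi.mono_set (prod_mono_right (s := ball (0 : Space n) 1) hsub0)
  have hUi' := hUi.mono_set (prod_mono_right (s := ball (0 : Space n) 1) hsub0)
  have hDs := (integrableOn_integral_slice hDi').mono_set hsub2
  have hUs := (integrableOn_integral_slice hUi').mono_set hsub2
  have hPs := (integrableOn_integral_slice hPi).mono_set hsub2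
  rw [setIntegral_prod_slices hDi', setIntegral_prod_slices hUi',
    setIntegral_prod_slices hPi] at hle
  have e1 : ∀ s, ∫ x in ball 0 1, φ (x, s) * pairing (a (x, s)) (Du (x, s)) (Du (x, s)) =
      χ s * ∫ x in ball 0 1, ψ x * pairing (a (x, s)) (Du (x, s)) (Du (x, s)) := by
    intro s
    rw [← integral_const_mul]
    exact integral_congr_ae (Eventually.of_forall fun x => by simp only [hφ]; ring)
  have e2 : ∀ s, ∫ x in ball 0 1, |u (x, s)| ^ 2 * timeDeriv φ (x, s) =
      deriv χ s * ∫ x in ball 0 1, ψ x * u (x, s) ^ 2 := by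
    intro s
    rw [← integral_const_mul]
    exact integral_congr_ae (Eventually.of_forall fun x => by
      simp only [hφ, timeDeriv_mul, sq_abs]; ring)
  have e3 : ∀ s, ∫ x in ball 0 1, pairing (a (x, s) + d (x, s)) (Du (x, s))
        (spatialGrad φ (x, s)) * u (x, s) =
      χ s * ∫ x in ball 0 1, pairing (a (x, s) + d (x, s)) (Du (x, s)) (gradient ψ x) *
        u (x, s) := by
    intro s
    rw [← integral_const_mul]
    exact integral_congr_ae (Eventually.of_forall fun x => by
      simp only [hφ, spatialGrad_mul ψ χ (hψ.differentiable (by norm_cast)), pairing_smul_right]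
      ring)
  have e4 : ∫ x in ball 0 1, φ (x, t₀) * |u (x, t₀)| ^ 2 =
      χ t₀ * ∫ x in ball 0 1, ψ x * u (x, t₀) ^ 2 := by
    rw [← integral_const_mul]
    exact integral_congr_ae (Eventually.of_forall fun x => by simp only [hφ, sq_abs]; ring)
  simp only [e1] at hle hDs
  simp only [e2] at hle hUs
  simp only [e3] at hle hPs
  rw [e4] at hle
  -- the integrands vanish before the time `t₁'`
  have hcut : ∀ h : ℝ → ℝ, (∀ s < t₁', h s = 0) →
      ∫ s in Ioo (-1) t₀, h s = ∫ s in Ioo t₁ t₀, h s := by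
    intro h hh
    refine setIntegral_eq_of_subset_of_forall_sdiff_eq_zero measurableSet_Ioo hsub2 fun s hs => ?_
    refine hh s (not_le.1 fun hs' => hs.2 ⟨h11.trans_le hs', hs.1.2⟩)
  rw [hcut _ fun s hs => by rw [hχz s hs, zero_mul], hcut _ fun s hs => by rw [hχdz s hs, zero_mul],
    hcut _ fun s hs => by rw [hχz s hs, zero_mul]] at hle
  have hset : ∀ h : ℝ → ℝ, ∫ s in t₁..t₀, h s = ∫ s in Ioo t₁ t₀, h s := fun h => by
    rw [intervalIntegral.integral_of_le ht₀.1.le, integral_Ioc_eq_integral_Ioo]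
  rw [hset] at hWt
  have hWi' := hWi.mono_set hsub3
  have hχdi : IntegrableOn (deriv χ) (Ioo t₁ t₀) :=
    (hχd.continuous.integrable_of_hasCompactSupport hχc.deriv).integrableOn
  -- the term of second order in `c` is the integral of `χ'`
  have hχint : ∫ s in Ioo t₁ t₀, deriv χ s = χ t₀ := by
    rw [← hset, intervalIntegral.integral_deriv_eq_sub
      (fun x _ => (hχ.differentiable (by norm_cast)).differentiableAt)
      (hχd.continuous.intervalIntegrable _ _), hχz t₁ h11, sub_zero]
  have hslice : ∀ᵐ s ∂volume.restrict (Ioo t₁ t₀), energyRate a d u Du ψ χ c s =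
      1 / 2 * (deriv χ s * ∫ x in ball 0 1, ψ x * u (x, s) ^ 2)
      - χ s * (∫ x in ball 0 1, pairing (a (x, s) + d (x, s)) (Du (x, s)) (gradient ψ x) *
        u (x, s))
      - χ s * (∫ x in ball 0 1, ψ x * pairing (a (x, s)) (Du (x, s)) (Du (x, s)))
      - c * (deriv χ s * localMass u ψ s - χ s * flux a d Du ψ s)
      + 1 / 2 * c ^ 2 * m * deriv χ s := by
    have hae : ∀ {p : ℝ → Prop}, (∀ᵐ t ∂volume.restrict (Ioo t₁ t₂), p t) →
        ∀ᵐ t ∂volume.restrict (Ioo t₁ t₀), p t := fun h =>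
      ae_restrict_of_ae_restrict_of_subset hsub3 h
    filter_upwards [hae (hmono2 (ae_memLp_slice hW.memLp)), hae (ae_integrableOn_slice hpi),
      ae_restrict_of_ae_restrict_of_subset hsub2 (ae_integrableOn_slice hPi)] with s hs1 hs2 hs3
    rw [energyRate, hexp s hs1 c]
    have key : χ s * (∫ x in ball 0 1, pairing (a (x, s) + d (x, s)) (Du (x, s))
          (gradient ψ x) * (u (x, s) - c)) =
        χ s * (∫ x in ball 0 1, pairing (a (x, s) + d (x, s)) (Du (x, s)) (gradient ψ x) *
        u (x, s)) - c * (χ s * flux a d Du ψ s) := by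
      -- the weak formulation gives integrability of the slice only where `χ` does not vanish
      by_cases hχs : χ s = 0
      · rw [hχs]; ring
      have hs3' : IntegrableOn (fun x => pairing (a (x, s) + d (x, s)) (Du (x, s))
          (gradient ψ x) * u (x, s)) (ball 0 1) := by
        have := hs3.const_mul (χ s)⁻¹
        refine this.congr (Eventually.of_forall fun x => ?_)
        simp only [hφ, spatialGrad_mul ψ χ (hψ.differentiable (by norm_cast)), pairing_smul_right]
        field_simp
      have : ∫ x in ball 0 1, pairing (a (x, s) + d (x, s)) (Du (x, s))
          (gradient ψ x) * (u (x, s) - c) = (∫ x in ball 0 1,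
            pairing (a (x, s) + d (x, s)) (Du (x, s)) (gradient ψ x) * u (x, s)) -
            c * flux a d Du ψ s := by
        rw [flux, ← integral_const_mul, ← integral_sub hs3' (hs2.const_mul c)]
        refine integral_congr_ae (Eventually.of_forall fun x => ?_)
        simp only; ring
      rw [this]; ring
    rw [key]; ring
  obtain ⟨hE1, hE2⟩ := integral_linear_combination hUs hPs hDs hWi' hχdi (1 / 2) c
    (1 / 2 * c ^ 2 * m)
  refine ⟨hE1.congr (hslice.mono fun s hs => hs.symm), ?_⟩
  rw [integral_congr_ae hslice, hE2, hχint, ← hWt, hexp t₀ hut₀ c]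
  linarith

end IsSuitableWeakSolution

end EnergyInequality

end ParabolicBMO

namespace ParabolicBMO
open Filter Topology

/-! ### The coefficients on a slice -/

section Coefficients

variable {n : ℕ}

theorem isBallRegular_volume (n : ℕ) :
    IsBallRegular (volume : Measure (Space n)) (volume (ball (0 : Space n) 1)).toReal n := by
  refine ⟨ENNReal.toReal_pos (measure_ball_pos _ _ one_pos).ne' measure_ball_lt_top.ne,
    fun x r hr => ?_⟩
  rw [Measure.addHaar_closedBall _ _ hr.le, finrank_euclideanSpace, Fintype.card_fin,
    ENNReal.ofReal_mul ENNReal.toReal_nonneg, ENNReal.ofReal_toReal measure_ball_lt_top.ne, mul_comm]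

theorem restrict_ball_eq_restrict_closedBall (x : Space n) {r : ℝ} (hr : 0 < r) :
    (volume : Measure (Space n)).restrict (ball x r) = volume.restrict (closedBall x r) := by
  refine Measure.restrict_congr_set (ae_eq_of_subset_of_measure_ge ball_subset_closedBall ?_
    measurableSet_ball.nullMeasurableSet measure_closedBall_lt_top.ne)
  rw [Measure.addHaar_closedBall _ _ hr.le, Measure.addHaar_ball_of_pos _ _ hr]

/-- Compactness leaves room between a closed ball and the boundary of the unit ball. It is needed
because a suitable weak solution is approximated by smooth functions only away from the boundary. -/
theorem exists_lt_one_closedBall_subset {x : Space n} {r : ℝ} (h : closedBall x r ⊆ ball 0 1) :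
    ∃ ρ, 0 < ρ ∧ ρ < 1 ∧ closedBall x r ⊆ ball 0 ρ := by
  obtain ⟨C, hC1, hC2⟩ : ∃ C < (1:ℝ), ∀ y ∈ closedBall x r, ‖y‖ ≤ C := by
    rcases (closedBall x r).eq_empty_or_nonempty with he | hne
    · exact ⟨0, one_pos, by simp [he]⟩
    · obtain ⟨y, hy, hmax⟩ := (isCompact_closedBall x r).exists_isMaxOn hne continuous_norm.continuousOn
      exact ⟨‖y‖, mem_ball_zero_iff.1 (h hy), fun z hz => hmax hz⟩
  refine ⟨(max C 0 + 1) / 2, by positivity, ?_, fun y hy => ?_⟩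
  · have : max C 0 < 1 := max_lt hC1 one_pos
    linarith
  · rw [mem_ball_zero_iff]
    have : max C 0 < 1 := max_lt hC1 one_pos
    have := (hC2 y hy).trans (le_max_left C 0)
    linarith

theorem abs_entry_le_matNorm (M : Matrix (Fin n) (Fin n) ℝ) (i j : Fin n) :
    |M i j| ≤ matNorm M := by
  rw [matNorm]
  refine Real.le_sqrt_of_sq_le ?_
  rw [sq_abs]
  calc M i j ^ 2 ≤ ∑ j, M i j ^ 2 :=
        Finset.single_le_sum (f := fun j => M i j ^ 2) (fun _ _ => sq_nonneg _) (Finset.mem_univ j)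
    _ ≤ _ := Finset.single_le_sum (f := fun i => ∑ j, M i j ^ 2)
        (fun _ _ => Finset.sum_nonneg fun _ _ => sq_nonneg _) (Finset.mem_univ i)

/-- The seminorm of a matrix-valued function bounds the oscillation of every entry. -/
theorem lintegral_oscillation_le_of_bmoNorm_le {Γ : ℝ≥0} {D : Space n → Matrix (Fin n) (Fin n) ℝ}
    (hD : bmoNorm (ball 0 1) D ≤ Γ) {x : Space n} {r : ℝ} (hr : 0 < r)
    (hx : closedBall x r ⊆ ball 0 1) (i j : Fin n) :
    ∫⁻ y in ball x r, ‖D y i j - ⨍ w in ball x r, D w i j‖ₑ ≤ Γ * volume (ball x r) := by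
  have h1 : (volume (ball x r))⁻¹ *
      ∫⁻ y in ball x r, ENNReal.ofReal (matNorm (D y - ballAverage D x r)) ≤ Γ := by
    refine le_trans ?_ hD
    rw [bmoNorm]
    exact le_iSup_of_le x (le_iSup_of_le r (le_iSup_of_le hr (le_iSup_of_le hx le_rfl)))
  have h0 : volume (ball x r) ≠ 0 := (measure_ball_pos _ _ hr).ne'
  have ht : volume (ball x r) ≠ ⊤ := measure_ball_lt_top.ne
  have h2 : ∫⁻ y in ball x r, ENNReal.ofReal (matNorm (D y - ballAverage D x r)) ≤
      Γ * volume (ball x r) := by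
    calc _ = volume (ball x r) * ((volume (ball x r))⁻¹ *
        ∫⁻ y in ball x r, ENNReal.ofReal (matNorm (D y - ballAverage D x r))) := by
          rw [← mul_assoc, ENNReal.mul_inv_cancel h0 ht, one_mul]
      _ ≤ volume (ball x r) * Γ := by gcongr
      _ = _ := mul_comm _ _
  refine le_trans (lintegral_mono fun y => ?_) h2
  rw [← ofReal_norm, Real.norm_eq_abs]
  exact ENNReal.ofReal_le_ofReal (abs_entry_le_matNorm (D y - ballAverage D x r) i j)

/-- The size of the coefficients after the constant matrix `M` has been removed from `d`. -/
noncomputable def coeffBound (ν : ℝ) (M D : Matrix (Fin n) (Fin n) ℝ) : ℝ :=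
  ν⁻¹ + ∑ i, ∑ j, |D i j - M i j|

theorem coeffBound_ge {ν : ℝ} (M D : Matrix (Fin n) (Fin n) ℝ) : ν⁻¹ ≤ coeffBound ν M D := by
  have : 0 ≤ ∑ i, ∑ j, |D i j - M i j| := by positivity
  rw [coeffBound]; linarith

theorem coeffBound_pos {ν : ℝ} (hν : 0 < ν) (M D : Matrix (Fin n) (Fin n) ℝ) :
    0 < coeffBound ν M D := lt_of_lt_of_le (inv_pos.2 hν) (coeffBound_ge M D)

/-- Convexity of the power `s`, for a constant plus finitely many functions. -/
theorem lintegral_const_add_sum_rpow_le {X ι : Type*} [MeasurableSpace X] [Fintype ι]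
    {P : Measure X} [IsProbabilityMeasure P] {s : ℝ} (hs : 1 ≤ s) (c : ℝ≥0∞) {Y : ι → X → ℝ≥0∞}
    (hY : ∀ i, AEMeasurable (Y i) P) {b : ℝ≥0∞} (hb : ∀ i, ∫⁻ x, Y i x ^ s ∂P ≤ b) :
    ∫⁻ x, (c + ∑ i, Y i x) ^ s ∂P ≤ 2 ^ (s - 1) * (c ^ s +
      ((Finset.univ : Finset ι).card : ℝ≥0∞) ^ (s - 1) * ∑ _i : ι, b) := by
  have hm : ∀ i, AEMeasurable (fun x => Y i x ^ s) P := fun i => (hY i).pow_const _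
  have hm' : AEMeasurable (fun x => ∑ i, Y i x ^ s) P :=
    Finset.aemeasurable_fun_sum _ fun i _ => hm i
  calc ∫⁻ x, (c + ∑ i, Y i x) ^ s ∂P
      ≤ ∫⁻ x, 2 ^ (s - 1) * (c ^ s +
          ((Finset.univ : Finset ι).card : ℝ≥0∞) ^ (s - 1) * ∑ i, Y i x ^ s) ∂P := by
        refine lintegral_mono fun x => ?_
        refine (ENNReal.rpow_add_le_mul_rpow_add_rpow _ _ hs).trans ?_
        gcongr
        exact ENNReal.rpow_sum_le_const_mul_sum_rpow _ _ hs
    _ = 2 ^ (s - 1) * (c ^ s +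
          ((Finset.univ : Finset ι).card : ℝ≥0∞) ^ (s - 1) * ∑ i, ∫⁻ x, Y i x ^ s ∂P) := by
        have hm2 : AEMeasurable (fun x => c ^ s +
            ((Finset.univ : Finset ι).card : ℝ≥0∞) ^ (s - 1) * ∑ i, Y i x ^ s) P :=
          aemeasurable_const.add (hm'.const_mul _)
        rw [lintegral_const_mul'' _ hm2,
          lintegral_add_left' aemeasurable_const, lintegral_const, measure_univ, mul_one,
          lintegral_const_mul'' _ hm', lintegral_finsetSum' _ fun i _ => hm i]
    _ ≤ _ := by gcongr with i; exact hb i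

/-- The John–Nirenberg inequality for the slices of `d`: there is a skew-symmetric matrix `M`,
the mean of `d(·, t)`, such that the powers of `d(·, t) - M` are controlled. The mean itself is
not bounded in `t`. -/
theorem exists_lintegral_coeffBound_le (n : ℕ) {ν : ℝ} (hν : 0 < ν) (Γ : ℝ≥0) {s : ℕ}
    (hs : s ≠ 0) : ∃ κ : ℝ≥0, ∀ D : Space n → Matrix (Fin n) (Fin n) ℝ,
      (∀ i j, AEStronglyMeasurable (fun x => D x i j) (volume.restrict (ball 0 1))) →
      (∀ᵐ x ∂volume.restrict (ball 0 1), D x = -(D x).transpose) → bmoNorm (ball 0 1) D ≤ Γ →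
      ∀ (x : Space n) (r : ℝ), 0 < r → closedBall x (2 * r) ⊆ ball 0 1 →
        ∃ M : Matrix (Fin n) (Fin n) ℝ, (∀ i j, M i j = -M j i) ∧
          ∫⁻ y, ENNReal.ofReal (coeffBound ν M (D y)) ^ (s:ℝ) ∂unif (ball x r) ≤ κ := by
  obtain ⟨C, hC⟩ := exists_john_nirenberg (isBallRegular_volume n) hs
  have hs1 : (1:ℝ) ≤ s := by exact_mod_cast Nat.one_le_iff_ne_zero.2 hs
  have hs0 : (0:ℝ) < s := by linarith
  obtain ⟨κ, hκ⟩ : ∃ κ : ℝ≥0∞, κ = 2 ^ ((s:ℝ) - 1) * (ENNReal.ofReal ν⁻¹ ^ (s:ℝ) +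
    ((Finset.univ : Finset (Fin n × Fin n)).card : ℝ≥0∞) ^ ((s:ℝ) - 1) *
      ∑ _p : Fin n × Fin n, (C * ((Γ + 1 : ℝ≥0) : ℝ≥0∞) ^ s)) := ⟨_, rfl⟩
  have hκt : κ ≠ ⊤ := by
    have h1 : 0 ≤ (s:ℝ) - 1 := by linarith
    rw [hκ]
    refine ENNReal.mul_ne_top (ENNReal.rpow_ne_top_of_nonneg h1 (by norm_num))
      (ENNReal.add_ne_top.2 ⟨ENNReal.rpow_ne_top_of_nonneg hs0.le ENNReal.ofReal_ne_top,
        ENNReal.mul_ne_top (ENNReal.rpow_ne_top_of_nonneg h1 (ENNReal.natCast_ne_top _)) ?_⟩)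
    refine (ENNReal.sum_lt_top.2 fun _ _ => ?_).ne
    exact ENNReal.mul_lt_top ENNReal.coe_lt_top (ENNReal.pow_lt_top ENNReal.coe_lt_top)
  refine ⟨κ.toNNReal, fun D hDm hDs hDb x r hr hx => ?_⟩
  rw [ENNReal.coe_toNNReal hκt]
  have hsub : ball x r ⊆ ball 0 1 := (ball_subset_closedBall.trans
    (closedBall_subset_closedBall (by linarith))).trans hx
  refine ⟨Matrix.of fun i j => ⨍ w in closedBall x r, D w i j, fun i j => ?_, ?_⟩
  · simp only [Matrix.of_apply]
    rw [← restrict_ball_eq_restrict_closedBall x hr, average_eq, average_eq, ← smul_neg,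
      ← integral_neg]
    congr 1
    refine integral_congr_ae ?_
    filter_upwards [ae_restrict_of_ae_restrict_of_subset hsub hDs] with y hy
    have := congrFun (congrFun hy i) j
    simpa using this
  have h0 : volume (ball x r) ≠ 0 := (measure_ball_pos _ _ hr).ne'
  have ht : volume (ball x r) ≠ ⊤ := measure_ball_lt_top.ne
  have hP := isProbabilityMeasure_unif h0 ht
  obtain ⟨ρ, hρ0, hρ1, hρ⟩ := exists_lt_one_closedBall_subset hx
  have hent : ∀ i j, ∫⁻ y, ‖D y i j - ⨍ w in closedBall x r, D w i j‖ₑ ^ (s:ℝ) ∂unif (ball x r) ≤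
      C * ((Γ + 1 : ℝ≥0) : ℝ≥0∞) ^ s := by
    intro i j
    -- `Γ + 1` replaces `Γ` since the John–Nirenberg inequality is stated for a positive bound
    have hosc : HasOscillationLE volume (ball 0 ρ) (Γ + 1) (fun y => D y i j) := by
      intro y t ht hy
      have h2 := lintegral_oscillation_le_of_bmoNorm_le hDb ht
        (hy.trans (ball_subset_ball hρ1.le)) i j
      rw [restrict_ball_eq_restrict_closedBall y ht] at h2
      refine h2.trans ?_
      gcongr
      · simp
      · exact ball_subset_closedBall
    -- a finite mean oscillation over the ball of radius `ρ` makes the entries integrable there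
    have hint : IntegrableOn (fun y => D y i j) (ball 0 ρ) := by
      have hcb : closedBall (0 : Space n) ρ ⊆ ball 0 1 := closedBall_subset_ball hρ1
      have h2 := lintegral_oscillation_le_of_bmoNorm_le hDb hρ0 hcb i j
      have hfin : IsFiniteMeasure ((volume : Measure (Space n)).restrict (ball 0 ρ)) :=
        ⟨by rw [Measure.restrict_apply_univ]; exact measure_ball_lt_top⟩
      set b := ⨍ w in ball 0 ρ, D w i j
      have h3 : Integrable (fun y => D y i j - b) (volume.restrict (ball 0 ρ)) := by
        refine ⟨((hDm i j).mono_set (ball_subset_ball hρ1.le)).sub aestronglyMeasurable_const, ?_⟩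
        exact h2.trans_lt (ENNReal.mul_lt_top ENNReal.coe_lt_top measure_ball_lt_top)
      refine (h3.add (integrable_const b)).congr (Eventually.of_forall fun y => ?_)
      simp
    have h4 := hC (ball 0 ρ) (Γ + 1) _ (by positivity) hint hosc x r hr hρ
    rw [lintegral_unif, restrict_ball_eq_restrict_closedBall x hr]
    simp only [ENNReal.rpow_natCast]
    have hvol : volume (closedBall x r) = volume (ball x r) := by
      rw [Measure.addHaar_closedBall _ _ hr.le, Measure.addHaar_ball_of_pos _ _ hr]
    rw [hvol] at h4
    calc _ ≤ (volume (ball x r))⁻¹ * (C * ((Γ + 1 : ℝ≥0) : ℝ≥0∞) ^ s * volume (ball x r)) := by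
          gcongr
      _ = C * ((Γ + 1 : ℝ≥0) : ℝ≥0∞) ^ s * ((volume (ball x r))⁻¹ * volume (ball x r)) := by ring
      _ = _ := by rw [ENNReal.inv_mul_cancel h0 ht, mul_one]
  set M : Matrix (Fin n) (Fin n) ℝ := Matrix.of fun i j => ⨍ w in closedBall x r, D w i j with hM
  have e : ∀ y, ENNReal.ofReal (coeffBound ν M (D y)) =
      ENNReal.ofReal ν⁻¹ + ∑ p : Fin n × Fin n, ‖D y p.1 p.2 - M p.1 p.2‖ₑ := by
    intro y
    rw [coeffBound, ENNReal.ofReal_add (by positivity) (by positivity), Fintype.sum_prod_type,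
      ENNReal.ofReal_sum_of_nonneg fun i _ => by positivity]
    congr 1
    refine Finset.sum_congr rfl fun i _ => ?_
    rw [ENNReal.ofReal_sum_of_nonneg fun i _ => by positivity]
    refine Finset.sum_congr rfl fun j _ => ?_
    rw [← Real.norm_eq_abs, ofReal_norm]
  simp only [e]
  rw [hκ]
  exact lintegral_const_add_sum_rpow_le hs1 (ENNReal.ofReal ν⁻¹)
    (Y := fun (p : Fin n × Fin n) y => ‖D y p.1 p.2 - M p.1 p.2‖ₑ)
    (fun p => ((((hDm p.1 p.2).mono_set hsub).mono_ac
      (unif_absolutelyContinuous _)).sub aestronglyMeasurable_const).enorm)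
    (b := C * ((Γ + 1 : ℝ≥0) : ℝ≥0∞) ^ s) fun p => hent p.1 p.2

/-- The ellipticity upper bound as a bound on the bilinear form. -/
theorem pairing_le_of_elliptic {ν : ℝ} (hν : 0 < ν) {A : Matrix (Fin n) (Fin n) ℝ}
    (hs : A.transpose = A) (hl : ∀ ξ : Space n, ν * ‖ξ‖ ^ 2 ≤ pairing A ξ ξ)
    (hup : ∀ ξ : Space n, pairing A ξ ξ ≤ ν⁻¹ * ‖ξ‖ ^ 2) (v w : Space n) :
    |pairing A v w| ≤ ν⁻¹ * ‖v‖ * ‖w‖ := by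
  have hsym : ∀ v w : Space n, pairing A w v = pairing A v w := by
    intro v w
    simp only [pairing]
    rw [Finset.sum_comm]
    refine Finset.sum_congr rfl fun i _ => Finset.sum_congr rfl fun j _ => ?_
    have : A j i = A i j := congrFun (congrFun hs i) j
    rw [this]; ring
  have hexp : ∀ (t : ℝ) (v w : Space n), pairing A (t • v + w) (t • v + w) =
      pairing A v v * (t * t) + 2 * pairing A v w * t + pairing A w w := by
    intro t v w
    have : pairing A (t • v + w) (t • v + w) = t * t * pairing A v v + t * pairing A v w +
        t * pairing A w v + pairing A w w := by
      simp only [pairing, Finset.mul_sum, ← Finset.sum_add_distrib]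
      refine Finset.sum_congr rfl fun i _ => Finset.sum_congr rfl fun j _ => ?_
      simp; ring
    rw [this, hsym v w]; ring
  -- the Cauchy–Schwarz inequality of the form, by way of its discriminant
  have hdis : discrim (pairing A v v) (2 * pairing A v w) (pairing A w w) ≤ 0 := by
    refine discrim_le_zero fun t => ?_
    rw [← hexp]
    exact le_trans (by positivity) (hl _)
  rw [discrim] at hdis
  refine abs_le_of_sq_le_sq ?_ (by positivity)
  have h1 := hup v
  have h2 := hup w
  have h3 : 0 ≤ pairing A w w := le_trans (by positivity) (hl _)
  calc pairing A v w ^ 2 ≤ pairing A v v * pairing A w w := by linarith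
    _ ≤ (ν⁻¹ * ‖v‖ ^ 2) * (ν⁻¹ * ‖w‖ ^ 2) := by gcongr
    _ = _ := by ring

/-- After removal of a constant matrix `M`, the coefficients are controlled by `coeffBound`. -/
theorem abs_pairing_add_sub_le {ν : ℝ} (hν : 0 < ν) {A D M : Matrix (Fin n) (Fin n) ℝ}
    (hs : A.transpose = A) (hl : ∀ ξ : Space n, ν * ‖ξ‖ ^ 2 ≤ pairing A ξ ξ)
    (hup : ∀ ξ : Space n, pairing A ξ ξ ≤ ν⁻¹ * ‖ξ‖ ^ 2) (v w : Space n) :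
    |pairing (A + D) v w - pairing M v w| ≤ coeffBound ν M D * ‖v‖ * ‖w‖ := by
  have e : pairing (A + D) v w - pairing M v w = pairing A v w + pairing (D - M) v w := by
    simp only [pairing, ← Finset.sum_add_distrib, ← Finset.sum_sub_distrib]
    refine Finset.sum_congr rfl fun i _ => Finset.sum_congr rfl fun j _ => ?_
    simp only [Matrix.add_apply, Matrix.sub_apply]; ring
  rw [e]
  refine (abs_add_le _ _).trans ?_
  have h1 := pairing_le_of_elliptic hν hs hl hup v w
  have h2 := norm_pairing_le (D - M) v w
  simp only [Matrix.sub_apply] at h2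
  calc _ ≤ ν⁻¹ * ‖v‖ * ‖w‖ + (∑ i, ∑ j, |D i j - M i j|) * ‖v‖ * ‖w‖ := add_le_add h1 h2
    _ = _ := by rw [coeffBound]; ring

end Coefficients

/-! ### Cutoff functions -/

section Cutoffs

variable {n : ℕ}

/-- Spatial cutoffs. They are squares, so that their gradients are controlled by their roots. -/
theorem exists_cutoff (n : ℕ) : ∃ Λ : ℝ, 0 < Λ ∧ ∀ (x₀ : Space n) (r : ℝ), 0 < r →
    ∃ ψ : Space n → ℝ, ContDiff ℝ ∞ ψ ∧ HasCompactSupport ψ ∧ tsupport ψ ⊆ ball x₀ (2 * r) ∧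
      (∀ x, 0 ≤ ψ x) ∧ (∀ x, ψ x ≤ 1) ∧ (∀ x ∈ ball x₀ r, ψ x = 1) ∧
      ∀ x, ‖gradient ψ x‖ ^ 2 ≤ (Λ / r) ^ 2 * ψ x := by
  set b : ContDiffBump (0 : Space n) := ⟨1, 3 / 2, one_pos, by norm_num⟩
  obtain ⟨C, hC⟩ := (b.hasCompactSupport.fderiv (𝕜 := ℝ)).exists_bound_of_continuous
    ((b.contDiff (n := 1)).continuous_fderiv (by norm_num))
  have hC0 : 0 ≤ C := (norm_nonneg _).trans (hC 0)
  refine ⟨2 * C + 1, by positivity, fun x₀ r hr => ?_⟩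
  set η : Space n → ℝ := fun x => b (r⁻¹ • (x - x₀)) with hη
  have hηs : ContDiff ℝ ∞ η := b.contDiff.comp ((contDiff_id.sub contDiff_const).const_smul r⁻¹)
  have hsupp : tsupport (fun x => η x ^ 2) ⊆ closedBall x₀ (3 / 2 * r) := by
    refine closure_minimal (fun x hx => ?_) isClosed_closedBall
    have h1 : r⁻¹ • (x - x₀) ∈ Function.support b := by
      intro h; exact hx (by simp only [hη, h]; norm_num)
    rw [b.support_eq, mem_ball_zero_iff, norm_smul, Real.norm_eq_abs, abs_of_pos (inv_pos.2 hr)] at h1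
    rw [mem_closedBall, dist_eq_norm]
    have h2 : r⁻¹ * ‖x - x₀‖ < 3 / 2 := h1
    rw [inv_mul_lt_iff₀ hr] at h2
    linarith
  have hη0 : ∀ x, 0 ≤ η x := fun x => b.nonneg
  have hη1 : ∀ x, η x ≤ 1 := fun x => b.le_one
  refine ⟨fun x => η x ^ 2, hηs.pow 2, (isCompact_closedBall _ _).of_isClosed_subset
    (isClosed_tsupport _) hsupp, hsupp.trans (closedBall_subset_ball (by linarith)),
    fun x => sq_nonneg _, fun x => pow_le_one₀ (hη0 x) (hη1 x), fun x hx => ?_, fun x => ?_⟩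
  · have : η x = 1 := by
      refine b.one_of_mem_closedBall ?_
      rw [mem_closedBall_zero_iff, norm_smul, Real.norm_eq_abs, abs_of_pos (inv_pos.2 hr)]
      rw [mem_ball, dist_eq_norm] at hx
      change r⁻¹ * ‖x - x₀‖ ≤ 1
      rw [inv_mul_le_iff₀ hr]; linarith
    simp only [this, one_pow]
  · have hd : HasFDerivAt η ((fderiv ℝ b (r⁻¹ • (x - x₀))).comp
        (r⁻¹ • ContinuousLinearMap.id ℝ (Space n))) x := by
      have h1 : HasFDerivAt (fun x : Space n => r⁻¹ • (x - x₀))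
          (r⁻¹ • ContinuousLinearMap.id ℝ (Space n)) x :=
        ((hasFDerivAt_id x).sub_const x₀).const_smul r⁻¹
      exact (((b.contDiff (n := 1)).differentiable (by norm_num)).differentiableAt.hasFDerivAt).comp x h1
    have hn : ‖fderiv ℝ η x‖ ≤ C / r := by
      rw [hd.fderiv, ContinuousLinearMap.comp_smul, ContinuousLinearMap.comp_id, norm_smul,
        Real.norm_eq_abs, abs_of_pos (inv_pos.2 hr), inv_mul_eq_div]
      gcongr
      exact hC _
    have hg : ‖gradient (fun x => η x ^ 2) x‖ ≤ 2 * η x * (C / r) := by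
      have h2 : fderiv ℝ (fun x => η x ^ 2) x = (2 * η x) • fderiv ℝ η x := by
        have := (hd.pow 2).fderiv
        rw [hd.fderiv]
        simpa using this
      have h3 : ‖gradient (fun x => η x ^ 2) x‖ = ‖fderiv ℝ (fun x => η x ^ 2) x‖ := by
        simp [gradient]
      rw [h3, h2, norm_smul, Real.norm_eq_abs, abs_of_nonneg (by have := hη0 x; positivity)]
      have := hη0 x
      gcongr
    have hη0x := hη0 x
    calc ‖gradient (fun x => η x ^ 2) x‖ ^ 2 ≤ (2 * η x * (C / r)) ^ 2 := by gcongr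
      _ = (2 * C / r) ^ 2 * η x ^ 2 := by ring
      _ ≤ _ := by gcongr; linarith

/-- Time cutoffs. They vanish near the bottom of the cylinder, but not at its top. -/
theorem exists_time_cutoff : ∃ Λ : ℝ, 0 < Λ ∧ ∀ (t₁ r : ℝ), 0 < r →
    ∃ χ : ℝ → ℝ, ContDiff ℝ ∞ χ ∧ HasCompactSupport χ ∧
      tsupport χ ⊆ Icc (t₁ - 2 * r ^ 2) (t₁ + 2 * r ^ 2) ∧
      (∀ t, 0 ≤ χ t) ∧ (∀ t, χ t ≤ 1) ∧ (∀ t ∈ Ioo (t₁ - r ^ 2) t₁, χ t = 1) ∧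
      ∀ t, |deriv χ t| ≤ Λ / r ^ 2 := by
  set b : ContDiffBump (0 : ℝ) := ⟨1, 2, one_pos, by norm_num⟩
  obtain ⟨C, hC⟩ := (b.hasCompactSupport.deriv).exists_bound_of_continuous
    ((b.contDiff (n := 1)).continuous_deriv (by norm_num))
  have hC0 : 0 ≤ C := (norm_nonneg _).trans (hC 0)
  refine ⟨C + 1, by positivity, fun t₁ r hr => ?_⟩
  have hr2 : 0 < r ^ 2 := by positivity
  set χ : ℝ → ℝ := fun t => b ((r ^ 2)⁻¹ * (t - t₁)) with hχ
  have hsupp : tsupport χ ⊆ Icc (t₁ - 2 * r ^ 2) (t₁ + 2 * r ^ 2) := by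
    refine closure_minimal (fun t ht => ?_) isClosed_Icc
    have h1 : (r ^ 2)⁻¹ * (t - t₁) ∈ Function.support b := ht
    rw [b.support_eq, mem_ball_zero_iff, Real.norm_eq_abs, abs_mul, abs_of_pos (inv_pos.2 hr2)] at h1
    have h2 : (r ^ 2)⁻¹ * |t - t₁| < 2 := h1
    rw [inv_mul_lt_iff₀ hr2] at h2
    have := abs_lt.1 h2
    exact ⟨by linarith, by linarith⟩
  refine ⟨χ, b.contDiff.comp (contDiff_const.mul (contDiff_id.sub contDiff_const)),
    isCompact_Icc.of_isClosed_subset (isClosed_tsupport _) hsupp, hsupp, fun t => b.nonneg,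
    fun t => b.le_one, fun t ht => ?_, fun t => ?_⟩
  · refine b.one_of_mem_closedBall ?_
    rw [mem_closedBall_zero_iff, Real.norm_eq_abs, abs_mul, abs_of_pos (inv_pos.2 hr2)]
    change (r ^ 2)⁻¹ * |t - t₁| ≤ 1
    rw [inv_mul_le_iff₀ hr2, mul_one, abs_le]
    exact ⟨by linarith [ht.1], by linarith [ht.2]⟩
  · have h1 : HasDerivAt (fun t : ℝ => (r ^ 2)⁻¹ * (t - t₁)) (r ^ 2)⁻¹ t := by
      simpa using ((hasDerivAt_id t).sub_const t₁).const_mul (r ^ 2)⁻¹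
    have h2 := (((b.contDiff (n := 1)).differentiable (by norm_num)).differentiableAt
      (x := (r ^ 2)⁻¹ * (t - t₁))).hasDerivAt.comp t h1
    have h3 : deriv χ t = deriv b ((r ^ 2)⁻¹ * (t - t₁)) * (r ^ 2)⁻¹ := h2.deriv
    rw [h3, abs_mul, abs_of_pos (inv_pos.2 hr2), ← div_eq_mul_inv]
    gcongr
    exact (hC _).trans (by linarith)

end Cutoffs

end ParabolicBMO

namespace ParabolicBMO
open Filter Topology

/-! ### Properties of almost every time slice -/

section GoodTimes

variable {n : ℕ} {ν : ℝ} {a d : Space n × ℝ → Matrix (Fin n) (Fin n) ℝ} {u : Space n × ℝ → ℝ}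
  {Du : Space n × ℝ → Space n} {κ : ℝ≥0} {s : ℕ}

/-- The properties of the time slices that hold at almost every time. -/
structure IsGoodTime (ν : ℝ) (κ : ℝ≥0) (s : ℕ) (a d : Space n × ℝ → Matrix (Fin n) (Fin n) ℝ)
    (u : Space n × ℝ → ℝ) (Du : Space n × ℝ → Space n) (t : ℝ) : Prop where
  elliptic : ∀ᵐ x ∂volume.restrict (ball 0 1), (a (x, t)).transpose = a (x, t) ∧
    (∀ ξ : Space n, ν * ‖ξ‖ ^ 2 ≤ pairing (a (x, t)) ξ ξ) ∧
    (∀ ξ : Space n, pairing (a (x, t)) ξ ξ ≤ ν⁻¹ * ‖ξ‖ ^ 2)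
  integrable_energy : IntegrableOn (fun x => pairing (a (x, t)) (Du (x, t)) (Du (x, t))) (ball 0 1)
  measurable_skew : ∀ i j, AEStronglyMeasurable (fun x => d (x, t) i j) (volume.restrict (ball 0 1))
  coeff : ∀ (x : Space n) (r : ℝ), 0 < r → closedBall x (2 * r) ⊆ ball 0 1 →
    ∃ M : Matrix (Fin n) (Fin n) ℝ, (∀ i j, M i j = -M j i) ∧
      ∫⁻ y, ENNReal.ofReal (coeffBound ν M (d (y, t))) ^ (s:ℝ) ∂unif (ball x r) ≤ κ
  memLp : MemLp (fun x => u (x, t)) 2 (volume.restrict (ball 0 1))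
  memLp_grad : MemLp (fun x => Du (x, t)) 2 (volume.restrict (ball 0 1))
  sobolev : ∀ ρ < 1, IsSobolevOn (ball 0 ρ) (fun x => u (x, t)) (fun x => Du (x, t))

theorem ae_ae_slice {B : Set (Space n)} {J : Set ℝ} {p : Space n × ℝ → Prop}
    (h : ∀ᵐ z ∂volume.restrict (B ×ˢ J), p z) :
    ∀ᵐ t ∂volume.restrict J, ∀ᵐ x ∂volume.restrict B, p (x, t) := by
  rw [restrict_prod_eq] at h
  have h2 := (Measure.measurePreserving_swap (μ := volume.restrict J)
    (ν := (volume : Measure (Space n)).restrict B)).quasiMeasurePreserving.ae h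
  exact Measure.ae_ae_of_ae_prod h2

/-- The constant `κ` is chosen before the solution: it depends only on `n`, `ν`, `Γ` and `s`. -/
theorem exists_ae_isGoodTime (n : ℕ) (hν : 0 < ν) (Γ : ℝ≥0) (hs : s ≠ 0) :
    ∃ κ : ℝ≥0, ∀ (a d : Space n × ℝ → Matrix (Fin n) (Fin n) ℝ) (u : Space n × ℝ → ℝ)
      (Du : Space n × ℝ → Space n), IsEllipticOn ν (parabolicBall 0 1) a →
      IsSkewOn (parabolicBall 0 1) d → linftyBMONorm (Ioo (-1) 0) (ball 0 1) d ≤ (Γ : ℝ≥0∞) →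
      IsSuitableWeakSolution a d 1 u Du →
      ∀ᵐ t ∂volume.restrict (Ioo (-1) 0), IsGoodTime ν κ s a d u Du t := by
  obtain ⟨κ, hκ⟩ := exists_lintegral_coeffBound_le n hν Γ hs
  refine ⟨κ, fun a d u Du ha hd hΓ hu => ?_⟩
  have hW := hu.memW
  rw [parabolicBall_zero_one] at ha hd hW
  have hb : ∀ᵐ t ∂volume.restrict (Ioo (-1) 0), bmoNorm (ball 0 1) (fun x => d (x, t)) ≤ Γ :=
    (ENNReal.ae_le_essSup _).mono fun t ht => ht.trans hΓ
  have hdm : ∀ᵐ t ∂volume.restrict (Ioo (-1) 0), ∀ i j,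
      AEStronglyMeasurable (fun x => d (x, t) i j) (volume.restrict (ball 0 1)) := by
    rw [ae_all_iff]; intro i
    rw [ae_all_iff]; intro j
    have := hd.measurable i j
    rw [restrict_prod_eq] at this
    exact this.prodMk_right
  have hai : IntegrableOn (fun z => pairing (a z) (Du z) (Du z)) (ball 0 1 ×ˢ Ioo (-1) 0) := by
    have hDu := hW.memLp_grad
    have h2 := (memLp_two_iff_integrable_sq_norm hDu.aestronglyMeasurable).1 hDu
    refine (h2.const_mul ν⁻¹).mono' (aestronglyMeasurable_pairing ha.measurable
      hDu.aestronglyMeasurable hDu.aestronglyMeasurable) ?_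
    filter_upwards [ha.lower, ha.upper] with z h3 h4
    rw [Real.norm_eq_abs, abs_of_nonneg (le_trans (by positivity) (h3 (Du z)))]
    exact h4 _
  filter_upwards [hb, hdm, ae_integrableOn_slice hai, ae_ae_slice ha.symm, ae_ae_slice ha.lower,
    ae_ae_slice ha.upper, ae_ae_slice hd.skew, ae_memLp_slice hW.memLp,
    ae_memLp_slice hW.memLp_grad, ae_isSobolevOn_slice isOpen_Ioo measure_Ioo_lt_top.ne hW]
    with t h1 h2 h3 h4 h5 h6 h7 h8 h9 h10
  exact ⟨by filter_upwards [h4, h5, h6] with x k1 k2 k3 using ⟨k1, k2, k3⟩, h3, h2,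
    hκ _ h2 h7 h1, h8, h9, h10⟩

theorem gradient_eq_zero_of_notMem {ψ : Space n → ℝ} {B : Set (Space n)} (hψB : tsupport ψ ⊆ B)
    {x : Space n} (hx : x ∉ B) : gradient ψ x = 0 := by
  have : fderiv ℝ ψ x = 0 :=
    image_eq_zero_of_notMem_tsupport fun h => hx (hψB (tsupport_fderiv_subset ℝ h))
  simp [gradient, this]

/-- The flux term after removal of a constant skew-symmetric matrix `M`, for `b = 1` and for
`b = u - c`. -/
theorem IsGoodTime.enorm_integral_pairing_le {t : ℝ} (ht : IsGoodTime ν κ s a d u Du t)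
    (hν : 0 < ν) {B : Set (Space n)} (hB : B ⊆ ball 0 1)
    {M : Matrix (Fin n) (Fin n) ℝ} {ψ : Space n → ℝ} (hψB : tsupport ψ ⊆ B) {b : Space n → ℝ}
    (hi : IntegrableOn (fun x => pairing M (Du (x, t)) (gradient ψ x) * b x) B)
    (h0 : ∫ x in B, pairing M (Du (x, t)) (gradient ψ x) * b x = 0) :
    ‖∫ x in ball 0 1, pairing (a (x, t) + d (x, t)) (Du (x, t)) (gradient ψ x) * b x‖ₑ ≤
      ∫⁻ x in B, ENNReal.ofReal
        (coeffBound ν M (d (x, t)) * ‖Du (x, t)‖ * ‖gradient ψ x‖ * |b x|) := by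
  have e1 : ∫ x in ball 0 1, pairing (a (x, t) + d (x, t)) (Du (x, t)) (gradient ψ x) * b x =
      ∫ x in B, pairing (a (x, t) + d (x, t)) (Du (x, t)) (gradient ψ x) * b x := by
    refine setIntegral_eq_of_subset_of_forall_sdiff_eq_zero measurableSet_ball hB fun x hx => ?_
    rw [gradient_eq_zero_of_notMem hψB hx.2]; simp [pairing]
  rw [e1]
  -- otherwise the integral on the left is zero by convention
  by_cases hi2 : IntegrableOn (fun x => pairing (a (x, t) + d (x, t)) (Du (x, t))
      (gradient ψ x) * b x) B
  swap
  · rw [integral_undef hi2]; simp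
  have e2 : ∫ x in B, pairing (a (x, t) + d (x, t)) (Du (x, t)) (gradient ψ x) * b x =
      ∫ x in B, (pairing (a (x, t) + d (x, t)) (Du (x, t)) (gradient ψ x) -
        pairing M (Du (x, t)) (gradient ψ x)) * b x := by
    rw [← sub_zero (∫ x in B, _), ← h0, ← integral_sub hi2 hi]
    refine integral_congr_ae (Eventually.of_forall fun x => ?_)
    simp only; ring
  rw [e2]
  refine (enorm_integral_le_lintegral_enorm _).trans (lintegral_mono_ae ?_)
  filter_upwards [ae_restrict_of_ae_restrict_of_subset hB ht.elliptic] with x hx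
  rw [← ofReal_norm, norm_mul, Real.norm_eq_abs, Real.norm_eq_abs]
  refine ENNReal.ofReal_le_ofReal (mul_le_mul_of_nonneg_right ?_ (abs_nonneg _))
  exact abs_pairing_add_sub_le hν hx.1 hx.2.1 hx.2.2 _ _

/-- The flux sees only `d - M`, since `M` is skew-symmetric and constant. -/
theorem IsGoodTime.enorm_flux_le {t : ℝ} (ht : IsGoodTime ν κ s a d u Du t) (hν : 0 < ν)
    {ρ : ℝ} (hρ : ρ < 1) {B : Set (Space n)} (hB : B ⊆ ball 0 ρ)
    {M : Matrix (Fin n) (Fin n) ℝ} (hM : ∀ i j, M i j = -M j i)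
    {ψ : Space n → ℝ} (hψ : ContDiff ℝ ∞ ψ) (hψc : HasCompactSupport ψ) (hψB : tsupport ψ ⊆ B)
    {Λ : ℝ} (hΛ : ∀ x, ‖gradient ψ x‖ ≤ Λ) :
    ‖flux a d Du ψ t‖ₑ ≤ ENNReal.ofReal Λ *
      ∫⁻ x in B, ENNReal.ofReal (coeffBound ν M (d (x, t))) * ‖Du (x, t)‖ₑ := by
  have hS := (ht.sobolev ρ hρ).mono hB
  have hBb : Bornology.IsBounded B := isBounded_ball.subset hB
  have hfin : IsFiniteMeasure (volume.restrict B) :=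
    ⟨by rw [Measure.restrict_apply_univ]; exact hBb.measure_lt_top⟩
  have h := ht.enorm_integral_pairing_le hν (hB.trans (ball_subset_ball hρ.le)) (M := M) hψB
    (b := fun _ => 1) (hS.integrable_pairing_mul M hψ hψc (memLp_const 1)) (by
      simpa using hS.integral_pairing_eq_zero hBb hM hψ hψc hψB)
  simp only [mul_one, abs_one] at h
  refine h.trans ?_
  rw [← lintegral_const_mul' _ _ ENNReal.ofReal_ne_top]
  refine lintegral_mono fun x => ?_
  have hk := (coeffBound_pos hν M (d (x, t))).le
  rw [← ofReal_norm, ← ENNReal.ofReal_mul hk, ← ENNReal.ofReal_mul ((norm_nonneg _).trans (hΛ 0))]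
  refine ENNReal.ofReal_le_ofReal ?_
  rw [mul_comm Λ]
  have h1 : 0 ≤ coeffBound ν M (d (x, t)) * ‖Du (x, t)‖ := by positivity
  exact mul_le_mul_of_nonneg_left (hΛ x) h1

/-- The slice form of the Caccioppoli inequality: by Young's inequality the gradient is absorbed. -/
theorem IsGoodTime.ofReal_energyRate_le {t : ℝ} (ht : IsGoodTime ν κ s a d u Du t) (hν : 0 < ν)
    {ρ : ℝ} (hρ : ρ < 1) {B : Set (Space n)} (hB : B ⊆ ball 0 ρ)
    {M : Matrix (Fin n) (Fin n) ℝ} (hM : ∀ i j, M i j = -M j i)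
    {ψ : Space n → ℝ} (hψ : ContDiff ℝ ∞ ψ) (hψc : HasCompactSupport ψ) (hψB : tsupport ψ ⊆ B)
    (hψ0 : ∀ x, 0 ≤ ψ x) (hψ1 : ∀ x, ψ x ≤ 1)
    {Λ : ℝ} (hΛ : ∀ x, ‖gradient ψ x‖ ^ 2 ≤ Λ ^ 2 * ψ x) {χ : ℝ → ℝ} (hχ0 : ∀ t, 0 ≤ χ t)
    (hχ1 : ∀ t, χ t ≤ 1) {Λ' : ℝ} (hΛ'0 : 0 < Λ') (hΛ' : ∀ t, |deriv χ t| ≤ Λ') (c : ℝ) :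
    ENNReal.ofReal (energyRate a d u Du ψ χ c t +
        ν / 2 * (χ t * ∫ x in ball 0 1, ψ x * ‖Du (x, t)‖ ^ 2)) ≤
      ENNReal.ofReal (1 / 2 * Λ' * ν ^ 2 + Λ ^ 2 / (2 * ν)) *
        ∫⁻ x in B, ENNReal.ofReal (coeffBound ν M (d (x, t))) ^ (2:ℝ) *
          ‖u (x, t) - c‖ₑ ^ (2:ℝ) := by
  set N : ℝ≥0∞ := ∫⁻ x in B, ENNReal.ofReal (coeffBound ν M (d (x, t))) ^ (2:ℝ) *
          ‖u (x, t) - c‖ₑ ^ (2:ℝ) with hN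
  have hX : 0 < 1 / 2 * Λ' * ν ^ 2 + Λ ^ 2 / (2 * ν) := by positivity
  -- an infinite right-hand side is allowed here; the factor in front of it is positive
  rcases eq_or_ne N ⊤ with hNt | hNt
  · rw [hNt, ENNReal.mul_top (by simpa using hX)]; exact le_top
  have hS := (ht.sobolev ρ hρ).mono hB
  have hBb : Bornology.IsBounded B := isBounded_ball.subset hB
  have hB1 : B ⊆ ball 0 1 := hB.trans (ball_subset_ball hρ.le)
  have hfin : IsFiniteMeasure (volume.restrict B) :=
    ⟨by rw [Measure.restrict_apply_univ]; exact hBb.measure_lt_top⟩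
  obtain ⟨Cψ, hCψ⟩ := hψc.exists_bound_of_continuous hψ.continuous
  have hψz : ∀ x, x ∉ B → ψ x = 0 := fun x hx =>
    image_eq_zero_of_notMem_tsupport fun h => hx (hψB h)
  set k : Space n → ℝ := fun x => coeffBound ν M (d (x, t)) with hk
  have hkν : ∀ x, ν⁻¹ ≤ k x := fun x => coeffBound_ge M _
  have hkpos : ∀ x, 0 < k x := fun x => coeffBound_pos hν M _
  have hNint : ∀ x, ENNReal.ofReal (k x) ^ (2:ℝ) * ‖u (x, t) - c‖ₑ ^ (2:ℝ) =
      ENNReal.ofReal (k x ^ 2 * (u (x, t) - c) ^ 2) := by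
    intro x
    rw [ENNReal.ofReal_mul (by positivity), ENNReal.ofReal_pow (hkpos x).le, ENNReal.rpow_ofNat,
      ENNReal.rpow_ofNat, ← sq_abs (u (x, t) - c), ENNReal.ofReal_pow (abs_nonneg _),
      ← Real.norm_eq_abs, ofReal_norm]
  have hfm := hS.memLp.aestronglyMeasurable
  -- the three integrals
  set G : ℝ := ∫ x in ball 0 1, ψ x * ‖Du (x, t)‖ ^ 2 with hG
  have hGi : IntegrableOn (fun x => ψ x * ‖Du (x, t)‖ ^ 2) (ball 0 1) :=
    ((memLp_two_iff_integrable_sq_norm ht.memLp_grad.aestronglyMeasurable).1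
      ht.memLp_grad).bdd_mul (c := Cψ) hψ.continuous.aestronglyMeasurable
      (Eventually.of_forall hCψ)
  have hG0 : 0 ≤ G := integral_nonneg fun x => mul_nonneg (hψ0 x) (sq_nonneg _)
  have hD : ν * G ≤ ∫ x in ball 0 1, ψ x * pairing (a (x, t)) (Du (x, t)) (Du (x, t)) := by
    rw [hG, ← integral_const_mul]
    refine integral_mono_ae (hGi.const_mul ν) (ht.integrable_energy.bdd_mul (c := Cψ)
      hψ.continuous.aestronglyMeasurable (Eventually.of_forall hCψ)) ?_
    filter_upwards [ht.elliptic] with x hx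
    calc ν * (ψ x * ‖Du (x, t)‖ ^ 2) = ψ x * (ν * ‖Du (x, t)‖ ^ 2) := by ring
      _ ≤ _ := mul_le_mul_of_nonneg_left (hx.2.1 _) (hψ0 x)
  -- `1 ≤ ν * k`, so the weight `k ^ 2` may be inserted
  have hU : ∫ x in ball 0 1, ψ x * (u (x, t) - c) ^ 2 ≤ ν ^ 2 * N.toReal := by
    rw [setIntegral_eq_of_subset_of_forall_sdiff_eq_zero measurableSet_ball hB1
      (fun x hx => by rw [hψz x hx.2, zero_mul])]
    have hle : ∫⁻ x in B, ENNReal.ofReal (ψ x * (u (x, t) - c) ^ 2) ≤ ENNReal.ofReal (ν ^ 2) * N := by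
      rw [hN, ← lintegral_const_mul' _ _ ENNReal.ofReal_ne_top]
      refine lintegral_mono fun x => ?_
      rw [hNint, ← ENNReal.ofReal_mul (by positivity)]
      refine ENNReal.ofReal_le_ofReal ?_
      have h1 : 1 ≤ ν * k x := by
        have := mul_le_mul_of_nonneg_left (hkν x) hν.le
        rwa [mul_inv_cancel₀ hν.ne'] at this
      have h2 : 1 ≤ ν ^ 2 * k x ^ 2 := by rw [← mul_pow]; exact one_le_pow₀ h1
      calc ψ x * (u (x, t) - c) ^ 2 ≤ (ν ^ 2 * k x ^ 2) * (u (x, t) - c) ^ 2 := by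
            gcongr; exact (hψ1 x).trans h2
        _ = _ := by ring
    have hm : AEStronglyMeasurable (fun x => ψ x * (u (x, t) - c) ^ 2) (volume.restrict B) :=
      hψ.continuous.aestronglyMeasurable.mul ((hfm.sub aestronglyMeasurable_const).pow 2)
    rw [integral_eq_lintegral_of_nonneg_ae (Eventually.of_forall fun x =>
      mul_nonneg (hψ0 x) (sq_nonneg _)) hm]
    have h3 := ENNReal.toReal_mono (ENNReal.mul_ne_top ENNReal.ofReal_ne_top hNt) hle
    rwa [ENNReal.toReal_mul, ENNReal.toReal_ofReal (by positivity)] at h3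
  -- the flux term; half of the elliptic term is spent here
  have hP : |∫ x in ball 0 1, pairing (a (x, t) + d (x, t)) (Du (x, t)) (gradient ψ x) *
      (u (x, t) - c)| ≤ ν / 2 * G + Λ ^ 2 / (2 * ν) * N.toReal := by
    have h := ht.enorm_integral_pairing_le hν hB1 (M := M) hψB
      (b := fun x => u (x, t) - c)
      (hS.integrable_pairing_mul M hψ hψc (hS.memLp.sub (memLp_const c)))
      (hS.integral_pairing_mul_sub_eq_zero hBb hM hψ hψc hψB c)
    have h2 : ∫⁻ x in B, ENNReal.ofReal (k x * ‖Du (x, t)‖ * ‖gradient ψ x‖ * |u (x, t) - c|) ≤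
        ENNReal.ofReal (ν / 2 * G) + ENNReal.ofReal (Λ ^ 2 / (2 * ν)) * N := by
      have h3 : ENNReal.ofReal (ν / 2 * G) =
          ∫⁻ x in B, ENNReal.ofReal (ν / 2 * (ψ x * ‖Du (x, t)‖ ^ 2)) := by
        rw [hG, setIntegral_eq_of_subset_of_forall_sdiff_eq_zero measurableSet_ball hB1
          (fun x hx => by rw [hψz x hx.2, zero_mul]), ← integral_const_mul,
          ofReal_integral_eq_lintegral_ofReal ((hGi.mono_set hB1).const_mul _)
          (Eventually.of_forall fun x => by have := hψ0 x; positivity)]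
      rw [h3, hN, ← lintegral_const_mul' _ _ ENNReal.ofReal_ne_top, ← lintegral_add_left']
      · refine lintegral_mono fun x => ?_
        have hψx := hψ0 x
        rw [hNint, ← ENNReal.ofReal_mul (by positivity), ← ENNReal.ofReal_add (by positivity)
          (by positivity)]
        refine ENNReal.ofReal_le_ofReal ?_
        set G' := ‖gradient ψ x‖
        set v := ‖Du (x, t)‖
        set w := |u (x, t) - c|
        have hw : (u (x, t) - c) ^ 2 = w ^ 2 := (sq_abs _).symm
        rw [hw]
        have hG' : G' ^ 2 ≤ Λ ^ 2 * ψ x := hΛ x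
        -- Young's inequality, with `|∇ψ| ≤ Λ √ψ`
        have h5 : G' ≤ |Λ| * Real.sqrt (ψ x) := by
          refine le_of_sq_le_sq ?_ (by positivity)
          rw [mul_pow, sq_abs, Real.sq_sqrt hψx]; exact hG'
        have h6 : Real.sqrt (ψ x) ^ 2 = ψ x := Real.sq_sqrt hψx
        have h7 : k x * v * G' * w ≤ (Real.sqrt (ψ x) * v) * (|Λ| * k x * w) := by
          have hkx := (hkpos x).le
          have hv : 0 ≤ v := norm_nonneg _
          have hw : 0 ≤ w := abs_nonneg _
          calc k x * v * G' * w = k x * v * w * G' := by ring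
            _ ≤ k x * v * w * (|Λ| * Real.sqrt (ψ x)) := by gcongr
            _ = _ := by ring
        have h8 : (Real.sqrt (ψ x) * v) * (|Λ| * k x * w) ≤
            ν / 2 * (Real.sqrt (ψ x) * v) ^ 2 + 1 / (2 * ν) * (|Λ| * k x * w) ^ 2 := by
          have h9 : 0 ≤ (ν * (Real.sqrt (ψ x) * v) - |Λ| * k x * w) ^ 2 / (2 * ν) := by positivity
          have h10 : (ν * (Real.sqrt (ψ x) * v) - |Λ| * k x * w) ^ 2 / (2 * ν) =
            ν / 2 * (Real.sqrt (ψ x) * v) ^ 2 + 1 / (2 * ν) * (|Λ| * k x * w) ^ 2 -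
              (Real.sqrt (ψ x) * v) * (|Λ| * k x * w) := by field_simp; ring
          linarith
        refine h7.trans (h8.trans (le_of_eq ?_))
        rw [mul_pow, h6, mul_pow, mul_pow, sq_abs]; ring
      · exact ((hGi.mono_set hB1).const_mul _).aestronglyMeasurable.aemeasurable.ennreal_ofReal
    have h4 := h.trans h2
    have h5 := ENNReal.toReal_mono (ENNReal.add_ne_top.2 ⟨ENNReal.ofReal_ne_top,
      ENNReal.mul_ne_top ENNReal.ofReal_ne_top hNt⟩) h4
    rwa [ENNReal.toReal_add ENNReal.ofReal_ne_top (ENNReal.mul_ne_top ENNReal.ofReal_ne_top hNt),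
      ENNReal.toReal_mul, ENNReal.toReal_ofReal (by positivity),
      ENNReal.toReal_ofReal (by positivity), toReal_enorm, Real.norm_eq_abs] at h5
  rw [← ENNReal.ofReal_toReal hNt, ← ENNReal.ofReal_mul hX.le]
  refine ENNReal.ofReal_le_ofReal ?_
  rw [energyRate]
  have hN0 : 0 ≤ N.toReal := ENNReal.toReal_nonneg
  set I1 := ∫ x in ball 0 1, ψ x * (u (x, t) - c) ^ 2 with hI1
  have hI10 : 0 ≤ I1 := integral_nonneg fun x => mul_nonneg (hψ0 x) (sq_nonneg _)
  set I2 := ∫ x in ball 0 1, pairing (a (x, t) + d (x, t)) (Du (x, t)) (gradient ψ x) *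
      (u (x, t) - c)
  set I3 := ∫ x in ball 0 1, ψ x * pairing (a (x, t)) (Du (x, t)) (Du (x, t))
  have hχt := hχ0 t
  have k1 : 1 / 2 * deriv χ t * I1 ≤ 1 / 2 * Λ' * (ν ^ 2 * N.toReal) := by
    have := le_of_abs_le (hΛ' t)
    calc 1 / 2 * deriv χ t * I1 ≤ 1 / 2 * Λ' * I1 := by gcongr
      _ ≤ _ := by gcongr
  have k2 : -(χ t * I2) ≤ χ t * (ν / 2 * G + Λ ^ 2 / (2 * ν) * N.toReal) := by
    rw [← mul_neg]
    exact mul_le_mul_of_nonneg_left ((neg_le_abs _).trans hP) hχt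
  have k3 : χ t * (ν * G) ≤ χ t * I3 := mul_le_mul_of_nonneg_left hD hχt
  have k4 : χ t * (Λ ^ 2 / (2 * ν) * N.toReal) ≤ 1 * (Λ ^ 2 / (2 * ν) * N.toReal) := by
    gcongr; exact hχ1 t
  linarith

end GoodTimes

end ParabolicBMO

namespace ParabolicBMO
open Filter Topology

/-! ### The Caccioppoli inequality and the drift of the local means -/

section Caccioppoli

variable {n : ℕ} {ν : ℝ} {a d : Space n × ℝ → Matrix (Fin n) (Fin n) ℝ} {u : Space n × ℝ → ℝ}
  {Du : Space n × ℝ → Space n} {κ : ℝ≥0} {s : ℕ}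

theorem ofReal_integral_le_lintegral_ofReal {X : Type*} [MeasurableSpace X] {μ : Measure X}
    {f : X → ℝ} (hf : Integrable f μ) :
    ENNReal.ofReal (∫ x, f x ∂μ) ≤ ∫⁻ x, ENNReal.ofReal (f x) ∂μ := by
  rw [integral_eq_lintegral_pos_part_sub_lintegral_neg_part hf]
  refine (ENNReal.ofReal_le_ofReal (sub_le_self _ ENNReal.toReal_nonneg)).trans ?_
  exact ENNReal.ofReal_toReal_le

/-- A bound valid at almost every upper limit is valid at the endpoint, by monotone convergence. -/
theorem lintegral_Ioo_le_of_ae {f : ℝ → ℝ≥0∞} {a b : ℝ} {C : ℝ≥0∞}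
    (h : ∀ᵐ t ∂volume.restrict (Ioo a b), ∫⁻ s in Ioo a t, f s ≤ C) :
    ∫⁻ s in Ioo a b, f s ≤ C := by
  rcases le_or_gt b a with hab | hab
  · rw [Ioo_eq_empty (not_lt.2 hab)]; simp
  have hex : ∀ k : ℕ, ∃ t, b - 1 / ((k : ℝ) + 1) < t ∧ t < b ∧ ∫⁻ s in Ioo a t, f s ≤ C := by
    intro k
    by_contra! hcon
    have hk : (0:ℝ) < 1 / ((k : ℝ) + 1) := by positivity
    set c := max a (b - 1 / ((k : ℝ) + 1)) with hc
    have hcb : c < b := max_lt hab (by linarith)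
    have h2 := ae_restrict_of_ae_restrict_of_subset (Ioo_subset_Ioo_left (le_max_left a
      (b - 1 / ((k : ℝ) + 1)))) h
    rw [ae_restrict_iff' measurableSet_Ioo] at h2
    have hz : volume (Ioo c b) = 0 := by
      refine measure_mono_null (fun t ht => ?_) h2
      simp only [mem_compl_iff, mem_ofPred_eq]
      exact fun h => absurd (h ht) (not_le.2 (hcon t ((le_max_right _ _).trans_lt ht.1) ht.2))
    rw [Real.volume_Ioo, ENNReal.ofReal_eq_zero] at hz
    linarith
  choose t ht1 ht2 ht3 using hex
  have hU : Ioo a b ⊆ ⋃ k, Ioo a (t k) := by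
    intro x hx
    obtain ⟨k, hk⟩ := exists_nat_one_div_lt (sub_pos.2 hx.2)
    exact mem_iUnion.2 ⟨k, hx.1, by linarith [ht1 k]⟩
  refine (lintegral_mono_set hU).trans ?_
  rw [setLIntegral_iUnion_of_directed]
  · exact iSup_le ht3
  · intro i j
    rcases le_total (t i) (t j) with h | h
    · exact ⟨j, Ioo_subset_Ioo_right h, subset_rfl⟩
    · exact ⟨i, subset_rfl, Ioo_subset_Ioo_right h⟩

theorem enorm_rpow_two_eq_ofReal_sq {F : Type*} [NormedAddCommGroup F] (v : F) :
    ‖v‖ₑ ^ (2:ℝ) = ENNReal.ofReal (‖v‖ ^ 2) := by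
  rw [ENNReal.ofReal_pow (norm_nonneg _), ofReal_norm, ENNReal.rpow_ofNat]

namespace IsSuitableWeakSolution

/-- The energy inequality for `u - c`, integrated in time, with the gradient absorbed. -/
theorem lintegral_sub_sq_le_and_lintegral_grad_sq_le (hu : IsSuitableWeakSolution a d 1 u Du)
    (hν : 0 < ν) (ha : IsEllipticOn ν (parabolicBall 0 1) a)
    {x₀ : Space n} {r t₁ : ℝ} (hr : 0 < r) (h1 : -1 < t₁ - (2 * r) ^ 2) (h2 : t₁ ≤ 0)
    (hx₀ : ball x₀ r ⊆ ball 0 1)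
    {ψ : Space n → ℝ} (hψ : ContDiff ℝ ∞ ψ) (hψc : HasCompactSupport ψ)
    (hψB : tsupport ψ ⊆ ball 0 1) (hψ0 : ∀ x, 0 ≤ ψ x) (hψ1 : ∀ x ∈ ball x₀ r, ψ x = 1)
    {χ : ℝ → ℝ} (hχ : ContDiff ℝ ∞ χ) (hχc : HasCompactSupport χ)
    (hχJ : tsupport χ ⊆ Icc (t₁ - 2 * r ^ 2) (t₁ + 2 * r ^ 2)) (hχ0 : ∀ t, 0 ≤ χ t)
    (hχ1 : ∀ t ∈ Ioo (t₁ - r ^ 2) t₁, χ t = 1) (c : ℝ) {N : ℝ → ℝ≥0∞}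
    (hN : ∀ᵐ t ∂volume.restrict (Ioo (t₁ - (2 * r) ^ 2) t₁),
      ENNReal.ofReal (energyRate a d u Du ψ χ c t +
        ν / 2 * (χ t * ∫ x in ball 0 1, ψ x * ‖Du (x, t)‖ ^ 2)) ≤ N t) :
    (∀ᵐ t ∂volume.restrict (Ioo (t₁ - r ^ 2) t₁),
      ∫⁻ x in ball x₀ r, ‖u (x, t) - c‖ₑ ^ (2:ℝ) ≤
        2 * ∫⁻ t in Ioo (t₁ - (2 * r) ^ 2) t₁, N t) ∧
    ∫⁻ t in Ioo (t₁ - r ^ 2) t₁, ∫⁻ x in ball x₀ r, ‖Du (x, t)‖ₑ ^ (2:ℝ) ≤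
      ENNReal.ofReal (2 / ν) * ∫⁻ t in Ioo (t₁ - (2 * r) ^ 2) t₁, N t := by
  have hr2 : 0 < r ^ 2 := by positivity
  have hfin : IsFiniteMeasure ((volume : Measure (Space n)).restrict (ball 0 1)) :=
    ⟨by rw [Measure.restrict_apply_univ]; exact measure_ball_lt_top⟩
  have hW := hu.memW
  rw [parabolicBall_zero_one] at hW
  have hE := hu.energy_sub_const hν ha hψ hψc hψB hψ0 hχ hχc
    (hχJ.trans (Icc_subset_Ioo (by nlinarith) (by nlinarith))) hχ0 h1
    (t₁' := t₁ - 2 * r ^ 2) (by nlinarith) (fun t ht =>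
      image_eq_zero_of_notMem_tsupport fun h => absurd (hχJ h).1 (not_le.2 ht))
  obtain ⟨Cψ, hCψ⟩ := hψc.exists_bound_of_continuous hψ.continuous
  obtain ⟨Cχ, hCχ⟩ := hχc.exists_bound_of_continuous hχ.continuous
  set G : ℝ → ℝ := fun t => ∫ x in ball 0 1, ψ x * ‖Du (x, t)‖ ^ 2 with hG
  have hG0 : ∀ t, 0 ≤ G t := fun t => integral_nonneg fun x => mul_nonneg (hψ0 x) (sq_nonneg _)
  have hGi : IntegrableOn (fun z => ψ z.1 * ‖Du z‖ ^ 2) (ball 0 1 ×ˢ Ioo (-1) 0) :=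
    ((memLp_two_iff_integrable_sq_norm hW.memLp_grad.aestronglyMeasurable).1
      hW.memLp_grad).bdd_mul (c := Cψ) (hψ.continuous.comp continuous_fst).aestronglyMeasurable
      (Eventually.of_forall fun z => hCψ z.1)
  have hχGi : IntegrableOn (fun t => χ t * G t) (Ioo (-1) 0) :=
    (integrableOn_integral_slice hGi).bdd_mul (c := Cχ) hχ.continuous.aestronglyMeasurable
      (Eventually.of_forall hCχ)
  have hJ1 : Ioo (t₁ - r ^ 2) t₁ ⊆ Ioo (t₁ - (2 * r) ^ 2) 0 := Ioo_subset_Ioo (by nlinarith) h2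
  have hJ2 : Ioo (t₁ - r ^ 2) t₁ ⊆ Ioo (-1) 0 := Ioo_subset_Ioo (by nlinarith) h2
  have hslices : ∀ᵐ t ∂volume.restrict (Ioo (-1) 0),
      IntegrableOn (fun x => ψ x * ‖Du (x, t)‖ ^ 2) (ball 0 1) ∧
      MemLp (fun x => u (x, t)) 2 (volume.restrict (ball 0 1)) := by
    filter_upwards [ae_integrableOn_slice hGi, ae_memLp_slice hW.memLp] with t h3 h4 using ⟨h3, h4⟩
  set I : ℝ≥0∞ := ∫⁻ t in Ioo (t₁ - (2 * r) ^ 2) t₁, N t with hI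
  -- the bound at a single final time `t₀`, from which both claims follow
  have hkey : ∀ᵐ t₀ ∂volume.restrict (Ioo (t₁ - r ^ 2) t₁),
      ENNReal.ofReal (1 / 2 * (∫ x in ball 0 1, ψ x * (u (x, t₀) - c) ^ 2) +
        ν / 2 * ∫ t in Ioo (t₁ - (2 * r) ^ 2) t₀, χ t * G t) ≤ I := by
    filter_upwards [ae_restrict_of_ae_restrict_of_subset hJ1 hE,
      ae_restrict_mem measurableSet_Ioo] with t₀ ht₀ htm
    obtain ⟨hi, hle⟩ := ht₀ c
    have hsub : Ioo (t₁ - (2 * r) ^ 2) t₀ ⊆ Ioo (t₁ - (2 * r) ^ 2) t₁ :=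
      Ioo_subset_Ioo_right htm.2.le
    have hχGi' := hχGi.mono_set (hsub.trans (Ioo_subset_Ioo h1.le h2))
    rw [hχ1 t₀ htm, mul_one] at hle
    calc _ ≤ ENNReal.ofReal (∫ t in Ioo (t₁ - (2 * r) ^ 2) t₀,
          (energyRate a d u Du ψ χ c t + ν / 2 * (χ t * G t))) := by
          rw [integral_add hi (hχGi'.const_mul _), integral_const_mul]
          exact ENNReal.ofReal_le_ofReal (by linarith)
      _ ≤ ∫⁻ t in Ioo (t₁ - (2 * r) ^ 2) t₀, ENNReal.ofReal
          (energyRate a d u Du ψ χ c t + ν / 2 * (χ t * G t)) :=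
          ofReal_integral_le_lintegral_ofReal (hi.add (hχGi'.const_mul _))
      _ ≤ ∫⁻ t in Ioo (t₁ - (2 * r) ^ 2) t₀, N t :=
          lintegral_mono_ae (ae_restrict_of_ae_restrict_of_subset hsub hN)
      _ ≤ I := lintegral_mono_set hsub
  have hχGpos : ∀ t₀, 0 ≤ ∫ t in Ioo (t₁ - (2 * r) ^ 2) t₀, χ t * G t := fun t₀ =>
    integral_nonneg fun t => mul_nonneg (hχ0 t) (hG0 t)
  refine ⟨?_, ?_⟩
  · filter_upwards [hkey, ae_restrict_of_ae_restrict_of_subset hJ2 hslices] with t₀ ht₀ hsl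
    have hsq : IntegrableOn (fun x => ψ x * (u (x, t₀) - c) ^ 2) (ball 0 1) :=
      (hsl.2.sub (memLp_const c)).integrable_sq.bdd_mul (c := Cψ)
        hψ.continuous.aestronglyMeasurable (Eventually.of_forall hCψ)
    calc ∫⁻ x in ball x₀ r, ‖u (x, t₀) - c‖ₑ ^ (2:ℝ)
        ≤ ∫⁻ x in ball x₀ r, ENNReal.ofReal (ψ x * (u (x, t₀) - c) ^ 2) := by
          refine lintegral_mono_ae ?_
          filter_upwards [ae_restrict_mem measurableSet_ball] with x hx
          rw [enorm_rpow_two_eq_ofReal_sq, hψ1 x hx, one_mul, Real.norm_eq_abs, sq_abs]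
      _ ≤ ∫⁻ x in ball 0 1, ENNReal.ofReal (ψ x * (u (x, t₀) - c) ^ 2) := lintegral_mono_set hx₀
      _ = ENNReal.ofReal (∫ x in ball 0 1, ψ x * (u (x, t₀) - c) ^ 2) :=
          (ofReal_integral_eq_lintegral_ofReal hsq
            (Eventually.of_forall fun x => mul_nonneg (hψ0 x) (sq_nonneg _))).symm
      _ = 2 * ENNReal.ofReal (1 / 2 * ∫ x in ball 0 1, ψ x * (u (x, t₀) - c) ^ 2) := by
          have e : ∀ y : ℝ, ENNReal.ofReal y = 2 * ENNReal.ofReal (1 / 2 * y) := fun y => by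
            rw [show (2:ℝ≥0∞) = ENNReal.ofReal 2 by simp, ← ENNReal.ofReal_mul (by norm_num)]
            congr 1; ring
          exact e _
      _ ≤ 2 * I := by
          gcongr
          refine (ENNReal.ofReal_le_ofReal ?_).trans ht₀
          have := hχGpos t₀
          have : 0 ≤ ν / 2 * ∫ t in Ioo (t₁ - (2 * r) ^ 2) t₀, χ t * G t := by positivity
          linarith
  · refine lintegral_Ioo_le_of_ae ?_
    filter_upwards [hkey, ae_restrict_mem measurableSet_Ioo] with t₀ ht₀ htm
    have hsub1 : Ioo (t₁ - r ^ 2) t₀ ⊆ Ioo (t₁ - r ^ 2) t₁ := Ioo_subset_Ioo_right htm.2.le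
    have hsub2 : Ioo (t₁ - r ^ 2) t₀ ⊆ Ioo (t₁ - (2 * r) ^ 2) t₀ := Ioo_subset_Ioo_left (by nlinarith)
    have hsub3 : Ioo (t₁ - (2 * r) ^ 2) t₀ ⊆ Ioo (-1) 0 :=
      Ioo_subset_Ioo h1.le (htm.2.le.trans h2)
    calc ∫⁻ t in Ioo (t₁ - r ^ 2) t₀, ∫⁻ x in ball x₀ r, ‖Du (x, t)‖ₑ ^ (2:ℝ)
        ≤ ∫⁻ t in Ioo (t₁ - r ^ 2) t₀, ENNReal.ofReal (χ t * G t) := by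
          refine lintegral_mono_ae ?_
          filter_upwards [ae_restrict_of_ae_restrict_of_subset (hsub1.trans hJ2) hslices,
            ae_restrict_mem measurableSet_Ioo] with t hsl htt
          rw [hχ1 t (hsub1 htt), one_mul]
          calc ∫⁻ x in ball x₀ r, ‖Du (x, t)‖ₑ ^ (2:ℝ)
              ≤ ∫⁻ x in ball x₀ r, ENNReal.ofReal (ψ x * ‖Du (x, t)‖ ^ 2) := by
                refine lintegral_mono_ae ?_
                filter_upwards [ae_restrict_mem measurableSet_ball] with x hx
                rw [enorm_rpow_two_eq_ofReal_sq, hψ1 x hx, one_mul]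
            _ ≤ ∫⁻ x in ball 0 1, ENNReal.ofReal (ψ x * ‖Du (x, t)‖ ^ 2) := lintegral_mono_set hx₀
            _ = ENNReal.ofReal (G t) := (ofReal_integral_eq_lintegral_ofReal hsl.1
                (Eventually.of_forall fun x => mul_nonneg (hψ0 x) (sq_nonneg _))).symm
      _ ≤ ∫⁻ t in Ioo (t₁ - (2 * r) ^ 2) t₀, ENNReal.ofReal (χ t * G t) := lintegral_mono_set hsub2
      _ = ENNReal.ofReal (∫ t in Ioo (t₁ - (2 * r) ^ 2) t₀, χ t * G t) :=
          (ofReal_integral_eq_lintegral_ofReal (hχGi.mono_set hsub3)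
            (Eventually.of_forall fun t => mul_nonneg (hχ0 t) (hG0 t))).symm
      _ = ENNReal.ofReal (2 / ν) *
          ENNReal.ofReal (ν / 2 * ∫ t in Ioo (t₁ - (2 * r) ^ 2) t₀, χ t * G t) := by
          rw [← ENNReal.ofReal_mul (by positivity)]
          congr 1; field_simp
      _ ≤ ENNReal.ofReal (2 / ν) * I := by
          gcongr
          refine (ENNReal.ofReal_le_ofReal ?_).trans ht₀
          have : 0 ≤ ∫ x in ball 0 1, ψ x * (u (x, t₀) - c) ^ 2 :=
            integral_nonneg fun x => mul_nonneg (hψ0 x) (sq_nonneg _)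
          linarith

/-- The means `∫ ψ u` at two times differ by at most the total flux. -/
theorem exists_enorm_localMass_sub_le (hu : IsSuitableWeakSolution a d 1 u Du) {ψ : Space n → ℝ}
    (hψ : ContDiff ℝ ∞ ψ) (hψc : HasCompactSupport ψ) (hψB : tsupport ψ ⊆ ball 0 1) {t₁ t₂ : ℝ}
    (h1 : -1 < t₁) (h2 : t₂ ≤ 0) :
    ∃ S : Set ℝ, (∀ᵐ t ∂volume.restrict (Ioo t₁ t₂), t ∈ S) ∧ ∀ t ∈ S, ∀ t' ∈ S,
      ‖localMass u ψ t - localMass u ψ t'‖ₑ ≤ ∫⁻ t in Ioo t₁ t₂, ‖flux a d Du ψ t‖ₑ := by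
  -- the representation of the local mass is available up to any time before `t₂` only; the
  -- constants `K k` may differ, but both times of a pair are compared with the same `k`
  set b : ℕ → ℝ := fun k => t₂ - 1 / ((k : ℝ) + 1) with hb
  have hbt : ∀ k, b k < t₂ := fun k => by
    have : (0:ℝ) < 1 / ((k : ℝ) + 1) := by positivity
    simp only [hb]; linarith
  have hex : ∀ k, ∃ K, ∀ᵐ t ∂volume.restrict (Ioo t₁ (b k)),
      localMass u ψ t = K - ∫ s in t₁..t, flux a d Du ψ s := by
    intro k
    rcases le_or_gt (b k) t₁ with h | h
    · refine ⟨0, ?_⟩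
      rw [Ioo_eq_empty (not_lt.2 h), Measure.restrict_empty, ae_zero]; trivial
    · exact hu.exists_localMass_eq hψ hψc hψB h1 h ((hbt k).trans_le h2)
  choose K hK using hex
  refine ⟨{t | t ∈ Ioo t₁ t₂ ∧ ∀ k, t < b k →
    localMass u ψ t = K k - ∫ s in t₁..t, flux a d Du ψ s}, ?_, ?_⟩
  · have h3 : ∀ᵐ t ∂volume.restrict (Ioo t₁ t₂), ∀ k, t < b k →
        localMass u ψ t = K k - ∫ s in t₁..t, flux a d Du ψ s := by
      rw [ae_all_iff]; intro k
      have h4 := hK k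
      rw [ae_restrict_iff' measurableSet_Ioo] at h4 ⊢
      filter_upwards [h4] with t ht htm htb using ht ⟨htm.1, htb⟩
    filter_upwards [h3, ae_restrict_mem measurableSet_Ioo] with t ht htm using ⟨htm, ht⟩
  · rintro t ⟨ht, htK⟩ t' ⟨ht', htK'⟩
    obtain ⟨k, hk⟩ := exists_nat_one_div_lt (sub_pos.2 (max_lt ht.2 ht'.2))
    have hkb : max t t' < b k := by simp only [hb]; linarith
    rw [htK k ((le_max_left _ _).trans_lt hkb), htK' k ((le_max_right _ _).trans_lt hkb)]
    have hi : IntegrableOn (flux a d Du ψ) (Ioo t₁ (b k)) :=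
      hu.integrableOn_flux hψ hψc hψB h1 ((hbt k).trans_le h2)
    have hii : ∀ τ, τ ∈ Ioo t₁ t₂ → τ < b k → IntervalIntegrable (flux a d Du ψ) volume t₁ τ := by
      intro τ hτ hτb
      rw [intervalIntegrable_iff_integrableOn_Ioo_of_le hτ.1.le]
      exact hi.mono_set (Ioo_subset_Ioo_right hτb.le)
    have e : K k - (∫ s in t₁..t, flux a d Du ψ s) - (K k - ∫ s in t₁..t', flux a d Du ψ s) =
        ∫ s in t..t', flux a d Du ψ s := by
      rw [← intervalIntegral.integral_interval_sub_left
        (hii t' ht' ((le_max_right _ _).trans_lt hkb))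
        (hii t ht ((le_max_left _ _).trans_lt hkb))]
      ring
    rw [e]
    have hnorm : ‖∫ s in t..t', flux a d Du ψ s‖ₑ = ‖∫ s in uIoc t t', flux a d Du ψ s‖ₑ := by
      rw [← ofReal_norm, ← ofReal_norm, intervalIntegral.norm_intervalIntegral_eq]
    rw [hnorm]
    refine (enorm_integral_le_lintegral_enorm _).trans (lintegral_mono_set ?_)
    intro x hx
    exact ⟨lt_of_lt_of_le (lt_min ht.1 ht'.1) hx.1.le, lt_of_le_of_lt hx.2 (max_lt ht.2 ht'.2)⟩

end IsSuitableWeakSolution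

end Caccioppoli

end ParabolicBMO

namespace ParabolicBMO
open Filter Topology

/-! ### The one-scale estimate -/

section OneScale

variable {n : ℕ} {ν : ℝ} {a d : Space n × ℝ → Matrix (Fin n) (Fin n) ℝ} {u : Space n × ℝ → ℝ}
  {Du : Space n × ℝ → Space n} {κ : ℝ≥0} {α q m : ℝ} {s : ℕ}

/-- The mean square deviation of `u(·, t)` from its weighted mean over `B`. -/
noncomputable def sliceDeviation (B : Set (Space n)) (ψ : Space n → ℝ) (u : Space n × ℝ → ℝ)
    (t : ℝ) : ℝ≥0∞ :=
  ∫⁻ x, ‖u (x, t) - weightedMean B ψ (fun x => u (x, t))‖ₑ ^ (2:ℝ) ∂unif B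

/-- The mean of `|∇u(·, t)|^q` over `B`. -/
noncomputable def sliceGrad (B : Set (Space n)) (Du : Space n × ℝ → Space n) (q t : ℝ) : ℝ≥0∞ :=
  ∫⁻ x, ‖Du (x, t)‖ₑ ^ q ∂unif B

theorem aemeasurable_sliceGrad {B : Set (Space n)} {J : Set ℝ}
    (h : AEStronglyMeasurable Du (volume.restrict (B ×ˢ J))) (q : ℝ) :
    AEMeasurable (sliceGrad B Du q) (volume.restrict J) := by
  rw [restrict_prod_eq] at h
  unfold sliceGrad
  simp only [lintegral_unif]
  exact ((h.enorm.pow_const q).lintegral_prod_left').const_mul _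

theorem volume_ball_two_mul (x : Space n) {r : ℝ} (hr : 0 < r) :
    volume (ball x (2 * r)) = 2 ^ n * volume (ball x r) := by
  rw [Measure.addHaar_ball_of_pos _ _ (by positivity), Measure.addHaar_ball_of_pos _ _ hr,
    finrank_euclideanSpace, Fintype.card_fin, mul_pow, ENNReal.ofReal_mul (by positivity),
    ENNReal.ofReal_pow (by norm_num), mul_assoc]
  simp

theorem volume_ball_two_mul_le_ofReal_integral {x₀ : Space n} {r : ℝ} (hr : 0 < r) {ψ : Space n → ℝ}
    (hψ : Continuous ψ) (hψc : HasCompactSupport ψ) (hψ0 : ∀ x, 0 ≤ ψ x)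
    (hψ1 : ∀ x ∈ ball x₀ r, ψ x = 1) :
    volume (ball x₀ (2 * r)) ≤ 2 ^ n * ENNReal.ofReal (∫ y in ball x₀ (2 * r), ψ y) := by
  rw [volume_ball_two_mul x₀ hr]
  gcongr
  have hi : IntegrableOn ψ (ball x₀ (2 * r)) := (hψ.integrable_of_hasCompactSupport hψc).integrableOn
  rw [ofReal_integral_eq_lintegral_ofReal hi (Eventually.of_forall hψ0)]
  calc volume (ball x₀ r) = ∫⁻ _ in ball x₀ r, 1 := by simp
    _ = ∫⁻ y in ball x₀ r, ENNReal.ofReal (ψ y) := by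
        refine setLIntegral_congr_fun measurableSet_ball fun y hy => ?_
        simp only [hψ1 y hy, ENNReal.ofReal_one]
    _ ≤ _ := lintegral_mono_set (ball_subset_ball (by linarith))

/-- Hölder's inequality with the conjugate exponents `q` and `m`, where `m ≤ s`. -/
theorem lintegral_mul_enorm_le_of_isExponents (he : IsExponents n α q m s) {X : Type*}
    [MeasurableSpace X] {P : Measure X} [IsProbabilityMeasure P] {K v : X → ℝ≥0∞}
    (hK : AEMeasurable K P) (hv : AEMeasurable v P) (hKκ : ∫⁻ x, K x ^ (s:ℝ) ∂P ≤ κ) :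
    ∫⁻ x, K x * v x ∂P ≤ (κ : ℝ≥0∞) ^ (1 / (s:ℝ)) * (∫⁻ x, v x ^ q ∂P) ^ (1 / q) := by
  have hm0 : 0 < m := by linarith [he.two_le]
  have hs0 : (0:ℝ) < s := by linarith [he.le_s]
  have hq : q.HolderConjugate m := Real.holderConjugate_iff.2 ⟨he.one_le, he.conj⟩
  have h1 := ENNReal.lintegral_mul_le_Lp_mul_Lq P hq.symm hK hv
  refine h1.trans ?_
  gcongr
  have h2 : (∫⁻ x, K x ^ m ∂P) ^ ((s:ℝ) / m) ≤ κ := by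
    refine (lintegral_rpow_le_of_isProbabilityMeasure (hK.pow_const _)
      (by rw [le_div_iff₀ hm0, one_mul]; exact he.le_s)).trans ?_
    refine le_trans (le_of_eq (lintegral_congr fun x => ?_)) hKκ
    rw [← ENNReal.rpow_mul, mul_div_cancel₀ _ hm0.ne']
  calc (∫⁻ x, K x ^ m ∂P) ^ (1 / m) = ((∫⁻ x, K x ^ m ∂P) ^ ((s:ℝ) / m)) ^ (1 / (s:ℝ)) := by
        rw [← ENNReal.rpow_mul]; congr 1; field_simp
    _ ≤ _ := by gcongr

theorem IsGoodTime.aemeasurable_coeffBound {t : ℝ} (ht : IsGoodTime ν κ s a d u Du t)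
    (M : Matrix (Fin n) (Fin n) ℝ) {B : Set (Space n)} (hB : B ⊆ ball 0 1) :
    AEMeasurable (fun x => ENNReal.ofReal (coeffBound ν M (d (x, t)))) (unif B) := by
  refine AEMeasurable.ennreal_ofReal ?_
  unfold coeffBound
  refine aemeasurable_const.add (Finset.aemeasurable_fun_sum _ fun i _ =>
    Finset.aemeasurable_fun_sum _ fun j _ => ?_)
  have h1 := ((ht.measurable_skew i j).mono_set hB).mono_ac (unif_absolutelyContinuous B)
  exact (h1.sub aestronglyMeasurable_const).norm.aemeasurable

theorem enorm_sub_le_ofReal_of_mem_ball {x₀ : Space n} {r : ℝ} {x y : Space n}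
    (hx : x ∈ ball x₀ r) (hy : y ∈ ball x₀ r) : ‖x - y‖ₑ ≤ ENNReal.ofReal (2 * r) := by
  rw [← ofReal_norm, ← dist_eq_norm]
  refine ENNReal.ofReal_le_ofReal ?_
  rw [mem_ball] at hx hy
  linarith [dist_triangle_right x y x₀]

/-- **One-scale estimate.** The quantity `r^q ⨍ (E(t))^{1-α} ⨍|∇u|^q dt + r² (⨍⨍ |∇u|^q)^{2/q}`
controls both the deviation of `u` from a constant and the gradient, where `E` is the deviation of
the slices from their weighted means. -/
theorem exists_one_scale (he : IsExponents n α q m s) (hν : 0 < ν) (κ : ℝ≥0) :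
    ∃ C : ℝ≥0∞, C ≠ ⊤ ∧ ∀ (a d : Space n × ℝ → Matrix (Fin n) (Fin n) ℝ) (u : Space n × ℝ → ℝ)
      (Du : Space n × ℝ → Space n), IsEllipticOn ν (parabolicBall 0 1) a →
      IsSuitableWeakSolution a d 1 u Du →
      (∀ᵐ t ∂volume.restrict (Ioo (-1) 0), IsGoodTime ν κ s a d u Du t) →
      ∀ (x₀ : Space n) (r t₁ : ℝ), 0 < r → -1 < t₁ - (2 * r) ^ 2 → t₁ ≤ 0 →
      closedBall x₀ (2 * (2 * r)) ⊆ ball 0 1 →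
      ∃ (ψ : Space n → ℝ) (c : ℝ), Continuous ψ ∧ (∀ x, 0 ≤ ψ x) ∧ (∀ x, ψ x ≤ 1) ∧
        volume (ball x₀ (2 * r)) ≤ 2 ^ n * ENNReal.ofReal (∫ y in ball x₀ (2 * r), ψ y) ∧
        (∀ᵐ t ∂volume.restrict (Ioo (t₁ - r ^ 2) t₁),
          ∫⁻ x, ‖u (x, t) - c‖ₑ ^ (2:ℝ) ∂unif (ball x₀ r) ≤ C * (ENNReal.ofReal r ^ q *
            (∫⁻ t, sliceDeviation (ball x₀ (2 * r)) ψ u t ^ (1 - α) *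
              sliceGrad (ball x₀ (2 * r)) Du q t ∂unif (Ioo (t₁ - (2 * r) ^ 2) t₁)) +
            ENNReal.ofReal r ^ (2:ℝ) * (∫⁻ t, sliceGrad (ball x₀ (2 * r)) Du q t
              ∂unif (Ioo (t₁ - (2 * r) ^ 2) t₁)) ^ (2 / q))) ∧
        ENNReal.ofReal r ^ (2:ℝ) *
          (∫⁻ t, sliceGrad (ball x₀ r) Du 2 t ∂unif (Ioo (t₁ - r ^ 2) t₁)) ≤
            C * (ENNReal.ofReal r ^ q *
            (∫⁻ t, sliceDeviation (ball x₀ (2 * r)) ψ u t ^ (1 - α) *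
              sliceGrad (ball x₀ (2 * r)) Du q t ∂unif (Ioo (t₁ - (2 * r) ^ 2) t₁)) +
            ENNReal.ofReal r ^ (2:ℝ) * (∫⁻ t, sliceGrad (ball x₀ (2 * r)) Du q t
              ∂unif (Ioo (t₁ - (2 * r) ^ 2) t₁)) ^ (2 / q)) := by
  have hq0 : 0 < q := by linarith [he.one_le]
  have hm0 : 0 < m := by linarith [he.two_le]
  have hs0 : (0:ℝ) < s := by linarith [he.le_s]
  obtain ⟨Λ, hΛ0, hcut⟩ := exists_cutoff n
  obtain ⟨Λ', hΛ'0, hcut'⟩ := exists_time_cutoff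
  -- the constant of the slice energy inequality at unit scale
  set X₀ : ℝ := 1 / 2 * Λ' * ν ^ 2 + Λ ^ 2 / (2 * ν) with hX₀
  set L : ℝ≥0∞ := 2 ^ n with hL
  have hLt : L ≠ ⊤ := ENNReal.pow_ne_top (by norm_num)
  -- the factor `4` is the ratio of the diameter of the doubled ball to `r`
  set S := sobolevConst n m q L * 4 ^ q with hS
  have hSt : S ≠ ⊤ := ENNReal.mul_ne_top (sobolevConst_ne_top hm0 hq0 hLt)
    (ENNReal.rpow_ne_top_of_nonneg hq0.le (by norm_num))
  set K₁ : ℝ≥0∞ := (κ : ℝ≥0∞) ^ (1 / (s:ℝ)) with hK₁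
  have hK₁t : K₁ ≠ ⊤ := ENNReal.rpow_ne_top_of_nonneg (by positivity) ENNReal.coe_ne_top
  set K₂ : ℝ≥0∞ := (κ : ℝ≥0∞) ^ (2 / (s:ℝ)) with hK₂
  have hK₂t : K₂ ≠ ⊤ := ENNReal.rpow_ne_top_of_nonneg (by positivity) ENNReal.coe_ne_top
  set Y : ℝ≥0∞ := (L * ENNReal.ofReal Λ * K₁ * 4) ^ (2:ℝ) with hY
  have hYt : Y ≠ ⊤ := ENNReal.rpow_ne_top_of_nonneg (by norm_num) (ENNReal.mul_ne_top
    (ENNReal.mul_ne_top (ENNReal.mul_ne_top hLt ENNReal.ofReal_ne_top) hK₁t) (by norm_num))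
  set C₁ : ℝ≥0∞ := ENNReal.ofReal X₀ * L * (2 * K₂) * 4 * (S + Y) with hC₁
  have hC₁t : C₁ ≠ ⊤ := by
    refine ENNReal.mul_ne_top (ENNReal.mul_ne_top (ENNReal.mul_ne_top (ENNReal.mul_ne_top
      ENNReal.ofReal_ne_top hLt) (ENNReal.mul_ne_top (by norm_num) hK₂t)) (by norm_num))
      (ENNReal.add_ne_top.2 ⟨hSt, hYt⟩)
  refine ⟨(2 + ENNReal.ofReal (2 / ν)) * C₁, ENNReal.mul_ne_top (ENNReal.add_ne_top.2
    ⟨by norm_num, ENNReal.ofReal_ne_top⟩) hC₁t, ?_⟩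
  intro a d u Du ha hu hgood x₀ r t₁ hr h1 h2 hball
  obtain ⟨ψ, hψ, hψc, hψB, hψ0, hψ1, hψr, hψg⟩ := hcut x₀ r hr
  obtain ⟨χ, hχ, hχc, hχJ, hχ0, hχ1, hχr, hχd⟩ := hcut' t₁ r hr
  set B := ball x₀ (2 * r) with hBdef
  set J := Ioo (t₁ - (2 * r) ^ 2) t₁ with hJdef
  set ρ := ENNReal.ofReal r with hρdef
  have hr2 : 0 < r ^ 2 := by positivity
  have hρ0 : ρ ≠ 0 := by simpa [hρdef] using hr
  have hρt : ρ ≠ ⊤ := ENNReal.ofReal_ne_top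
  obtain ⟨R, hR0, hR1, hR⟩ := exists_lt_one_closedBall_subset hball
  have hBR : B ⊆ ball 0 R := (ball_subset_closedBall.trans
    (closedBall_subset_closedBall (by linarith))).trans hR
  have hB1 : B ⊆ ball 0 1 := hBR.trans (ball_subset_ball hR1.le)
  have hψB1 : tsupport ψ ⊆ ball 0 1 := hψB.trans hB1
  have hJ1 : J ⊆ Ioo (-1) 0 := Ioo_subset_Ioo h1.le h2
  have hB0 : volume B ≠ 0 := (measure_ball_pos _ _ (by positivity)).ne'
  have hBt : volume B ≠ ⊤ := measure_ball_lt_top.ne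
  have hP := isProbabilityMeasure_unif hB0 hBt
  have hvJ : volume J = 4 * ρ ^ (2:ℝ) := by
    rw [hJdef, Real.volume_Ioo, hρdef, ENNReal.rpow_ofNat, ← ENNReal.ofReal_pow hr.le,
      show (4:ℝ≥0∞) = ENNReal.ofReal 4 by simp, ← ENNReal.ofReal_mul (by norm_num)]
    congr 1; ring
  have hρ2 : ρ ^ (2:ℝ) ≠ 0 := by simp [hρ0]
  have hρ2t : ρ ^ (2:ℝ) ≠ ⊤ := ENNReal.rpow_ne_top_of_nonneg (by norm_num) hρt
  have hJ0 : volume J ≠ 0 := by rw [hvJ]; exact mul_ne_zero (by norm_num) hρ2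
  have hJt : volume J ≠ ⊤ := by rw [hvJ]; exact ENNReal.mul_ne_top (by norm_num) hρ2t
  have hT := isProbabilityMeasure_unif hJ0 hJt
  have hLB := volume_ball_two_mul_le_ofReal_integral hr hψ.continuous hψc hψ0 hψr
  have hDm : AEStronglyMeasurable Du (volume.restrict (B ×ˢ J)) := by
    have := hu.memW.memLp_grad.aestronglyMeasurable
    rw [parabolicBall_zero_one] at this
    exact this.mono_set (prod_mono hB1 hJ1)
  have hGm : AEMeasurable (sliceGrad B Du q) (unif J) :=
    (aemeasurable_sliceGrad hDm q).mono_ac (unif_absolutelyContinuous J)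
  have hgoodJ := ae_restrict_of_ae_restrict_of_subset hJ1 hgood
  set E := sliceDeviation B ψ u with hE
  set G := sliceGrad B Du q with hG
  set GT := ∫⁻ t, G t ∂unif J with hGT
  have hunif : ∀ f : ℝ → ℝ≥0∞, ∫⁻ t in J, f t = volume J * ∫⁻ t, f t ∂unif J := fun f => by
    rw [lintegral_unif, ← mul_assoc, ENNReal.mul_inv_cancel hJ0 hJt, one_mul]
  have hunifB : ∀ f : Space n → ℝ≥0∞, ∫⁻ x in B, f x = volume B * ∫⁻ x, f x ∂unif B := fun f => by
    rw [lintegral_unif, ← mul_assoc, ENNReal.mul_inv_cancel hB0 hBt, one_mul]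
  -- the gradient of the cutoff
  have hψg1 : ∀ x, ‖gradient ψ x‖ ≤ Λ / r := by
    intro x
    refine le_of_sq_le_sq ((hψg x).trans ?_) (by positivity)
    exact mul_le_of_le_one_right (by positivity) (hψ1 x)
  -- the flux
  have hflux : ∀ᵐ t ∂volume.restrict J, ‖flux a d Du ψ t‖ₑ ≤
      ENNReal.ofReal (Λ / r) * (volume B * (K₁ * G t ^ (1 / q))) := by
    filter_upwards [hgoodJ] with t ht
    obtain ⟨M, hM, hMκ⟩ := ht.coeff x₀ (2 * r) (by positivity) hball
    refine (ht.enorm_flux_le hν hR1 hBR hM hψ hψc hψB hψg1).trans ?_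
    rw [hunifB]
    gcongr
    exact lintegral_mul_enorm_le_of_isExponents he (ht.aemeasurable_coeffBound M hB1)
      ((ht.memLp_grad.aestronglyMeasurable.mono_set hB1).mono_ac
        (unif_absolutelyContinuous B)).enorm hMκ
  have hfluxJ : ∫⁻ t in J, ‖flux a d Du ψ t‖ₑ ≤
      ENNReal.ofReal (Λ / r) * (volume B * (K₁ * (4 * ρ ^ (2:ℝ) * GT ^ (1 / q)))) := by
    refine (lintegral_mono_ae hflux).trans ?_
    rw [lintegral_const_mul' _ _ ENNReal.ofReal_ne_top, lintegral_const_mul' _ _ hBt,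
      lintegral_const_mul' _ _ hK₁t, hunif, hvJ]
    gcongr
    rw [one_div, ENNReal.le_rpow_inv_iff hq0]
    refine (lintegral_rpow_le_of_isProbabilityMeasure (hGm.pow_const _) he.one_le.le).trans
      (le_of_eq (lintegral_congr fun t => ?_))
    rw [ENNReal.rpow_inv_rpow hq0.ne']
  obtain ⟨T, hTae, hTle⟩ := hu.exists_enorm_localMass_sub_le hψ hψc hψB1 h1 h2
  obtain ⟨t', ht'⟩ : ∃ t', t' ∈ T := by
    by_contra hcon
    push Not at hcon
    rw [ae_restrict_iff' measurableSet_Ioo] at hTae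
    refine hJ0 (measure_mono_null (fun t ht => ?_) hTae)
    simp only [mem_compl_iff, mem_ofPred_eq]
    exact fun h => hcon t (h ht)
  have hwm : ∀ t, weightedMean B ψ (fun x => u (x, t)) =
      (∫ y in B, ψ y)⁻¹ * localMass u ψ t := by
    intro t
    rw [weightedMean, localMass, setIntegral_eq_of_subset_of_forall_sdiff_eq_zero measurableSet_ball hB1]
    intro x hx
    rw [image_eq_zero_of_notMem_tsupport fun h => hx.2 (hψB h), zero_mul]
  -- the constant is the weighted mean at one time `t'`; the means at other times are close to it
  -- because the flux is controlled
  set c := weightedMean B ψ (fun x => u (x, t')) with hc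
  have hWpos : 0 < ∫ y in B, ψ y := by
    by_contra hcon
    rw [ENNReal.ofReal_of_nonpos (not_lt.1 hcon), mul_zero] at hLB
    exact hB0 (le_antisymm hLB zero_le)
  have hmean : ∀ᵐ t ∂volume.restrict J,
      ‖weightedMean B ψ (fun x => u (x, t)) - c‖ₑ ^ (2:ℝ) ≤ Y * (ρ ^ (2:ℝ) * GT ^ (2 / q)) := by
    filter_upwards [hTae] with t ht
    have h3 : ‖weightedMean B ψ (fun x => u (x, t)) - c‖ₑ ≤
        L * ENNReal.ofReal Λ * K₁ * 4 * (ρ * GT ^ (1 / q)) := by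
      rw [hc, hwm, hwm, ← mul_sub, enorm_mul, Real.enorm_eq_ofReal (by positivity),
        ENNReal.ofReal_inv_of_pos hWpos]
      have h4 := (hTle t ht t' ht').trans hfluxJ
      have h5 : (ENNReal.ofReal (∫ y in B, ψ y))⁻¹ * volume B ≤ L := by
        have hWp : ENNReal.ofReal (∫ y in B, ψ y) ≠ 0 := by simpa using hWpos
        calc _ ≤ (ENNReal.ofReal (∫ y in B, ψ y))⁻¹ * (L * ENNReal.ofReal (∫ y in B, ψ y)) := by
              gcongr
          _ = L * ((ENNReal.ofReal (∫ y in B, ψ y))⁻¹ * ENNReal.ofReal (∫ y in B, ψ y)) := by ring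
          _ = L := by rw [ENNReal.inv_mul_cancel hWp ENNReal.ofReal_ne_top, mul_one]
      have h6 : ENNReal.ofReal (Λ / r) * ρ ^ (2:ℝ) = ENNReal.ofReal Λ * ρ := by
        rw [hρdef, ENNReal.rpow_ofNat, ← ENNReal.ofReal_pow hr.le, ← ENNReal.ofReal_mul (by positivity),
          ← ENNReal.ofReal_mul (by positivity)]
        congr 1; field_simp
      calc _ ≤ (ENNReal.ofReal (∫ y in B, ψ y))⁻¹ * (ENNReal.ofReal (Λ / r) *
            (volume B * (K₁ * (4 * ρ ^ (2:ℝ) * GT ^ (1 / q))))) := by gcongr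
        _ = ((ENNReal.ofReal (∫ y in B, ψ y))⁻¹ * volume B) *
            (ENNReal.ofReal (Λ / r) * ρ ^ (2:ℝ)) * K₁ * 4 * GT ^ (1 / q) := by ring
        _ ≤ L * (ENNReal.ofReal Λ * ρ) * K₁ * 4 * GT ^ (1 / q) := by rw [h6]; gcongr
        _ = _ := by ring
    refine (ENNReal.rpow_le_rpow h3 (by norm_num)).trans (le_of_eq ?_)
    rw [ENNReal.mul_rpow_of_nonneg (L * ENNReal.ofReal Λ * K₁ * 4) _ (by norm_num),
      ENNReal.mul_rpow_of_nonneg ρ _ (by norm_num), ← ENNReal.rpow_mul, hY]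
    congr 3; ring
  -- the slice form of the energy inequality
  set X := ENNReal.ofReal (1 / 2 * (Λ' / r ^ 2) * ν ^ 2 + (Λ / r) ^ 2 / (2 * ν)) with hX
  have hXρ : X * ρ ^ (2:ℝ) = ENNReal.ofReal X₀ := by
    rw [hX, hρdef, ENNReal.rpow_ofNat, ← ENNReal.ofReal_pow hr.le,
      ← ENNReal.ofReal_mul (by positivity), hX₀]
    congr 1; field_simp
  have hN : ∀ᵐ t ∂volume.restrict J, ENNReal.ofReal (energyRate a d u Du ψ χ c t +
        ν / 2 * (χ t * ∫ x in ball 0 1, ψ x * ‖Du (x, t)‖ ^ 2)) ≤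
      X * volume B * (2 * K₂) * (S * ρ ^ q * (E t ^ (1 - α) * G t) +
        Y * (ρ ^ (2:ℝ) * GT ^ (2 / q))) := by
    filter_upwards [hgoodJ, hmean] with t ht hmt
    obtain ⟨M, hM, hMκ⟩ := ht.coeff x₀ (2 * r) (by positivity) hball
    refine (ht.ofReal_energyRate_le hν hR1 hBR hM hψ hψc hψB hψ0 hψ1 hψg hχ0 hχ1
      (by positivity) hχd c).trans ?_
    have h7 := lintegral_sq_mul_sub_sq_le he ((ht.sobolev R hR1).mono hBR) (convex_ball x₀ (2 * r))
      measurableSet_ball hB0 hBt (d := ENNReal.ofReal (2 * (2 * r))) ENNReal.ofReal_ne_top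
      (fun x hx y hy => enorm_sub_le_ofReal_of_mem_ball hx hy) hψ.continuous hψ0 hψ1 hLB
      (ht.aemeasurable_coeffBound M hB1) hMκ c
    rw [hunifB, ← mul_assoc, mul_assoc (X * volume B)]
    refine mul_le_mul' le_rfl (h7.trans ?_)
    refine mul_le_mul' le_rfl (add_le_add (le_of_eq ?_) hmt)
    have h8 : ENNReal.ofReal (2 * (2 * r)) = 4 * ρ := by
      rw [hρdef, show (4:ℝ≥0∞) = ENNReal.ofReal 4 by simp, ← ENNReal.ofReal_mul (by norm_num)]
      congr 1; ring
    rw [h8, ENNReal.mul_rpow_of_nonneg _ _ hq0.le, hS, hE, hG]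
    simp only [sliceDeviation, sliceGrad]
    ring
  obtain ⟨hu1, hu2⟩ := hu.lintegral_sub_sq_le_and_lintegral_grad_sq_le hν ha hr h1 h2
    ((ball_subset_ball (by linarith)).trans hB1) hψ hψc hψB1 hψ0 hψr hχ hχc hχJ hχ0 hχr c hN
  set RHS := ρ ^ q * (∫⁻ t, E t ^ (1 - α) * G t ∂unif J) + ρ ^ (2:ℝ) * GT ^ (2 / q) with hRHS
  have hsum : ∫⁻ t in J, X * volume B * (2 * K₂) * (S * ρ ^ q * (E t ^ (1 - α) * G t) +
        Y * (ρ ^ (2:ℝ) * GT ^ (2 / q))) ≤ volume (ball x₀ r) * (C₁ * RHS) := by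
    have hρq : ρ ^ q ≠ ⊤ := ENNReal.rpow_ne_top_of_nonneg hq0.le hρt
    rw [hunif, lintegral_const_mul' _ _ (ENNReal.mul_ne_top (ENNReal.mul_ne_top
      ENNReal.ofReal_ne_top hBt) (ENNReal.mul_ne_top (by norm_num) hK₂t)),
      lintegral_add_right _ measurable_const, lintegral_const, measure_univ, mul_one,
      lintegral_const_mul' _ _ (ENNReal.mul_ne_top hSt hρq), hvJ, hBdef, volume_ball_two_mul x₀ hr]
    calc _ = volume (ball x₀ r) * (((X * ρ ^ (2:ℝ)) * L * (2 * K₂) * 4) *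
          (S * (ρ ^ q * ∫⁻ t, E t ^ (1 - α) * G t ∂unif J) + Y * (ρ ^ (2:ℝ) * GT ^ (2 / q)))) := by
          ring
      _ ≤ volume (ball x₀ r) * (((X * ρ ^ (2:ℝ)) * L * (2 * K₂) * 4) * ((S + Y) * RHS)) := by
          gcongr
          rw [hRHS, mul_add]
          gcongr
          · exact le_self_add
          · exact le_add_self
      _ = _ := by rw [hXρ, hC₁]; ring
  have hb0 : volume (ball x₀ r) ≠ 0 := (measure_ball_pos _ _ hr).ne'
  have hbt : volume (ball x₀ r) ≠ ⊤ := measure_ball_lt_top.ne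
  refine ⟨ψ, c, hψ.continuous, hψ0, hψ1, hLB, ?_, ?_⟩
  · filter_upwards [hu1] with t ht
    rw [lintegral_unif]
    calc _ ≤ (volume (ball x₀ r))⁻¹ * (2 * (volume (ball x₀ r) * (C₁ * RHS))) := by
          gcongr; exact ht.trans (by gcongr)
      _ = ((volume (ball x₀ r))⁻¹ * volume (ball x₀ r)) * (2 * (C₁ * RHS)) := by ring
      _ = 2 * C₁ * RHS := by rw [ENNReal.inv_mul_cancel hb0 hbt]; ring
      _ ≤ _ := by gcongr; exact le_self_add
  · have hj : volume (Ioo (t₁ - r ^ 2) t₁) = ρ ^ (2:ℝ) := by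
      rw [Real.volume_Ioo, hρdef, ENNReal.rpow_ofNat, ← ENNReal.ofReal_pow hr.le]
      congr 1; ring
    rw [lintegral_unif, hj, ← mul_assoc, ENNReal.mul_inv_cancel hρ2 hρ2t, one_mul]
    unfold sliceGrad
    simp only [lintegral_unif]
    rw [lintegral_const_mul' _ _ (ENNReal.inv_ne_top.2 hb0)]
    calc _ ≤ (volume (ball x₀ r))⁻¹ * (ENNReal.ofReal (2 / ν) *
          (volume (ball x₀ r) * (C₁ * RHS))) := by
          gcongr; exact hu2.trans (by gcongr)
      _ = ((volume (ball x₀ r))⁻¹ * volume (ball x₀ r)) * (ENNReal.ofReal (2 / ν) * (C₁ * RHS)) := by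
          ring
      _ = ENNReal.ofReal (2 / ν) * C₁ * RHS := by
          rw [ENNReal.inv_mul_cancel hb0 hbt]; ring
      _ ≤ (2 + ENNReal.ofReal (2 / ν)) * C₁ * RHS := by gcongr; exact le_add_self
      _ = _ := by
          rw [hRHS, hGT, hE, hG]
          unfold sliceGrad
          simp only [lintegral_unif]

end OneScale

end ParabolicBMO

namespace ParabolicBMO
open Filter Topology

/-! ### The reverse Hölder inequality on backward cylinders -/

section BackwardReverseHolder

variable {n : ℕ} {ν : ℝ} {a d : Space n × ℝ → Matrix (Fin n) (Fin n) ℝ} {u : Space n × ℝ → ℝ}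
  {Du : Space n × ℝ → Space n} {κ : ℝ≥0} {α q m : ℝ} {s : ℕ}

theorem inv_le_mul_inv_of_le_mul {v w K : ℝ≥0∞} (hv : v ≠ 0) (hv' : v ≠ ⊤) (hw : w ≠ 0)
    (hw' : w ≠ ⊤) (h : w ≤ K * v) : v⁻¹ ≤ K * w⁻¹ := by
  rw [ENNReal.inv_le_iff_le_mul (fun _ => hv) (fun h => absurd h hv')]
  calc (1:ℝ≥0∞) = w * w⁻¹ := (ENNReal.mul_inv_cancel hw hw').symm
    _ ≤ K * v * w⁻¹ := by gcongr
    _ = _ := by ring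

/-- Means over a subset, compared with means over the whole set. -/
theorem lintegral_unif_le_mul {X : Type*} [MeasureSpace X] {A B : Set X} (h : A ⊆ B)
    (hA : volume A ≠ 0) (hB : volume B ≠ ⊤) {K : ℝ≥0∞} (hK : volume B ≤ K * volume A)
    (f : X → ℝ≥0∞) : ∫⁻ x, f x ∂unif A ≤ K * ∫⁻ x, f x ∂unif B := by
  have hA' : volume A ≠ ⊤ := ne_top_of_le_ne_top hB (measure_mono h)
  have hB' : volume B ≠ 0 := fun h0 => hA (measure_mono_null h h0)
  rw [lintegral_unif, lintegral_unif, ← mul_assoc]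
  gcongr
  exact inv_le_mul_inv_of_le_mul hA hA' hB' hB hK

theorem volume_parabolicBall (z : Space n × ℝ) {r : ℝ} (hr : 0 < r) :
    volume (parabolicBall z r) =
      ENNReal.ofReal ((volume (ball (0 : Space n) 1)).toReal * r ^ (n + 2)) := by
  rw [parabolicBall, Measure.volume_eq_prod, Measure.prod_prod, Real.volume_Ioo,
    Measure.addHaar_ball_of_pos _ _ hr, finrank_euclideanSpace, Fintype.card_fin,
    ENNReal.ofReal_mul ENNReal.toReal_nonneg, ENNReal.ofReal_toReal measure_ball_lt_top.ne,
    pow_add, ENNReal.ofReal_mul (by positivity), sub_sub_cancel]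
  ring

theorem volume_parabolicBall_mul (z z' : Space n × ℝ) {k r : ℝ} (hk : 0 < k) (hr : 0 < r) :
    volume (parabolicBall z (k * r)) =
      ENNReal.ofReal (k ^ (n + 2)) * volume (parabolicBall z' r) := by
  rw [volume_parabolicBall _ (by positivity), volume_parabolicBall _ hr,
    ← ENNReal.ofReal_mul (by positivity)]
  congr 1; ring

theorem volume_parabolicBall_ne_zero (z : Space n × ℝ) {r : ℝ} (hr : 0 < r) :
    volume (parabolicBall z r) ≠ 0 := by
  rw [volume_parabolicBall _ hr]
  have := ENNReal.toReal_pos (measure_ball_pos volume (0 : Space n) one_pos).ne'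
    measure_ball_lt_top.ne
  simp only [ne_eq, ENNReal.ofReal_eq_zero, not_le]
  positivity

theorem volume_parabolicBall_ne_top (z : Space n × ℝ) {r : ℝ} (hr : 0 < r) :
    volume (parabolicBall z r) ≠ ⊤ := by
  rw [volume_parabolicBall _ hr]
  exact ENNReal.ofReal_ne_top

theorem lintegral_sliceGrad {B : Set (Space n)} {J : Set ℝ}
    (hB : volume B ≠ 0) (hJ : volume J ≠ 0)
    (h : AEStronglyMeasurable Du (volume.restrict (B ×ˢ J))) (q : ℝ) :
    ∫⁻ t, sliceGrad B Du q t ∂unif J = ∫⁻ z, ‖Du z‖ₑ ^ q ∂unif (B ×ˢ J) := by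
  have hv : volume (B ×ˢ J) = volume B * volume J := by
    rw [Measure.volume_eq_prod, Measure.prod_prod]
  rw [restrict_prod_eq] at h
  rw [lintegral_unif (B ×ˢ J), hv, restrict_prod_eq,
    lintegral_prod_symm _ (h.enorm.pow_const q), lintegral_unif]
  unfold sliceGrad
  simp only [lintegral_unif]
  rw [lintegral_const_mul'' _ ((h.enorm.pow_const q).lintegral_prod_left'), ← mul_assoc,
    ENNReal.mul_inv (Or.inl hB) (Or.inr hJ), mul_comm (volume B)⁻¹]

/-- Jensen's inequality on a slice, since `q = 2 α`. -/
theorem sliceGrad_le_rpow (he : IsExponents n α q m s) {B : Set (Space n)} {t : ℝ}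
    (hB0 : volume B ≠ 0) (hBt : volume B ≠ ⊤)
    (h : AEStronglyMeasurable (fun x => Du (x, t)) (volume.restrict B)) :
    sliceGrad B Du q t ≤ sliceGrad B Du 2 t ^ α := by
  have hP := isProbabilityMeasure_unif hB0 hBt
  have hα := he.pos
  have h1 : 1 ≤ α⁻¹ := (one_le_inv₀ hα).2 he.lt_one.le
  refine (ENNReal.rpow_inv_le_iff hα).1 ?_
  refine (lintegral_rpow_le_of_isProbabilityMeasure
    ((h.mono_ac (unif_absolutelyContinuous B)).enorm.pow_const _) h1).trans (le_of_eq ?_)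
  refine lintegral_congr fun x => ?_
  rw [← ENNReal.rpow_mul, he.eq_two_mul, mul_assoc, mul_inv_cancel₀ hα.ne', mul_one]

/-- On one time slice, the product on the right of the one-scale estimate is at most the mean
of `|∇u|²`. -/
theorem sliceDeviation_rpow_mul_sliceGrad_le (he : IsExponents n α q m s) {x₀ : Space n}
    {r t : ℝ} (hr : 0 < r)
    (h : IsSobolevOn (ball x₀ (2 * r)) (fun x => u (x, t)) (fun x => Du (x, t)))
    {ψ : Space n → ℝ} (hψ : Continuous ψ) (hψ0 : ∀ x, 0 ≤ ψ x) (hψ1 : ∀ x, ψ x ≤ 1)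
    (hL : volume (ball x₀ (2 * r)) ≤ 2 ^ n * ENNReal.ofReal (∫ y in ball x₀ (2 * r), ψ y)) :
    sliceDeviation (ball x₀ (2 * r)) ψ u t ^ (1 - α) * sliceGrad (ball x₀ (2 * r)) Du q t ≤
      (sobolevConst n m q (2 ^ n) ^ (2 / q) * 4 ^ (2:ℝ)) ^ (1 - α) *
        (ENNReal.ofReal r ^ (2:ℝ)) ^ (1 - α) * sliceGrad (ball x₀ (2 * r)) Du 2 t := by
  have hα := he.pos
  have hα1 : 0 ≤ 1 - α := by linarith [he.lt_one]
  have hB0 : volume (ball x₀ (2 * r)) ≠ 0 := (measure_ball_pos _ _ (by positivity)).ne'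
  have hBt : volume (ball x₀ (2 * r)) ≠ ⊤ := measure_ball_lt_top.ne
  have h1 := lintegral_sub_weightedMean_sq_le he h (convex_ball x₀ (2 * r)) measurableSet_ball
    hB0 hBt (d := ENNReal.ofReal (2 * (2 * r))) ENNReal.ofReal_ne_top
    (fun x hx y hy => enorm_sub_le_ofReal_of_mem_ball hx hy) hψ hψ0 hψ1 hL
  have h2 := sliceGrad_le_rpow he hB0 hBt h.memLp_grad.aestronglyMeasurable
  have h8 : ENNReal.ofReal (2 * (2 * r)) = 4 * ENNReal.ofReal r := by
    rw [show (4:ℝ≥0∞) = ENNReal.ofReal 4 by simp, ← ENNReal.ofReal_mul (by norm_num)]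
    congr 1; ring
  rw [h8, ENNReal.mul_rpow_of_nonneg 4 _ (by norm_num)] at h1
  set G := sliceGrad (ball x₀ (2 * r)) Du 2 t with hG
  have hGG : G = G ^ (1 - α) * G ^ α := by
    rw [← ENNReal.rpow_add_of_nonneg _ _ hα1 hα.le]; simp
  calc _ ≤ (sobolevConst n m q (2 ^ n) ^ (2 / q) * (4 ^ (2:ℝ) * ENNReal.ofReal r ^ (2:ℝ)) * G)
          ^ (1 - α) * G ^ α := by
        gcongr
        exact h1
    _ = (sobolevConst n m q (2 ^ n) ^ (2 / q) * 4 ^ (2:ℝ)) ^ (1 - α) *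
        (ENNReal.ofReal r ^ (2:ℝ)) ^ (1 - α) * (G ^ (1 - α) * G ^ α) := by
        rw [ENNReal.mul_rpow_of_nonneg _ G hα1, ← mul_assoc (sobolevConst n m q (2 ^ n) ^ (2 / q)),
          ENNReal.mul_rpow_of_nonneg _ (ENNReal.ofReal r ^ (2:ℝ)) hα1]
        ring
    _ = _ := by rw [← hGG]

/-- At almost all times of a cylinder, the mean square deviation of `u` from a constant is
controlled by the mean of `|∇u|²` over the cylinder of twice the radius. -/
theorem exists_slice_deviation_le (he : IsExponents n α q m s) (hν : 0 < ν) (κ : ℝ≥0) :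
    ∃ C : ℝ≥0∞, C ≠ ⊤ ∧ ∀ (a d : Space n × ℝ → Matrix (Fin n) (Fin n) ℝ) (u : Space n × ℝ → ℝ)
      (Du : Space n × ℝ → Space n), IsEllipticOn ν (parabolicBall 0 1) a →
      IsSuitableWeakSolution a d 1 u Du →
      (∀ᵐ t ∂volume.restrict (Ioo (-1) 0), IsGoodTime ν κ s a d u Du t) →
      ∀ (x₀ : Space n) (r t₁ : ℝ), 0 < r → -1 < t₁ - (2 * r) ^ 2 → t₁ ≤ 0 →
      closedBall x₀ (2 * (2 * r)) ⊆ ball 0 1 →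
      ∃ c : ℝ, ∀ᵐ t ∂volume.restrict (Ioo (t₁ - r ^ 2) t₁),
        ∫⁻ x, ‖u (x, t) - c‖ₑ ^ (2:ℝ) ∂unif (ball x₀ r) ≤ C * ENNReal.ofReal r ^ (2:ℝ) *
          ∫⁻ t, sliceGrad (ball x₀ (2 * r)) Du 2 t ∂unif (Ioo (t₁ - (2 * r) ^ 2) t₁) := by
  have hα := he.pos
  have hα1 : 0 ≤ 1 - α := by linarith [he.lt_one]
  have hq0 : 0 < q := by linarith [he.one_le]
  have hm0 : 0 < m := by linarith [he.two_le]
  obtain ⟨C, hC, hone⟩ := exists_one_scale he hν κ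
  set S := (sobolevConst n m q (2 ^ n) ^ (2 / q) * 4 ^ (2:ℝ)) ^ (1 - α) with hS
  have hSt : S ≠ ⊤ := by
    refine ENNReal.rpow_ne_top_of_nonneg hα1 (ENNReal.mul_ne_top (ENNReal.rpow_ne_top_of_nonneg
      (by positivity) ?_) (ENNReal.rpow_ne_top_of_nonneg (by norm_num) (by norm_num)))
    exact sobolevConst_ne_top hm0 hq0 (ENNReal.pow_ne_top (by norm_num))
  refine ⟨C * (S + 1), ENNReal.mul_ne_top hC (ENNReal.add_ne_top.2 ⟨hSt, by norm_num⟩), ?_⟩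
  intro a d u Du ha hu hgood x₀ r t₁ hr h1 h2 hball
  obtain ⟨ψ, c, hψ, hψ0, hψ1, hL, hdev, -⟩ := hone a d u Du ha hu hgood x₀ r t₁ hr h1 h2 hball
  refine ⟨c, ?_⟩
  set B := ball x₀ (2 * r) with hB
  set J := Ioo (t₁ - (2 * r) ^ 2) t₁ with hJ
  set ρ := ENNReal.ofReal r with hρ
  obtain ⟨R, hR0, hR1, hR⟩ := exists_lt_one_closedBall_subset hball
  have hBR : B ⊆ ball 0 R := (ball_subset_closedBall.trans
    (closedBall_subset_closedBall (by linarith))).trans hR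
  have hB1 : B ⊆ ball 0 1 := hBR.trans (ball_subset_ball hR1.le)
  have hJ1 : J ⊆ Ioo (-1) 0 := Ioo_subset_Ioo h1.le h2
  have hB0 : volume B ≠ 0 := (measure_ball_pos _ _ (by positivity)).ne'
  have hBt : volume B ≠ ⊤ := measure_ball_lt_top.ne
  have hr2 : 0 < r ^ 2 := by positivity
  have hJ0 : volume J ≠ 0 := by
    rw [hJ, Real.volume_Ioo]; simp only [ne_eq, ENNReal.ofReal_eq_zero, not_le]; nlinarith
  have hJt : volume J ≠ ⊤ := by rw [hJ, Real.volume_Ioo]; exact ENNReal.ofReal_ne_top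
  have hT := isProbabilityMeasure_unif hJ0 hJt
  have hDm : AEStronglyMeasurable Du (volume.restrict (B ×ˢ J)) := by
    have := hu.memW.memLp_grad.aestronglyMeasurable
    rw [parabolicBall_zero_one] at this
    exact this.mono_set (prod_mono hB1 hJ1)
  have hGm : AEMeasurable (sliceGrad B Du q) (unif J) :=
    (aemeasurable_sliceGrad hDm q).mono_ac (unif_absolutelyContinuous J)
  have hgoodJ := (unif_absolutelyContinuous J).ae_le
    (ae_restrict_of_ae_restrict_of_subset hJ1 hgood)
  set H := ∫⁻ t, sliceGrad B Du 2 t ∂unif J with hH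
  have hρq : ρ ^ q * (ρ ^ (2:ℝ)) ^ (1 - α) = ρ ^ (2:ℝ) := by
    rw [← ENNReal.rpow_mul, ← ENNReal.rpow_add_of_nonneg _ _ hq0.le (by positivity),
      he.eq_two_mul]
    congr 1; ring
  have hρt : ρ ^ (2:ℝ) ≠ ⊤ := ENNReal.rpow_ne_top_of_nonneg (by norm_num) ENNReal.ofReal_ne_top
  have hA : ∫⁻ t, sliceDeviation B ψ u t ^ (1 - α) * sliceGrad B Du q t ∂unif J ≤
      S * (ρ ^ (2:ℝ)) ^ (1 - α) * H := by
    rw [hH, ← lintegral_const_mul' _ _ (ENNReal.mul_ne_top hSt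
      (ENNReal.rpow_ne_top_of_nonneg hα1 hρt))]
    refine lintegral_mono_ae ?_
    filter_upwards [hgoodJ] with t ht
    exact sliceDeviation_rpow_mul_sliceGrad_le he hr ((ht.sobolev R hR1).mono hBR) hψ hψ0 hψ1 hL
  have hBq : (∫⁻ t, sliceGrad B Du q t ∂unif J) ^ (2 / q) ≤ H := by
    refine (lintegral_rpow_le_of_isProbabilityMeasure hGm (by
      rw [le_div_iff₀ hq0]; linarith [he.eq_two_mul, he.lt_one])).trans (lintegral_mono_ae ?_)
    filter_upwards [hgoodJ] with t ht
    have := sliceGrad_le_rpow he hB0 hBt (ht.memLp_grad.aestronglyMeasurable.mono_set hB1)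
    calc _ ≤ (sliceGrad B Du 2 t ^ α) ^ (2 / q) := by gcongr
      _ = _ := by
        rw [← ENNReal.rpow_mul, he.eq_two_mul,
          show α * (2 / (2 * α)) = 1 by field_simp, ENNReal.rpow_one]
  filter_upwards [hdev] with t ht
  calc _ ≤ _ := ht
    _ ≤ C * (ρ ^ q * (S * (ρ ^ (2:ℝ)) ^ (1 - α) * H) + ρ ^ (2:ℝ) * H) := by gcongr
    _ = C * (S * (ρ ^ q * (ρ ^ (2:ℝ)) ^ (1 - α)) * H + ρ ^ (2:ℝ) * H) := by ring
    _ = _ := by rw [hρq]; ring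

/-- The deviation of a slice from its weighted mean is comparable with its deviation from any
constant. -/
theorem sliceDeviation_le {x₀ : Space n} {r t : ℝ} (hr : 0 < r) {ψ : Space n → ℝ}
    (hf : MemLp (fun x => u (x, t)) 2 (volume.restrict (ball x₀ r)))
    (hψ : Continuous ψ) (hψ0 : ∀ x, 0 ≤ ψ x) (hψ1 : ∀ x, ψ x ≤ 1) {L : ℝ≥0∞}
    (hL : volume (ball x₀ r) ≤ L * ENNReal.ofReal (∫ y in ball x₀ r, ψ y)) (c : ℝ) :
    sliceDeviation (ball x₀ r) ψ u t ≤
      2 * (1 + L ^ (2:ℝ)) * ∫⁻ x, ‖u (x, t) - c‖ₑ ^ (2:ℝ) ∂unif (ball x₀ r) := by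
  set B := ball x₀ r with hB
  have hB0 : volume B ≠ 0 := (measure_ball_pos _ _ hr).ne'
  have hBt : volume B ≠ ⊤ := measure_ball_lt_top.ne
  have hP := isProbabilityMeasure_unif hB0 hBt
  have hfin : IsFiniteMeasure (volume.restrict B) :=
    ⟨by rw [Measure.restrict_apply_univ]; exact hBt.lt_top⟩
  have hfm := hf.aestronglyMeasurable.mono_ac (unif_absolutelyContinuous B)
  have h1 := enorm_sub_weightedMean_le hB0 hBt hψ hψ0 hψ1 hL (hf.integrable (by norm_num)) c
  have h2 : ‖c - weightedMean B ψ (fun x => u (x, t))‖ₑ ^ (2:ℝ) ≤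
      L ^ (2:ℝ) * ∫⁻ x, ‖u (x, t) - c‖ₑ ^ (2:ℝ) ∂unif B := by
    calc _ ≤ (L * ∫⁻ y, ‖c - u (y, t)‖ₑ ∂unif B) ^ (2:ℝ) := by gcongr
      _ = L ^ (2:ℝ) * (∫⁻ y, ‖u (y, t) - c‖ₑ ∂unif B) ^ (2:ℝ) := by
          rw [ENNReal.mul_rpow_of_nonneg _ _ (by norm_num)]
          simp only [enorm_sub_rev c]
      _ ≤ _ := by
          gcongr
          exact lintegral_rpow_le_of_isProbabilityMeasure
            (hfm.sub aestronglyMeasurable_const).enorm (by norm_num)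
  set w := weightedMean B ψ (fun x => u (x, t)) with hw
  calc sliceDeviation B ψ u t
      ≤ ∫⁻ x, 2 * (‖u (x, t) - c‖ₑ ^ (2:ℝ) + ‖c - w‖ₑ ^ (2:ℝ)) ∂unif B := by
        refine lintegral_mono fun x => ?_
        have h3 : ‖u (x, t) - w‖ₑ ≤ ‖u (x, t) - c‖ₑ + ‖c - w‖ₑ := by
          rw [← sub_add_sub_cancel (u (x, t)) c w]; exact enorm_add_le _ _
        refine (ENNReal.rpow_le_rpow h3 (by norm_num)).trans
          ((ENNReal.rpow_add_le_mul_rpow_add_rpow _ _ (by norm_num : (1:ℝ) ≤ 2)).trans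
            (le_of_eq ?_))
        norm_num
    _ = 2 * ((∫⁻ x, ‖u (x, t) - c‖ₑ ^ (2:ℝ) ∂unif B) + ‖c - w‖ₑ ^ (2:ℝ)) := by
        rw [lintegral_const_mul' _ _ (by norm_num), lintegral_add_right _ measurable_const,
          lintegral_const, measure_univ, mul_one]
    _ ≤ 2 * ((∫⁻ x, ‖u (x, t) - c‖ₑ ^ (2:ℝ) ∂unif B) +
          L ^ (2:ℝ) * ∫⁻ x, ‖u (x, t) - c‖ₑ ^ (2:ℝ) ∂unif B) := by gcongr
    _ = _ := by ring

/-- **Reverse Hölder inequality on backward cylinders.** The one-scale estimate is applied with the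
deviation of the slices bounded by the slice estimate at the doubled scale. -/
theorem exists_reverse_holder (he : IsExponents n α q m s) (hν : 0 < ν) (κ : ℝ≥0) :
    ∃ A : ℝ≥0∞, A ≠ ⊤ ∧ ∀ (a d : Space n × ℝ → Matrix (Fin n) (Fin n) ℝ) (u : Space n × ℝ → ℝ)
      (Du : Space n × ℝ → Space n), IsEllipticOn ν (parabolicBall 0 1) a →
      IsSuitableWeakSolution a d 1 u Du →
      (∀ᵐ t ∂volume.restrict (Ioo (-1) 0), IsGoodTime ν κ s a d u Du t) →
      ∀ (z : Space n × ℝ) (r : ℝ), 0 < r → -1 < z.2 - (4 * r) ^ 2 → z.2 ≤ 0 →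
      closedBall z.1 (8 * r) ⊆ ball 0 1 →
      ∫⁻ y, ‖Du y‖ₑ ^ (2:ℝ) ∂unif (parabolicBall z r) ≤
        A * (∫⁻ y, ‖Du y‖ₑ ^ (2:ℝ) ∂unif (parabolicBall z (4 * r))) ^ (1 - α) *
          ∫⁻ y, ‖Du y‖ₑ ^ q ∂unif (parabolicBall z (4 * r)) := by
  have hα := he.pos
  have hα1 : 0 ≤ 1 - α := by linarith [he.lt_one]
  have hq0 : 0 < q := by linarith [he.one_le]
  have hm0 : 0 < m := by linarith [he.two_le]
  obtain ⟨C, hC, hone⟩ := exists_one_scale he hν κ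
  obtain ⟨C', hC', htwo⟩ := exists_slice_deviation_le he hν κ
  set V : ℝ≥0∞ := ENNReal.ofReal (2 ^ (n + 2)) with hV
  have hVt : V ≠ ⊤ := ENNReal.ofReal_ne_top
  set L : ℝ≥0∞ := 2 ^ n with hL
  have hLt : L ≠ ⊤ := ENNReal.pow_ne_top (by norm_num)
  set T : ℝ≥0∞ := 2 * (1 + L ^ (2:ℝ)) * (C' * 4) with hT
  have hTt : T ≠ ⊤ := ENNReal.mul_ne_top (ENNReal.mul_ne_top (by norm_num) (ENNReal.add_ne_top.2
    ⟨by norm_num, ENNReal.rpow_ne_top_of_nonneg (by norm_num) hLt⟩))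
    (ENNReal.mul_ne_top hC' (by norm_num))
  refine ⟨C * ((T ^ (1 - α) + V ^ (1 - α)) * V), ENNReal.mul_ne_top hC (ENNReal.mul_ne_top
    (ENNReal.add_ne_top.2 ⟨ENNReal.rpow_ne_top_of_nonneg hα1 hTt,
      ENNReal.rpow_ne_top_of_nonneg hα1 hVt⟩) hVt), ?_⟩
  intro a d u Du ha hu hgood z r hr h1 h2 hball
  obtain ⟨x₀, t₁⟩ := z
  simp only at h1 h2 hball
  have hr2 : 0 < r ^ 2 := by positivity
  -- the gradient estimate from radius `r` to `2 r`, and the deviation estimate from `2 r` to `4 r`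
  obtain ⟨ψ, -, hψ, hψ0, hψ1, hLψ, -, hgrad⟩ := hone a d u Du ha hu hgood x₀ r t₁ hr
    (by nlinarith) h2 ((closedBall_subset_closedBall (by linarith)).trans hball)
  obtain ⟨c, hdev⟩ := htwo a d u Du ha hu hgood x₀ (2 * r) t₁ (by positivity)
    (by nlinarith) h2 ((closedBall_subset_closedBall (by linarith)).trans hball)
  rw [show 2 * (2 * r) = 4 * r by ring] at hdev
  have hball1 : ∀ k, k ≤ 8 → ball x₀ (k * r) ⊆ ball 0 1 := fun k hk =>
    (ball_subset_closedBall.trans (closedBall_subset_closedBall (by nlinarith))).trans hball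
  have hsub : ∀ k : ℝ, 0 < k → k ≤ 4 → parabolicBall (x₀, t₁) (k * r) ⊆ parabolicBall 0 1 := by
    intro k hk0 hk
    rw [parabolicBall_zero_one]
    refine prod_mono (hball1 k (by linarith)) (Ioo_subset_Ioo ?_ h2)
    simp only
    have : (k * r) ^ 2 ≤ (4 * r) ^ 2 := by gcongr
    linarith
  have hslice : ∀ k : ℝ, 0 < k → k ≤ 4 → ∀ p : ℝ,
      ∫⁻ t, sliceGrad (ball x₀ (k * r)) Du p t ∂unif (Ioo (t₁ - (k * r) ^ 2) t₁) =
        ∫⁻ y, ‖Du y‖ₑ ^ p ∂unif (parabolicBall (x₀, t₁) (k * r)) := by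
    intro k hk0 hk p
    refine lintegral_sliceGrad (measure_ball_pos _ _ (by positivity)).ne' ?_
      (hu.memW.memLp_grad.aestronglyMeasurable.mono_set (hsub k hk0 hk)) p
    rw [Real.volume_Ioo]; simp only [ne_eq, ENNReal.ofReal_eq_zero, not_le]
    have : 0 < (k * r) ^ 2 := by positivity
    linarith
  have hdouble : ∀ p : ℝ, ∫⁻ y, ‖Du y‖ₑ ^ p ∂unif (parabolicBall (x₀, t₁) (2 * r)) ≤
      V * ∫⁻ y, ‖Du y‖ₑ ^ p ∂unif (parabolicBall (x₀, t₁) (4 * r)) := by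
    intro p
    have hss : parabolicBall (x₀, t₁) (2 * r) ⊆ parabolicBall (x₀, t₁) (4 * r) := by
      refine Set.prod_mono (ball_subset_ball (by linarith)) (Ioo_subset_Ioo_left ?_)
      simp only; nlinarith
    refine lintegral_unif_le_mul hss (volume_parabolicBall_ne_zero _ (by positivity))
      (volume_parabolicBall_ne_top _ (by positivity)) ?_ _
    · rw [show 4 * r = 2 * (2 * r) by ring, volume_parabolicBall_mul _ (x₀, t₁) two_pos (by positivity)]
  have hs1 := hslice 1 one_pos (by norm_num) 2
  rw [one_mul] at hs1
  rw [hslice 4 (by norm_num) le_rfl 2] at hdev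
  rw [hs1, hslice 2 (by norm_num) (by norm_num) q] at hgrad
  set ρ := ENNReal.ofReal r with hρ
  set B := ball x₀ (2 * r) with hB
  set J := Ioo (t₁ - (2 * r) ^ 2) t₁ with hJ
  set H := ∫⁻ y, ‖Du y‖ₑ ^ (2:ℝ) ∂unif (parabolicBall (x₀, t₁) (4 * r)) with hH
  set Q := ∫⁻ y, ‖Du y‖ₑ ^ q ∂unif (parabolicBall (x₀, t₁) (4 * r)) with hQ
  set Q' := ∫⁻ y, ‖Du y‖ₑ ^ q ∂unif (parabolicBall (x₀, t₁) (2 * r)) with hQ'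
  have hρ0 : ρ ≠ 0 := by simpa [hρ] using hr
  have hρt : ρ ≠ ⊤ := ENNReal.ofReal_ne_top
  have hρ2 : ρ ^ (2:ℝ) ≠ 0 := by simp [hρ0]
  have hρ2t : ρ ^ (2:ℝ) ≠ ⊤ := ENNReal.rpow_ne_top_of_nonneg (by norm_num) hρt
  have hρq : ρ ^ q * (ρ ^ (2:ℝ)) ^ (1 - α) = ρ ^ (2:ℝ) := by
    rw [← ENNReal.rpow_mul, ← ENNReal.rpow_add_of_nonneg _ _ hq0.le (by positivity),
      he.eq_two_mul]
    congr 1; ring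
  have hJ1 : J ⊆ Ioo (-1) 0 := Ioo_subset_Ioo (by nlinarith) h2
  have hJm : ∀ {p : ℝ → Prop}, (∀ᵐ t ∂volume.restrict J, p t) → ∀ᵐ t ∂unif J, p t :=
    fun h => (unif_absolutelyContinuous J).ae_le h
  have hρ4 : ENNReal.ofReal (2 * r) ^ (2:ℝ) = 4 * ρ ^ (2:ℝ) := by
    rw [ENNReal.ofReal_mul (by norm_num), ENNReal.mul_rpow_of_nonneg _ _ (by norm_num)]
    congr 1
    rw [ENNReal.ofReal_rpow_of_pos two_pos]; norm_num
  have hDV : ∀ᵐ t ∂unif J, sliceDeviation B ψ u t ≤ T * (ρ ^ (2:ℝ) * H) := by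
    filter_upwards [hJm hdev, hJm (ae_restrict_of_ae_restrict_of_subset hJ1 hgood)] with t ht ht'
    refine (sliceDeviation_le (by positivity) (ht'.memLp.mono_measure
      (Measure.restrict_mono (hball1 2 (by norm_num)) le_rfl)) hψ hψ0 hψ1 hLψ c).trans ?_
    calc _ ≤ 2 * (1 + L ^ (2:ℝ)) * (C' * ENNReal.ofReal (2 * r) ^ (2:ℝ) * H) := by gcongr
      _ = _ := by rw [hρ4, hT]; ring
  have hX : ∫⁻ t, sliceDeviation B ψ u t ^ (1 - α) * sliceGrad B Du q t ∂unif J ≤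
      T ^ (1 - α) * (ρ ^ (2:ℝ)) ^ (1 - α) * H ^ (1 - α) * Q' := by
    have hQs : Q' = ∫⁻ t, sliceGrad B Du q t ∂unif J := (hslice 2 (by norm_num) (by norm_num) q).symm
    have hDm : AEStronglyMeasurable Du (volume.restrict (B ×ˢ J)) :=
      hu.memW.memLp_grad.aestronglyMeasurable.mono_set (hsub 2 (by norm_num) (by norm_num))
    rw [hQs, ← lintegral_const_mul'' _
      ((aemeasurable_sliceGrad hDm q).mono_ac (unif_absolutelyContinuous J))]
    refine lintegral_mono_ae ?_
    filter_upwards [hDV] with t ht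
    gcongr
    refine (ENNReal.rpow_le_rpow ht hα1).trans (le_of_eq ?_)
    rw [ENNReal.mul_rpow_of_nonneg T _ hα1, ENNReal.mul_rpow_of_nonneg (ρ ^ (2:ℝ)) H hα1,
      mul_assoc]
  have hP := isProbabilityMeasure_unif
    (volume_parabolicBall_ne_zero (x₀, t₁) (by positivity : 0 < 2 * r))
    (volume_parabolicBall_ne_top (x₀, t₁) (by positivity : 0 < 2 * r))
  -- since `2 / q = 1 + (1 - α) / α`, the excess power of `Q'` is paid by the mean of `|∇u|²`
  have hY : Q' ^ (2 / q) ≤ V ^ (1 - α) * H ^ (1 - α) * Q' := by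
    have h3 : Q' ^ α⁻¹ ≤ V * H := by
      refine le_trans ?_ (hdouble 2)
      refine (lintegral_rpow_le_of_isProbabilityMeasure ?_
        ((one_le_inv₀ hα).2 he.lt_one.le)).trans (le_of_eq (lintegral_congr fun y => ?_))
      · exact ((hu.memW.memLp_grad.aestronglyMeasurable.mono_set
          (hsub 2 (by norm_num) (by norm_num))).mono_ac
            (unif_absolutelyContinuous _)).enorm.pow_const _
      · rw [← ENNReal.rpow_mul, he.eq_two_mul, mul_assoc, mul_inv_cancel₀ hα.ne', mul_one]
    have e1 : 2 / q = α⁻¹ * (1 - α) + 1 := by rw [he.eq_two_mul]; field_simp; ring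
    have h0 : 0 ≤ α⁻¹ * (1 - α) := by positivity
    rw [e1, ENNReal.rpow_add_of_nonneg _ _ h0 zero_le_one, ENNReal.rpow_one, ENNReal.rpow_mul,
      ← ENNReal.mul_rpow_of_nonneg _ _ hα1]
    gcongr
  -- every term carries the factor `r²`, which cancels
  refine (ENNReal.mul_le_mul_iff_right hρ2 hρ2t).1 (hgrad.trans ?_)
  calc _ ≤ C * (ρ ^ q * (T ^ (1 - α) * (ρ ^ (2:ℝ)) ^ (1 - α) * H ^ (1 - α) * Q') +
        ρ ^ (2:ℝ) * (V ^ (1 - α) * H ^ (1 - α) * Q')) := by gcongr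
    _ = C * ((ρ ^ q * (ρ ^ (2:ℝ)) ^ (1 - α)) * (T ^ (1 - α) * H ^ (1 - α) * Q') +
        ρ ^ (2:ℝ) * (V ^ (1 - α) * H ^ (1 - α) * Q')) := by ring
    _ = ρ ^ (2:ℝ) * (C * ((T ^ (1 - α) + V ^ (1 - α)) * H ^ (1 - α)) * Q') := by rw [hρq]; ring
    _ ≤ ρ ^ (2:ℝ) * (C * ((T ^ (1 - α) + V ^ (1 - α)) * H ^ (1 - α)) * (V * Q)) := by
        gcongr
        exact hdouble q
    _ = _ := by ring

end BackwardReverseHolder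

end ParabolicBMO

namespace ParabolicBMO
open Filter Topology

/-! ### The parabolic distance -/

section ParabolicMetric

variable {n : ℕ}

/-- The time axis with the distance `|t - s|^{1/2}`. -/
noncomputable abbrev ParabolicTime : Type := Metric.Snowflaking ℝ (1 / 2) (by norm_num) (by norm_num)

/-- The Borel sets, which are those of `ℝ` since the topology is unchanged. -/
noncomputable instance : MeasurableSpace ParabolicTime := borel _

instance : BorelSpace ParabolicTime := ⟨rfl⟩

/-- Space-time with the parabolic distance `max (|x - y|, |t - s|^{1/2})`. Its balls are the
cylinders which extend to both sides of their centre in time. -/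
abbrev ParabolicSpace (n : ℕ) : Type := Space n × ParabolicTime

/-- The identity from space-time to space-time with the parabolic distance. -/
noncomputable def toParabolic (n : ℕ) : Space n × ℝ ≃ᵐ ParabolicSpace n :=
  (MeasurableEquiv.refl (Space n)).prodCongr
    (Metric.Snowflaking.homeomorph : ParabolicTime ≃ₜ ℝ).symm.toMeasurableEquiv

/-- Lebesgue measure on space-time with the parabolic distance. -/
noncomputable def parabolicVolume (n : ℕ) : Measure (ParabolicSpace n) :=
  Measure.map (toParabolic n) volume

theorem setLIntegral_parabolicVolume (A : Set (ParabolicSpace n)) (f : ParabolicSpace n → ℝ≥0∞) :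
    ∫⁻ y in A, f y ∂parabolicVolume n = ∫⁻ z in toParabolic n ⁻¹' A, f (toParabolic n z) := by
  rw [parabolicVolume, MeasurableEquiv.restrict_map, lintegral_map_equiv]

theorem toParabolic_mem_ball (z₀ z : Space n × ℝ) {r : ℝ} (hr : 0 < r) :
    toParabolic n z ∈ ball (toParabolic n z₀) r ↔ dist z.1 z₀.1 < r ∧ |z.2 - z₀.2| < r ^ 2 := by
  have h : dist (toParabolic n z) (toParabolic n z₀) =
      max (dist z.1 z₀.1) (dist z.2 z₀.2 ^ (1 / 2 : ℝ)) := rfl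
  rw [mem_ball, h, max_lt_iff, ← Real.sqrt_eq_rpow, Real.sqrt_lt' hr, Real.dist_eq]

theorem dist_toParabolic (z₀ z : Space n × ℝ) :
    dist (toParabolic n z) (toParabolic n z₀) = max (dist z.1 z₀.1) (√|z.2 - z₀.2|) := by
  have h : dist (toParabolic n z) (toParabolic n z₀) =
      max (dist z.1 z₀.1) (dist z.2 z₀.2 ^ (1 / 2 : ℝ)) := rfl
  rw [h, ← Real.sqrt_eq_rpow, Real.dist_eq]

theorem toParabolic_preimage_closedBall (z₀ : Space n × ℝ) {r : ℝ} (hr : 0 < r) :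
    toParabolic n ⁻¹' closedBall (toParabolic n z₀) r =
      closedBall z₀.1 r ×ˢ Icc (z₀.2 - r ^ 2) (z₀.2 + r ^ 2) := by
  ext z
  rw [mem_preimage, mem_closedBall, dist_toParabolic, max_le_iff, Real.sqrt_le_left hr.le,
    mem_prod, mem_closedBall, mem_Icc, abs_sub_le_iff]
  constructor
  · rintro ⟨h1, h2, h3⟩; exact ⟨h1, by linarith, by linarith⟩
  · rintro ⟨h1, h2, h3⟩; exact ⟨h1, by linarith, by linarith⟩

theorem isBallRegular_parabolicVolume (n : ℕ) :
    IsBallRegular (parabolicVolume n) (2 * (volume (ball (0 : Space n) 1)).toReal) (n + 2) := by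
  have hv := (isBallRegular_volume n)
  refine ⟨mul_pos two_pos hv.pos, fun x r hr => ?_⟩
  obtain ⟨z, rfl⟩ := (toParabolic n).surjective x
  rw [parabolicVolume, MeasurableEquiv.map_apply, toParabolic_preimage_closedBall z hr,
    Measure.volume_eq_prod, Measure.prod_prod, hv.measure_closedBall _ _ hr, Real.volume_Icc,
    ← ENNReal.ofReal_mul (mul_nonneg hv.pos.le (by positivity))]
  congr 1; ring

theorem ball_inter_past_eq (z₀ : Space n × ℝ) {r : ℝ} (hr : 0 < r) :
    toParabolic n ⁻¹' ball (toParabolic n z₀) r ∩ {z | z.2 < z₀.2} = parabolicBall z₀ r := by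
  ext z
  rw [mem_inter_iff, mem_preimage, toParabolic_mem_ball _ _ hr, mem_ofPred_eq, parabolicBall,
    mem_prod, mem_ball, mem_Ioo, abs_sub_lt_iff]
  have : 0 < r ^ 2 := by positivity
  constructor
  · rintro ⟨⟨h1, h2, h3⟩, h4⟩; exact ⟨h1, by linarith, h4⟩
  · rintro ⟨h1, h2, h3⟩; exact ⟨⟨h1, by linarith, by linarith⟩, h3⟩

/-- The reverse Hölder inequality on backward cylinders turns into one on the balls of the parabolic
distance for the function extended by zero past the time `t₀`: such a ball meets `{t < t₀}` in
a subset of the backward cylinder of twice the radius whose top is at most `t₀`. -/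
theorem reverseHolder_parabolicVolume {α : ℝ} (hα : 0 < α) (hα1 : α < 1) {A : ℝ≥0}
    {g : Space n × ℝ → ℝ≥0∞} {z₀ : Space n × ℝ} {ρ₀ : ℝ}
    (h : ∀ (z : Space n × ℝ) (r : ℝ), 0 < r → z₀.2 - ρ₀ ^ 2 < z.2 - (4 * r) ^ 2 → z.2 ≤ z₀.2 →
      closedBall z.1 (8 * r) ⊆ ball z₀.1 ρ₀ →
      ∫⁻ y, g y ∂unif (parabolicBall z r) ≤
        A * (∫⁻ y, g y ∂unif (parabolicBall z (4 * r))) ^ (1 - α) *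
          ∫⁻ y, g y ^ α ∂unif (parabolicBall z (4 * r))) :
    ReverseHolder (parabolicVolume n) 16
      (A * (2 ^ (n + 2)) * (2 * 2 ^ (n + 2)) ^ (1 - α) * (2 * 2 ^ (n + 2))) α
      {y | ((toParabolic n).symm y).2 < z₀.2} (toParabolic n z₀) ρ₀
      (fun y => (parabolicBall z₀ ρ₀).indicator g ((toParabolic n).symm y)) := by
  intro y hy r hr hdist
  obtain ⟨z, rfl⟩ := (toParabolic n).surjective y
  simp only [mem_ofPred_eq, MeasurableEquiv.symm_apply_apply] at hy
  rw [dist_toParabolic] at hdist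
  have hd1 : dist z.1 z₀.1 + 16 * r < ρ₀ := lt_of_le_of_lt (by gcongr; exact le_max_left _ _) hdist
  have hd2 : √|z.2 - z₀.2| < ρ₀ - 16 * r := by
    have := lt_of_le_of_lt (add_le_add_left (le_max_right _ _) _) hdist
    linarith
  have hρ : 0 < ρ₀ - 16 * r := lt_of_le_of_lt (Real.sqrt_nonneg _) hd2
  rw [Real.sqrt_lt' hρ, abs_sub_lt_iff] at hd2
  have hr2 : 0 < r ^ 2 := by positivity
  -- the top of the backward cylinder
  set τ := min (z.2 + 2 * r ^ 2) z₀.2 with hτ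
  have hτ1 : τ ≤ z₀.2 := min_le_right _ _
  have hτ2 : τ ≤ z.2 + 2 * r ^ 2 := min_le_left _ _
  have hτ3 : z.2 < τ := lt_min (by linarith) hy
  have hbig : closedBall z.1 (8 * (2 * r)) ⊆ ball z₀.1 ρ₀ :=
    closedBall_subset_ball' (by linarith)
  have hstart : z₀.2 - ρ₀ ^ 2 < τ - (4 * (2 * r)) ^ 2 := by nlinarith
  have key := h (z.1, τ) (2 * r) (by positivity) hstart hτ1 hbig
  set Z : Space n × ℝ := (z.1, τ) with hZ
  set f := (parabolicBall z₀ ρ₀).indicator g with hf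
  set μ := parabolicVolume n with hμ
  have hreg := isBallRegular_parabolicVolume n
  have hμr : μ (closedBall (toParabolic n z) r) ≠ 0 := (hreg.measure_pos _ hr).ne'
  have hv0 := (isBallRegular_volume n).pos
  set v := (volume (ball (0 : Space n) 1)).toReal with hv
  -- means over parabolic balls as integrals over two-sided cylinders
  have hav : ∀ (k : ℝ) (F : ParabolicSpace n → ℝ≥0∞), 0 < k →
      ⨍⁻ y in closedBall (toParabolic n z) k, F y ∂μ =
        (ENNReal.ofReal (2 * v * k ^ (n + 2)))⁻¹ *
          ∫⁻ y in closedBall z.1 k ×ˢ Icc (z.2 - k ^ 2) (z.2 + k ^ 2), F (toParabolic n y) := by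
    intro k F hk
    rw [setLAverage_eq, setLIntegral_parabolicVolume, toParabolic_preimage_closedBall z hk,
      hreg.measure_closedBall _ _ hk, ENNReal.div_eq_inv_mul]
  have hm1 : MeasurableSet (parabolicBall z₀ ρ₀) := measurableSet_ball.prod measurableSet_Ioo
  have hne : ∀ {b : ℝ}, 0 < b → ENNReal.ofReal b ≠ 0 := fun hb => by simpa using hb
  have htwo : (2:ℝ≥0∞) ^ (n + 2) = ENNReal.ofReal (2 ^ (n + 2)) := by
    rw [ENNReal.ofReal_pow (by norm_num)]; simp
  -- the ball of radius `r` meets the past of `z₀` inside the backward cylinder of radius `2 r`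
  have hle : ⨍⁻ y in closedBall (toParabolic n z) r, f ((toParabolic n).symm y) ∂μ ≤
      2 ^ (n + 2) * ∫⁻ y, g y ∂unif (parabolicBall Z (2 * r)) := by
    rw [hav r _ hr, lintegral_unif, volume_parabolicBall _ (by positivity : 0 < 2 * r), ← hv,
      ← mul_assoc]
    simp only [MeasurableEquiv.symm_apply_apply]
    refine mul_le_mul' ?_ ?_
    · refine inv_le_mul_inv_of_le_mul (hne (by positivity)) ENNReal.ofReal_ne_top
        (hne (by positivity)) ENNReal.ofReal_ne_top ?_
      rw [htwo, ← ENNReal.ofReal_mul (by positivity)]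
      refine ENNReal.ofReal_le_ofReal ?_
      rw [mul_pow]
      have : 0 < v * (2 ^ (n + 2) * r ^ (n + 2)) := by positivity
      nlinarith
    · rw [hf, setLIntegral_indicator hm1]
      refine lintegral_mono_set ?_
      rintro ⟨x, t⟩ ⟨⟨hx0, hx1⟩, hx2, hx3, hx4⟩
      simp only at hx0 hx1 hx2 hx3 hx4
      refine ⟨ball_subset_ball (by linarith) (closedBall_subset_ball (by linarith : r < 2 * r) hx2),
        ?_, lt_min (by linarith) hx1.2⟩
      simp only [hZ]
      nlinarith
  -- the enlarged backward cylinder lies inside the ball of radius `16 r`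
  have hge : ∀ (G : Space n × ℝ → ℝ≥0∞) (F : ParabolicSpace n → ℝ≥0∞),
      (∀ y ∈ parabolicBall z₀ ρ₀, F (toParabolic n y) = G y) →
      ∫⁻ y, G y ∂unif (parabolicBall Z (4 * (2 * r))) ≤
        2 * 2 ^ (n + 2) * ⨍⁻ y in closedBall (toParabolic n z) (16 * r), F y ∂μ := by
    intro G F hFG
    rw [hav _ _ (by positivity), lintegral_unif, volume_parabolicBall _ (by positivity), ← hv,
      ← mul_assoc (2 * 2 ^ (n + 2))]
    have hsub : parabolicBall Z (4 * (2 * r)) ⊆ parabolicBall z₀ ρ₀ := by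
      refine Set.prod_mono ((ball_subset_ball (by linarith)).trans
        (ball_subset_closedBall.trans hbig)) (Ioo_subset_Ioo hstart.le hτ1)
    refine mul_le_mul' ?_ ?_
    · refine inv_le_mul_inv_of_le_mul (hne (by positivity)) ENNReal.ofReal_ne_top
        (hne (by positivity)) ENNReal.ofReal_ne_top ?_
      rw [htwo, show (2:ℝ≥0∞) = ENNReal.ofReal 2 by simp, ← ENNReal.ofReal_mul (by positivity),
        ← ENNReal.ofReal_mul (by positivity)]
      refine ENNReal.ofReal_le_ofReal (le_of_eq ?_)
      rw [show 16 * r = 2 * (4 * (2 * r)) by ring, mul_pow 2]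
      ring
    · calc ∫⁻ y in parabolicBall Z (4 * (2 * r)), G y
          = ∫⁻ y in parabolicBall Z (4 * (2 * r)), F (toParabolic n y) :=
            setLIntegral_congr_fun (measurableSet_ball.prod measurableSet_Ioo)
              fun y hy => (hFG y (hsub hy)).symm
        _ ≤ _ := by
            have hs2 : parabolicBall Z (4 * (2 * r)) ⊆ closedBall z.1 (16 * r) ×ˢ
                Icc (z.2 - (16 * r) ^ 2) (z.2 + (16 * r) ^ 2) := ?_
            · exact lintegral_mono_set hs2
            refine Set.prod_mono ?_ ?_
            · exact (ball_subset_ball (by linarith)).trans ball_subset_closedBall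
            · refine Ioo_subset_Icc_self.trans (Icc_subset_Icc ?_ ?_) <;> simp only [hZ] <;> nlinarith
  have h1 := hge g (fun y => f ((toParabolic n).symm y)) fun y hy => by
    simp only [MeasurableEquiv.symm_apply_apply, hf, indicator_of_mem hy]
  have h2 := hge (fun y => g y ^ α) (fun y => f ((toParabolic n).symm y) ^ α) fun y hy => by
    simp only [MeasurableEquiv.symm_apply_apply, hf, indicator_of_mem hy]
  refine hle.trans ((mul_le_mul_right key _).trans ?_)
  have hα1' : 0 ≤ 1 - α := by linarith
  calc _ ≤ 2 ^ (n + 2) * (A * (2 * 2 ^ (n + 2) * ⨍⁻ y in closedBall (toParabolic n z) (16 * r),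
          f ((toParabolic n).symm y) ∂μ) ^ (1 - α) * (2 * 2 ^ (n + 2) *
          ⨍⁻ y in closedBall (toParabolic n z) (16 * r), f ((toParabolic n).symm y) ^ α ∂μ)) := by
        gcongr
    _ = _ := by
        rw [ENNReal.mul_rpow_of_nonneg _ _ hα1']
        push_cast [ENNReal.coe_rpow_of_nonneg _ hα1']
        ring

end ParabolicMetric

end ParabolicBMO

namespace ParabolicBMO
open Filter Topology

/-! ### Higher integrability -/

section HigherIntegrability

variable {n : ℕ} {ν : ℝ} {a d : Space n × ℝ → Matrix (Fin n) (Fin n) ℝ} {u : Space n × ℝ → ℝ}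
  {Du : Space n × ℝ → Space n} {κ : ℝ≥0} {α q m : ℝ} {s : ℕ}

theorem parabolicBall_subset_iff {z : Space n × ℝ} {r : ℝ} (hr : 0 < r) :
    parabolicBall z r ⊆ parabolicBall 0 1 ↔
      ball z.1 r ⊆ ball 0 1 ∧ -1 ≤ z.2 - r ^ 2 ∧ z.2 ≤ 0 := by
  have hr2 : 0 < r ^ 2 := by positivity
  have h : z.2 - r ^ 2 < z.2 := by linarith
  rw [parabolicBall_zero_one, parabolicBall, prod_subset_prod_iff, Ioo_subset_Ioo_iff h]
  have h1 : (ball z.1 r).Nonempty := ⟨z.1, mem_ball_self hr⟩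
  have h2 : (Ioo (z.2 - r ^ 2) z.2).Nonempty := nonempty_Ioo.2 h
  simp [h1.ne_empty, h2.ne_empty]

/-- **Higher integrability of the gradient.** Gehring's lemma, applied to `|∇u|²` on a cylinder. -/
theorem exists_lintegral_grad_rpow_le (he : IsExponents n α q m s) (hν : 0 < ν) (κ : ℝ≥0) :
    ∃ τ₀ : ℝ, 0 < τ₀ ∧ ∀ τ : ℝ, 0 < τ → τ ≤ τ₀ →
      ∀ (a d : Space n × ℝ → Matrix (Fin n) (Fin n) ℝ) (u : Space n × ℝ → ℝ)
      (Du : Space n × ℝ → Space n), IsEllipticOn ν (parabolicBall 0 1) a →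
      IsSuitableWeakSolution a d 1 u Du →
      (∀ᵐ t ∂volume.restrict (Ioo (-1) 0), IsGoodTime ν κ s a d u Du t) →
      ∀ (z₀ : Space n × ℝ) (R : ℝ), 0 < R → parabolicBall z₀ (6 * R) ⊆ parabolicBall 0 1 →
      (volume (parabolicBall z₀ R))⁻¹ * ∫⁻ z in parabolicBall z₀ R, ‖Du z‖ₑ ^ (2 * (1 + τ)) ≤
        4 * (6 ^ (n + 2) * ((volume (parabolicBall z₀ (6 * R)))⁻¹ *
          ∫⁻ z in parabolicBall z₀ (6 * R), ‖Du z‖ₑ ^ (2:ℝ))) ^ (1 + τ) := by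
  obtain ⟨A, hA, hrh⟩ := exists_reverse_holder he hν κ
  lift A to ℝ≥0 using hA
  obtain ⟨τ₀, hτ₀, hG⟩ := gehring (isBallRegular_parabolicVolume n) (by norm_num : (1:ℝ) ≤ 16)
    (A * (2 ^ (n + 2)) * (2 * 2 ^ (n + 2)) ^ (1 - α) * (2 * 2 ^ (n + 2))) he.pos he.lt_one
  refine ⟨τ₀, hτ₀, ?_⟩
  intro τ hτ hττ a d u Du ha hu hgood z₀ R hR hsub
  have h6 : 0 < 6 * R := by positivity
  obtain ⟨hs1, hs2, hs3⟩ := (parabolicBall_subset_iff h6).1 hsub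
  have hDm := hu.memW.memLp_grad.aestronglyMeasurable
  -- a measurable modification of the gradient
  set Dv := hDm.mk Du with hDv
  have hDvm : Measurable Dv := hDm.stronglyMeasurable_mk.measurable
  have hae : ∀ {P : Set (Space n × ℝ)}, P ⊆ parabolicBall 0 1 → ∀ p : ℝ,
      (fun z => ‖Du z‖ₑ ^ p) =ᵐ[volume.restrict P] fun z => ‖Dv z‖ₑ ^ p := by
    intro P hP p
    filter_upwards [ae_restrict_of_ae_restrict_of_subset hP hDm.ae_eq_mk] with z hz
    rw [hz]
  have hm6 : MeasurableSet (parabolicBall z₀ (6 * R)) := measurableSet_ball.prod measurableSet_Ioo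
  have hmR : MeasurableSet (parabolicBall z₀ R) := measurableSet_ball.prod measurableSet_Ioo
  have hR6 : parabolicBall z₀ R ⊆ parabolicBall z₀ (6 * R) := by
    refine Set.prod_mono (ball_subset_ball (by linarith)) (Ioo_subset_Ioo_left ?_)
    nlinarith
  set I := ∫⁻ z in parabolicBall z₀ (6 * R), ‖Du z‖ₑ ^ (2:ℝ) with hI
  have hIt : I ≠ ⊤ := by
    have := (hu.memW.memLp_grad.mono_measure (Measure.restrict_mono hsub le_rfl)).2
    rw [eLpNorm_lt_top_iff_lintegral_rpow_enorm_lt_top (by norm_num) (by norm_num)] at this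
    exact this.ne
  set G : ParabolicSpace n → ℝ := fun y =>
    (parabolicBall z₀ (6 * R)).indicator (fun z => ‖Dv z‖ ^ 2) ((toParabolic n).symm y) with hGdef
  have hGm : Measurable G :=
    ((hDvm.norm.pow_const 2).indicator hm6).comp (toParabolic n).symm.measurable
  have hG0 : ∀ y, 0 ≤ G y := fun y => indicator_nonneg (fun z _ => by positivity) _
  have hofG : (fun y => ENNReal.ofReal (G y)) = fun y =>
      (parabolicBall z₀ (6 * R)).indicator (fun z => ‖Dv z‖ₑ ^ (2:ℝ)) ((toParabolic n).symm y) := by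
    funext y
    simp only [hGdef, indicator]
    split_ifs
    · rw [ENNReal.rpow_ofNat, ← ofReal_norm, ENNReal.ofReal_pow (norm_nonneg _)]
    · simp
  have hI' : ∫⁻ y in ball (toParabolic n z₀) (6 * R), ENNReal.ofReal (G y) ∂parabolicVolume n ≤ I := by
    rw [hofG, setLIntegral_parabolicVolume]
    simp only [MeasurableEquiv.symm_apply_apply]
    rw [setLIntegral_indicator hm6, hI, lintegral_congr_ae (hae hsub 2)]
    exact lintegral_mono_set inter_subset_left
  have hRH : ReverseHolder (parabolicVolume n) 16
      (A * (2 ^ (n + 2)) * (2 * 2 ^ (n + 2)) ^ (1 - α) * (2 * 2 ^ (n + 2))) α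
      {y | ((toParabolic n).symm y).2 < z₀.2} (toParabolic n z₀) (6 * R)
      (fun y => ENNReal.ofReal (G y)) := by
    rw [hofG]
    refine reverseHolder_parabolicVolume he.pos he.lt_one fun z r hr h1 h2 h3 => ?_
    have h4 : parabolicBall z (4 * r) ⊆ parabolicBall 0 1 :=
      (parabolicBall_subset_iff (by positivity)).2
        ⟨(ball_subset_ball (by linarith)).trans (ball_subset_closedBall.trans (h3.trans hs1)),
          by linarith, by linarith⟩
    have h5 : parabolicBall z r ⊆ parabolicBall 0 1 := by
      refine subset_trans (Set.prod_mono (ball_subset_ball (by linarith))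
        (Ioo_subset_Ioo_left ?_)) h4
      nlinarith
    have hun : ∀ {P : Set (Space n × ℝ)}, P ⊆ parabolicBall 0 1 → ∀ p : ℝ,
        ∫⁻ y, ‖Du y‖ₑ ^ p ∂unif P = ∫⁻ y, ‖Dv y‖ₑ ^ p ∂unif P := fun hP p =>
      lintegral_congr_ae ((unif_absolutelyContinuous _).ae_eq (hae hP p))
    have key := hrh a d u Du ha hu hgood z r hr (by linarith) (by linarith) (h3.trans hs1)
    rw [hun h4, hun h4, hun h5] at key
    have hq : ∀ y, (‖Dv y‖ₑ ^ (2:ℝ)) ^ α = ‖Dv y‖ₑ ^ q := fun y => by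
      rw [← ENNReal.rpow_mul, he.eq_two_mul]
    simp only [hq]
    exact key
  have hmain := hG τ hτ hττ G _ (toParabolic n z₀) R hGm hG0 hR hRH (fun y hy => by
      have := mem_of_indicator_ne_zero hy
      exact this.2.2) (ne_top_of_le_ne_top hIt hI')
  have hlhs : ∫⁻ z in parabolicBall z₀ R, ‖Du z‖ₑ ^ (2 * (1 + τ)) ≤
      ∫⁻ y in ball (toParabolic n z₀) R, ENNReal.ofReal (G y ^ (1 + τ)) ∂parabolicVolume n := by
    rw [lintegral_congr_ae (hae (hR6.trans hsub) _), setLIntegral_parabolicVolume]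
    calc _ = ∫⁻ z in parabolicBall z₀ R, ENNReal.ofReal (G (toParabolic n z) ^ (1 + τ)) := by
          refine setLIntegral_congr_fun hmR fun z hz => ?_
          simp only [hGdef, MeasurableEquiv.symm_apply_apply, indicator_of_mem (hR6 hz)]
          rw [← ENNReal.ofReal_rpow_of_nonneg (by positivity) (by positivity),
            ENNReal.ofReal_pow (norm_nonneg _), ofReal_norm, ENNReal.rpow_mul, ENNReal.rpow_ofNat]
      _ ≤ _ := by
          rw [← ball_inter_past_eq z₀ hR]
          exact lintegral_mono_set inter_subset_left
  set v := (volume (ball (0 : Space n) 1)).toReal with hv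
  have hv0 : 0 < v := (isBallRegular_volume n).pos
  set w := volume (parabolicBall z₀ R) with hw
  have hw0 : w ≠ 0 := volume_parabolicBall_ne_zero z₀ hR
  have hwt : w ≠ ⊤ := volume_parabolicBall_ne_top z₀ hR
  set Y := 6 ^ (n + 2) * ((volume (parabolicBall z₀ (6 * R)))⁻¹ * I) with hY
  have hwI : w⁻¹ * I ≤ Y := by
    rw [hY, ← mul_assoc]
    gcongr
    refine inv_le_mul_inv_of_le_mul hw0 hwt (volume_parabolicBall_ne_zero z₀ h6)
      (volume_parabolicBall_ne_top z₀ h6) (le_of_eq ?_)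
    rw [volume_parabolicBall_mul z₀ z₀ (by norm_num : (0:ℝ) < 6) hR,
      ENNReal.ofReal_pow (by norm_num), ENNReal.ofReal_ofNat]
  set I' := ∫⁻ y in ball (toParabolic n z₀) (6 * R), ENNReal.ofReal (G y) ∂parabolicVolume n
  have hlev : ENNReal.ofReal ((I'.toReal / (2 * v * R ^ (n + 2))) ^ τ) ≤ Y ^ τ := by
    rw [← ENNReal.ofReal_rpow_of_nonneg (by positivity) hτ.le]
    refine ENNReal.rpow_le_rpow (le_trans ?_ hwI) hτ.le
    rw [ENNReal.ofReal_div_of_pos (by positivity), ENNReal.div_eq_inv_mul]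
    refine mul_le_mul' (ENNReal.inv_le_inv.2 ?_) (ENNReal.ofReal_toReal_le.trans hI')
    rw [hw, volume_parabolicBall z₀ hR]
    refine ENNReal.ofReal_le_ofReal ?_
    have : 0 < v * R ^ (n + 2) := by positivity
    linarith
  calc _ ≤ w⁻¹ * (4 * Y ^ τ * I) := by
        gcongr
        exact hlhs.trans (hmain.trans (by gcongr))
    _ = 4 * Y ^ τ * (w⁻¹ * I) := by ring
    _ ≤ 4 * Y ^ τ * Y := by gcongr
    _ = _ := by
        rw [add_comm, ENNReal.rpow_add_of_nonneg _ _ hτ.le zero_le_one, ENNReal.rpow_one]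
        ring

/-- A compact part of the cylinder is covered by finitely many cylinders on which the gradient is
known to be integrable to the power `p`. -/
theorem lintegral_parabolicBall_ne_top_of_local {f : Space n × ℝ → ℝ≥0∞} {R : ℝ} (hR0 : 0 < R)
    (hR1 : R < 1) (h : ∀ (z : Space n × ℝ) (r : ℝ), 0 < r →
      parabolicBall z (6 * r) ⊆ parabolicBall 0 1 → ∫⁻ y in parabolicBall z r, f y ≠ ⊤) :
    ∫⁻ y in parabolicBall 0 R, f y ≠ ⊤ := by
  set K : Set (Space n × ℝ) := closedBall 0 R ×ˢ Icc (-R ^ 2) 0 with hK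
  have hKc : IsCompact K := (isCompact_closedBall _ _).prod isCompact_Icc
  have hind : ∫⁻ y in K ∩ {y | y.2 < 0}, f y ≠ ⊤ := by
    refine hKc.induction_on (p := fun s => ∫⁻ y in s ∩ {y | y.2 < 0}, f y ≠ ⊤) (by simp) ?_ ?_ ?_
    · intro s t hst ht
      exact ne_top_of_le_ne_top ht (lintegral_mono_set (inter_subset_inter_left _ hst))
    · intro s t hs ht
      rw [union_inter_distrib_right]
      exact ne_top_of_le_ne_top (ENNReal.add_ne_top.2 ⟨hs, ht⟩) (lintegral_union_le _ _ _)
    · rintro ⟨x, t⟩ ⟨hx, ht1, ht2⟩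
      simp only at hx ht1 ht2
      -- with this radius, the enlarged cylinder reaches exactly to the distance `1 - R`
      set r := (1 - R) / 6 with hr
      have hr0 : 0 < r := by simp only [hr]; linarith
      have hr6 : 6 * r = 1 - R := by simp only [hr]; ring
      have hr2 : 0 < r ^ 2 := by positivity
      refine ⟨ball x r ×ˢ Ioo (t - r ^ 2 / 2) (t + r ^ 2 / 2), mem_nhdsWithin_of_mem_nhds ?_, ?_⟩
      · exact prod_mem_nhds (ball_mem_nhds x hr0) (Ioo_mem_nhds (by linarith) (by linarith))
      -- a backward cylinder whose top lies slightly after `t` when possible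
      set τ := min (t + r ^ 2 / 2) 0 with hτ
      have hτ1 : τ ≤ t + r ^ 2 / 2 := min_le_left _ _
      have hτ2 : τ ≤ 0 := min_le_right _ _
      have hτ3 : t ≤ τ := le_min (by linarith) ht2
      refine ne_top_of_le_ne_top (h (x, τ) r hr0 ((parabolicBall_subset_iff (by positivity)).2
        ⟨ball_subset_ball' ?_, ?_, hτ2⟩)) (lintegral_mono_set ?_)
      · rw [mem_closedBall] at hx
        linarith
      · simp only
        rw [hr6]
        nlinarith
      · rintro ⟨y, s⟩ ⟨⟨hy, hs1, hs2⟩, hs3⟩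
        simp only [mem_ofPred_eq] at hs1 hs2 hs3
        refine ⟨hy, ?_, lt_min hs2 hs3⟩
        simp only
        linarith
  refine ne_top_of_le_ne_top hind (lintegral_mono_set ?_)
  rw [parabolicBall_zero]
  rintro ⟨x, t⟩ ⟨hx, ht1, ht2⟩
  exact ⟨⟨ball_subset_closedBall hx, ht1.le, ht2.le⟩, ht2⟩

/-- Interpolation between the powers `2` and `m`. -/
theorem lintegral_rpow_two_add_le {X : Type*} [MeasurableSpace X] {P : Measure X}
    [IsProbabilityMeasure P] {w : X → ℝ≥0∞} (hw : AEMeasurable w P) {m τ : ℝ} (hm : 2 ≤ m)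
    (hτ : 0 ≤ τ) (hτm : τ ≤ 1 - 2 / m) :
    ∫⁻ x, w x ^ (2 * (1 + τ)) ∂P ≤ (∫⁻ x, w x ^ m ∂P) ^ (2 / m) * (∫⁻ x, w x ^ (2:ℝ) ∂P) ^ τ := by
  have hm0 : 0 < m := by linarith
  have h := ENNReal.lintegral_prod_norm_pow_le (μ := P) (Finset.univ : Finset (Fin 3))
    (f := ![fun x => w x ^ m, fun x => w x ^ (2:ℝ), fun _ => 1]) (by
      intro i _
      fin_cases i
      · exact hw.pow_const _
      · exact hw.pow_const _
      · exact aemeasurable_const) (p := ![2 / m, τ, 1 - 2 / m - τ]) (by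
      simp [Fin.sum_univ_three]) (by
      intro i _
      fin_cases i
      · simp only [Fin.zero_eta, Matrix.cons_val]; positivity
      · simpa using hτ
      · simp only [Fin.reduceFinMk, Matrix.cons_val]; linarith)
  simp only [Fin.prod_univ_three, Matrix.cons_val_zero, Matrix.cons_val_one, Matrix.cons_val,
    ENNReal.one_rpow, mul_one, lintegral_const, measure_univ] at h
  refine le_trans (le_of_eq (lintegral_congr fun x => ?_)) h
  rw [← ENNReal.rpow_mul, ← ENNReal.rpow_mul, mul_div_cancel₀ _ hm0.ne',
    ← ENNReal.rpow_add_of_nonneg _ _ (by norm_num) (by positivity)]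
  congr 1; ring

/-- On almost every time slice, `u` is integrable to a power larger than two, by the
Sobolev–Poincaré inequality and interpolation. -/
theorem lintegral_slice_rpow_le (he : IsExponents n α q m s) {R : ℝ} (hR : 0 < R) {t : ℝ}
    (h : IsSobolevOn (ball 0 R) (fun x => u (x, t)) (fun x => Du (x, t))) {τ : ℝ} (hτ : 0 ≤ τ)
    (hτm : τ ≤ 1 - 2 / m) {M : ℝ≥0∞}
    (hM : ∫⁻ x, ‖u (x, t)‖ₑ ^ (2:ℝ) ∂unif (ball (0 : Space n) R) ≤ M) :
    ∫⁻ x, ‖u (x, t)‖ₑ ^ (2 * (1 + τ)) ∂unif (ball (0 : Space n) R) ≤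
      2 ^ (2 * (1 + τ) - 1) * (sobolevConst n m q 1 ^ (2 / q) * ENNReal.ofReal (2 * R) ^ (2:ℝ) *
        (4 * M) ^ τ * sliceGrad (ball 0 R) Du 2 t + M ^ (1 + τ)) := by
  set B : Set (Space n) := ball 0 R with hB
  have hB0 : volume B ≠ 0 := (measure_ball_pos _ _ hR).ne'
  have hBt : volume B ≠ ⊤ := measure_ball_lt_top.ne
  have hP := isProbabilityMeasure_unif hB0 hBt
  have hq0 : 0 < q := by linarith [he.one_le]
  have hm0 : 0 < m := by linarith [he.two_le]
  have hfin : IsFiniteMeasure (volume.restrict B) :=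
    ⟨by rw [Measure.restrict_apply_univ]; exact hBt.lt_top⟩
  -- the weight is constant, so the weighted mean is the mean
  have hL : volume B ≤ 1 * ENNReal.ofReal (∫ _ in B, (1:ℝ)) := by
    rw [setIntegral_const, smul_eq_mul, mul_one, one_mul, Measure.real, ENNReal.ofReal_toReal hBt]
  have hfm := h.memLp.aestronglyMeasurable.mono_ac (unif_absolutelyContinuous B)
  set c := weightedMean B (fun _ => 1) (fun x => u (x, t)) with hc
  have hwm : AEMeasurable (fun x => ‖u (x, t) - c‖ₑ) (unif B) :=
    (hfm.sub aestronglyMeasurable_const).enorm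
  have h1 : (∫⁻ x, ‖u (x, t) - c‖ₑ ^ m ∂unif B) ^ (2 / m) ≤
      sobolevConst n m q 1 ^ (2 / q) * ENNReal.ofReal (2 * R) ^ (2:ℝ) * sliceGrad B Du 2 t := by
    have h2 := lintegral_sub_weightedMean_rpow_le he h (convex_ball 0 R) measurableSet_ball hB0 hBt
      (d := ENNReal.ofReal (2 * R)) ENNReal.ofReal_ne_top
      (fun x hx y hy => enorm_sub_le_ofReal_of_mem_ball hx hy) continuous_const
      (fun _ => zero_le_one) (fun _ => le_rfl) hL
    have h3 := sliceGrad_le_rpow he hB0 hBt h.memLp_grad.aestronglyMeasurable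
    have hq2 : 0 ≤ 2 / q := by positivity
    calc _ = ((∫⁻ x, ‖u (x, t) - c‖ₑ ^ m ∂unif B) ^ (q / m)) ^ (2 / q) := by
          rw [← ENNReal.rpow_mul]; congr 1; field_simp
      _ ≤ (sobolevConst n m q 1 * ENNReal.ofReal (2 * R) ^ q * sliceGrad B Du 2 t ^ α) ^ (2 / q) :=
          ENNReal.rpow_le_rpow (h2.trans (mul_le_mul_right h3 _)) hq2
      _ = _ := by
          rw [ENNReal.mul_rpow_of_nonneg _ _ hq2, ENNReal.mul_rpow_of_nonneg _ _ hq2,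
            ← ENNReal.rpow_mul, ← ENNReal.rpow_mul, mul_div_cancel₀ _ hq0.ne',
            show α * (2 / q) = 1 by have := he.pos; rw [he.eq_two_mul]; field_simp,
            ENNReal.rpow_one]
  have h4 : ∫⁻ x, ‖u (x, t) - c‖ₑ ^ (2:ℝ) ∂unif B ≤ 4 * M := by
    have := sliceDeviation_le hR h.memLp continuous_const (fun _ => zero_le_one)
      (fun _ => le_rfl) hL 0
    simp only [sub_zero, ENNReal.one_rpow] at this
    refine this.trans ?_
    calc _ ≤ 2 * (1 + 1) * M := by gcongr
      _ = _ := by norm_num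
  have h5 : ‖c‖ₑ ^ (2 * (1 + τ)) ≤ M ^ (1 + τ) := by
    rw [ENNReal.rpow_mul]
    gcongr
    have h6 := enorm_sub_weightedMean_le hB0 hBt continuous_const (fun _ => zero_le_one)
      (fun _ => le_rfl) hL (h.memLp.integrable (by norm_num)) 0
    simp only [zero_sub, enorm_neg, one_mul] at h6
    calc ‖c‖ₑ ^ (2:ℝ) ≤ (∫⁻ y, ‖u (y, t)‖ₑ ∂unif B) ^ (2:ℝ) := by gcongr
      _ ≤ _ := lintegral_rpow_le_of_isProbabilityMeasure hfm.enorm (by norm_num)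
      _ ≤ M := hM
  have hp : 1 ≤ 2 * (1 + τ) := by linarith
  calc _ ≤ ∫⁻ x, 2 ^ (2 * (1 + τ) - 1) * (‖u (x, t) - c‖ₑ ^ (2 * (1 + τ)) +
          ‖c‖ₑ ^ (2 * (1 + τ))) ∂unif B := by
        refine lintegral_mono fun x => ?_
        have h7 : ‖u (x, t)‖ₑ ≤ ‖u (x, t) - c‖ₑ + ‖c‖ₑ := by
          conv_lhs => rw [← sub_add_cancel (u (x, t)) c]
          exact enorm_add_le _ _
        exact (ENNReal.rpow_le_rpow h7 (by linarith)).trans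
          (ENNReal.rpow_add_le_mul_rpow_add_rpow _ _ hp)
    _ = 2 ^ (2 * (1 + τ) - 1) * ((∫⁻ x, ‖u (x, t) - c‖ₑ ^ (2 * (1 + τ)) ∂unif B) +
          ‖c‖ₑ ^ (2 * (1 + τ))) := by
        rw [lintegral_const_mul' _ _ (ENNReal.rpow_ne_top_of_nonneg (by linarith) (by norm_num)),
          lintegral_add_right _ measurable_const, lintegral_const, measure_univ, mul_one]
    _ ≤ 2 ^ (2 * (1 + τ) - 1) * ((∫⁻ x, ‖u (x, t) - c‖ₑ ^ m ∂unif B) ^ (2 / m) *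
          (∫⁻ x, ‖u (x, t) - c‖ₑ ^ (2:ℝ) ∂unif B) ^ τ + M ^ (1 + τ)) := by
        gcongr
        exact lintegral_rpow_two_add_le hwm he.two_le hτ hτm
    _ ≤ 2 ^ (2 * (1 + τ) - 1) * (sobolevConst n m q 1 ^ (2 / q) * ENNReal.ofReal (2 * R) ^ (2:ℝ) *
          sliceGrad B Du 2 t * (4 * M) ^ τ + M ^ (1 + τ)) := by gcongr
    _ = _ := by ring

/-- **Higher integrability of the solution.** -/
theorem IsSuitableWeakSolution.lintegral_rpow_ne_top (he : IsExponents n α q m s)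
    (hu : IsSuitableWeakSolution a d 1 u Du)
    (hgood : ∀ᵐ t ∂volume.restrict (Ioo (-1) 0), IsGoodTime ν κ s a d u Du t) {τ : ℝ} (hτ : 0 ≤ τ)
    (hτm : τ ≤ 1 - 2 / m) {R : ℝ} (hR0 : 0 < R) (hR1 : R < 1) :
    ∫⁻ z in parabolicBall 0 R, ‖u z‖ₑ ^ (2 * (1 + τ)) ≠ ⊤ := by
  set B : Set (Space n) := ball 0 R with hB
  set J : Set ℝ := Ioo (-R ^ 2) 0 with hJ
  have hB0 : volume B ≠ 0 := (measure_ball_pos _ _ hR0).ne'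
  have hBt : volume B ≠ ⊤ := measure_ball_lt_top.ne
  have hq0 : 0 < q := by linarith [he.one_le]
  have hm0 : 0 < m := by linarith [he.two_le]
  have hB1 : B ⊆ ball 0 1 := ball_subset_ball hR1.le
  have hJ1 : J ⊆ Ioo (-1) 0 := Ioo_subset_Ioo_left (by nlinarith)
  have hsub : B ×ˢ J ⊆ parabolicBall 0 1 := by
    rw [parabolicBall_zero_one]; exact Set.prod_mono hB1 hJ1
  have hum : AEStronglyMeasurable u (volume.restrict (B ×ˢ J)) :=
    hu.memW.memLp.aestronglyMeasurable.mono_set hsub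
  have hDm : AEStronglyMeasurable Du (volume.restrict (B ×ˢ J)) :=
    hu.memW.memLp_grad.aestronglyMeasurable.mono_set hsub
  -- the bound of the slices in `L²`, uniform in time
  obtain ⟨E, hE, hEle⟩ : ∃ E : ℝ≥0∞, E ≠ ⊤ ∧ ∀ᵐ t ∂volume.restrict J,
      ∫⁻ x, ‖u (x, t)‖ₑ ^ (2:ℝ) ∂unif B ≤ E := by
    have hbd := hu.memL2Linfty.bounded
    have hle := ENNReal.ae_le_essSup (μ := volume.restrict (Ioo (-1 ^ 2) 0))
      (fun t => eLpNorm (fun x => u (x, t)) 2 (volume.restrict (ball (0 : Space n) 1)))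
    set N := essSup (fun t => eLpNorm (fun x => u (x, t)) 2 (volume.restrict (ball (0 : Space n) 1)))
      (volume.restrict (Ioo (-1 ^ 2) (0:ℝ))) with hN
    refine ⟨(volume B)⁻¹ * N ^ (2:ℝ), ENNReal.mul_ne_top (ENNReal.inv_ne_top.2 hB0)
      (ENNReal.rpow_ne_top_of_nonneg (by norm_num) hbd.ne), ?_⟩
    rw [one_pow] at hle
    filter_upwards [ae_restrict_of_ae_restrict_of_subset hJ1 hle] with t ht
    rw [lintegral_unif]
    gcongr
    refine (lintegral_mono_set hB1).trans ?_
    rw [eLpNorm_eq_lintegral_rpow_enorm_toReal (by norm_num) (by norm_num)] at ht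
    simp only [ENNReal.toReal_ofNat] at ht
    rw [one_div, ENNReal.rpow_inv_le_iff (by norm_num)] at ht
    exact ht
  rw [parabolicBall_zero, restrict_prod_eq, lintegral_prod_symm _ (by
    rw [restrict_prod_eq] at hum; exact hum.enorm.pow_const _)]
  set C := sobolevConst n m q 1 ^ (2 / q) * ENNReal.ofReal (2 * R) ^ (2:ℝ) * (4 * E) ^ τ with hC
  have hCt : C ≠ ⊤ := ENNReal.mul_ne_top (ENNReal.mul_ne_top
    (ENNReal.rpow_ne_top_of_nonneg (by positivity) (sobolevConst_ne_top hm0 hq0 (by norm_num)))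
    (ENNReal.rpow_ne_top_of_nonneg (by norm_num) ENNReal.ofReal_ne_top))
    (ENNReal.rpow_ne_top_of_nonneg hτ (ENNReal.mul_ne_top (by norm_num) hE))
  have h2t : (2:ℝ≥0∞) ^ (2 * (1 + τ) - 1) ≠ ⊤ :=
    ENNReal.rpow_ne_top_of_nonneg (by linarith) (by norm_num)
  have hslice : ∀ᵐ t ∂volume.restrict J, ∫⁻ x in B, ‖u (x, t)‖ₑ ^ (2 * (1 + τ)) ≤
      volume B * (2 ^ (2 * (1 + τ) - 1) * (C * sliceGrad B Du 2 t + E ^ (1 + τ))) := by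
    filter_upwards [hEle, ae_restrict_of_ae_restrict_of_subset hJ1 hgood] with t hEt ht
    have := lintegral_slice_rpow_le he hR0 (ht.sobolev R hR1) hτ hτm hEt
    rw [lintegral_unif] at this
    calc _ = volume B * ((volume B)⁻¹ * ∫⁻ x in B, ‖u (x, t)‖ₑ ^ (2 * (1 + τ))) := by
          rw [← mul_assoc, ENNReal.mul_inv_cancel hB0 hBt, one_mul]
      _ ≤ _ := by gcongr
  refine ne_top_of_le_ne_top ?_ (lintegral_mono_ae hslice)
  have hJt : volume J ≠ ⊤ := by rw [hJ, Real.volume_Ioo]; exact ENNReal.ofReal_ne_top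
  have hGt : ∫⁻ t in J, sliceGrad B Du 2 t ≠ ⊤ := by
    have h1 := (hu.memW.memLp_grad.mono_measure (Measure.restrict_mono hsub le_rfl)).2
    rw [eLpNorm_lt_top_iff_lintegral_rpow_enorm_lt_top (by norm_num) (by norm_num),
      restrict_prod_eq] at h1
    rw [restrict_prod_eq] at hDm
    rw [lintegral_prod_symm _ (hDm.enorm.pow_const _)] at h1
    unfold sliceGrad
    simp only [lintegral_unif]
    rw [lintegral_const_mul' _ _ (ENNReal.inv_ne_top.2 hB0)]
    exact ENNReal.mul_ne_top (ENNReal.inv_ne_top.2 hB0) h1.ne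
  rw [lintegral_const_mul' _ _ hBt, lintegral_const_mul' _ _ h2t,
    lintegral_add_right _ measurable_const, lintegral_const_mul' _ _ hCt, lintegral_const,
    Measure.restrict_apply_univ]
  exact ENNReal.mul_ne_top hBt (ENNReal.mul_ne_top h2t (ENNReal.add_ne_top.2
    ⟨ENNReal.mul_ne_top hCt hGt, ENNReal.mul_ne_top
      (ENNReal.rpow_ne_top_of_nonneg (by linarith) hE) hJt⟩))

end HigherIntegrability

end ParabolicBMO

open ParabolicBMO
theorem theoremt21 (n : ℕ) (hn : 1 ≤ n) (ν : ℝ) (hν : 0 < ν) (Γ : ℝ≥0) :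
    ∃ p C : ℝ, 2 < p ∧ 0 < C ∧
      ∀ (a d : Space n × ℝ → Matrix (Fin n) (Fin n) ℝ)
        (u : Space n × ℝ → ℝ) (Du : Space n × ℝ → Space n),
        IsEllipticOn ν (parabolicBall 0 1) a →
        IsSkewOn (parabolicBall 0 1) d →
        linftyBMONorm (Ioo (-1) 0) (ball 0 1) d ≤ (Γ : ℝ≥0∞) →
        IsSuitableWeakSolution a d 1 u Du →
        (∀ R : ℝ, 0 < R → R < 1 →
          MemLp u (ENNReal.ofReal p) (volume.restrict (parabolicBall 0 R)) ∧
          MemLp Du (ENNReal.ofReal p) (volume.restrict (parabolicBall 0 R))) ∧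
        (∀ (z₀ : Space n × ℝ) (R : ℝ), 0 < R →
          parabolicBall z₀ (6 * R) ⊆ parabolicBall 0 1 →
          6 * R < infDist z₀.1 (frontier (ball 0 1)) →
          -1 < z₀.2 - (6 * R) ^ 2 →
          ((volume (parabolicBall z₀ R))⁻¹ *
              ∫⁻ z in parabolicBall z₀ R, ‖Du z‖ₑ ^ p) ^ (1 / p)
            ≤ ENNReal.ofReal C *
              ((volume (parabolicBall z₀ (6 * R)))⁻¹ *
                ∫⁻ z in parabolicBall z₀ (6 * R), ‖Du z‖ₑ ^ (2 : ℝ)) ^ (1 / 2 : ℝ)) := by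
  have hn1 : (1:ℝ) ≤ n := by exact_mod_cast hn
  have he := exists_isExponents hn
  obtain ⟨κ, hκ⟩ := exists_ae_isGoodTime n hν Γ (s := 4 * n + 2) (by omega)
  obtain ⟨τ₀, hτ₀, hgrad⟩ := exists_lintegral_grad_rpow_le he hν κ
  -- the exponent for which both `u` and its gradient are controlled
  set τ : ℝ := min τ₀ (1 / (2 * n)) with hτ
  have hτ0 : 0 < τ := lt_min hτ₀ (by positivity)
  have hτm : τ ≤ 1 - 2 / (4 * n / (2 * n - 1)) := by
    refine (min_le_right _ _).trans (le_of_eq ?_)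
    have : (2 * n - 1 : ℝ) ≠ 0 := by linarith
    field_simp
    ring
  set p : ℝ := 2 * (1 + τ) with hp
  have hp0 : 0 < p := by positivity
  refine ⟨p, (4 * (6 ^ (n + 2)) ^ (1 + τ)) ^ (1 / p), by linarith, by positivity, ?_⟩
  intro a d u Du ha hd hdΓ hu
  have hgood := hκ a d u Du ha hd hdΓ hu
  have hloc := hgrad τ hτ0 (min_le_left _ _) a d u Du ha hu hgood
  have hI : ∀ {P : Set (Space n × ℝ)}, P ⊆ parabolicBall 0 1 → ∫⁻ z in P, ‖Du z‖ₑ ^ (2:ℝ) ≠ ⊤ := by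
    intro P hP
    have := (hu.memW.memLp_grad.mono_measure (Measure.restrict_mono hP le_rfl)).2
    rw [eLpNorm_lt_top_iff_lintegral_rpow_enorm_lt_top (by norm_num) (by norm_num)] at this
    exact this.ne
  constructor
  · intro R hR0 hR1
    have hsub : parabolicBall (0 : Space n × ℝ) R ⊆ parabolicBall 0 1 :=
      (parabolicBall_subset_iff hR0).2 ⟨ball_subset_ball hR1.le, by simp only [Prod.snd_zero]; nlinarith, le_rfl⟩
    have hpt : (ENNReal.ofReal p).toReal = p := ENNReal.toReal_ofReal hp0.le
    have hpne : ENNReal.ofReal p ≠ 0 := by simpa using hp0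
    refine ⟨⟨hu.memW.memLp.aestronglyMeasurable.mono_set hsub, ?_⟩,
      ⟨hu.memW.memLp_grad.aestronglyMeasurable.mono_set hsub, ?_⟩⟩
    · rw [eLpNorm_lt_top_iff_lintegral_rpow_enorm_lt_top hpne ENNReal.ofReal_ne_top, hpt]
      exact (hu.lintegral_rpow_ne_top he hgood hτ0.le hτm hR0 hR1).lt_top
    · rw [eLpNorm_lt_top_iff_lintegral_rpow_enorm_lt_top hpne ENNReal.ofReal_ne_top, hpt]
      refine (lintegral_parabolicBall_ne_top_of_local hR0 hR1 fun z r hr hz h => ?_).lt_top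
      have h1 := hloc z r hr hz
      rw [h, ENNReal.mul_top (ENNReal.inv_ne_zero.2 (volume_parabolicBall_ne_top z hr)),
        top_le_iff] at h1
      exact ENNReal.mul_ne_top (by norm_num) (ENNReal.rpow_ne_top_of_nonneg (by positivity)
        (ENNReal.mul_ne_top (ENNReal.pow_ne_top (by norm_num)) (ENNReal.mul_ne_top
          (ENNReal.inv_ne_top.2 (volume_parabolicBall_ne_zero z (by positivity))) (hI hz)))) h1
  -- `1 / p` times the power `1 + τ` is `1 / 2`
  · intro z₀ R hR hsub _ _
    have h1 := hloc z₀ R hR hsub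
    have hp1 : 0 ≤ 1 / p := by positivity
    have hτ1 : 0 ≤ 1 + τ := by positivity
    refine (ENNReal.rpow_le_rpow h1 hp1).trans (le_of_eq ?_)
    rw [ENNReal.mul_rpow_of_nonneg _ _ hτ1, ← mul_assoc, ENNReal.mul_rpow_of_nonneg _ _ hp1,
      ← ENNReal.rpow_mul _ (1 + τ) (1 / p)]
    congr 1
    · rw [← ENNReal.ofReal_rpow_of_pos (by positivity), ENNReal.ofReal_mul (by norm_num),
        ← ENNReal.ofReal_rpow_of_pos (by positivity), ENNReal.ofReal_pow (by norm_num),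
        ENNReal.ofReal_ofNat, ENNReal.ofReal_ofNat]
    · congr 1
      rw [hp]
      field_simp
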